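/- Let $N\geq 2$ be an integer and $h$ a formal parameter. Put $$\overline R(z_1,z_2)=(z_1e^{-h/2}-z_2e^{h/2})\sum_{i}e_{ii}\otimes e_{ii}+(z_1-z_2)\sum_{i\ne j}e_{ii}\otimes e_{jj}+(e^{-h/2}-e^{h/2})z_1\sum_{i>j}e_{ij}\otimes e_{ji}+(e^{-h/2}-e^{h/2})z_2\sum_{i<j}e_{ij}\otimes e_{ji},$$ where $e_{ij}$ are the matrix units of $\mathrm{End}\,\mathbb C^N$, and $R(x)=g(x)\overline R(x,1)$ with $g(x)=-e^{h/2}(1-xe^{h})^{-1}$ (the trigonometric $R$-matrix of type $A$). Let $V(R)$ be the topologically free associative $\mathbb C[[h]]$-algebra with generators $l_{ij}^{(-r)}$ ($r\ge 1$, $1\le i,j\le N$) and defining relation $$R_{21}(e^{-u+v})L_1^+(u)L_2^+(v)=L_2^+(v)L_1^+(u)R_{12}(e^{u-v}),\qquad L^+(u)=\sum_{i,j}e_{ij}\otimes\sum_{r\ge1}l_{ij}^{(-r)}u^{r-1},$$ where $R_{21}(e^{-u+v})$ and $R_{12}(e^{u-v})$ are expanded in $\mathbb C((u))((v))[[h]]$;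 that is, $V(R)$ is the quotient of the $h$-adically completed free $\mathbb C[[h]]$-algebra on the $l_{ij}^{(-r)}$ by the smallest two-sided ideal which contains the coefficients of the relation and whose quotient is $h$-adically separated and $h$-torsion free. Tensor products of $\mathbb C[[h]]$-modules are $h$-adically completed, and subscripts indicate tensor factors. Write $\mathbf 1$ for the unit of $V(R)$ and $L^+_{[n]}(u)=L_1^+(u_1)\cdots L_n^+(u_n)$ for $u=(u_1,\dots,u_n)$. There is a unique $\mathbb C[[h]]$-module map $\sigma(z)\colon V(R)\otimes V(R)\to V(R)\otimes V(R)\otimes\mathbb C(z)[[h]]$ such that, for all $n,m\ge 0$, $u=(u_1,\dots,u_n)$ and $v=(v_1,\dots,v_m)$, $$\sigma(z)\big(L^{+13}_{[n]}(u)L^{+24}_{[m]}(v)(\mathbf 1\otimes\mathbf 1)\big)=R^{\bar1\bar2}_{nm}(ze^{u-v})\,L^{+13}_{[n]}(u)\,L^{+24}_{[m]}(v)\,R^{12}_{nm}(ze^{u-v})^{-1}(\mathbf 1\otimes\mathbf 1).$$ Here the superscripts $1,2$ denote the tensor factors $1,\dots,n$ and $n+1,\dots,n+m$ of $(\mathrm{End}\,\mathbb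 C^N)^{\otimes(n+m)}$ and $3,4$ the two factors of $V(R)\otimes V(R)$; $R_{nm}^{12}(ze^{u-v})$ is the product of the $R_{i,n+j}(ze^{u_i-v_j})$ with $i=1,\dots,n$ increasing from left to right and, for each $i$, $j=1,\dots,m$ decreasing; $R_{nm}^{\bar1\bar2}(ze^{u-v})$ is the product of the same factors with $i$ decreasing and, for each $i$, $j$ increasing; and the entries of $R(ze^{u_i-v_j})$ are taken in $\mathbb C(z)[[u_i,v_j,h]]$. For $n=1,\dots,N$ let $$L^+_{(n)}(u)=\mathrm{tr}_{1,\dots,n}\,L_1^+(u)L_2^+(u-h)\cdots L_n^+(u-(n-1)h)\mathbf 1\in V(R)[[u]].$$ Then the braiding map $\sigma$ satisfies $$\sigma(z)\big(L^+_{(m)}(u)\otimes L^+_{(n)}(v)\big)=L^+_{(m)}(u)\otimes L^+_{(n)}(v)\quad\text{for all } m,n=1,\dots,N,$$ $$\sigma(z)\big(a\otimes L^+_{(N)}(v)\big)=a\otimes L^+_{(N)}(v)\quad\text{for all } a\in V(R),$$ where $x\in V(R)\otimes V(R)$ on the right is identified with $x\otimes1$. -/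

import Mathlib

open scoped TensorProduct Kronecker

noncomputable section

namespace TrigFRT

/-! ### Formal exponentials and the trigonometric R-matrix -/

/-- The exponential series `e^{c X} = ∑ c^k X^k / k!` over a `ℂ`-algebra `S`. -/
def expSeries (c : ℂ) (S : Type*) [Semiring S] [Algebra ℂ S] : PowerSeries S :=
  PowerSeries.mk fun k => algebraMap ℂ S (c ^ k / (k.factorial : ℂ))

/-- The two-parameter trigonometric R-matrix `R̄(z₁, z₂)`, where `q = e^{h/2}` and
`q' = e^{-h/2}`. -/
def trigRBar (N : ℕ) {S : Type*} [CommRing S] (q q' z₁ z₂ : S) :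
    Matrix (Fin N × Fin N) (Fin N × Fin N) S :=
  (z₁ * q' - z₂ * q) •
      ∑ i : Fin N, Matrix.single i i (1 : S) ⊗ₖ Matrix.single i i (1 : S)
  + (z₁ - z₂) • ∑ i : Fin N, ∑ j : Fin N,
      (if i ≠ j then Matrix.single i i (1 : S) ⊗ₖ Matrix.single j j (1 : S) else 0)
  + ((q' - q) * z₁) • ∑ i : Fin N, ∑ j : Fin N,
      (if j < i then Matrix.single i j (1 : S) ⊗ₖ Matrix.single j i (1 : S) else 0)
  + ((q' - q) * z₂) • ∑ i : Fin N, ∑ j : Fin N,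
      (if i < j then Matrix.single i j (1 : S) ⊗ₖ Matrix.single j i (1 : S) else 0)

/-- The normalized R-matrix `R(x) = g(x) R̄(x, 1)` with `g(x) = -e^{h/2} (1 - x e^h)⁻¹`,
in a commutative ring in which `1 - x e^h` is invertible; `q = e^{h/2}`, `q' = e^{-h/2}`. -/
def trigR (N : ℕ) {S : Type*} [CommRing S] (q q' x : S) :
    Matrix (Fin N × Fin N) (Fin N × Fin N) S :=
  (-q * Ring.inverse (1 - x * q ^ 2)) • trigRBar N q q' x 1

/-! ### Matrix copies

`(End ℂ^N)^{⊗τ} ⊗ S` is the ring of matrices over `S` indexed by `τ → Fin N`. -/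

/-- The copy of `M ∈ End ℂ^N ⊗ S` in the tensor factor `b`. -/
def leg {N : ℕ} {τ : Type*} [Fintype τ] [DecidableEq τ] {S : Type*} [Zero S] (b : τ)
    (M : Matrix (Fin N) (Fin N) S) : Matrix (τ → Fin N) (τ → Fin N) S :=
  fun i j => if ∀ c, c ≠ b → i c = j c then M (i b) (j b) else 0

/-- The copy `M_{ab}` of `M ∈ (End ℂ^N)^{⊗2} ⊗ S` in the distinct tensor factors `a`, `b`, in this
order. -/
def leg₂ {N : ℕ} {τ : Type*} [Fintype τ] [DecidableEq τ] {S : Type*} [Zero S] (a b : τ)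
    (M : Matrix (Fin N × Fin N) (Fin N × Fin N) S) : Matrix (τ → Fin N) (τ → Fin N) S :=
  fun i j => if ∀ c, c ≠ a → c ≠ b → i c = j c then M (i a, i b) (j a, j b) else 0

/-! ### The algebra `V(R)` -/

/-- The free algebra over `ℂ` on the generators; `(r, i, j)` stands for `l_{ij}^{(-(r+1))}`. -/
abbrev Words (N : ℕ) : Type := FreeAlgebra ℂ (ℕ × Fin N × Fin N)

/-- The topologically free `ℂ[[h]]`-algebra on the generators `l_{ij}^{(-r)}`, that is, the `h`-adic
completion of the free `ℂ[[h]]`-algebra. The variable of this power series ring is `h`. -/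
abbrev FreeTop (N : ℕ) : Type := PowerSeries (Words N)

instance FreeTop.instAlgebra (N : ℕ) : Algebra (PowerSeries ℂ) (FreeTop N) :=
  (PowerSeries.map (algebraMap ℂ (Words N))).toAlgebra' (by
    intro c x
    ext n
    rw [PowerSeries.coeff_mul, PowerSeries.coeff_mul, ← Finset.Nat.sum_antidiagonal_swap]
    refine Finset.sum_congr rfl fun p _ => ?_
    simp [Algebra.commutes])

/-- The generator `l_{ij}^{(-(r+1))}` of the free algebra. -/
def word {N : ℕ} (r : ℕ) (i j : Fin N) : Words N := FreeAlgebra.ι ℂ (r, i, j)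

/-- The ring `A((u))((v))[[h]]`. -/
abbrev Iter (A : Type*) [Semiring A] : Type _ :=
  PowerSeries (LaurentSeries (LaurentSeries A))

/-- The map on Laurent series induced by a ring homomorphism. -/
def laurentMap {A B : Type*} [Semiring A] [Semiring B] (f : A →+* B) :
    LaurentSeries A →+* LaurentSeries B where
  toFun x := HahnSeries.map x f
  map_zero' := by ext; simp
  map_one' := HahnSeries.map_one f.toMonoidWithZeroHom
  map_add' x y := by ext; simp
  map_mul' x y := HahnSeries.map_mul f.toNonUnitalRingHom

/-- The inclusion `ℂ((u))((v))[[h]] → ℂ⟨l⟩((u))((v))[[h]]`. -/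
def iterMap (N : ℕ) : Iter ℂ →+* Iter (Words N) :=
  PowerSeries.map (laurentMap (laurentMap (algebraMap ℂ (Words N))))

/-- `f(u)` as an element of `A((u))((v))[[h]]`. -/
def inU {A : Type*} [Semiring A] (f : PowerSeries A) : Iter A :=
  PowerSeries.C (HahnSeries.C (HahnSeries.ofPowerSeries ℤ A f))

/-- `f(v)` as an element of `A((u))((v))[[h]]`. -/
def inV {A : Type*} [Semiring A] (f : PowerSeries A) : Iter A :=
  PowerSeries.C (HahnSeries.ofPowerSeries ℤ (LaurentSeries A)
    (PowerSeries.map (HahnSeries.C (Γ := ℤ) (R := A)) f))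

/-- `R(e^{u-v})`, expanded in `ℂ((u))((v))[[h]]`. -/
def rUV (N : ℕ) : Matrix (Fin N × Fin N) (Fin N × Fin N) (Iter ℂ) :=
  trigR N (expSeries (1 / 2) _) (expSeries (-1 / 2) _)
    (inU (expSeries 1 ℂ) * inV (expSeries (-1) ℂ))

/-- `R(e^{-u+v})`, expanded in `ℂ((u))((v))[[h]]`. -/
def rVU (N : ℕ) : Matrix (Fin N × Fin N) (Fin N × Fin N) (Iter ℂ) :=
  trigR N (expSeries (1 / 2) _) (expSeries (-1 / 2) _)
    (inU (expSeries (-1) ℂ) * inV (expSeries 1 ℂ))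

/-- The series `l_{ij}^+(u) = ∑_{r ≥ 1} l_{ij}^{(-r)} u^{r-1}` in `ℂ⟨l⟩[[u]]`. -/
def lWords {N : ℕ} (i j : Fin N) : PowerSeries (Words N) :=
  PowerSeries.mk fun r => word r i j

/-- The difference `R_{21}(e^{-u+v}) L_1^+(u) L_2^+(v) - L_2^+(v) L_1^+(u) R_{12}(e^{u-v})`. -/
def relMatrix (N : ℕ) : Matrix (Fin 2 → Fin N) (Fin 2 → Fin N) (Iter (Words N)) :=
  let L₁ : Matrix (Fin 2 → Fin N) (Fin 2 → Fin N) (Iter (Words N)) :=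
    leg 0 (Matrix.of fun i j => inU (lWords i j))
  let L₂ : Matrix (Fin 2 → Fin N) (Fin 2 → Fin N) (Iter (Words N)) :=
    leg 1 (Matrix.of fun i j => inV (lWords i j))
  (leg₂ 1 0 (rVU N)).map (iterMap N) * L₁ * L₂ - L₂ * L₁ * (leg₂ 0 1 (rUV N)).map (iterMap N)

/-- The coefficient of `u^a v^b` in the matrix entry `(i, j)` of the defining relation. -/
def relCoeff (N : ℕ) (i j : Fin 2 → Fin N) (a b : ℤ) : FreeTop N :=
  PowerSeries.mk fun k => ((PowerSeries.coeff k (relMatrix N i j)).coeff b).coeff a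

/-- The two-sided ideals by which the quotient of the free topological algebra is again topologically
free: the quotient is `h`-adically separated (hence complete) and has no `h`-torsion. -/
def IsTopFreeIdeal {N : ℕ} (I : TwoSidedIdeal (FreeTop N)) : Prop :=
  (∀ f : FreeTop N, (∀ k : ℕ, ∃ g ∈ I, (PowerSeries.X : FreeTop N) ^ k ∣ f - g) → f ∈ I) ∧
  (∀ f : FreeTop N, (PowerSeries.X : FreeTop N) * f ∈ I → f ∈ I)

/-- The ideal of relations of `V(R)`. -/
def relIdeal (N : ℕ) : TwoSidedIdeal (FreeTop N) :=
  sInf {I | IsTopFreeIdeal I ∧ ∀ i j a b, relCoeff N i j a b ∈ I}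

/-- The topologically free `ℂ[[h]]`-algebra `V(R)` presented by the generators `l_{ij}^{(-r)}` and the
relation `R_{21}(e^{-u+v}) L_1^+(u) L_2^+(v) = L_2^+(v) L_1^+(u) R_{12}(e^{u-v})`. -/
def VR (N : ℕ) : Type := (relIdeal N).ringCon.Quotient

instance VR.instRing (N : ℕ) : Ring (VR N) :=
  inferInstanceAs (Ring (relIdeal N).ringCon.Quotient)

instance VR.instAlgebra (N : ℕ) : Algebra (PowerSeries ℂ) (VR N) :=
  inferInstanceAs (Algebra (PowerSeries ℂ) (relIdeal N).ringCon.Quotient)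

/-- The projection of the free topological algebra onto `V(R)`. -/
def toVR (N : ℕ) : FreeTop N →+* VR N := (relIdeal N).ringCon.mk'

/-- The generator `l_{ij}^{(-(r+1))}` of `V(R)`. -/
def gen {N : ℕ} (r : ℕ) (i j : Fin N) : VR N := toVR N (PowerSeries.C (word r i j))

/-! ### The braiding map `σ(z)` -/

/-- The `h`-adic completion of a `ℂ[[h]]`-module. -/
abbrev HComp (M : Type*) [AddCommGroup M] [Module (PowerSeries ℂ) M] : Type _ :=
  AdicCompletion (Ideal.span {(PowerSeries.X : PowerSeries ℂ)}) M

/-- `V(R) ⊗ V(R)` over `ℂ[[h]]`, before completion. -/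
abbrev VV (N : ℕ) : Type := VR N ⊗[PowerSeries ℂ] VR N

/-- `V(R) ⊗ V(R) ⊗ ℂ(z)[[h]]` over `ℂ[[h]]`, before completion. -/
abbrev VVz (N : ℕ) : Type := VV N ⊗[PowerSeries ℂ] PowerSeries (RatFunc ℂ)

/-- An element of the uncompleted tensor product `M`, regarded in its `h`-adic completion. -/
abbrev toHComp (M : Type*) [AddCommGroup M] [Module (PowerSeries ℂ) M] :
    M →ₗ[PowerSeries ℂ] HComp M :=
  AdicCompletion.of (Ideal.span {(PowerSeries.X : PowerSeries ℂ)}) M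

/-- A one-variable series `f`, evaluated at the variable `x_k` of a family `x`. -/
def inVar {τ : Type*} {S : Type*} [Semiring S] (k : τ) (f : PowerSeries S) :
    MvPowerSeries τ S :=
  open Classical in fun e => if e = Finsupp.single k (e k) then PowerSeries.coeff (e k) f else 0

/-- The ring `ℂ(z)[[h]][[u_1, …, u_n, v_1, …, v_m]]`, where the variable `Sum.inl i` is `u_i` and
`Sum.inr j` is `v_j`. -/
abbrev ZSeries (n m : ℕ) : Type := MvPowerSeries (Fin n ⊕ Fin m) (PowerSeries (RatFunc ℂ))

/-- The R-matrix `R_{i, n+j}(z e^{u_i - v_j})` in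
`(End ℂ^N)^{⊗(n+m)} ⊗ ℂ(z)[[h]][[u_1, …, u_n, v_1, …, v_m]]`. -/
def rFactor (N : ℕ) {n m : ℕ} (i : Fin n) (j : Fin m) :
    Matrix (Fin n ⊕ Fin m → Fin N) (Fin n ⊕ Fin m → Fin N) (ZSeries n m) :=
  leg₂ (Sum.inl i) (Sum.inr j)
    (trigR N (S := ZSeries n m)
      (MvPowerSeries.C (expSeries (1 / 2) (RatFunc ℂ)))
      (MvPowerSeries.C (expSeries (-1 / 2) (RatFunc ℂ)))
      (MvPowerSeries.C (PowerSeries.C (RatFunc.X : RatFunc ℂ)) *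
        (inVar (Sum.inl i) (expSeries 1 (PowerSeries (RatFunc ℂ))) *
          inVar (Sum.inr j) (expSeries (-1) (PowerSeries (RatFunc ℂ))))))

/-- `R_{nm}^{12}(z e^{u-v})`: the product of the `R_{i, n+j}(z e^{u_i - v_j})` with `i` increasing and,
for each `i`, `j` decreasing. -/
def rNM (N n m : ℕ) :
    Matrix (Fin n ⊕ Fin m → Fin N) (Fin n ⊕ Fin m → Fin N) (ZSeries n m) :=
  ((List.finRange n).map fun i =>
    ((List.finRange m).reverse.map fun j => rFactor N i j).prod).prod

/-- `R_{nm}^{1̄2̄}(z e^{u-v})`: the product of the `R_{i, n+j}(z e^{u_i - v_j})` in the order opposite to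
that of `R_{nm}^{12}`: `i` decreasing and, for each `i`, `j` increasing. -/
def rNMBar (N n m : ℕ) :
    Matrix (Fin n ⊕ Fin m → Fin N) (Fin n ⊕ Fin m → Fin N) (ZSeries n m) :=
  ((List.finRange n).reverse.map fun i =>
    ((List.finRange m).map fun j => rFactor N i j).prod).prod

/-- `L_{[n]}^{+13}(u) L_{[m]}^{+24}(v) (1 ⊗ 1)`, a matrix with entries in
`(V(R) ⊗ V(R))[[u_1, …, u_n, v_1, …, v_m]]`. -/
def lNM (N n m : ℕ) :
    Matrix (Fin n ⊕ Fin m → Fin N) (Fin n ⊕ Fin m → Fin N)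
      (MvPowerSeries (Fin n ⊕ Fin m) (VV N)) :=
  ((List.finRange n).map fun i => leg (Sum.inl i)
    (Matrix.of fun a b => inVar (Sum.inl i)
      (PowerSeries.mk fun r => gen r a b ⊗ₜ[PowerSeries ℂ] (1 : VR N)))).prod *
  ((List.finRange m).map fun j => leg (Sum.inr j)
    (Matrix.of fun a b => inVar (Sum.inr j)
      (PowerSeries.mk fun r => (1 : VR N) ⊗ₜ[PowerSeries ℂ] gen r a b))).prod

/-- The inclusion of scalars `ℂ(z)[[h]] → V(R) ⊗ V(R) ⊗ ℂ(z)[[h]]`, applied to coefficients. -/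
def scalarMap (N n m : ℕ) : ZSeries n m →+* MvPowerSeries (Fin n ⊕ Fin m) (VVz N) :=
  MvPowerSeries.map (Algebra.TensorProduct.includeRight :
    PowerSeries (RatFunc ℂ) →ₐ[PowerSeries ℂ] VVz N).toRingHom

/-- The inclusion `V(R) ⊗ V(R) → V(R) ⊗ V(R) ⊗ ℂ(z)[[h]]`, applied to coefficients. -/
def vectorMap (N n m : ℕ) :
    MvPowerSeries (Fin n ⊕ Fin m) (VV N) →+* MvPowerSeries (Fin n ⊕ Fin m) (VVz N) :=
  MvPowerSeries.map (Algebra.TensorProduct.includeLeft :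
    VV N →ₐ[PowerSeries ℂ] VVz N).toRingHom

/-- `R_{nm}^{1̄2̄}(z e^{u-v}) L_{[n]}^{+13}(u) L_{[m]}^{+24}(v) R_{nm}^{12}(z e^{u-v})⁻¹ (1 ⊗ 1)`. -/
def braidedLNM (N n m : ℕ) :
    Matrix (Fin n ⊕ Fin m → Fin N) (Fin n ⊕ Fin m → Fin N)
      (MvPowerSeries (Fin n ⊕ Fin m) (VVz N)) :=
  (rNMBar N n m).map (scalarMap N n m) * (lNM N n m).map (vectorMap N n m) *
    ((rNM N n m)⁻¹).map (scalarMap N n m)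

/-- The defining property of the braiding map `σ(z)`: for all `n, m ≥ 0`, every coefficient of every
matrix entry of
`σ(z)(L_{[n]}^{+13}(u) L_{[m]}^{+24}(v) (1 ⊗ 1)) =
  R_{nm}^{1̄2̄}(z e^{u-v}) L_{[n]}^{+13}(u) L_{[m]}^{+24}(v) R_{nm}^{12}(z e^{u-v})⁻¹ (1 ⊗ 1)`. -/
def IsBraiding (N : ℕ) (σ : HComp (VV N) →ₗ[PowerSeries ℂ] HComp (VVz N)) : Prop :=
  ∀ (n m : ℕ) (i j : Fin n ⊕ Fin m → Fin N) (e : Fin n ⊕ Fin m →₀ ℕ),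
    σ (toHComp (VV N) (MvPowerSeries.coeff e (lNM N n m i j))) =
      toHComp (VVz N) (MvPowerSeries.coeff e (braidedLNM N n m i j))

/-! ### The series `L_{(n)}^+(u)` -/

/-- The series `l_{ij}^+(u - k h)` in `V(R)[[u]]`: the coefficient of `u^s` is the `h`-adically
convergent sum `∑_d binom(s+d, s) (-k h)^d l_{ij}^{(-(s+d+1))}`. -/
def lShift {N : ℕ} (k : ℕ) (i j : Fin N) : PowerSeries (VR N) :=
  PowerSeries.mk fun s => toVR N (PowerSeries.mk fun d =>
    (((s + d).choose s : ℂ) * (-(k : ℂ)) ^ d) • word (s + d) i j)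

/-- `L_{(n)}^+(u) = tr_{1,…,n} L_1^+(u) L_2^+(u - h) … L_n^+(u - (n-1) h) 1`. -/
def lTrace (N n : ℕ) : PowerSeries (VR N) :=
  Matrix.trace ((List.finRange n).map fun k : Fin n => leg k
    (Matrix.of fun i j : Fin N => lShift (k : ℕ) i j)).prod

/-- `σ(z)` fixes the element `x ⊗ y` of `V(R) ⊗ V(R)`: `σ(z)(x ⊗ y) = x ⊗ y ⊗ 1`. -/
def FixesTensor {N : ℕ} (σ : HComp (VV N) →ₗ[PowerSeries ℂ] HComp (VVz N)) (x y : VR N) : Prop :=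
  σ (toHComp (VV N) (x ⊗ₜ[PowerSeries ℂ] y)) =
    toHComp (VVz N) ((x ⊗ₜ[PowerSeries ℂ] y) ⊗ₜ[PowerSeries ℂ] (1 : PowerSeries (RatFunc ℂ)))

end TrigFRT

end

/-! Existence of the braiding. The coefficients of the entries of $L_{[n]}(u)L_{[m]}(v)$ are exactly
the pairs of words in the generators, so the defining formula prescribes a value for each pair of
words. On the free algebra, modulo $h^p$, these values extend linearly with no condition to check
(`braidFree`). What has to be proved is that the extension kills a relation standing anywhere inside
a word. Multiply by $\overline R$ in two neighbouring slots $b,c$ of one group. The Yang-Baxter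
equation carries this factor through the two products of R-matrices around the L-operators, and
between them the relation of $V(R)$ exchanges $L_b$ and $L_c$ (`braided_exchange_left`,
`braided_exchange_right`). Hence the braided products satisfy the same exchange relation as the
ordered products, and the difference of its two sides goes to zero. The largest ideal killed by all
the maps modulo $h^p$ (`kerIdeal`) has a separated and torsion-free quotient, because $V(R)\otimes
V(R)\otimes\mathbb C(z)[[h]]$ has no $h$-torsion. So it contains `relIdeal`, which is minimal with
these properties, and the maps descend to $V(R)\otimes V(R)$ and glue to a map of completions.
Uniqueness holds because words span modulo every $h^p$.

Fusion. In $L_{(n)}(u)$ the spectral parameters $e^{u-kh}$ form a geometric progression of ratio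
$q^{-2}$, $q=e^{h/2}$. At such points the product of all $\overline R_{bc}$ over pairs of slots is a
multiple of a $q$-antisymmetrizer $A$ (`fus_eq_smul_asym`): unitarity degenerates for neighbours, so
$\overline R_{k+1,k}$ annihilates the product from the left, and this makes its columns
antisymmetric. The Yang-Baxter equation then says that $A$ passes through a product of R-matrices
while reversing the order of the factors of its group (`asym_exchange_left`, `asym_exchange_right`).
If $A$ has $N$ slots, its image is a line in those slots, and a product of R-matrices acts on it by
a scalar (`asym_top`). In $V(R)$ one side of the defining relation vanishes for $L(u-kh)$,
$L(u-(k+1)h)$; what is left says that the fused product $X$ of L-operators is antisymmetric in rows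
and in columns (`fusedPair_lShift`), so $AX=n!\,X=XA$.

Fixed elements. Let $C$ and $C'$ be the R-matrix products in the two orders, so that $\sigma$ sends
$X$ to $C'XC^{-1}$, and let $A$ be the product of the antisymmetrizers of both groups. From $AC=C'A$
the factor $A$ contained in $X$ can be pulled through $C'$, around the trace and back into $X$,
which leaves the trace of $CXC^{-1}$, that is, of $X$ (`trace_braided`). When the second group has
$N$ slots, $C$ and $C'$ act on $A$ by the same scalar and $C'XC^{-1}=X$ holds entry by entry
(`braided_eq_self`). No trace over the first group is needed, so the first tensor factor may be
arbitrary.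

Passage from formal variables to algebra. All identities are proved after substituting nilpotent
elements for the variables, in algebras where $h$ is nilpotent. There the shift $u-kh$ and the
exponentials are finite sums, and nilpotent evaluation is a ring homomorphism (`evNil`).
Coefficients modulo $h^p$ are recovered by evaluating at the variables of a truncated polynomial
ring (`truncCoeff`, `eq_zero_of_sum_eq_zero`). The fusion scalars may be zero divisors in such
rings, so the fusion identities are first proved over a polynomial ring over $\mathbb C[[h]]$, a
domain, and then specialized. -/

open scoped TensorProduct Kronecker

set_option linter.unusedSectionVars false

noncomputable section

namespace TrigFRT

/-! ### Matrices acting in some of the tensor factors -/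

section ActsOn

variable {N : ℕ} {τ : Type*} [Fintype τ] [DecidableEq τ]

/-- The matrix `X` acts as the identity in the tensor factors outside of `s`. -/
def ActsOn {S : Type*} [Zero S] (s : Set τ) (X : Matrix (τ → Fin N) (τ → Fin N) S) : Prop :=
  (∀ I J, (∃ c, c ∉ s ∧ I c ≠ J c) → X I J = 0) ∧
  ∀ I J I' J', (∀ c ∈ s, I c = I' c ∧ J c = J' c) → (∀ c, c ∉ s → I c = J c) →
    (∀ c, c ∉ s → I' c = J' c) → X I J = X I' J'

theorem ActsOn.map {S S' : Type*} [Zero S] [Zero S'] {s : Set τ}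
    {X : Matrix (τ → Fin N) (τ → Fin N) S} (h : ActsOn s X) (f : S → S') (hf : f 0 = 0) :
    ActsOn s (X.map f) :=
  ⟨fun I J hc => by simp [h.1 I J hc, hf], fun I J I' J' h1 h2 h3 => by
    simp [h.2 I J I' J' h1 h2 h3]⟩

theorem actsOn_leg {S : Type*} [Zero S] (b : τ) (M : Matrix (Fin N) (Fin N) S) :
    ActsOn {b} (leg b M) := by
  constructor
  · rintro I J ⟨c, hc, h⟩
    rw [leg, if_neg]
    exact fun h' => h (h' c hc)
  · intro I J I' J' h1 h2 h3
    have hb := h1 b rfl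
    have h2' : ∀ c, c ≠ b → I c = J c := h2
    have h3' : ∀ c, c ≠ b → I' c = J' c := h3
    simp only [leg]
    rw [if_pos h2', if_pos h3', hb.1, hb.2]

theorem actsOn_leg₂ {S : Type*} [Zero S] (a b : τ)
    (M : Matrix (Fin N × Fin N) (Fin N × Fin N) S) : ActsOn {a, b} (leg₂ a b M) := by
  constructor
  · rintro I J ⟨c, hc, h⟩
    rw [leg₂, if_neg]
    simp only [Set.mem_insert_iff, Set.mem_singleton_iff, not_or] at hc
    exact fun h' => h (h' c hc.1 hc.2)
  · intro I J I' J' h1 h2 h3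
    have ha := h1 a (by simp)
    have hb := h1 b (by simp)
    rw [leg₂, leg₂, if_pos (fun c h h' => h2 c (by simp [h, h'])),
      if_pos (fun c h h' => h3 c (by simp [h, h'])), ha.1, ha.2, hb.1, hb.2]

/-- In the sum for an entry of either product only one intermediate index survives: `X` can change
letters only in `s` and `Y` only in `t`, so the index is forced in every slot. Both entries are then
the product of the same entry of `X` with the same entry of `Y`. -/
theorem ActsOn.commute {S : Type*} [Semiring S] {s t : Set τ}
    {X Y : Matrix (τ → Fin N) (τ → Fin N) S} (hX : ActsOn s X) (hY : ActsOn t Y)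
    (hst : Disjoint s t) (hc : ∀ I J K L, Commute (X I J) (Y K L)) : Commute X Y := by
  classical
  have hs : ∀ c, c ∈ s → c ∉ t := fun c h h' => Set.disjoint_left.1 hst h h'
  ext I J
  by_cases hIJ : ∃ c, c ∉ s ∧ c ∉ t ∧ I c ≠ J c
  · obtain ⟨c, hcs, hct, hne⟩ := hIJ
    rw [Matrix.mul_apply, Matrix.mul_apply, Finset.sum_eq_zero, Finset.sum_eq_zero]
    · intro K _
      by_cases h : I c = K c
      · rw [hX.1 K J ⟨c, hcs, h ▸ hne⟩, mul_zero]
      · rw [hY.1 I K ⟨c, hct, h⟩, zero_mul]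
    · intro K _
      by_cases h : I c = K c
      · rw [hY.1 K J ⟨c, hct, h ▸ hne⟩, mul_zero]
      · rw [hX.1 I K ⟨c, hcs, h⟩, zero_mul]
  · push Not at hIJ
    rw [Matrix.mul_apply, Matrix.mul_apply,
      Finset.sum_eq_single (fun c => if c ∈ s then J c else I c),
      Finset.sum_eq_single (fun c => if c ∈ t then J c else I c)]
    · rw [(hc _ _ _ _).eq]
      congr 1
      · apply hY.2
        · intro c hct
          have : c ∉ s := fun h => hs c h hct
          simp [hct, this]
        · intro c hct
          by_cases h : c ∈ s
          · simp [h]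
          · simp [h, hIJ c h hct]
        · intro c hct
          simp [hct]
      · apply hX.2
        · intro c h
          simp [h, hs c h]
        · intro c h
          simp [h]
        · intro c h
          by_cases h' : c ∈ t
          · simp [h']
          · simp [h', hIJ c h h']
    · intro K _ hK
      by_contra hne
      apply hK
      funext c
      by_cases h : c ∈ t
      · rw [if_pos h]
        by_contra h'
        exact hne (by rw [hX.1 K J ⟨c, fun h'' => hs c h'' h, h'⟩, mul_zero])
      · rw [if_neg h]
        by_contra h'
        exact hne (by rw [hY.1 I K ⟨c, h, fun h'' => h' h''.symm⟩, zero_mul])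
    · simp
    · intro K _ hK
      by_contra hne
      apply hK
      funext c
      by_cases h : c ∈ s
      · rw [if_pos h]
        by_contra h'
        exact hne (by rw [hY.1 K J ⟨c, hs c h, h'⟩, mul_zero])
      · rw [if_neg h]
        by_contra h'
        exact hne (by rw [hX.1 I K ⟨c, h, fun h'' => h' h''.symm⟩, zero_mul])
    · simp

/-- An ordered product of matrices in single tensor factors has the ordered products of matrix
entries as its entries. -/
theorem prod_leg_apply {S : Type*} [Semiring S] (M : τ → Matrix (Fin N) (Fin N) S) (l : List τ)
    (hl : l.Nodup) (I J : τ → Fin N) :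
    (l.map fun b => leg b (M b)).prod I J =
      if ∀ c, c ∉ l → I c = J c then (l.map fun b => M b (I b) (J b)).prod else 0 := by
  induction l generalizing I J with
  | nil =>
    simp [Matrix.one_apply, funext_iff]
  | cons b l ih =>
    have hb := (List.nodup_cons.1 hl).1
    rw [List.map_cons, List.prod_cons, Matrix.mul_apply,
      Finset.sum_eq_single (Function.update I b (J b))]
    · rw [ih (List.nodup_cons.1 hl).2, leg, if_pos (fun c hc => by simp [hc])]
      have h1 : (l.map fun c => M c (Function.update I b (J b) c) (J c)) =
          l.map fun c => M c (I c) (J c) := by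
        refine List.map_congr_left fun c hc => ?_
        rw [Function.update_of_ne (by rintro rfl; exact hb hc)]
      rw [h1]
      by_cases h : ∀ c, c ∉ b :: l → I c = J c
      · rw [if_pos h, if_pos]
        · simp
        · intro c hc
          by_cases hcb : c = b
          · subst hcb; simp
          · rw [Function.update_of_ne hcb]
            exact h c (by simp [hcb, hc])
      · rw [if_neg h, if_neg, mul_zero]
        intro h'
        apply h
        intro c hc
        simp only [List.mem_cons, not_or] at hc
        have := h' c hc.2
        rwa [Function.update_of_ne hc.1] at this
    · intro K _ hK
      rw [ih (List.nodup_cons.1 hl).2]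
      by_cases h : ∀ c, c ≠ b → I c = K c
      · rw [if_neg, mul_zero]
        intro h'
        apply hK
        funext c
        by_cases hcb : c = b
        · subst hcb; simpa using h' c hb
        · rw [Function.update_of_ne hcb, h c hcb]
      · rw [leg, if_neg h, zero_mul]
    · simp

end ActsOn

/-! ### The R-matrix in two tensor factors -/

section RMatrix

variable {N : ℕ} {τ : Type*} [Fintype τ] [DecidableEq τ] {S : Type*} [CommRing S]

/-- The diagonal entries of the R-matrix. -/
def wD (q q' z w : S) (a b : Fin N) : S := if a = b then z * q' - w * q else z - w

/-- The entries of the R-matrix at the positions of the flip. -/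
def wO (q q' z w : S) (a b : Fin N) : S :=
  if b < a then (q' - q) * z else if a < b then (q' - q) * w else 0

/-- The R-matrix either keeps a pair of letters or flips it. For `i = k` the two positions coincide;
`wO` is zero there, so nothing is counted twice. -/
theorem trigRBar_apply (q q' z w : S) (i k j l : Fin N) :
    trigRBar N q q' z w (i, k) (j, l) =
      (if i = j ∧ k = l then wD q q' z w i k else 0) +
        (if i = l ∧ k = j then wO q q' z w i k else 0) := by
  have h1 : (∑ a : Fin N, Matrix.single a a (1 : S) ⊗ₖ Matrix.single a a (1 : S)) (i, k) (j, l) =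
      if i = j ∧ k = l ∧ i = k then 1 else 0 := by
    rw [Matrix.sum_apply, Finset.sum_eq_single i]
    · simp only [Matrix.kroneckerMap_apply, Matrix.single_apply, true_and, ← ite_and, mul_ite,
        mul_one, mul_zero]
      congr 1
      apply propext
      constructor
      · rintro ⟨⟨rfl, rfl⟩, rfl⟩; simp
      · rintro ⟨rfl, rfl, rfl⟩; simp
    · intro a _ ha
      simp [Matrix.single_apply, ha]
    · simp
  have h2 : ∀ (P : Fin N → Fin N → Prop) [∀ a b, Decidable (P a b)],
      (∑ a : Fin N, ∑ b : Fin N, if P a b then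
        Matrix.single a a (1 : S) ⊗ₖ Matrix.single b b (1 : S) else 0) (i, k) (j, l) =
      if P i k ∧ i = j ∧ k = l then 1 else 0 := by
    intro P _
    simp only [Matrix.sum_apply]
    rw [Finset.sum_eq_single i, Finset.sum_eq_single k]
    · by_cases h : P i k <;> simp [h, Matrix.single_apply, ← ite_and, and_comm]
    · intro b _ hb
      by_cases h : P i b <;> simp [h, Matrix.single_apply, hb]
    · simp
    · intro a _ ha
      refine Finset.sum_eq_zero fun b _ => ?_
      by_cases h : P a b <;> simp [h, Matrix.single_apply, ha]
    · simp
  have h3 : ∀ (P : Fin N → Fin N → Prop) [∀ a b, Decidable (P a b)],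
      (∑ a : Fin N, ∑ b : Fin N, if P a b then
        Matrix.single a b (1 : S) ⊗ₖ Matrix.single b a (1 : S) else 0) (i, k) (j, l) =
      if P i k ∧ i = l ∧ k = j then 1 else 0 := by
    intro P _
    simp only [Matrix.sum_apply]
    rw [Finset.sum_eq_single i, Finset.sum_eq_single k]
    · by_cases h : P i k
      · simp only [h, if_true, Matrix.kroneckerMap_apply, Matrix.single_apply, true_and, ← ite_and,
          mul_ite, mul_one, mul_zero]
      · simp [h]
    · intro b _ hb
      by_cases h : P i b <;> simp [h, Matrix.single_apply, hb]
    · simp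
    · intro a _ ha
      refine Finset.sum_eq_zero fun b _ => ?_
      by_cases h : P a b <;> simp [h, Matrix.single_apply, ha]
    · simp
  rw [trigRBar, Matrix.add_apply, Matrix.add_apply, Matrix.add_apply, Matrix.smul_apply,
    Matrix.smul_apply, Matrix.smul_apply, Matrix.smul_apply, h1, h2 (fun a b => a ≠ b),
    h3 (fun a b => b < a), h3 (fun a b => a < b)]
  simp only [wD, wO, smul_eq_mul]
  rcases lt_trichotomy i k with h | h | h
  · simp only [h, h.ne, h.not_gt, and_false, if_false, ne_eq, not_false_eq_true, true_and,
      false_and, if_true]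
    split_ifs <;> ring
  · subst h
    simp only [lt_irrefl, and_true, ne_eq, not_true, false_and, if_false, if_true]
    split_ifs <;> ring
  · simp only [h, h.ne', h.not_gt, and_false, if_false, ne_eq, not_false_eq_true, true_and,
      false_and, if_true]
    split_ifs <;> ring

theorem trigRBar_smul (q q' c z w : S) :
    trigRBar N q q' (c * z) (c * w) = c • trigRBar N q q' z w := by
  ext ⟨i, k⟩ ⟨j, l⟩
  rw [Matrix.smul_apply, trigRBar_apply, trigRBar_apply, wD, wD, wO, wO, smul_eq_mul]
  split_ifs <;> ring

theorem trigRBar_map {S' : Type*} [CommRing S'] (f : S →+* S') (q q' z w : S) :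
    (trigRBar N q q' z w).map f = trigRBar N (f q) (f q') (f z) (f w) := by
  ext ⟨i, k⟩ ⟨j, l⟩
  rw [Matrix.map_apply, trigRBar_apply, trigRBar_apply, wD, wD, wO, wO]
  split_ifs <;> simp

theorem leg₂_map {S₁ S₂ : Type*} [Zero S₁] [Zero S₂] (f : S₁ → S₂) (hf : f 0 = 0) (a b : τ)
    (M : Matrix (Fin N × Fin N) (Fin N × Fin N) S₁) :
    (leg₂ a b M).map f = leg₂ a b (M.map f) := by
  ext I J
  simp only [Matrix.map_apply, leg₂]
  split_ifs <;> simp [hf]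

theorem leg_map {S₁ S₂ : Type*} [Zero S₁] [Zero S₂] (f : S₁ → S₂) (hf : f 0 = 0) (a : τ)
    (M : Matrix (Fin N) (Fin N) S₁) :
    (leg a M).map f = leg a (M.map f) := by
  ext I J
  simp only [Matrix.map_apply, leg]
  split_ifs <;> simp [hf]

theorem leg₂_smul (a b : τ) (c : S) (M : Matrix (Fin N × Fin N) (Fin N × Fin N) S) :
    leg₂ a b (c • M) = c • leg₂ a b M := by
  ext I J
  simp only [Matrix.smul_apply, leg₂]
  split_ifs <;> simp

/-- The R-matrix `R̄(ζ_b, ζ_c)` in the tensor factors `b`, `c`. -/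
def rb (N : ℕ) (q q' : S) (ζ : τ → S) (b c : τ) : Matrix (τ → Fin N) (τ → Fin N) S :=
  leg₂ b c (trigRBar N q q' (ζ b) (ζ c))

variable (q q' : S) (ζ : τ → S)

theorem rb_map {S' : Type*} [CommRing S'] (f : S →+* S') (b c : τ) :
    (rb N q q' ζ b c).map f = rb N (f q) (f q') (fun x => f (ζ x)) b c := by
  rw [rb, rb, leg₂_map _ (map_zero f), trigRBar_map]

theorem actsOn_rb (b c : τ) : ActsOn {b, c} (rb N q q' ζ b c) := actsOn_leg₂ _ _ _

theorem rb_commute {b c d e : τ} (h1 : b ≠ d) (h2 : b ≠ e) (h3 : c ≠ d) (h4 : c ≠ e) :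
    Commute (rb N q q' ζ b c) (rb N q q' ζ d e) := by
  refine (actsOn_rb _ _ _ b c).commute (actsOn_rb _ _ _ d e) ?_ fun _ _ _ _ => mul_comm _ _
  simp [h1.symm, h2.symm, h3.symm, h4.symm]

/-- Each row has at most two nonzero entries, at the index itself and at its swap. This turns
identities between products of R-matrices into identities between functions of indices and
transpositions of slots. -/
theorem rb_apply (b c : τ) (I J : τ → Fin N) :
    rb N q q' ζ b c I J =
      (if J = I then wD q q' (ζ b) (ζ c) (I b) (I c) else 0) +
        (if J = I ∘ Equiv.swap b c then wO q q' (ζ b) (ζ c) (I b) (I c) else 0) := by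
  rw [rb, leg₂]
  by_cases h : ∀ d, d ≠ b → d ≠ c → I d = J d
  · rw [if_pos h, trigRBar_apply]
    congr 1
    · congr 1
      apply propext
      constructor
      · rintro ⟨h1, h2⟩
        funext d
        by_cases hb : d = b
        · rw [hb, h1]
        by_cases hc : d = c
        · rw [hc, h2]
        exact (h d hb hc).symm
      · rintro rfl; simp
    · congr 1
      apply propext
      constructor
      · rintro ⟨h1, h2⟩
        funext d
        by_cases hb : d = b
        · rw [hb]; simp [h2]
        by_cases hc : d = c
        · rw [hc]; simp [h1]
        simp [Equiv.swap_apply_of_ne_of_ne hb hc, h d hb hc]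
      · rintro rfl; simp
  · rw [if_neg h, if_neg, if_neg, add_zero]
    · rintro rfl
      exact h fun d hb hc => by simp [Equiv.swap_apply_of_ne_of_ne hb hc]
    · rintro rfl
      exact h fun d _ _ => rfl

theorem rb_mul_apply {E : Type*} [Ring E] [Algebra S E] (b c : τ)
    (X : Matrix (τ → Fin N) (τ → Fin N) E) (I J : τ → Fin N) :
    ((rb N q q' ζ b c).map (algebraMap S E) * X) I J =
      wD q q' (ζ b) (ζ c) (I b) (I c) • X I J +
        wO q q' (ζ b) (ζ c) (I b) (I c) • X (I ∘ Equiv.swap b c) J := by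
  simp only [Matrix.mul_apply, Matrix.map_apply, rb_apply q q' ζ b c, map_add, add_mul,
    Finset.sum_add_distrib, apply_ite (algebraMap S E), map_zero, ite_mul, zero_mul,
    Finset.sum_ite_eq', Finset.mem_univ, if_true, Algebra.smul_def]

theorem mul_rb_apply {E : Type*} [Ring E] [Algebra S E] (b c : τ)
    (X : Matrix (τ → Fin N) (τ → Fin N) E) (I J : τ → Fin N) :
    (X * (rb N q q' ζ b c).map (algebraMap S E)) I J =
      wD q q' (ζ b) (ζ c) (J b) (J c) • X I J +
        wO q q' (ζ b) (ζ c) (J c) (J b) • X I (J ∘ Equiv.swap b c) := by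
  have h : ∀ K : τ → Fin N, (J = K ∘ Equiv.swap b c) ↔ K = J ∘ Equiv.swap b c := by
    intro K
    constructor <;> rintro rfl <;> funext d <;> simp
  simp only [Matrix.mul_apply, Matrix.map_apply, rb_apply q q' ζ b c, map_add, mul_add,
    Finset.sum_add_distrib, apply_ite (algebraMap S E), map_zero, mul_ite, mul_zero, h,
    Finset.sum_ite_eq, Finset.sum_ite_eq', Finset.mem_univ, if_true, Algebra.smul_def]
  simp [Algebra.commutes]

theorem rb_mul_apply' (b c : τ)
    (X : Matrix (τ → Fin N) (τ → Fin N) S) (I J : τ → Fin N) :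
    (rb N q q' ζ b c * X) I J =
      wD q q' (ζ b) (ζ c) (I b) (I c) * X I J +
        wO q q' (ζ b) (ζ c) (I b) (I c) * X (I ∘ Equiv.swap b c) J := by
  have := rb_mul_apply q q' ζ b c X I J
  rwa [Algebra.algebraMap_self, show (rb N q q' ζ b c).map (RingHom.id S) = rb N q q' ζ b c from
    Matrix.map_id _] at this

/-- Only the two letters in the slots `b`, `c` matter, so the proof reduces to the three possible
orders of these letters. The scalar vanishes at `ζ b = q ^ 2 * ζ c`; this degeneration is the source
of fusion. -/
theorem rb_unitarity (b c : τ) (hq : q * q' = 1) :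
    rb N q q' ζ b c * rb N q q' ζ c b =
      ((ζ b * q' - ζ c * q) * (ζ c * q' - ζ b * q)) • 1 := by
  ext I J
  rw [← mul_one (rb N q q' ζ c b), rb_mul_apply' q q' ζ b c, rb_mul_apply' q q' ζ c b,
    rb_mul_apply' q q' ζ c b, Matrix.smul_apply, smul_eq_mul]
  have h1 : (I ∘ Equiv.swap b c) ∘ Equiv.swap c b = I := by
    funext d; simp [Equiv.swap_comm c b]
  rw [h1, Equiv.swap_comm c b]
  simp only [Function.comp_apply, Equiv.swap_apply_left, Equiv.swap_apply_right]
  generalize (1 : Matrix (τ → Fin N) (τ → Fin N) S) I J = A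
  by_cases h2 : I b = I c
  · simp [wD, wO, h2]; ring
  · generalize (1 : Matrix (τ → Fin N) (τ → Fin N) S) (I ∘ Equiv.swap b c) J = B
    rcases lt_or_gt_of_ne h2 with h | h
    · simp only [wD, wO, h, h.not_gt, h.ne, h.ne', if_true, if_false]
      linear_combination ((ζ b ^ 2 + ζ c ^ 2 - 2 * ζ b * ζ c) * A) * hq
    · simp only [wD, wO, h, h.not_gt, h.ne, h.ne', if_true, if_false]
      linear_combination ((ζ b ^ 2 + ζ c ^ 2 - 2 * ζ b * ζ c) * A) * hq

/-- Expanding both sides row by row moves only the letters in the slots `b`, `c`, `d`. The weights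
depend on the relative order of these three letters alone, so finitely many polynomial identities
remain. -/
theorem rb_yangBaxter {b c d : τ} (hbc : b ≠ c) (hbd : b ≠ d) (hcd : c ≠ d) (hq : q * q' = 1) :
    rb N q q' ζ b c * rb N q q' ζ b d * rb N q q' ζ c d =
      rb N q q' ζ c d * rb N q q' ζ b d * rb N q q' ζ b c := by
  ext I J
  rw [← mul_one (rb N q q' ζ c d), ← mul_one (rb N q q' ζ b c)]
  simp only [mul_assoc, one_mul]
  simp only [rb_mul_apply', Function.comp_assoc]
  obtain ⟨V, hV⟩ : ∃ V : (τ → Fin N) → S, ∀ K, (1 : Matrix (τ → Fin N) (τ → Fin N) S) K J = V K :=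
    ⟨_, fun _ => rfl⟩
  simp only [hV, Function.comp_assoc]
  -- All indices occurring in the expansion differ from `I` only in three slots; `F` records the
  -- unknown vector as a function of the three letters there, so that equal permuted indices become
  -- syntactically equal.
  set F : Fin N → Fin N → Fin N → S := fun x y z =>
    V (Function.update (Function.update (Function.update I b x) c y) d z) with hF
  have hG : ∀ π : τ → τ, (∀ e, e ≠ b → e ≠ c → e ≠ d → π e = e) →
      V (I ∘ π) = F (I (π b)) (I (π c)) (I (π d)) := by
    intro π hπ
    simp only [hF]
    refine congrArg V (funext fun e => ?_)
    by_cases hd : e = d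
    · simp [hd]
    by_cases hc : e = c
    · simp [hc, hcd]
    by_cases hb : e = b
    · simp [hb, hbc, hbd]
    simp [hb, hc, hd, hπ e hb hc hd]
  have h0 : V I = F (I b) (I c) (I d) :=
    hG id fun _ _ _ _ => rfl
  have hπ1 : ∀ e, e ≠ b → e ≠ c → e ≠ d → Equiv.swap b c e = e := fun e h h' _ =>
    Equiv.swap_apply_of_ne_of_ne h h'
  have hπ2 : ∀ e, e ≠ b → e ≠ c → e ≠ d → Equiv.swap b d e = e := fun e h _ h' =>
    Equiv.swap_apply_of_ne_of_ne h h'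
  have hπ3 : ∀ e, e ≠ b → e ≠ c → e ≠ d → Equiv.swap c d e = e := fun e _ h h' =>
    Equiv.swap_apply_of_ne_of_ne h h'
  have sb : Equiv.swap b c d = d := Equiv.swap_apply_of_ne_of_ne hbd.symm hcd.symm
  have sc : Equiv.swap b d c = c := Equiv.swap_apply_of_ne_of_ne hbc.symm hcd
  have sd : Equiv.swap c d b = b := Equiv.swap_apply_of_ne_of_ne hbc hbd
  have e1 := hG (Equiv.swap b c) hπ1
  have e2 := hG (Equiv.swap b d) hπ2
  have e3 := hG (Equiv.swap c d) hπ3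
  have e4 := hG (Equiv.swap b c ∘ Equiv.swap b d) fun e h h' h'' => by
    simp [hπ1 e h h' h'', hπ2 e h h' h'']
  have e5 := hG (Equiv.swap b c ∘ Equiv.swap c d) fun e h h' h'' => by
    simp [hπ1 e h h' h'', hπ3 e h h' h'']
  have e6 := hG (Equiv.swap b d ∘ Equiv.swap c d) fun e h h' h'' => by
    simp [hπ2 e h h' h'', hπ3 e h h' h'']
  have e7 := hG (Equiv.swap c d ∘ Equiv.swap b d) fun e h h' h'' => by
    simp [hπ2 e h h' h'', hπ3 e h h' h'']
  have e8 := hG (Equiv.swap c d ∘ Equiv.swap b c) fun e h h' h'' => by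
    simp [hπ1 e h h' h'', hπ3 e h h' h'']
  have e9 := hG (Equiv.swap b d ∘ Equiv.swap b c) fun e h h' h'' => by
    simp [hπ1 e h h' h'', hπ2 e h h' h'']
  have e10 := hG (Equiv.swap b c ∘ Equiv.swap b d ∘ Equiv.swap c d) fun e h h' h'' => by
    simp [hπ1 e h h' h'', hπ2 e h h' h'', hπ3 e h h' h'']
  have e11 := hG (Equiv.swap c d ∘ Equiv.swap b d ∘ Equiv.swap b c) fun e h h' h'' => by
    simp [hπ1 e h h' h'', hπ2 e h h' h'', hπ3 e h h' h'']
  simp only [h0, e1, e2, e3, e4, e5, e6, e7, e8, e9, e10, e11, Function.comp_apply,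
    Equiv.swap_apply_left, Equiv.swap_apply_right, sb, sc, sd]
  clear h0 e1 e2 e3 e4 e5 e6 e7 e8 e9 e10 e11 hG
  clear_value F
  clear hF
  clear hπ1 hπ2 hπ3 sb sc sd
  generalize I b = x, I c = y, I d = z, ζ b = u, ζ c = v, ζ d = w
  rcases lt_trichotomy x y with h1 | h1 | h1 <;> rcases lt_trichotomy y z with h2 | h2 | h2 <;>
    rcases lt_trichotomy x z with h3 | h3 | h3 <;> (try subst h1) <;> (try subst h2) <;>
    (try subst h3) <;> (try (exfalso; order)) <;>
    simp only [wD, wO, *, lt_irrefl, if_true, if_false, ne_of_lt, ne_of_gt, not_lt_of_gt]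
  all_goals try grind

end RMatrix

/-! ### Ordered products and exchange relations -/

section Monoid

variable {M : Type*} [Monoid M] {ι κ : Type*}

theorem commute_list_prod {x : M} {f : ι → M} {l : List ι} (h : ∀ i ∈ l, Commute x (f i)) :
    Commute x (l.map f).prod := by
  refine Commute.list_prod_right _ _ fun y hy => ?_
  obtain ⟨i, hi, rfl⟩ := List.mem_map.1 hy
  exact h i hi

/-- An exchange relation for the factors gives one for the ordered products. -/
theorem exchange_list_prod {x : M} {f g : ι → M} {l : List ι} (hl : l.Nodup)
    (hx : ∀ i ∈ l, x * f i * g i = g i * f i * x)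
    (hfg : ∀ i ∈ l, ∀ j ∈ l, i ≠ j → Commute (f i) (g j)) :
    x * (l.map f).prod * (l.map g).prod = (l.map g).prod * (l.map f).prod * x := by
  induction l with
  | nil => simp
  | cons i l ih =>
    obtain ⟨hi, hl⟩ := List.nodup_cons.1 hl
    have ih := ih hl (fun j hj => hx j (by simp [hj]))
      (fun j hj k hk => hfg j (by simp [hj]) k (by simp [hk]))
    have h1 : Commute (g i) (l.map f).prod := commute_list_prod fun j hj =>
      (hfg j (by simp [hj]) i (by simp) (by rintro rfl; exact hi hj)).symm
    have h2 : Commute (f i) (l.map g).prod := commute_list_prod fun j hj =>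
      hfg i (by simp) j (by simp [hj]) (by rintro rfl; exact hi hj)
    have h3 := hx i (by simp)
    simp only [List.map_cons, List.prod_cons]
    calc x * (f i * (l.map f).prod) * (g i * (l.map g).prod)
        = x * f i * ((l.map f).prod * g i) * (l.map g).prod := by simp only [mul_assoc]
      _ = x * f i * g i * (l.map f).prod * (l.map g).prod := by
        rw [← h1.eq]; simp only [mul_assoc]
      _ = g i * f i * (x * (l.map f).prod * (l.map g).prod) := by
        rw [h3]; simp only [mul_assoc]
      _ = g i * (f i * (l.map g).prod) * (l.map f).prod * x := by
        rw [ih]; simp only [mul_assoc]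
      _ = _ := by rw [h2.eq]; simp only [mul_assoc]

/-- The product of the `ρ i j` with `i` and, for each `i`, with `j` in the order of the lists. -/
def crossProd (ρ : ι → κ → M) (l : List ι) (l' : List κ) : M :=
  (l.map fun i => (l'.map fun j => ρ i j).prod).prod

/-- The entries of the new row are pushed one at a time to the head of their own column; each passes
only entries lying in another row and another column. -/
theorem row_mul_crossProd (ρ : ι → κ → M) {i : ι} {l : List ι} {l' : List κ} (hl' : l'.Nodup)
    (h : ∀ a ∈ l, ∀ j ∈ l', ∀ j' ∈ l', j ≠ j' → Commute (ρ i j) (ρ a j')) :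
    (l'.map fun j => ρ i j).prod * crossProd (fun j i => ρ i j) l' l =
      crossProd (fun j i => ρ i j) l' (i :: l) := by
  induction l' with
  | nil => simp [crossProd]
  | cons j l' ih =>
    obtain ⟨hj, hl'⟩ := List.nodup_cons.1 hl'
    have ih := ih hl' fun a ha b hb c hc => h a ha b (by simp [hb]) c (by simp [hc])
    have h1 : Commute (l'.map fun j => ρ i j).prod (l.map fun a => ρ a j).prod := by
      refine commute_list_prod fun a ha => (commute_list_prod fun c hc => ?_).symm
      exact (h a ha c (by simp [hc]) j (by simp) (by rintro rfl; exact hj hc)).symm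
    simp only [crossProd, List.map_cons, List.prod_cons] at ih ⊢
    rw [mul_assoc, mul_assoc, ← ih, ← mul_assoc (l'.map fun j => ρ i j).prod, h1.eq, mul_assoc]

/-- A product over a rectangle may be taken by rows or by columns. -/
theorem crossProd_flip (ρ : ι → κ → M) {l : List ι} {l' : List κ} (hl : l.Nodup)
    (hl' : l'.Nodup)
    (h : ∀ i ∈ l, ∀ i' ∈ l, ∀ j ∈ l', ∀ j' ∈ l', i ≠ i' → j ≠ j' → Commute (ρ i j) (ρ i' j')) :
    crossProd ρ l l' = crossProd (fun j i => ρ i j) l' l := by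
  induction l with
  | nil => simp [crossProd]
  | cons i l ih =>
    obtain ⟨hi, hl⟩ := List.nodup_cons.1 hl
    have ih := ih hl fun a ha b hb => h a (by simp [ha]) b (by simp [hb])
    have h' : ∀ a ∈ l, ∀ j ∈ l', ∀ j' ∈ l', j ≠ j' → Commute (ρ i j) (ρ a j') :=
      fun a ha j hj j' hj' => h i (by simp) a (by simp [ha]) j hj j' hj'
        (by rintro rfl; exact hi ha)
    rw [crossProd, List.map_cons, List.prod_cons]
    change _ * crossProd ρ l l' = _
    rw [ih, row_mul_crossProd ρ hl' h']

theorem crossProd_append (ρ : ι → κ → M) (l₁ l₂ : List ι) (l' : List κ) :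
    crossProd ρ (l₁ ++ l₂) l' = crossProd ρ l₁ l' * crossProd ρ l₂ l' := by
  simp [crossProd]

theorem crossProd_cons (ρ : ι → κ → M) (i : ι) (l₂ : List ι) (l' : List κ) :
    crossProd ρ (i :: l₂) l' = (l'.map fun j => ρ i j).prod * crossProd ρ l₂ l' := by
  simp [crossProd]

theorem commute_crossProd {x : M} {ρ : ι → κ → M} {l : List ι} {l' : List κ}
    (h : ∀ i ∈ l, ∀ j ∈ l', Commute x (ρ i j)) : Commute x (crossProd ρ l l') :=
  commute_list_prod fun i hi => commute_list_prod fun j hj => h i hi j hj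

/-- Two neighbouring rows may be exchanged by means of an element `x`. -/
theorem exchange_crossProd {x : M} {ρ : ι → κ → M} {l₁ l₃ : List ι} {b c : ι} {l' : List κ}
    (hl' : l'.Nodup)
    (hx : ∀ j ∈ l', x * ρ b j * ρ c j = ρ c j * ρ b j * x)
    (h1 : ∀ i ∈ l₁, ∀ j ∈ l', Commute x (ρ i j)) (h3 : ∀ i ∈ l₃, ∀ j ∈ l', Commute x (ρ i j))
    (h : ∀ j ∈ l', ∀ j' ∈ l', j ≠ j' → Commute (ρ b j) (ρ c j')) :
    x * crossProd ρ (l₁ ++ b :: c :: l₃) l' = crossProd ρ (l₁ ++ c :: b :: l₃) l' * x := by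
  have e := exchange_list_prod (f := fun j => ρ b j) (g := fun j => ρ c j) hl' hx h
  have e1 := commute_crossProd h1
  have e3 := commute_crossProd h3
  simp only [crossProd_append, crossProd_cons]
  rw [← mul_assoc, e1.eq]
  simp only [mul_assoc] at e ⊢
  congr 1
  rw [← e3.eq, ← mul_assoc _ _ (crossProd ρ l₃ l'), ← mul_assoc x, e]
  simp only [mul_assoc]

end Monoid

/-- The skeleton of the exchange argument. The factor `x` passes the first R-matrix product and the
L-operators `L₁`, is turned into `y` by the relation between `b` and `c`, and `y` leaves through
`L₃` and the inverse R-matrix product. -/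
theorem braid_exchange {S A : Type*} [CommRing S] [Ring A] [Algebra S A] {k k' : S}
    {x y P P' L₁ b c L₃ Q Q' : A} (hx : x * P = P' * x) (hxL : Commute x L₁)
    (hy : Commute y L₃) (hQ : y * Q = Q' * y) (h : k • (x * b * c) = k' • (c * b * y)) :
    k • (x * (P * (L₁ * b * c * L₃) * Q)) = k' • (P' * (L₁ * c * b * L₃) * Q' * y) := by
  calc k • (x * (P * (L₁ * b * c * L₃) * Q))
      = k • (x * P * L₁ * b * c * L₃ * Q) := by simp only [mul_assoc]
    _ = k • (P' * (x * L₁) * b * c * L₃ * Q) := by rw [hx]; simp only [mul_assoc]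
    _ = P' * L₁ * (k • (x * b * c)) * L₃ * Q := by
      rw [hxL.eq]; simp only [mul_assoc, mul_smul_comm, smul_mul_assoc]
    _ = k' • (P' * L₁ * c * b * (y * L₃) * Q) := by
      rw [h]; simp only [mul_assoc, mul_smul_comm, smul_mul_assoc]
    _ = k' • (P' * L₁ * c * b * L₃ * (y * Q)) := by rw [hy.eq]; simp only [mul_assoc]
    _ = _ := by rw [hQ]; simp only [mul_assoc]

theorem inv_exchange {A : Type*} [Monoid A] {y R R' Q Q' : A} (h : y * R = R' * y)
    (hQ : R * Q = 1) (hQ' : Q' * R' = 1) : y * Q = Q' * y := by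
  calc y * Q = Q' * R' * y * Q := by rw [hQ', one_mul]
    _ = Q' * (y * R) * Q := by rw [h]; simp only [mul_assoc]
    _ = _ := by rw [mul_assoc, mul_assoc, hQ, mul_one]

/-! ### The braided products and the defining relation -/

section Braided

variable {N : ℕ} {τ : Type*} [Fintype τ] [DecidableEq τ] {S E : Type*} [CommRing S] [Ring E]
  [Algebra S E] (q q' : S) (ζ : τ → S) (G : τ → τ → S) (L : τ → Matrix (Fin N) (Fin N) E)

/-- A scalar matrix, regarded as a matrix over an algebra. -/
def sc (N : ℕ) (τ E : Type*) [Fintype τ] [DecidableEq τ] {S : Type*} [CommRing S] [Ring E]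
    [Algebra S E] :
    Matrix (τ → Fin N) (τ → Fin N) S →+* Matrix (τ → Fin N) (τ → Fin N) E :=
  (algebraMap S E).mapMatrix

theorem sc_apply (X : Matrix (τ → Fin N) (τ → Fin N) S) :
    sc N τ E X = X.map (algebraMap S E) := rfl

theorem sc_smul (c : S) (X : Matrix (τ → Fin N) (τ → Fin N) S) :
    sc N τ E (c • X) = c • sc N τ E X := by
  ext I J
  rw [Matrix.smul_apply, sc_apply, sc_apply, Matrix.map_apply, Matrix.map_apply,
    Matrix.smul_apply, smul_eq_mul, map_mul, Algebra.smul_def]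

/-- The products of the R-matrices between two lists of tensor factors. -/
def crossR (N : ℕ) (l l' : List τ) : Matrix (τ → Fin N) (τ → Fin N) S :=
  crossProd (fun i j => G i j • rb N q q' ζ i j) l l'

/-- The ordered products `L_{b_1} ⋯ L_{b_n}`. -/
def prodL (l : List τ) : Matrix (τ → Fin N) (τ → Fin N) E :=
  (l.map fun b => leg b (L b)).prod

theorem actsOn_sc {s : Set τ} {X : Matrix (τ → Fin N) (τ → Fin N) S} (h : ActsOn s X) :
    ActsOn s (sc N τ E X) :=
  h.map _ (map_zero _)

theorem sc_commute_leg {s : Set τ} {X : Matrix (τ → Fin N) (τ → Fin N) S} (h : ActsOn s X)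
    {b : τ} (hb : b ∉ s) (M : Matrix (Fin N) (Fin N) E) : Commute (sc N τ E X) (leg b M) :=
  (actsOn_sc h).commute (actsOn_leg b M) (by simpa using hb) fun _ _ _ _ =>
    Algebra.commutes _ _

theorem sc_commute_prodL {s : Set τ} {X : Matrix (τ → Fin N) (τ → Fin N) S} (h : ActsOn s X)
    {l : List τ} (hl : ∀ b ∈ l, b ∉ s) : Commute (sc N τ E X) (prodL L l) :=
  commute_list_prod fun b hb => sc_commute_leg h (hl b hb) _

variable {q q'} (hq : q * q' = 1)

include hq in
/-- Exchange of two neighbouring factors of the first group. -/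
theorem braided_exchange_left {l₁ l₃ l' : List τ} {b c : τ} {k k' : S}
    {Q Q' : Matrix (τ → Fin N) (τ → Fin N) S}
    (hnd : (l₁ ++ b :: c :: l₃ ++ l').Nodup)
    (hL : k • (sc N τ E (rb N q q' ζ c b) * leg b (L b) * leg c (L c)) =
      k' • (leg c (L c) * leg b (L b) * sc N τ E (rb N q q' ζ b c)))
    (hQ : crossR q q' ζ G N (l₁ ++ b :: c :: l₃) l'.reverse * Q = 1)
    (hQ' : Q' * crossR q q' ζ G N (l₁ ++ c :: b :: l₃) l'.reverse = 1) :
    k • (sc N τ E (rb N q q' ζ c b) *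
        (sc N τ E (crossR q q' ζ G N (l₁ ++ b :: c :: l₃).reverse l') *
          (prodL L (l₁ ++ b :: c :: l₃) * prodL L l') * sc N τ E Q)) =
      k' • (sc N τ E (crossR q q' ζ G N (l₁ ++ c :: b :: l₃).reverse l') *
          (prodL L (l₁ ++ c :: b :: l₃) * prodL L l') * sc N τ E Q' *
        sc N τ E (rb N q q' ζ b c)) := by
  simp only [List.nodup_append, List.nodup_cons, List.mem_append, List.mem_cons, not_or] at hnd
  obtain ⟨⟨h1, ⟨⟨hbc, hb3⟩, hc3, h3⟩, h13⟩, hl', hd⟩ := hnd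
  have hb1 : ∀ i ∈ l₁, i ≠ b := fun i hi => h13 i hi b (by simp)
  have hc1 : ∀ i ∈ l₁, i ≠ c := fun i hi => h13 i hi c (by simp)
  have hb3' : ∀ i ∈ l₃, i ≠ b := fun i hi => by rintro rfl; exact hb3 hi
  have hc3' : ∀ i ∈ l₃, i ≠ c := fun i hi => by rintro rfl; exact hc3 hi
  have hbl : ∀ j ∈ l', j ≠ b := fun j hj => (hd b (by simp) j hj).symm
  have hcl : ∀ j ∈ l', j ≠ c := fun j hj => (hd c (by simp) j hj).symm
  -- On the left the rows are listed backwards, so `c` stands before `b` and the Yang-Baxter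
  -- equation is needed for `c`, `b`, `j`. In the product which gets inverted the rows are in the
  -- given order, and `b`, `c`, `j` is used.
  have hx : rb N q q' ζ c b * crossR q q' ζ G N (l₁ ++ b :: c :: l₃).reverse l' =
      crossR q q' ζ G N (l₁ ++ c :: b :: l₃).reverse l' * rb N q q' ζ c b := by
    simp only [List.reverse_append, List.reverse_cons, List.append_assoc, List.singleton_append]
    refine exchange_crossProd hl' ?_ ?_ ?_ ?_
    · intro j hj
      simp only [mul_smul_comm, smul_mul_assoc, smul_smul]
      rw [rb_yangBaxter q q' ζ (Ne.symm hbc) (hcl j hj).symm (hbl j hj).symm hq, mul_comm]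
    · intro i hi j hj
      replace hi : i ∈ l₃ := List.mem_reverse.1 hi
      exact (rb_commute _ _ _ (hc3' i hi).symm (hcl j hj).symm (hb3' i hi).symm
        (hbl j hj).symm).smul_right _
    · intro i hi j hj
      replace hi : i ∈ l₁ := List.mem_reverse.1 hi
      exact (rb_commute _ _ _ (hc1 i hi).symm (hcl j hj).symm (hb1 i hi).symm
        (hbl j hj).symm).smul_right _
    · intro j hj j' hj' hjj
      exact ((rb_commute _ _ _ (Ne.symm hbc) (hcl j' hj').symm (hbl j hj) hjj).smul_right
        _).smul_left _
  have hy : rb N q q' ζ b c * crossR q q' ζ G N (l₁ ++ b :: c :: l₃) l'.reverse =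
      crossR q q' ζ G N (l₁ ++ c :: b :: l₃) l'.reverse * rb N q q' ζ b c := by
    refine exchange_crossProd (List.nodup_reverse.2 hl') ?_ ?_ ?_ ?_ <;>
      simp only [List.mem_reverse]
    · intro j hj
      simp only [mul_smul_comm, smul_mul_assoc, smul_smul]
      rw [rb_yangBaxter q q' ζ hbc (hbl j hj).symm (hcl j hj).symm hq, mul_comm]
    · intro i hi j hj
      exact (rb_commute _ _ _ (hb1 i hi).symm (hbl j hj).symm (hc1 i hi).symm
        (hcl j hj).symm).smul_right _
    · intro i hi j hj
      exact (rb_commute _ _ _ (hb3' i hi).symm (hbl j hj).symm (hc3' i hi).symm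
        (hcl j hj).symm).smul_right _
    · intro j hj j' hj' hjj
      exact ((rb_commute _ _ _ hbc (hbl j' hj').symm (hcl j hj) hjj).smul_right
        _).smul_left _
  have e := braid_exchange (k := k) (k' := k') (L₁ := prodL L l₁) (b := leg b (L b))
    (c := leg c (L c)) (L₃ := prodL L l₃ * prodL L l')
    (x := sc N τ E (rb N q q' ζ c b)) (y := sc N τ E (rb N q q' ζ b c))
    (P := sc N τ E (crossR q q' ζ G N (l₁ ++ b :: c :: l₃).reverse l'))
    (P' := sc N τ E (crossR q q' ζ G N (l₁ ++ c :: b :: l₃).reverse l'))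
    (Q := sc N τ E Q) (Q' := sc N τ E Q')
    (by rw [← map_mul, hx, map_mul])
    (sc_commute_prodL _ (actsOn_rb _ _ _ _ _) fun i hi => by simp [hb1 i hi, hc1 i hi])
    ((sc_commute_prodL _ (actsOn_rb _ _ _ _ _) fun i hi => by simp [hb3' i hi, hc3' i hi]).mul_right
      (sc_commute_prodL _ (actsOn_rb _ _ _ _ _) fun i hi => by simp [hbl i hi, hcl i hi]))
    (by rw [← map_mul, inv_exchange hy hQ hQ', map_mul]) hL
  simp only [prodL, List.map_append, List.map_cons, List.prod_append, List.prod_cons,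
    mul_assoc] at e ⊢
  exact e

include hq in
/-- Exchange of two neighbouring factors of the second group. -/
theorem braided_exchange_right {l l₁ l₃ : List τ} {b c : τ} {k k' : S}
    {Q Q' : Matrix (τ → Fin N) (τ → Fin N) S}
    (hnd : (l ++ (l₁ ++ b :: c :: l₃)).Nodup)
    (hL : k • (sc N τ E (rb N q q' ζ c b) * leg b (L b) * leg c (L c)) =
      k' • (leg c (L c) * leg b (L b) * sc N τ E (rb N q q' ζ b c)))
    (hQ : crossR q q' ζ G N l (l₁ ++ b :: c :: l₃).reverse * Q = 1)
    (hQ' : Q' * crossR q q' ζ G N l (l₁ ++ c :: b :: l₃).reverse = 1) :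
    k • (sc N τ E (rb N q q' ζ c b) *
        (sc N τ E (crossR q q' ζ G N l.reverse (l₁ ++ b :: c :: l₃)) *
          (prodL L l * prodL L (l₁ ++ b :: c :: l₃)) * sc N τ E Q)) =
      k' • (sc N τ E (crossR q q' ζ G N l.reverse (l₁ ++ c :: b :: l₃)) *
          (prodL L l * prodL L (l₁ ++ c :: b :: l₃)) * sc N τ E Q' *
        sc N τ E (rb N q q' ζ b c)) := by
  have hnd' := hnd
  simp only [List.nodup_append, List.nodup_cons, List.mem_append, List.mem_cons, not_or] at hnd
  obtain ⟨hl, ⟨h1, ⟨⟨hbc, hb3⟩, hc3, h3⟩, h13⟩, hd⟩ := hnd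
  have hb1 : ∀ i ∈ l₁, i ≠ b := fun i hi => h13 i hi b (by simp)
  have hc1 : ∀ i ∈ l₁, i ≠ c := fun i hi => h13 i hi c (by simp)
  have hb3' : ∀ i ∈ l₃, i ≠ b := fun i hi => by rintro rfl; exact hb3 hi
  have hc3' : ∀ i ∈ l₃, i ≠ c := fun i hi => by rintro rfl; exact hc3 hi
  have hbl : ∀ j ∈ l, j ≠ b := fun j hj => hd j hj b (by simp)
  have hcl : ∀ j ∈ l, j ≠ c := fun j hj => hd j hj c (by simp)
  have hn1 : (l₁ ++ b :: c :: l₃).Nodup := (List.nodup_append.1 hnd').2.1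
  have hn2 : (l₁ ++ c :: b :: l₃).Nodup := by
    have : (l₁ ++ c :: b :: l₃).Perm (l₁ ++ b :: c :: l₃) :=
      List.Perm.append_left _ (List.Perm.swap _ _ _)
    exact this.nodup_iff.2 hn1
  have hmem : ∀ j, j ∈ l₁ ++ c :: b :: l₃ → j ∈ l₁ ++ b :: c :: l₃ := by
    intro j hj
    simp only [List.mem_append, List.mem_cons] at hj ⊢
    tauto
  have hcomm : ∀ i ∈ l, ∀ i' ∈ l, ∀ j ∈ l₁ ++ b :: c :: l₃, ∀ j' ∈ l₁ ++ b :: c :: l₃,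
      i ≠ i' → j ≠ j' → Commute (G i j • rb N q q' ζ i j) (G i' j' • rb N q q' ζ i' j') := by
    intro i hi i' hi' j hj j' hj' hii hjj
    have hd' : ∀ i ∈ l, ∀ j ∈ l₁ ++ b :: c :: l₃, i ≠ j := (List.nodup_append.1 hnd').2.2
    exact ((rb_commute _ _ _ hii (hd' i hi j' hj') (hd' i' hi' j hj).symm hjj).smul_right
      _).smul_left _
  have hx : rb N q q' ζ c b * crossR q q' ζ G N l.reverse (l₁ ++ b :: c :: l₃) =
      crossR q q' ζ G N l.reverse (l₁ ++ c :: b :: l₃) * rb N q q' ζ c b := by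
    -- Here `b` and `c` label columns. After the product over the rectangle is rearranged by columns
    -- they label neighbouring rows, and the argument for the first group applies.
    rw [crossR, crossR, crossProd_flip _ (List.nodup_reverse.2 hl) hn1,
      crossProd_flip _ (List.nodup_reverse.2 hl) hn2]
    · refine exchange_crossProd (List.nodup_reverse.2 hl) ?_ ?_ ?_ ?_ <;>
        simp only [List.mem_reverse]
      · intro i hi
        have e := rb_yangBaxter (N := N) q q' ζ (hcl i hi) (hbl i hi) (Ne.symm hbc) hq
        simp only [mul_smul_comm, smul_mul_assoc, smul_smul]
        rw [← e, mul_comm]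
      · intro j hj i hi
        exact (rb_commute _ _ _ (hcl i hi).symm (hc1 j hj).symm (hbl i hi).symm
          (hb1 j hj).symm).smul_right _
      · intro j hj i hi
        exact (rb_commute _ _ _ (hcl i hi).symm (hc3' j hj).symm (hbl i hi).symm
          (hb3' j hj).symm).smul_right _
      · intro i hi i' hi' hii
        exact hcomm i hi i' hi' b (by simp) c (by simp) hii hbc
    · simp only [List.mem_reverse]
      exact fun i hi i' hi' j hj j' hj' => hcomm i hi i' hi' j (hmem j hj) j' (hmem j' hj')
    · simp only [List.mem_reverse]
      exact hcomm
  have hy : rb N q q' ζ b c * crossR q q' ζ G N l (l₁ ++ b :: c :: l₃).reverse =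
      crossR q q' ζ G N l (l₁ ++ c :: b :: l₃).reverse * rb N q q' ζ b c := by
    rw [crossR, crossR, crossProd_flip _ hl (List.nodup_reverse.2 hn1),
      crossProd_flip _ hl (List.nodup_reverse.2 hn2)]
    · simp only [List.reverse_append, List.reverse_cons, List.append_assoc, List.singleton_append]
      refine exchange_crossProd hl ?_ ?_ ?_ ?_
      · intro i hi
        have e := rb_yangBaxter (N := N) q q' ζ (hbl i hi) (hcl i hi) hbc hq
        simp only [mul_smul_comm, smul_mul_assoc, smul_smul]
        rw [← e, mul_comm]
      · intro j hj i hi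
        replace hj : j ∈ l₃ := List.mem_reverse.1 hj
        exact (rb_commute _ _ _ (hbl i hi).symm (hb3' j hj).symm (hcl i hi).symm
          (hc3' j hj).symm).smul_right _
      · intro j hj i hi
        replace hj : j ∈ l₁ := List.mem_reverse.1 hj
        exact (rb_commute _ _ _ (hbl i hi).symm (hb1 j hj).symm (hcl i hi).symm
          (hc1 j hj).symm).smul_right _
      · intro i hi i' hi' hii
        exact hcomm i hi i' hi' c (by simp) b (by simp) hii (Ne.symm hbc)
    · simp only [List.mem_reverse]
      exact fun i hi i' hi' j hj j' hj' => hcomm i hi i' hi' j (hmem j hj) j' (hmem j' hj')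
    · simp only [List.mem_reverse]
      exact hcomm
  have e := braid_exchange (k := k) (k' := k') (L₁ := prodL L l * prodL L l₁) (b := leg b (L b))
    (c := leg c (L c)) (L₃ := prodL L l₃)
    (x := sc N τ E (rb N q q' ζ c b)) (y := sc N τ E (rb N q q' ζ b c))
    (P := sc N τ E (crossR q q' ζ G N l.reverse (l₁ ++ b :: c :: l₃)))
    (P' := sc N τ E (crossR q q' ζ G N l.reverse (l₁ ++ c :: b :: l₃)))
    (Q := sc N τ E Q) (Q' := sc N τ E Q')
    (by rw [← map_mul, hx, map_mul])
    ((sc_commute_prodL _ (actsOn_rb _ _ _ _ _) fun i hi => by simp [hbl i hi, hcl i hi]).mul_right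
      (sc_commute_prodL _ (actsOn_rb _ _ _ _ _) fun i hi => by simp [hb1 i hi, hc1 i hi]))
    (sc_commute_prodL _ (actsOn_rb _ _ _ _ _) fun i hi => by simp [hb3' i hi, hc3' i hi])
    (by rw [← map_mul, inv_exchange hy hQ hQ', map_mul]) hL
  simp only [prodL, List.map_append, List.map_cons, List.prod_append, List.prod_cons,
    mul_assoc] at e ⊢
  exact e

end Braided

/-! ### Inversion weights and the antisymmetrizer -/

section Weights

variable {N n : ℕ} {S : Type*} [CommRing S]

/-- The weight `q^{inv(x)}`, where `inv(x)` is the number of inversions of the tuple `x`. -/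
def wt (q : S) (x : Fin n → Fin N) : S :=
  ∏ p : Fin n × Fin n, if p.1 < p.2 ∧ x p.2 < x p.1 then q else 1

theorem wt_mul_wt {q q' : S} (hq : q * q' = 1) (x : Fin n → Fin N) : wt q x * wt q' x = 1 := by
  rw [wt, wt, ← Finset.prod_mul_distrib]
  refine Finset.prod_eq_one fun p _ => ?_
  split_ifs <;> simp [hq]

theorem wt_map {S' : Type*} [CommRing S'] (f : S →+* S') (q : S) (x : Fin n → Fin N) :
    f (wt q x) = wt (f q) x := by
  rw [wt, wt, map_prod]
  refine Finset.prod_congr rfl fun p _ => ?_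
  split_ifs <;> simp

/-- Swapping an adjacent ascent creates exactly one new inversion. The transposition permutes all
other pairs of positions and preserves their order, so it matches the remaining factors. -/
theorem wt_comp_swap (q : S) (x : Fin (n + 1) → Fin N) (k : Fin n)
    (h : x k.castSucc < x k.succ) :
    wt q (x ∘ Equiv.swap k.castSucc k.succ) = q * wt q x := by
  set s := Equiv.swap k.castSucc k.succ with hs
  have hlt : k.castSucc < k.succ := Fin.castSucc_lt_succ
  have h1 : wt q (x ∘ s) =
      ∏ p : Fin (n + 1) × Fin (n + 1), if s p.1 < s p.2 ∧ x p.2 < x p.1 then q else 1 := by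
    rw [wt, ← Equiv.prod_comp (s.prodCongr s)]
    refine Finset.prod_congr rfl fun p _ => ?_
    simp [hs]
  rw [h1, wt, ← Finset.mul_prod_erase _ _ (Finset.mem_univ (k.succ, k.castSucc)),
    ← Finset.mul_prod_erase Finset.univ
      (fun p : Fin (n + 1) × Fin (n + 1) => if p.1 < p.2 ∧ x p.2 < x p.1 then q else 1)
      (Finset.mem_univ (k.succ, k.castSucc))]
  have e1 : s k.succ = k.castSucc := Equiv.swap_apply_right _ _
  have e2 : s k.castSucc = k.succ := Equiv.swap_apply_left _ _
  simp only [e1, e2, hlt, hlt.not_gt, h, and_self, if_true, false_and, if_false, one_mul]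
  congr 1
  refine Finset.prod_congr rfl fun p hp => ?_
  obtain ⟨i, j⟩ := p
  have hp' : ¬(i = k.succ ∧ j = k.castSucc) := by simpa using hp
  by_cases hq : i = k.castSucc ∧ j = k.succ
  · obtain ⟨rfl, rfl⟩ := hq
    simp [h.not_gt]
  · have : s i < s j ↔ i < j := by
      simp only [hs, Equiv.swap_apply_def, Fin.ext_iff, Fin.lt_def, Fin.val_castSucc,
        Fin.val_succ] at *
      split_ifs <;> simp <;> omega
    simp only [this]

end Weights

/-! ### Weighted antisymmetric functions and the antisymmetrizer -/

section Asym

variable {N n : ℕ} {τ : Type*} [Fintype τ] [DecidableEq τ] {S : Type*} [CommRing S]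

/-- The permutation of the tensor factors `g 0, …, g (n - 1)` given by `w`. -/
def slotPerm (g : Fin n ↪ τ) (w : Equiv.Perm (Fin n)) : Equiv.Perm τ := w.viaEmbedding g

@[simp] theorem slotPerm_apply (g : Fin n ↪ τ) (w : Equiv.Perm (Fin n)) (k : Fin n) :
    slotPerm g w (g k) = g (w k) := Equiv.Perm.viaEmbedding_apply _ _ _

theorem slotPerm_apply_of_notMem (g : Fin n ↪ τ) (w : Equiv.Perm (Fin n)) {c : τ}
    (hc : c ∉ Set.range g) : slotPerm g w c = c :=
  Equiv.Perm.viaEmbedding_apply_of_notMem _ _ _ hc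

theorem slotPerm_mul (g : Fin n ↪ τ) (w w' : Equiv.Perm (Fin n)) :
    slotPerm g (w * w') = slotPerm g w * slotPerm g w' :=
  map_mul (Equiv.Perm.viaEmbeddingHom g) w w'

@[simp] theorem slotPerm_one (g : Fin n ↪ τ) : slotPerm g 1 = 1 :=
  map_one (Equiv.Perm.viaEmbeddingHom g)

theorem slotPerm_swap (g : Fin n ↪ τ) (i j : Fin n) :
    slotPerm g (Equiv.swap i j) = Equiv.swap (g i) (g j) := by
  ext c
  by_cases hc : c ∈ Set.range g
  · obtain ⟨k, rfl⟩ := hc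
    rw [slotPerm_apply, Equiv.swap_apply_def, Equiv.swap_apply_def]
    simp only [g.injective.eq_iff]
    split_ifs <;> rfl
  · rw [slotPerm_apply_of_notMem g _ hc, Equiv.swap_apply_of_ne_of_ne]
    · rintro rfl; exact hc ⟨i, rfl⟩
    · rintro rfl; exact hc ⟨j, rfl⟩

theorem exists_slotPerm (g : Fin n ↪ τ) (π : Equiv.Perm τ) (hπ : ∀ c, c ∉ Set.range g → π c = c) :
    ∃ w, slotPerm g w = π := by
  have h : ∀ k, ∃ k', g k' = π (g k) := by
    intro k
    by_contra hk
    have h1 : π (g k) ∉ Set.range g := fun ⟨k', h⟩ => hk ⟨k', h⟩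
    have h2 := π.injective (hπ _ h1)
    exact h1 (by rw [h2]; exact ⟨k, rfl⟩)
  choose w hw using h
  have hinj : Function.Injective w := by
    intro a b hab
    apply g.injective
    apply π.injective
    rw [← hw, ← hw, hab]
  refine ⟨Equiv.ofBijective w (Finite.injective_iff_bijective.1 hinj), ?_⟩
  ext c
  by_cases hc : c ∈ Set.range g
  · obtain ⟨k, rfl⟩ := hc
    simp [hw]
  · rw [slotPerm_apply_of_notMem g _ hc, hπ c hc]

theorem comp_slotPerm_comp (g : Fin n ↪ τ) (w : Equiv.Perm (Fin n)) (I : τ → Fin N) :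
    (I ∘ slotPerm g w) ∘ g = (I ∘ g) ∘ w := by
  funext k
  simp

/-- A function which is antisymmetric in the tensor factors `g 0, …, g (n - 1)`, up to the inversion
weights. -/
def IsAsym {M : Type*} [AddCommGroup M] [Module S M] (q q' : S) (g : Fin n ↪ τ)
    (F : (τ → Fin N) → M) : Prop :=
  ∀ (w : Equiv.Perm (Fin n)) (I : τ → Fin N),
    F (I ∘ slotPerm g w) =
      ((Equiv.Perm.sign w : ℤ) : S) • (wt q ((I ∘ g) ∘ w) * wt q' (I ∘ g)) • F I

variable {M : Type*} [AddCommGroup M] [Module S M] {q q' : S}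

theorem sign_mul_sign (w : Equiv.Perm (Fin n)) :
    ((Equiv.Perm.sign w : ℤ) : S) * ((Equiv.Perm.sign w : ℤ) : S) = 1 := by
  rw [← Int.cast_mul, ← Units.val_mul, Int.units_mul_self]
  simp

/-- Adjacent transpositions generate the symmetric group, and antisymmetry is stable under
composition. The condition for ascents also gives the one for descents, since a transposition is an
involution and `q` is invertible. -/
theorem isAsym_of_adjacent (hq : q * q' = 1) (g : Fin (n + 1) ↪ τ) {F : (τ → Fin N) → M}
    (h0 : ∀ (k : Fin n) I, I (g k.castSucc) = I (g k.succ) → F I = 0)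
    (h1 : ∀ (k : Fin n) I, I (g k.castSucc) < I (g k.succ) →
      F (I ∘ Equiv.swap (g k.castSucc) (g k.succ)) = -(q • F I)) : IsAsym q q' g F := by
  -- Dividing `F` by its inversion weight turns weighted antisymmetry into plain antisymmetry, which
  -- is multiplicative in the permutation.
  have key : ∀ (w : Equiv.Perm (Fin (n + 1))) (I : τ → Fin N),
      wt q' ((I ∘ g) ∘ w) • F (I ∘ slotPerm g w) =
        ((Equiv.Perm.sign w : ℤ) : S) • wt q' (I ∘ g) • F I := by
    intro w
    have hw : w ∈ Submonoid.closure
        (Set.range fun i : Fin n => Equiv.swap i.castSucc i.succ) := by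
      rw [Equiv.Perm.mclosure_swap_castSucc_succ]; trivial
    induction hw using Submonoid.closure_induction with
    | mem w hw =>
      obtain ⟨k, rfl⟩ := hw
      have hlt : ∀ I : τ → Fin N, I (g k.castSucc) < I (g k.succ) →
          wt q' ((I ∘ g) ∘ Equiv.swap k.castSucc k.succ) •
            F (I ∘ slotPerm g (Equiv.swap k.castSucc k.succ)) = -(wt q' (I ∘ g) • F I) := by
        intro I hI
        rw [slotPerm_swap, h1 k I hI, wt_comp_swap q' (I ∘ g) k hI, smul_neg, smul_smul]
        congr 2
        linear_combination wt q' (I ∘ g) * hq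
      intro I
      have hne : k.castSucc ≠ k.succ := (Fin.castSucc_lt_succ).ne
      simp only [Equiv.Perm.sign_swap hne, Units.val_neg, Units.val_one, Int.cast_neg,
        Int.cast_one, neg_smul, one_smul]
      rcases lt_trichotomy (I (g k.castSucc)) (I (g k.succ)) with h | h | h
      · exact hlt I h
      · rw [h0 k I h, slotPerm_swap, h0 k _ (by simp [h])]
        simp
      · have := hlt (I ∘ slotPerm g (Equiv.swap k.castSucc k.succ)) (by simp [h])
        rw [comp_slotPerm_comp] at this
        have e1 : (((I ∘ g) ∘ Equiv.swap k.castSucc k.succ) ∘ Equiv.swap k.castSucc k.succ) =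
            I ∘ g := by funext x; simp
        have e2 : (I ∘ slotPerm g (Equiv.swap k.castSucc k.succ)) ∘
            slotPerm g (Equiv.swap k.castSucc k.succ) = I := by
          rw [slotPerm_swap]; funext x; simp
        rw [e1, e2] at this
        rw [this, neg_neg]
    | one => intro I; simp [Function.comp_def]
    | mul w w' _ _ h h' =>
      intro I
      have := h' (I ∘ slotPerm g w)
      rw [comp_slotPerm_comp, h I, smul_smul] at this
      rw [slotPerm_mul, Equiv.Perm.coe_mul, Equiv.Perm.coe_mul, ← Function.comp_assoc,
        ← Function.comp_assoc, this]
      simp [mul_comm]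
  intro w I
  have h2 : F (I ∘ slotPerm g w) =
      wt q ((I ∘ g) ∘ w) • wt q' ((I ∘ g) ∘ w) • F (I ∘ slotPerm g w) := by
    rw [smul_smul, wt_mul_wt hq, one_smul]
  rw [h2, key, smul_comm, smul_smul (wt q _)]

/-- The antisymmetrizer in the tensor factors `g 0, …, g (n - 1)`. -/
def asym (N : ℕ) (q q' : S) (g : Fin n ↪ τ) : Matrix (τ → Fin N) (τ → Fin N) S := fun I J =>
  ∑ w : Equiv.Perm (Fin n), if J = I ∘ slotPerm g w then
    ((Equiv.Perm.sign w : ℤ) : S) * (wt q (I ∘ g) * wt q' (J ∘ g)) else 0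

theorem asym_map {S' : Type*} [CommRing S'] (f : S →+* S') (q q' : S) (g : Fin n ↪ τ) :
    (asym N q q' g).map f = asym N (f q) (f q') g := by
  ext I J
  simp only [Matrix.map_apply, asym, map_sum]
  refine Finset.sum_congr rfl fun w _ => ?_
  split_ifs <;> simp [wt_map]

/-- Replacing `w` by its inverse in the sum transposes the matrix. Consequently statements on
columns follow from those on rows with `q` and `q'` exchanged. -/
theorem asym_symm (g : Fin n ↪ τ) (I J : τ → Fin N) : asym N q q' g I J = asym N q' q g J I := by
  rw [asym, asym, ← Equiv.sum_comp (Equiv.inv (Equiv.Perm (Fin n)))]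
  refine Finset.sum_congr rfl fun w _ => ?_
  have : (J = I ∘ slotPerm g w⁻¹) ↔ (I = J ∘ slotPerm g w) := by
    have h : slotPerm g w⁻¹ = (slotPerm g w)⁻¹ := map_inv (Equiv.Perm.viaEmbeddingHom g) w
    constructor
    · rintro rfl; rw [h]; funext c; simp
    · rintro rfl; rw [h]; funext c; simp
  simp only [Equiv.inv_apply, this, Equiv.Perm.sign_inv]
  congr 1
  ring

theorem isAsym_asym (hq : q * q' = 1) (g : Fin n ↪ τ) (J : τ → Fin N) :
    IsAsym q q' g fun I => asym N q q' g I J := by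
  intro w I
  simp only [asym, smul_eq_mul, Finset.mul_sum]
  rw [← Equiv.sum_comp (Equiv.mulLeft w)
    (fun w' => ((Equiv.Perm.sign w : ℤ) : S) * (wt q ((I ∘ g) ∘ w) * wt q' (I ∘ g) * _))]
  refine Finset.sum_congr rfl fun w' _ => ?_
  simp only [Equiv.coe_mulLeft, slotPerm_mul, Equiv.Perm.coe_mul, ← Function.comp_assoc]
  split_ifs
  · rw [comp_slotPerm_comp, map_mul, Units.val_mul, Int.cast_mul]
    have h1 := wt_mul_wt hq (I ∘ g)
    have h2 := sign_mul_sign (S := S) w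
    linear_combination (-((Equiv.Perm.sign w' : ℤ) : S) * wt q ((I ∘ g) ∘ w) * wt q' (J ∘ g)) *
      (((Equiv.Perm.sign w : ℤ) : S) * ((Equiv.Perm.sign w : ℤ) : S) * h1 + h2)
  · simp

/-- The summand of each permutation equals `F I`: the sign and the weight in the antisymmetrizer
undo those by which `F` changes. The antisymmetrizer is therefore `n !` times a projection. -/
theorem sum_asym_smul (hq : q * q' = 1) (g : Fin n ↪ τ) {F : (τ → Fin N) → M}
    (hF : IsAsym q q' g F) (I : τ → Fin N) :
    ∑ K, asym N q q' g I K • F K = (n.factorial : S) • F I := by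
  simp only [asym, Finset.sum_smul, ite_smul, zero_smul]
  rw [Finset.sum_comm]
  simp only [Finset.sum_ite_eq', Finset.mem_univ, if_true]
  have : ∀ w : Equiv.Perm (Fin n), (((Equiv.Perm.sign w : ℤ) : S) *
      (wt q (I ∘ g) * wt q' ((I ∘ slotPerm g w) ∘ g))) • F (I ∘ slotPerm g w) = F I := by
    intro w
    rw [hF w I, smul_smul, smul_smul, comp_slotPerm_comp]
    convert one_smul S (F I) using 2
    have h1 := wt_mul_wt hq (I ∘ g)
    have h2 := sign_mul_sign (S := S) w
    have h3 := wt_mul_wt hq ((I ∘ g) ∘ w)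
    linear_combination (wt q (I ∘ g) * wt q' (I ∘ g) * wt q ((I ∘ g) ∘ w) * wt q' ((I ∘ g) ∘ w)) *
      h2 + (wt q ((I ∘ g) ∘ w) * wt q' ((I ∘ g) ∘ w)) * h1 + h3
  rw [Finset.sum_congr rfl fun w _ => this w, Finset.sum_const, Finset.card_univ,
    Fintype.card_perm, Fintype.card_fin, Nat.cast_smul_eq_nsmul]

theorem asym_mul_asym (hq : q * q' = 1) (g : Fin n ↪ τ) :
    asym N q q' g * asym N q q' g = (n.factorial : S) • asym N q q' g := by
  ext I J
  exact sum_asym_smul hq g (isAsym_asym hq g J) I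

/-- The transposition of two slots with equal letters fixes the index. The weights cancel and the
sign remains, so `F I = -F I`. -/
theorem IsAsym.eq_zero (h2 : ∀ x : M, x + x = 0 → x = 0) (hq : q * q' = 1) {g : Fin n ↪ τ}
    {F : (τ → Fin N) → M} (hF : IsAsym q q' g F) {I : τ → Fin N}
    (hI : ¬Function.Injective (I ∘ g)) : F I = 0 := by
  simp only [Function.Injective, not_forall] at hI
  obtain ⟨i, j, hij, hne⟩ := hI
  have e : I ∘ slotPerm g (Equiv.swap i j) = I := by
    rw [slotPerm_swap]
    funext c
    simp only [Function.comp_apply, Equiv.swap_apply_def] at hij ⊢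
    split_ifs with h h'
    · rw [h, hij]
    · rw [h', hij]
    · rfl
  have e' : (I ∘ g) ∘ Equiv.swap i j = I ∘ g := by rw [← comp_slotPerm_comp, e]
  have := hF (Equiv.swap i j) I
  rw [e, e', wt_mul_wt hq, Equiv.Perm.sign_swap hne] at this
  apply h2
  nth_rewrite 1 [this]
  simp

theorem asym_self (g : Fin n ↪ τ) (hq : q * q' = 1) {J : τ → Fin N}
    (hJ : Function.Injective (J ∘ g)) : asym N q q' g J J = 1 := by
  rw [asym, Finset.sum_eq_single 1]
  · simp [wt_mul_wt hq, Function.comp_def]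
  · intro w _ hw
    rw [if_neg]
    intro h
    apply hw
    ext k
    have : (J ∘ g) (w k) = (J ∘ g) k := by
      rw [← Function.comp_apply (f := J ∘ g), ← comp_slotPerm_comp, ← h]
    simpa using congrArg Fin.val (hJ this)
  · simp

theorem asym_eq_zero (g : Fin n ↪ τ) {I J : τ → Fin N} (h : ¬∃ w, J = I ∘ slotPerm g w) :
    asym N q q' g I J = 0 :=
  Finset.sum_eq_zero fun w _ => if_neg fun h' => h ⟨w, h'⟩

end Asym

/-! ### Fusion -/

section FusionMonoid

variable {M : Type*} [Monoid M] {τ : Type*}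

/-- The fusion product of the `r b c` over the pairs `b`, `c` of a list. -/
def fus (r : τ → τ → M) : List τ → M
  | [] => 1
  | b :: l => (l.map fun c => r b c).prod * fus r l

theorem commute_fus {x : M} {r : τ → τ → M} {l : List τ}
    (h : ∀ b ∈ l, ∀ c ∈ l, Commute x (r b c)) : Commute x (fus r l) := by
  induction l with
  | nil => exact Commute.one_right x
  | cons b l ih =>
    exact (commute_list_prod fun c hc => h b (by simp) c (by simp [hc])).mul_right
      (ih fun b hb c hc => h b (by simp [hb]) c (by simp [hc]))

/-- The fusion product behaves like the longest permutation: pulled through a product of the `T`, it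
reverses their order. In the induction the inner fusion product reverses the tail, and then the row
of `b` carries `T b` from the front to the end. -/
theorem fus_mul_list_prod {r : τ → τ → M} {T : τ → M} {l : List τ} (hl : l.Nodup)
    (hc : ∀ b ∈ l, ∀ c ∈ l, ∀ d ∈ l, d ≠ b → d ≠ c → Commute (r b c) (T d))
    (hT : ∀ b ∈ l, ∀ c ∈ l, b ≠ c → r b c * T b * T c = T c * T b * r b c) :
    fus r l * (l.map T).prod = (l.reverse.map T).prod * fus r l := by
  induction l with
  | nil => simp
  | cons b l ih =>
    obtain ⟨hb, hl⟩ := List.nodup_cons.1 hl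
    have ih := ih hl (fun b hb c hc' d hd => hc b (by simp [hb]) c (by simp [hc']) d (by simp [hd]))
      (fun b hb c hc => hT b (by simp [hb]) c (by simp [hc]))
    have hne : ∀ c ∈ l, b ≠ c := fun c hc => by rintro rfl; exact hb hc
    have h1 : Commute (fus r l) (T b) := (commute_fus fun c hc' d hd =>
      (hc c (by simp [hc']) d (by simp [hd]) b (by simp) (hne c hc') (hne d hd)).symm).symm
    have h2 : ∀ k : List τ, k.Nodup → (∀ c ∈ k, c ∈ l) →
        (k.map fun c => r b c).prod * (T b * (k.reverse.map T).prod) =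
          (k.reverse.map T).prod * (T b * (k.map fun c => r b c).prod) := by
      intro k
      induction k with
      | nil => simp
      | cons c k ihk =>
        intro hk hkl
        obtain ⟨hck, hk⟩ := List.nodup_cons.1 hk
        have ihk := ihk hk fun d hd => hkl d (by simp [hd])
        have hcl := hkl c (by simp)
        have e1 : Commute (r b c) (k.reverse.map T).prod := commute_list_prod fun d hd => by
          have hd' : d ∈ k := by simpa using hd
          have hdl := hkl d (by simp [hd'])
          exact hc b (by simp) c (by simp [hcl]) d (by simp [hdl]) (hne d hdl).symm
            (by rintro rfl; exact hck hd')
        have e2 : Commute (T c) (k.map fun d => r b d).prod := commute_list_prod fun d hd => by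
          have hdl := hkl d (by simp [hd])
          exact (hc b (by simp) d (by simp [hdl]) c (by simp [hcl]) (hne c hcl).symm
            (by rintro rfl; exact hck hd)).symm
        have e3 := hT b (by simp) c (by simp [hcl]) (hne c hcl)
        simp only [List.map_cons, List.prod_cons, List.reverse_cons, List.map_append,
          List.prod_append, List.map_nil, List.prod_nil, mul_one]
        calc r b c * (k.map fun c => r b c).prod * (T b * ((k.reverse.map T).prod * T c))
            = r b c * ((k.map fun c => r b c).prod * (T b * (k.reverse.map T).prod)) * T c := by
              simp only [mul_assoc]
          _ = r b c * (k.reverse.map T).prod * T b * ((k.map fun c => r b c).prod * T c) := by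
              rw [ihk]; simp only [mul_assoc]
          _ = (k.reverse.map T).prod * (r b c * T b * T c) * (k.map fun c => r b c).prod := by
              rw [e1.eq, ← e2.eq]; simp only [mul_assoc]
          _ = _ := by rw [e3]; simp only [mul_assoc]
    have h3 := h2 l hl fun c hc => hc
    simp only [fus, List.map_cons, List.prod_cons, List.reverse_cons, List.map_append,
      List.prod_append, List.map_nil, List.prod_nil, mul_one]
    calc (l.map fun c => r b c).prod * fus r l * (T b * (l.map T).prod)
        = (l.map fun c => r b c).prod * (fus r l * T b) * (l.map T).prod := by
          simp only [mul_assoc]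
      _ = (l.map fun c => r b c).prod * T b * (fus r l * (l.map T).prod) := by
          rw [h1.eq]; simp only [mul_assoc]
      _ = (l.map fun c => r b c).prod * (T b * (l.reverse.map T).prod) * fus r l := by
          rw [ih]; simp only [mul_assoc]
      _ = _ := by rw [h3]; simp only [mul_assoc]

theorem fus_mul_list_prod_reverse {r : τ → τ → M} {T : τ → M} {l : List τ} (hl : l.Nodup)
    (hc : ∀ b ∈ l, ∀ c ∈ l, ∀ d ∈ l, d ≠ b → d ≠ c → Commute (r b c) (T d))
    (hT : ∀ b ∈ l, ∀ c ∈ l, b ≠ c → r b c * T c * T b = T b * T c * r b c) :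
    fus r l * (l.reverse.map T).prod = (l.map T).prod * fus r l := by
  induction l with
  | nil => simp
  | cons b l ih =>
    obtain ⟨hb, hl⟩ := List.nodup_cons.1 hl
    have ih := ih hl (fun b hb c hc' d hd => hc b (by simp [hb]) c (by simp [hc']) d (by simp [hd]))
      (fun b hb c hc => hT b (by simp [hb]) c (by simp [hc]))
    have hne : ∀ c ∈ l, b ≠ c := fun c hc => by rintro rfl; exact hb hc
    have h1 : Commute (fus r l) (T b) := (commute_fus fun c hc' d hd =>
      (hc c (by simp [hc']) d (by simp [hd]) b (by simp) (hne c hc') (hne d hd)).symm).symm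
    have h2 : ∀ k : List τ, k.Nodup → (∀ c ∈ k, c ∈ l) →
        (k.map fun c => r b c).prod * ((k.map T).prod * T b) =
          T b * ((k.map T).prod * (k.map fun c => r b c).prod) := by
      intro k
      induction k with
      | nil => simp
      | cons c k ihk =>
        intro hk hkl
        obtain ⟨hck, hk⟩ := List.nodup_cons.1 hk
        have ihk := ihk hk fun d hd => hkl d (by simp [hd])
        have hcl := hkl c (by simp)
        have e1 : Commute (r b c) (k.map T).prod := commute_list_prod fun d hd => by
          have hdl := hkl d (by simp [hd])
          exact hc b (by simp) c (by simp [hcl]) d (by simp [hdl]) (hne d hdl).symm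
            (by rintro rfl; exact hck hd)
        have e2 : Commute (T c) (k.map fun d => r b d).prod := commute_list_prod fun d hd => by
          have hdl := hkl d (by simp [hd])
          exact (hc b (by simp) d (by simp [hdl]) c (by simp [hcl]) (hne c hcl).symm
            (by rintro rfl; exact hck hd)).symm
        have e3 := hT b (by simp) c (by simp [hcl]) (hne c hcl)
        simp only [List.map_cons, List.prod_cons]
        calc r b c * (k.map fun c => r b c).prod * (T c * (k.map T).prod * T b)
            = r b c * ((k.map fun c => r b c).prod * T c) * ((k.map T).prod * T b) := by
              simp only [mul_assoc]
          _ = r b c * T c * ((k.map fun c => r b c).prod * ((k.map T).prod * T b)) := by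
              rw [← e2.eq]; simp only [mul_assoc]
          _ = (r b c * T c * T b) * ((k.map T).prod * (k.map fun c => r b c).prod) := by
              rw [ihk]; simp only [mul_assoc]
          _ = T b * T c * (r b c * (k.map T).prod) * (k.map fun c => r b c).prod := by
              rw [e3]; simp only [mul_assoc]
          _ = _ := by rw [e1.eq]; simp only [mul_assoc]
    have h3 := h2 l hl fun c hc => hc
    simp only [fus, List.map_cons, List.prod_cons, List.reverse_cons, List.map_append,
      List.prod_append, List.map_nil, List.prod_nil, mul_one]
    calc (l.map fun c => r b c).prod * fus r l * ((l.reverse.map T).prod * T b)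
        = (l.map fun c => r b c).prod * (fus r l * (l.reverse.map T).prod) * T b := by
          simp only [mul_assoc]
      _ = (l.map fun c => r b c).prod * (l.map T).prod * (fus r l * T b) := by
          rw [ih]; simp only [mul_assoc]
      _ = (l.map fun c => r b c).prod * ((l.map T).prod * T b) * fus r l := by
          rw [h1.eq]; simp only [mul_assoc]
      _ = _ := by rw [h3]; simp only [mul_assoc]

end FusionMonoid

/-! ### The fusion product of R-matrices as an antisymmetrizer -/

section Fusion

variable {N n : ℕ} {τ : Type*} [Fintype τ] [DecidableEq τ] {D : Type*} [CommRing D]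
  {q q' : D} (hq : q * q' = 1) {ζ : τ → D}

include hq in
-- If `b` is the head of the list, the product starts with `R_{bc}`, and `R_{cb} R_{bc}` is the
-- unitarity scalar, which is zero at these parameters. Otherwise the Yang-Baxter equation moves
-- `R_{cb}` past the row of the head `a`, and induction applies.
theorem rb_mul_fus_eq_zero {l₁ l₃ : List τ} {b c : τ} (hnd : (l₁ ++ b :: c :: l₃).Nodup)
    (hζ : ζ b = q ^ 2 * ζ c) :
    rb N q q' ζ c b * fus (rb N q q' ζ) (l₁ ++ b :: c :: l₃) = 0 := by
  induction l₁ with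
  | nil =>
    rw [List.nil_append, fus, List.map_cons, List.prod_cons, mul_assoc, ← mul_assoc,
      rb_unitarity _ _ _ _ _ hq, hζ]
    have : (ζ c * q' - q ^ 2 * ζ c * q) * (q ^ 2 * ζ c * q' - ζ c * q) = 0 := by
      linear_combination ((ζ c * q' - q ^ 2 * ζ c * q) * ζ c * q) * hq
    rw [this, zero_smul, zero_mul]
  | cons a l₁ ih =>
    obtain ⟨ha, hnd⟩ := List.nodup_cons.1 hnd
    replace hnd : (l₁ ++ b :: c :: l₃).Nodup := hnd
    have ih := ih hnd
    have ha : a ∉ l₁ ∧ a ≠ b ∧ a ≠ c ∧ a ∉ l₃ := by simpa using ha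
    obtain ⟨ha1, hab, hac, ha3⟩ := ha
    simp only [List.nodup_append, List.nodup_cons, List.mem_cons, not_or] at hnd
    obtain ⟨h1, ⟨⟨hbc, hb3⟩, hc3, h3⟩, h13⟩ := hnd
    have e1 : Commute (rb N q q' ζ c b) (l₁.map fun d => rb N q q' ζ a d).prod :=
      commute_list_prod fun d hd => rb_commute _ _ _ (Ne.symm hac) (h13 d hd c (by simp)).symm
        (Ne.symm hab) (h13 d hd b (by simp)).symm
    have e3 : Commute (rb N q q' ζ c b) (l₃.map fun d => rb N q q' ζ a d).prod :=
      commute_list_prod fun d hd => rb_commute _ _ _ (Ne.symm hac) (by rintro rfl; exact hc3 hd)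
        (Ne.symm hab) (by rintro rfl; exact hb3 hd)
    have e2 := rb_yangBaxter (N := N) q q' ζ hac hab (Ne.symm hbc) hq
    rw [List.cons_append, fus]
    simp only [List.map_append, List.map_cons, List.prod_append, List.prod_cons]
    rw [← mul_assoc, ← mul_assoc, e1.eq]
    calc (l₁.map fun d => rb N q q' ζ a d).prod * rb N q q' ζ c b *
          (rb N q q' ζ a b * (rb N q q' ζ a c * (l₃.map fun d => rb N q q' ζ a d).prod)) *
          fus (rb N q q' ζ) (l₁ ++ b :: c :: l₃)
        = (l₁.map fun d => rb N q q' ζ a d).prod *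
          (rb N q q' ζ c b * rb N q q' ζ a b * rb N q q' ζ a c) *
          (l₃.map fun d => rb N q q' ζ a d).prod * fus (rb N q q' ζ) (l₁ ++ b :: c :: l₃) := by
          simp only [mul_assoc]
      _ = (l₁.map fun d => rb N q q' ζ a d).prod * rb N q q' ζ a c * rb N q q' ζ a b *
          (rb N q q' ζ c b * (l₃.map fun d => rb N q q' ζ a d).prod) *
            fus (rb N q q' ζ) (l₁ ++ b :: c :: l₃) := by
          rw [← e2]; simp only [mul_assoc]
      _ = (l₁.map fun d => rb N q q' ζ a d).prod * rb N q q' ζ a c * rb N q q' ζ a b *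
          (l₃.map fun d => rb N q q' ζ a d).prod *
            (rb N q q' ζ c b * fus (rb N q q' ζ) (l₁ ++ b :: c :: l₃)) := by
          rw [e3.eq]; simp only [mul_assoc]
      _ = 0 := by rw [ih, mul_zero]

theorem ofFn_split {α : Type*} (f : Fin (n + 1) → α) (k : Fin n) :
    ∃ l₁ l₃ : List α, List.ofFn f = l₁ ++ f k.castSucc :: f k.succ :: l₃ := by
  refine ⟨(List.ofFn f).take k, (List.ofFn f).drop (k + 2), ?_⟩
  conv_lhs => rw [← List.take_append_drop k (List.ofFn f)]
  congr 1
  rw [List.drop_eq_getElem_cons (by simp), List.drop_eq_getElem_cons (by simp)]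
  rw [List.getElem_ofFn, List.getElem_ofFn]
  rfl

/-- A matrix whose nonzero entries are at pairs of indices that differ by a permutation of the
tensor factors in `l`. -/
def PermSupported (l : List τ) (X : Matrix (τ → Fin N) (τ → Fin N) D) : Prop :=
  ∀ I J, X I J ≠ 0 → ∃ π : Equiv.Perm τ, (∀ c, c ∉ l → π c = c) ∧ J = I ∘ π

theorem permSupported_one (l : List τ) :
    PermSupported l (1 : Matrix (τ → Fin N) (τ → Fin N) D) := by
  intro I J h
  refine ⟨1, fun _ _ => rfl, ?_⟩
  by_contra h'
  exact h (Matrix.one_apply_ne (by rintro rfl; exact h' rfl))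

theorem PermSupported.mul {l : List τ} {X Y : Matrix (τ → Fin N) (τ → Fin N) D}
    (hX : PermSupported l X) (hY : PermSupported l Y) : PermSupported l (X * Y) := by
  intro I J h
  rw [Matrix.mul_apply] at h
  obtain ⟨K, _, hK⟩ := Finset.exists_ne_zero_of_sum_ne_zero h
  obtain ⟨π, hπ, rfl⟩ := hX I K (left_ne_zero_of_mul hK)
  obtain ⟨ρ, hρ, rfl⟩ := hY _ J (right_ne_zero_of_mul hK)
  exact ⟨π * ρ, fun c hc => by simp [hρ c hc, hπ c hc], by funext c; simp⟩

theorem PermSupported.list_prod {l : List τ} {ι : Type*}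
    {f : ι → Matrix (τ → Fin N) (τ → Fin N) D}
    {k : List ι} (h : ∀ i ∈ k, PermSupported l (f i)) : PermSupported l (k.map f).prod := by
  induction k with
  | nil => exact permSupported_one l
  | cons i k ih =>
    exact (h i (by simp)).mul (ih fun j hj => h j (by simp [hj]))

theorem PermSupported.mono {l l' : List τ} {X : Matrix (τ → Fin N) (τ → Fin N) D}
    (hX : PermSupported l X) (h : ∀ c ∈ l, c ∈ l') : PermSupported l' X := fun I J hne =>
  let ⟨π, hπ, e⟩ := hX I J hne
  ⟨π, fun c hc => hπ c fun hc' => hc (h c hc'), e⟩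

theorem permSupported_rb {l : List τ} {b c : τ} (hb : b ∈ l) (hc : c ∈ l) :
    PermSupported l (rb N q q' ζ b c) := by
  intro I J h
  rw [rb_apply] at h
  by_cases h1 : J = I
  · exact ⟨1, fun _ _ => rfl, h1⟩
  by_cases h2 : J = I ∘ Equiv.swap b c
  · refine ⟨Equiv.swap b c, fun d hd => Equiv.swap_apply_of_ne_of_ne ?_ ?_, h2⟩
    · rintro rfl; exact hd hb
    · rintro rfl; exact hd hc
  · simp [h1, h2] at h

theorem permSupported_fus (l : List τ) : PermSupported l (fus (rb N q q' ζ) l) := by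
  induction l with
  | nil => exact permSupported_one _
  | cons b l ih =>
    exact (PermSupported.list_prod fun c hc => permSupported_rb (by simp) (by simp [hc])).mul
      (ih.mono fun c hc => by simp [hc])

theorem permSupported_asym (g : Fin n ↪ τ) :
    PermSupported (List.ofFn g) (asym N q q' g) := by
  intro I J h
  by_contra hne
  apply h
  refine asym_eq_zero g fun ⟨w, hw⟩ => hne ⟨slotPerm g w, fun c hc => ?_, hw⟩
  exact slotPerm_apply_of_notMem g w (by simpa [List.mem_ofFn] using hc)

/-- A product of R-matrices `R_{bc}` has no entries at which the index in the factor `b` returns. -/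
theorem list_prod_rb_apply {b : τ} {l : List τ} (hl : (b :: l).Nodup) {J K : τ → Fin N}
    (hb : J b = K b) (h : ∀ c ∈ l, K c ≠ K b) :
    (l.map fun c => rb N q q' ζ b c).prod J K =
      if J = K then (l.map fun c => ζ b - ζ c).prod else 0 := by
  induction l generalizing J with
  | nil => simp [Matrix.one_apply]
  | cons c l ih =>
    simp only [List.nodup_cons, List.mem_cons, not_or] at hl
    obtain ⟨⟨hbc, hbl⟩, hcl, hl⟩ := hl
    have hnd : (b :: l).Nodup := List.nodup_cons.2 ⟨hbl, hl⟩
    have ih := fun {J : τ → Fin N} (hJ : J b = K b) => ih hnd hJ fun d hd => h d (by simp [hd])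
    have hK := h c (by simp)
    rw [List.map_cons, List.prod_cons, rb_mul_apply', ih hb]
    have h0 : (l.map fun c => rb N q q' ζ b c).prod (J ∘ Equiv.swap b c) K = 0 := by
      have hs : PermSupported (b :: l) (l.map fun c => rb N q q' ζ b c).prod :=
        PermSupported.list_prod fun d hd => permSupported_rb (by simp) (by simp [hd])
      by_contra hne
      obtain ⟨π, hπ, e⟩ := hs _ _ hne
      apply hK
      rw [e, Function.comp_apply, hπ c (by simp [Ne.symm hbc, hcl]), ← e, ← hb]
      simp
    rw [h0, mul_zero, add_zero]
    split_ifs with hJK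
    · subst hJK
      rw [wD, if_neg (fun h' => hK h'.symm), List.map_cons, List.prod_cons]
    · simp

/-- The product of the differences `ζ b - ζ c` over the pairs of a list. -/
def fusScalar (ζ : τ → D) (l : List τ) : D := fus (fun b c => ζ b - ζ c) l

/-- The letters are distinct and each later factor only permutes letters away from `b`, so the row
of `b` must return the letter of `b` to its slot. It can do so only by never flipping, and every
factor contributes its diagonal weight `ζ b - ζ c`. -/
theorem fus_apply_self {l : List τ} (hl : l.Nodup) {J : τ → Fin N}
    (hJ : ∀ b ∈ l, ∀ c ∈ l, J b = J c → b = c) :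
    fus (rb N q q' ζ) l J J = fusScalar ζ l := by
  induction l with
  | nil => simp [fus, fusScalar]
  | cons b l ih =>
    have hnd := hl
    obtain ⟨hb, hl⟩ := List.nodup_cons.1 hl
    have ih := ih hl fun b hb c hc => hJ b (by simp [hb]) c (by simp [hc])
    have hJ' : ∀ c ∈ l, J c ≠ J b := fun c hc e => hb (hJ c (by simp [hc]) b (by simp) e ▸ hc)
    rw [fus, Matrix.mul_apply, Finset.sum_eq_single J]
    · rw [list_prod_rb_apply hnd rfl hJ', if_pos rfl, ih]
      rfl
    · intro K _ hK
      by_cases h0 : fus (rb N q q' ζ) l K J = 0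
      · rw [h0, mul_zero]
      · obtain ⟨π, hπ, e⟩ := permSupported_fus l K J h0
        have hKb : K b = J b := by rw [e, Function.comp_apply, hπ b hb]
        have e' : K = J ∘ π.symm := by rw [e]; funext c; simp
        have hKc : ∀ c ∈ l, K c ≠ K b := by
          intro c hc
          rw [hKb, e', Function.comp_apply]
          refine hJ' _ ?_
          by_contra hcl
          have := hπ _ hcl
          rw [Equiv.apply_symm_apply] at this
          exact hcl (this ▸ hc)
        rw [list_prod_rb_apply hnd hKb.symm hKc, if_neg (Ne.symm hK), zero_mul]
    · simp

include hq in
/-- The fusion product of R-matrices at the points of a geometric progression is a multiple of the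
antisymmetrizer. -/
theorem fus_eq_smul_asym [IsDomain D] [CharZero D] (g : Fin (n + 1) ↪ τ)
    (hζ : ∀ k : Fin n, ζ (g k.castSucc) = q ^ 2 * ζ (g k.succ)) (hζ0 : ∀ b, ζ b ≠ 0)
    (hq2 : q ^ 2 ≠ 1) (hq4 : q ^ 4 ≠ 1) :
    fus (rb N q q' ζ) (List.ofFn g) = fusScalar ζ (List.ofFn g) • asym N q q' g := by
  have hnd : (List.ofFn g).Nodup := List.nodup_ofFn.2 g.injective
  have h2 : ∀ x : D, x + x = 0 → x = 0 := fun x hx => by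
    rwa [← two_mul, mul_eq_zero, or_iff_right two_ne_zero] at hx
  have hq0 : q ≠ 0 := left_ne_zero_of_mul_eq_one hq
  have hz : ∀ (k : Fin n) I J, (rb N q q' ζ (g k.succ) (g k.castSucc) *
      fus (rb N q q' ζ) (List.ofFn g)) I J = 0 := by
    intro k I J
    obtain ⟨l₁, l₃, e⟩ := ofFn_split g k
    rw [e, rb_mul_fus_eq_zero hq (e ▸ hnd) (hζ k)]
    rfl
  -- The vanishing of `R_{k+1,k}` times the fusion product is read off row by row. Equal letters
  -- give a multiple by `ζ (1 - q ^ 4)` after scaling by `q`, an ascent gives one by `ζ (1 - q ^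
  -- 2)`; this is where both conditions on `q` enter.
  have hA : ∀ J, IsAsym q q' g fun I => fus (rb N q q' ζ) (List.ofFn g) I J := by
    intro J
    refine isAsym_of_adjacent hq g (fun k I hI => ?_) fun k I hI => ?_
    · have := hz k I J
      rw [rb_mul_apply', hζ, wD, wO, hI] at this
      simp only [lt_irrefl, if_true, if_false, zero_mul, add_zero] at this
      refine (mul_eq_zero.1 this).resolve_left fun h => hq4 ?_
      have h' : ζ (g k.succ) * (1 - q ^ 4) = 0 := by
        linear_combination q * h - ζ (g k.succ) * hq
      rw [mul_eq_zero, or_iff_right (hζ0 _), sub_eq_zero] at h'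
      exact h'.symm
    · have := hz k I J
      rw [rb_mul_apply', hζ, wD, wO, if_neg hI.ne', if_pos hI, Equiv.swap_comm] at this
      have h' : (ζ (g k.succ) * (1 - q ^ 2)) * (fus (rb N q q' ζ) (List.ofFn g)
            (I ∘ Equiv.swap (g k.castSucc) (g k.succ)) J +
          q * fus (rb N q q' ζ) (List.ofFn g) I J) = 0 := by
        linear_combination q * this - ζ (g k.succ) * fus (rb N q q' ζ) (List.ofFn g)
            (I ∘ Equiv.swap (g k.castSucc) (g k.succ)) J * hq
      rw [mul_eq_zero, or_iff_right (mul_ne_zero (hζ0 _) (sub_ne_zero.2 (Ne.symm hq2)))] at h'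
      rw [smul_eq_mul]
      exact eq_neg_of_add_eq_zero_left h'
  ext I J
  rw [Matrix.smul_apply, smul_eq_mul]
  -- Both sides have antisymmetric columns and vanish unless `J` permutes the letters of `I` in the
  -- slots of `g`. So it is enough to compare them at the diagonal entry `J`, `J` with distinct
  -- letters.
  by_cases hw : ∃ w, J = I ∘ slotPerm g w
  · obtain ⟨w, rfl⟩ := hw
    by_cases hI : Function.Injective (I ∘ g)
    · set J := I ∘ slotPerm g w with hJ
      have hIJ : I = J ∘ slotPerm g w⁻¹ := by
        rw [hJ, show slotPerm g w⁻¹ = (slotPerm g w)⁻¹ from map_inv (Equiv.Perm.viaEmbeddingHom g) w]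
        funext c; simp
      have hJi : Function.Injective (J ∘ g) := by
        rw [hJ, comp_slotPerm_comp]
        exact hI.comp w.injective
      have e1 := hA J w⁻¹ J
      have e2 := isAsym_asym (N := N) hq g J w⁻¹ J
      simp only [← hIJ] at e1 e2
      rw [e1, e2, asym_self g hq hJi, fus_apply_self hnd]
      · simp only [smul_eq_mul]; ring
      · simp only [List.mem_ofFn]
        rintro _ ⟨i, rfl⟩ _ ⟨j, rfl⟩ hij
        rw [hJi hij]
    · rw [(hA _).eq_zero h2 hq hI, (isAsym_asym hq g _).eq_zero h2 hq hI, mul_zero]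
  · rw [asym_eq_zero g hw, mul_zero]
    by_contra hne
    obtain ⟨π, hπ, e⟩ := permSupported_fus _ I J hne
    obtain ⟨w, hw'⟩ := exists_slotPerm g π fun c hc => hπ c fun h =>
      hc (List.mem_ofFn.1 h)
    exact hw ⟨w, by rw [hw', e]⟩

theorem fusScalar_ne_zero [IsDomain D] {l : List τ} (hl : l.Nodup)
    (h : ∀ b ∈ l, ∀ c ∈ l, b ≠ c → ζ b ≠ ζ c) : fusScalar ζ l ≠ 0 := by
  induction l with
  | nil => simp [fusScalar, fus]
  | cons b l ih =>
    obtain ⟨hb, hl⟩ := List.nodup_cons.1 hl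
    refine mul_ne_zero (List.prod_ne_zero ?_) (ih hl fun b hb c hc => h b (by simp [hb]) c (by simp [hc]))
    simp only [List.mem_map, not_exists, not_and, sub_eq_zero]
    exact fun c hc => h b (by simp) c (by simp [hc]) (by rintro rfl; exact hb hc)

end Fusion

/-! ### The antisymmetrizer and products of R-matrices -/

section AsymCross

variable {N n : ℕ} {τ : Type*} [Fintype τ] [DecidableEq τ] {D : Type*} [CommRing D]
  {q q' : D} (hq : q * q' = 1) {ζ : τ → D} [IsDomain D] [CharZero D] (g : Fin (n + 1) ↪ τ)
    (hζ : ∀ k : Fin n, ζ (g k.castSucc) = q ^ 2 * ζ (g k.succ)) (hζ0 : ∀ b, ζ b ≠ 0)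
    (hζi : ∀ i j, i ≠ j → ζ (g i) ≠ ζ (g j))
    (hq2 : q ^ 2 ≠ 1) (hq4 : q ^ 4 ≠ 1)

include hζi in
theorem smul_fusScalar_cancel {X Y : Matrix (τ → Fin N) (τ → Fin N) D}
    (h : fusScalar ζ (List.ofFn g) • X = fusScalar ζ (List.ofFn g) • Y) : X = Y := by
  have h0 : fusScalar ζ (List.ofFn g) ≠ 0 := by
    refine fusScalar_ne_zero (List.nodup_ofFn.2 g.injective) ?_
    simp only [List.mem_ofFn]
    rintro _ ⟨i, rfl⟩ _ ⟨j, rfl⟩ hij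
    exact hζi i j fun e => hij (by rw [e])
  ext I J
  exact mul_left_cancel₀ h0 (congrFun (congrFun h I) J)

include hq hζ hζ0 hζi hq2 hq4 in
-- With the antisymmetrizer replaced by the fusion product the claim is an iterated Yang-Baxter
-- equation. The scalar between the two is nonzero and is cancelled in the domain `D`.
theorem asym_mul_crossProd_left {l : List τ} (hl : l.Nodup) (hd : ∀ c ∈ l, c ∉ Set.range g) :
    asym N q q' g * crossProd (rb N q q' ζ) (List.ofFn g) l =
      crossProd (rb N q q' ζ) (List.ofFn g).reverse l * asym N q q' g := by
  have hnd : (List.ofFn g).Nodup := List.nodup_ofFn.2 g.injective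
  have hne : ∀ b ∈ List.ofFn g, ∀ c ∈ l, b ≠ c := by
    rintro b hb c hc rfl
    exact hd b hc (List.mem_ofFn.1 hb)
  apply smul_fusScalar_cancel g hζi
  rw [← smul_mul_assoc, ← mul_smul_comm, ← fus_eq_smul_asym hq g hζ hζ0 hq2 hq4]
  refine fus_mul_list_prod (T := fun i => (l.map fun j => rb N q q' ζ i j).prod) hnd ?_ ?_
  · intro b hb c hc d hd' hdb hdc
    exact commute_list_prod fun j hj => rb_commute _ _ _ hdb.symm (hne b hb j hj) hdc.symm
      (hne c hc j hj)
  · intro b hb c hc hbc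
    refine exchange_list_prod hl ?_ ?_
    · intro j hj
      rw [rb_yangBaxter q q' ζ hbc (hne b hb j hj) (hne c hc j hj) hq]
    · intro j hj j' hj' hjj
      exact rb_commute _ _ _ hbc (hne b hb j' hj') (hne c hc j hj).symm hjj

include hq hζ hζ0 hζi hq2 hq4 in
theorem asym_mul_crossProd_right {l : List τ} (hl : l.Nodup) (hd : ∀ c ∈ l, c ∉ Set.range g) :
    asym N q q' g * crossProd (rb N q q' ζ) l (List.ofFn g).reverse =
      crossProd (rb N q q' ζ) l (List.ofFn g) * asym N q q' g := by
  have hnd : (List.ofFn g).Nodup := List.nodup_ofFn.2 g.injective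
  have hne : ∀ b ∈ List.ofFn g, ∀ c ∈ l, b ≠ c := by
    rintro b hb c hc rfl
    exact hd b hc (List.mem_ofFn.1 hb)
  have hcomm : ∀ i ∈ l, ∀ i' ∈ l, ∀ j ∈ List.ofFn g, ∀ j' ∈ List.ofFn g, i ≠ i' → j ≠ j' →
      Commute (rb N q q' ζ i j) (rb N q q' ζ i' j') := by
    intro i hi i' hi' j hj j' hj' hii hjj
    exact rb_commute _ _ _ hii (hne j' hj' i hi).symm (hne j hj i' hi') hjj
  apply smul_fusScalar_cancel g hζi
  rw [← smul_mul_assoc, ← mul_smul_comm, ← fus_eq_smul_asym hq g hζ hζ0 hq2 hq4,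
    crossProd_flip _ hl hnd hcomm, crossProd_flip _ hl (List.nodup_reverse.2 hnd)]
  · refine fus_mul_list_prod_reverse (T := fun j => (l.map fun i => rb N q q' ζ i j).prod) hnd ?_ ?_
    · intro b hb c hc d hd' hdb hdc
      exact commute_list_prod fun j hj => rb_commute _ _ _ (hne b hb j hj) hdb.symm
        (hne c hc j hj) hdc.symm
    · intro b hb c hc hbc
      refine exchange_list_prod hl ?_ ?_
      · intro i hi
        have := rb_yangBaxter (N := N) q q' ζ (hne b hb i hi).symm (hne c hc i hi).symm hbc hq
        simp only [mul_assoc] at this ⊢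
        exact this.symm
      · intro i hi i' hi' hii
        exact rb_commute _ _ _ hii (hne b hb i hi).symm (hne c hc i' hi') (Ne.symm hbc)
  · simp only [List.mem_reverse]
    exact hcomm

/-- The scalar by which a column of R-matrices acts on the totally antisymmetric tensor of top
degree. -/
def topScalar (q q' : D) (ζ : τ → D) (g : Fin (n + 1) ↪ τ) (i : τ) : D :=
  (ζ i * q' - ζ (g 0) * q) * ((List.ofFn fun k : Fin n => g k.succ).map fun c => ζ i - ζ c).prod

include hq hζ hζ0 hζi hq2 hq4 in
-- There are as many slots as letters, so antisymmetric tensors in these slots form a line. The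
-- product `M` is antisymmetric in its rows because of the antisymmetrizer on the left, and in its
-- columns because the antisymmetrizer can be moved to the right. Hence `M` is determined by its
-- diagonal entries at distinct letters.
theorem asym_mul_row_top {i : τ} (hi : i ∉ Set.range g) :
    asym (n + 1) q q' g * ((List.ofFn g).reverse.map fun j => rb (n + 1) q q' ζ i j).prod =
      topScalar q q' ζ g i • asym (n + 1) q q' g := by
  have hnd : (List.ofFn g).Nodup := List.nodup_ofFn.2 g.injective
  have h2 : ∀ x : D, x + x = 0 → x = 0 := fun x hx => by
    rwa [← two_mul, mul_eq_zero, or_iff_right two_ne_zero] at hx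
  have hq' : q' * q = 1 := by rw [mul_comm, hq]
  set T := ((List.ofFn g).reverse.map fun j => rb (n + 1) q q' ζ i j).prod with hT
  set T' := ((List.ofFn g).map fun j => rb (n + 1) q q' ζ i j).prod with hT'
  have hTT : asym (n + 1) q q' g * T = T' * asym (n + 1) q q' g := by
    have := asym_mul_crossProd_right (N := n + 1) hq g hζ hζ0 hζi hq2 hq4 (l := [i])
      (List.nodup_singleton i) (by simpa using hi)
    simp only [crossProd, List.map_cons, List.map_nil, List.prod_cons, List.prod_nil, mul_one] at this
    exact this
  set M := asym (n + 1) q q' g * T with hM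
  have hleft : ∀ J, IsAsym q q' g fun I => M I J := by
    intro J w I
    have := isAsym_asym (N := n + 1) hq g
    simp only [hM, Matrix.mul_apply, smul_eq_mul, Finset.mul_sum]
    refine Finset.sum_congr rfl fun K _ => ?_
    have e := isAsym_asym (N := n + 1) hq g K w I
    simp only [smul_eq_mul] at e
    rw [e]; ring
  have hright : ∀ I, IsAsym q' q g fun J => M I J := by
    intro I w J
    simp only [hTT, Matrix.mul_apply, smul_eq_mul, Finset.mul_sum]
    refine Finset.sum_congr rfl fun K _ => ?_
    have e := isAsym_asym (N := n + 1) hq' g K w J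
    simp only [smul_eq_mul] at e
    rw [asym_symm g K, asym_symm g K, e]; ring
  have hsupp : PermSupported (i :: List.ofFn g) M := by
    refine ((permSupported_asym g).mono fun c hc => List.mem_cons.2 (Or.inr hc)).mul ?_
    refine PermSupported.list_prod fun j hj => permSupported_rb (by simp) ?_
    exact List.mem_cons.2 (Or.inr (List.mem_reverse.1 hj))
  -- If the letter in the slot `i` is the one in `g 0`, no other slot of `g` carries it. The factors
  -- for the other slots cannot flip it away and bring it back, so only diagonal weights contribute.
  have hdiag0 : ∀ J : τ → Fin (n + 1), Function.Injective (J ∘ g) → J i = J (g 0) →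
      M J J = topScalar q q' ζ g i := by
    intro J hJ hJi
    have hJs : ∀ k : Fin n, J (g k.succ) ≠ J i := by
      intro k e
      rw [hJi] at e
      exact Fin.succ_ne_zero k (hJ e)
    have hl0 : List.ofFn g = g 0 :: List.ofFn fun k : Fin n => g k.succ := List.ofFn_succ
    have hnd' : (i :: (List.ofFn fun k : Fin n => g k.succ).reverse).Nodup := by
      rw [List.nodup_cons, List.mem_reverse, List.nodup_reverse]
      refine ⟨?_, (List.nodup_cons.1 (hl0 ▸ hnd)).2⟩
      rw [List.mem_ofFn]
      rintro ⟨k, hk⟩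
      exact hi ⟨_, hk⟩
    have hTK : ∀ K : τ → Fin (n + 1), K i = J i → T K J =
        if K = J then topScalar q q' ζ g i else 0 := by
      intro K hK
      rw [hT, hl0, List.reverse_cons, List.map_append, List.prod_append, List.map_singleton,
        List.prod_singleton]
      have := mul_rb_apply (E := D) q q' ζ i (g 0)
        ((List.ofFn fun k : Fin n => g k.succ).reverse.map fun j => rb (n + 1) q q' ζ i j).prod K J
      rw [Algebra.algebraMap_self, show (rb (n + 1) q q' ζ i (g 0)).map (RingHom.id D) =
        rb (n + 1) q q' ζ i (g 0) from Matrix.map_id _] at this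
      rw [this, wO, hJi]
      simp only [lt_irrefl, if_false, zero_smul, add_zero]
      rw [list_prod_rb_apply hnd' hK, wD, if_pos rfl]
      · rw [List.map_reverse, List.prod_reverse]
        split_ifs
        · rw [topScalar, smul_eq_mul]
        · simp
      · simp only [List.mem_reverse, List.mem_ofFn]
        rintro _ ⟨k, rfl⟩
        exact hJs k
    rw [hM, Matrix.mul_apply, Finset.sum_eq_single J]
    · rw [asym_self g hq hJ, hTK J rfl, if_pos rfl, one_mul]
    · intro K _ hK
      by_cases h0 : asym (n + 1) q q' g J K = 0
      · rw [h0, zero_mul]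
      · obtain ⟨π, hπ, e⟩ := permSupported_asym g J K h0
        rw [hTK K, if_neg hK, mul_zero]
        rw [e, Function.comp_apply, hπ i fun h => hi (List.mem_ofFn.1 h)]
    · simp
  -- Some slot of `g` carries the letter `J i`, since all letters occur. Double antisymmetry makes
  -- the diagonal entries invariant under permutations of the slots, and a transposition moves this
  -- letter to `g 0`.
  have hdiag : ∀ J : τ → Fin (n + 1), Function.Injective (J ∘ g) →
      M J J = topScalar q q' ζ g i := by
    intro J hJ
    obtain ⟨k, hk⟩ := (Finite.injective_iff_surjective.1 hJ) (J i)
    set w : Equiv.Perm (Fin (n + 1)) := Equiv.swap 0 k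
    have e := hdiag0 (J ∘ slotPerm g w) (by
      rw [comp_slotPerm_comp]; exact hJ.comp w.injective) (by
      rw [Function.comp_apply, slotPerm_apply_of_notMem g w hi, ← hk]
      simp [w])
    have e1 := hleft (J ∘ slotPerm g w) w J
    have e2 := hright J w J
    simp only [smul_eq_mul] at e1 e2
    rw [← e, e1, e2]
    have h1 := wt_mul_wt hq (J ∘ g)
    have h2 := sign_mul_sign (S := D) w
    have h3 := wt_mul_wt hq ((J ∘ g) ∘ w)
    linear_combination -(M J J) * (wt q ((J ∘ g) ∘ w) * wt q' ((J ∘ g) ∘ w) *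
      (wt q (J ∘ g) * wt q' (J ∘ g)) * h2 + wt q ((J ∘ g) ∘ w) * wt q' ((J ∘ g) ∘ w) * h1 + h3)
  ext I J
  rw [Matrix.smul_apply, smul_eq_mul]
  by_cases hI : Function.Injective (I ∘ g)
  · by_cases hw : ∃ w, J = I ∘ slotPerm g w
    · obtain ⟨w, rfl⟩ := hw
      set J := I ∘ slotPerm g w with hJ
      have hIJ : I = J ∘ slotPerm g w⁻¹ := by
        rw [hJ, show slotPerm g w⁻¹ = (slotPerm g w)⁻¹ from map_inv (Equiv.Perm.viaEmbeddingHom g) w]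
        funext c; simp
      have hJi : Function.Injective (J ∘ g) := by
        rw [hJ, comp_slotPerm_comp]
        exact hI.comp w.injective
      have e1 := hleft J w⁻¹ J
      have e2 := isAsym_asym (N := n + 1) hq g J w⁻¹ J
      simp only [← hIJ] at e1 e2
      rw [e1, e2, asym_self g hq hJi, hdiag J hJi]
      simp only [smul_eq_mul]; ring
    · rw [asym_eq_zero g hw, mul_zero]
      by_contra hne
      have hJ : Function.Injective (J ∘ g) := by
        by_contra hJ
        exact hne ((hright I).eq_zero h2 hq' hJ)
      obtain ⟨π, hπ, e⟩ := hsupp I J hne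
      have hout : ∀ c, c ≠ i → c ∉ Set.range g → J c = I c := by
        intro c hci hc
        rw [e, Function.comp_apply, hπ c]
        rw [List.mem_cons, not_or]
        exact ⟨hci, fun h => hc (List.mem_ofFn.1 h)⟩
      have hIb := Finite.injective_iff_bijective.1 hI
      have hJb := Finite.injective_iff_bijective.1 hJ
      -- The total of all letters is conserved. Both indices run through all letters in the slots of
      -- `g` and agree outside `g` and `i`; thus they agree at `i` as well and differ by a
      -- permutation of the slots of `g`.
      have hsum : ∑ c, (J c : ℕ) = ∑ c, (I c : ℕ) := by
        rw [e]
        exact Equiv.sum_comp π fun c => (I c : ℕ)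
      have hrange : ∀ K : τ → Fin (n + 1), Function.Bijective (K ∘ g) →
          ∑ c, (K c : ℕ) = ((K i : ℕ) + ∑ a : Fin (n + 1), (a : ℕ)) +
            ∑ c ∈ Finset.univ.filter (fun c => c ≠ i ∧ c ∉ Set.range g), (K c : ℕ) := by
        intro K hK
        have h3 : ∑ a : Fin (n + 1), (a : ℕ) = ∑ c ∈ Finset.univ.map g, (K c : ℕ) := by
          rw [Finset.sum_map]
          exact (hK.sum_comp fun a => (a : ℕ)).symm
        rw [h3, ← Finset.sum_insert (f := fun c => (K c : ℕ)) (by simpa using hi),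
          ← Finset.sum_filter_add_sum_filter_not Finset.univ
            (fun c => c ∈ insert i (Finset.univ.map g))]
        congr 1
        · exact Finset.sum_congr (by ext; simp) fun _ _ => rfl
        · exact Finset.sum_congr (by ext; simp [not_or]) fun _ _ => rfl
      have hS : ∑ c ∈ Finset.univ.filter (fun c => c ≠ i ∧ c ∉ Set.range g), (J c : ℕ) =
          ∑ c ∈ Finset.univ.filter (fun c => c ≠ i ∧ c ∉ Set.range g), (I c : ℕ) :=
        Finset.sum_congr rfl fun c hc => by
          rw [hout c (Finset.mem_filter.1 hc).2.1 (Finset.mem_filter.1 hc).2.2]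
      rw [hrange J hJb, hrange I hIb, hS] at hsum
      have hii : J i = I i := by
        rw [Fin.ext_iff]; omega
      apply hw
      refine ⟨(Equiv.ofBijective _ hJb).trans (Equiv.ofBijective _ hIb).symm, ?_⟩
      funext c
      rw [Function.comp_apply]
      by_cases hc : c ∈ Set.range g
      · obtain ⟨k, rfl⟩ := hc
        rw [slotPerm_apply]
        exact ((Equiv.ofBijective _ hIb).apply_symm_apply ((J ∘ g) k)).symm
      · rw [slotPerm_apply_of_notMem g _ hc]
        by_cases hci : c = i
        · rw [hci, hii]
        · exact hout c hci hc
  · rw [(hleft J).eq_zero h2 hq hI, (isAsym_asym hq g _).eq_zero h2 hq hI, mul_zero]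

include hq hζ hζ0 hζi hq2 hq4 in
theorem asym_mul_crossProd_top {l : List τ} (hd : ∀ c ∈ l, c ∉ Set.range g) :
    asym (n + 1) q q' g * crossProd (rb (n + 1) q q' ζ) l (List.ofFn g).reverse =
      (l.map (topScalar q q' ζ g)).prod • asym (n + 1) q q' g := by
  induction l with
  | nil => simp [crossProd]
  | cons i l ih =>
    rw [crossProd_cons, ← mul_assoc,
      asym_mul_row_top hq g hζ hζ0 hζi hq2 hq4 (hd i (by simp)), smul_mul_assoc,
      ih fun c hc => hd c (by simp [hc]), smul_smul, List.map_cons, List.prod_cons]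

include hq hζ hζ0 hζi hq2 hq4 in
theorem crossProd_mul_asym_top {l : List τ} (hl : l.Nodup) (hd : ∀ c ∈ l, c ∉ Set.range g) :
    crossProd (rb (n + 1) q q' ζ) l.reverse (List.ofFn g) * asym (n + 1) q q' g =
      (l.map (topScalar q q' ζ g)).prod • asym (n + 1) q q' g := by
  rw [← asym_mul_crossProd_right hq g hζ hζ0 hζi hq2 hq4 (List.nodup_reverse.2 hl)
    (by simpa using hd), asym_mul_crossProd_top hq g hζ hζ0 hζi hq2 hq4
    (by simpa using hd), List.map_reverse, List.prod_reverse]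

end AsymCross

/-! ### Exponential series -/

section ExpSeries

variable {S : Type*} [Semiring S] [Algebra ℂ S]

theorem coeff_expSeries (c : ℂ) (k : ℕ) :
    PowerSeries.coeff k (expSeries c S) = algebraMap ℂ S (c ^ k / (k.factorial : ℂ)) :=
  PowerSeries.coeff_mk _ _

theorem expSeries_map {S' : Type*} [Semiring S'] [Algebra ℂ S'] (f : S →+* S')
    (hf : ∀ c, f (algebraMap ℂ S c) = algebraMap ℂ S' c) (c : ℂ) :
    PowerSeries.map f (expSeries c S) = expSeries c S' := by
  ext k
  rw [PowerSeries.coeff_map, coeff_expSeries, coeff_expSeries, hf]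

theorem expSeries_add_ℂ (a b : ℂ) : expSeries a ℂ * expSeries b ℂ = expSeries (a + b) ℂ := by
  have h : ∀ c : ℂ, expSeries c ℂ = PowerSeries.rescale c (PowerSeries.exp ℂ) := by
    intro c
    ext k
    rw [coeff_expSeries, PowerSeries.coeff_rescale, PowerSeries.coeff_exp]
    simp [div_eq_mul_inv]
  rw [h, h, h, PowerSeries.exp_mul_exp_eq_exp_add]

theorem expSeries_add (a b : ℂ) : expSeries a S * expSeries b S = expSeries (a + b) S := by
  have h := expSeries_map (algebraMap ℂ S) fun _ => rfl
  rw [← h a, ← h b, ← h (a + b), ← map_mul, expSeries_add_ℂ]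

theorem expSeries_zero : expSeries 0 S = 1 := by
  ext k
  rw [coeff_expSeries, PowerSeries.coeff_one]
  split_ifs with h <;> simp [h]

theorem expSeries_pow (a : ℂ) (k : ℕ) : expSeries a S ^ k = expSeries (k * a) S := by
  induction k with
  | zero => simp [expSeries_zero]
  | succ k ih => rw [pow_succ, ih, expSeries_add]; congr 1; push_cast; ring

theorem expSeries_injective : Function.Injective fun c : ℂ => expSeries c ℂ := by
  intro a b h
  simpa [coeff_expSeries] using congrArg (PowerSeries.coeff 1) h

end ExpSeries

/-! ### Fusion identities after specialization -/

section Specialize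

theorem actsOn_asym {N n : ℕ} {τ : Type*} [Fintype τ] [DecidableEq τ] {S : Type*} [CommRing S]
    (q q' : S) (g : Fin n ↪ τ) : ActsOn (Set.range g) (asym N q q' g) := by
  constructor
  · rintro I J ⟨c, hc, h⟩
    refine asym_eq_zero g fun ⟨w, hw⟩ => h ?_
    rw [hw, Function.comp_apply, slotPerm_apply_of_notMem g w hc]
  · intro I J I' J' h1 h2 h3
    have hI : I ∘ g = I' ∘ g := funext fun k => (h1 _ ⟨k, rfl⟩).1
    have hJ : J ∘ g = J' ∘ g := funext fun k => (h1 _ ⟨k, rfl⟩).2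
    rw [asym, asym, hI, hJ]
    refine Finset.sum_congr rfl fun w _ => ?_
    congr 1
    refine propext ⟨fun h => funext fun c => ?_, fun h => funext fun c => ?_⟩
    all_goals
      rw [Function.comp_apply]
      by_cases hc : c ∈ Set.range g
      · obtain ⟨k, rfl⟩ := hc
        have e := congrFun h (g k)
        rw [Function.comp_apply, slotPerm_apply] at e
        rw [slotPerm_apply]
        have e1 := h1 (g k) ⟨k, rfl⟩
        have e2 := h1 (g (w k)) ⟨w k, rfl⟩
        first | rw [← e1.2, e, e2.1] | rw [e1.2, e, ← e2.1]
      · rw [slotPerm_apply_of_notMem g w hc]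
        first | exact (h3 c hc).symm | exact (h2 c hc).symm

variable {N n : ℕ} {τ : Type*} [Fintype τ] [DecidableEq τ] {S : Type*} [CommRing S]
  [Algebra (PowerSeries ℂ) S]

/-- The image of `e^{c h}` in a `ℂ[[h]]`-algebra. -/
def qExp (S : Type*) [CommRing S] [Algebra (PowerSeries ℂ) S] (c : ℂ) : S :=
  algebraMap (PowerSeries ℂ) S (expSeries c ℂ)

theorem qExp_mul (a b : ℂ) : qExp S a * qExp S b = qExp S (a + b) := by
  rw [qExp, qExp, qExp, ← map_mul, expSeries_add]

theorem qExp_zero : qExp S 0 = 1 := by rw [qExp, expSeries_zero, map_one]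

theorem qExp_pow (a : ℂ) (k : ℕ) : qExp S a ^ k = qExp S (k * a) := by
  rw [qExp, qExp, ← map_pow, expSeries_pow]

theorem qExp_half_mul : qExp S (1 / 2) * qExp S (-1 / 2) = 1 := by
  rw [qExp_mul, ← qExp_zero (S := S)]; congr 1; ring

variable (g : Fin (n + 1) ↪ τ) {ζ : τ → S} (hζ : ∀ k, ζ (g k) = ζ (g 0) * qExp S (-(k : ℕ)))

/-- The parameters for which a group of tensor factors is fused, over a polynomial ring. -/
def univParam (g : Fin (n + 1) ↪ τ) : τ → MvPolynomial τ (PowerSeries ℂ) :=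
  open Classical in fun b => if h : ∃ k, g k = b then
    MvPolynomial.X (g 0) * qExp _ (-(h.choose : ℕ)) else MvPolynomial.X b

theorem univParam_apply (k : Fin (n + 1)) :
    univParam g (g k) = MvPolynomial.X (g 0) * qExp _ (-(k : ℕ)) := by
  have h : ∃ k', g k' = g k := ⟨k, rfl⟩
  rw [univParam, dif_pos h, g.injective h.choose_spec]

theorem univParam_ne_zero (b : τ) : univParam g b ≠ 0 := by
  rw [univParam]
  split_ifs with h
  · refine mul_ne_zero (MvPolynomial.X_ne_zero _) fun h0 => ?_
    have := qExp_mul (S := MvPolynomial τ (PowerSeries ℂ)) (h.choose : ℕ) (-(h.choose : ℕ))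
    rw [h0, mul_zero, add_neg_cancel, qExp_zero] at this
    exact zero_ne_one this
  · exact MvPolynomial.X_ne_zero _

instance : CharZero (MvPolynomial τ (PowerSeries ℂ)) :=
  charZero_of_injective_algebraMap (R := ℂ) (algebraMap ℂ _).injective

theorem qExp_univ_injective :
    Function.Injective (qExp (MvPolynomial τ (PowerSeries ℂ))) := fun _ _ h =>
  expSeries_injective (MvPolynomial.C_injective _ _ h)

theorem univParam_injective {i j : Fin (n + 1)} (h : i ≠ j) :
    univParam g (g i) ≠ univParam g (g j) := by
  rw [univParam_apply, univParam_apply]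
  intro e
  have := qExp_univ_injective (mul_left_cancel₀ (MvPolynomial.X_ne_zero _) e)
  rw [neg_inj, Nat.cast_inj] at this
  exact h (Fin.ext this)

theorem univParam_castSucc (k : Fin n) : univParam g (g k.castSucc) =
    qExp (MvPolynomial τ (PowerSeries ℂ)) (1 / 2) ^ 2 * univParam g (g k.succ) := by
  rw [univParam_apply, univParam_apply, mul_left_comm, qExp_pow, qExp_mul]
  congr 2
  push_cast [Fin.val_castSucc, Fin.val_succ]
  ring

theorem qExp_univ_pow_ne_one {k : ℕ} (hk : k ≠ 0) :
    qExp (MvPolynomial τ (PowerSeries ℂ)) (1 / 2) ^ k ≠ 1 := by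
  rw [qExp_pow, ← qExp_zero (S := MvPolynomial τ (PowerSeries ℂ))]
  intro h
  have := qExp_univ_injective h
  simp [hk] at this

include hζ in
theorem aeval_univParam (b : τ) : MvPolynomial.aeval ζ (univParam g b) = ζ b := by
  by_cases h : ∃ k, g k = b
  · obtain ⟨k, rfl⟩ := h
    rw [univParam_apply, map_mul, MvPolynomial.aeval_X, hζ k, qExp, AlgHom.commutes, qExp]
  · rw [univParam, dif_neg h, MvPolynomial.aeval_X]

theorem crossProd_map {M M' : Type*} [Ring M] [Ring M'] {ι κ : Type*} (f : M →+* M')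
    (ρ : ι → κ → M) (l : List ι) (l' : List κ) :
    f (crossProd ρ l l') = crossProd (fun i j => f (ρ i j)) l l' := by
  simp only [crossProd, map_list_prod, List.map_map, Function.comp_def]

include hζ in
theorem crossProd_rb_aeval (l l' : List τ) :
    (MvPolynomial.aeval (R := PowerSeries ℂ) ζ).toRingHom.mapMatrix
      (crossProd (rb N (qExp _ (1 / 2)) (qExp _ (-1 / 2)) (univParam g)) l l') =
      crossProd (rb N (qExp S (1 / 2)) (qExp S (-1 / 2)) ζ) l l' := by
  rw [crossProd_map]
  congr 1
  funext i j
  rw [RingHom.mapMatrix_apply, rb_map]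
  congr 1
  · exact AlgHom.commutes _ _
  · exact AlgHom.commutes _ _
  · funext b; exact aeval_univParam g hζ b

theorem asym_aeval : (MvPolynomial.aeval (R := PowerSeries ℂ) ζ).toRingHom.mapMatrix
      (asym N (qExp _ (1 / 2)) (qExp _ (-1 / 2)) g) =
      asym N (qExp S (1 / 2)) (qExp S (-1 / 2)) g := by
  rw [RingHom.mapMatrix_apply, asym_map]
  congr 1 <;> exact AlgHom.commutes _ _

include hζ in
-- In `S` the differences of spectral parameters may be zero divisors. The identity involves no
-- division, so it is the image of the same identity over the universal polynomial ring, which is a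
-- domain of characteristic zero.
theorem asym_exchange_left {l : List τ} (hl : l.Nodup) (hd : ∀ c ∈ l, c ∉ Set.range g) :
    asym N (qExp S (1 / 2)) (qExp S (-1 / 2)) g *
      crossProd (rb N (qExp S (1 / 2)) (qExp S (-1 / 2)) ζ) (List.ofFn g) l =
    crossProd (rb N (qExp S (1 / 2)) (qExp S (-1 / 2)) ζ) (List.ofFn g).reverse l *
      asym N (qExp S (1 / 2)) (qExp S (-1 / 2)) g := by
  rw [← crossProd_rb_aeval g hζ, ← crossProd_rb_aeval g hζ, ← asym_aeval (ζ := ζ), ← map_mul,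
    ← map_mul, asym_mul_crossProd_left qExp_half_mul g (univParam_castSucc g)
      (univParam_ne_zero g) (fun _ _ => univParam_injective g) (qExp_univ_pow_ne_one two_ne_zero)
      (qExp_univ_pow_ne_one four_ne_zero) hl hd]

include hζ in
theorem asym_exchange_right {l : List τ} (hl : l.Nodup) (hd : ∀ c ∈ l, c ∉ Set.range g) :
    asym N (qExp S (1 / 2)) (qExp S (-1 / 2)) g *
      crossProd (rb N (qExp S (1 / 2)) (qExp S (-1 / 2)) ζ) l (List.ofFn g).reverse =
    crossProd (rb N (qExp S (1 / 2)) (qExp S (-1 / 2)) ζ) l (List.ofFn g) *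
      asym N (qExp S (1 / 2)) (qExp S (-1 / 2)) g := by
  rw [← crossProd_rb_aeval g hζ, ← crossProd_rb_aeval g hζ, ← asym_aeval (ζ := ζ), ← map_mul,
    ← map_mul, asym_mul_crossProd_right qExp_half_mul g (univParam_castSucc g)
      (univParam_ne_zero g) (fun _ _ => univParam_injective g) (qExp_univ_pow_ne_one two_ne_zero)
      (qExp_univ_pow_ne_one four_ne_zero) hl hd]

include hζ in
-- The scalar is the image of the product of the `topScalar`. That one `ψ` serves both orders of the
-- R-matrices is what makes the two sides of the braiding cancel.
theorem asym_top (hN : N = n + 1) {l : List τ} (hl : l.Nodup) (hd : ∀ c ∈ l, c ∉ Set.range g) :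
    ∃ ψ : S, asym N (qExp S (1 / 2)) (qExp S (-1 / 2)) g *
        crossProd (rb N (qExp S (1 / 2)) (qExp S (-1 / 2)) ζ) l (List.ofFn g).reverse =
          ψ • asym N (qExp S (1 / 2)) (qExp S (-1 / 2)) g ∧
      crossProd (rb N (qExp S (1 / 2)) (qExp S (-1 / 2)) ζ) l.reverse (List.ofFn g) *
        asym N (qExp S (1 / 2)) (qExp S (-1 / 2)) g =
          ψ • asym N (qExp S (1 / 2)) (qExp S (-1 / 2)) g := by
  subst hN
  have hsm : ∀ (c : MvPolynomial τ (PowerSeries ℂ)) (X : Matrix (τ → Fin (n + 1)) (τ → Fin (n + 1))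
      (MvPolynomial τ (PowerSeries ℂ))),
      (MvPolynomial.aeval (R := PowerSeries ℂ) ζ).toRingHom.mapMatrix (c • X) =
        MvPolynomial.aeval (R := PowerSeries ℂ) ζ c •
          (MvPolynomial.aeval (R := PowerSeries ℂ) ζ).toRingHom.mapMatrix X := by
    intro c X
    ext I J
    exact map_mul (MvPolynomial.aeval (R := PowerSeries ℂ) ζ) _ _
  refine ⟨MvPolynomial.aeval ζ (l.map (topScalar (qExp _ (1 / 2)) (qExp _ (-1 / 2))
    (univParam g) g)).prod, ?_, ?_⟩
  · rw [← crossProd_rb_aeval g hζ, ← asym_aeval (ζ := ζ), ← map_mul, ← hsm,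
      asym_mul_crossProd_top qExp_half_mul g (univParam_castSucc g)
      (univParam_ne_zero g) (fun _ _ => univParam_injective g) (qExp_univ_pow_ne_one two_ne_zero)
      (qExp_univ_pow_ne_one four_ne_zero) hd]
  · rw [← crossProd_rb_aeval g hζ, ← asym_aeval (ζ := ζ), ← map_mul, ← hsm,
      crossProd_mul_asym_top qExp_half_mul g (univParam_castSucc g)
      (univParam_ne_zero g) (fun _ _ => univParam_injective g) (qExp_univ_pow_ne_one two_ne_zero)
      (qExp_univ_pow_ne_one four_ne_zero) hl hd]

end Specialize

/-! ### Antisymmetric products and traces -/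

section Fused

variable {N : ℕ} {τ : Type*} [Fintype τ] [DecidableEq τ] {S E : Type*} [CommRing S] [Ring E]
  [Algebra S E]

/-- The trace is not cyclic for matrices over a noncommutative ring, but here the entries of one
factor are central. -/
theorem trace_sc_mul_comm (A : Matrix (τ → Fin N) (τ → Fin N) S)
    (Y : Matrix (τ → Fin N) (τ → Fin N) E) :
    Matrix.trace (sc N τ E A * Y) = Matrix.trace (Y * sc N τ E A) := by
  simp only [Matrix.trace, Matrix.diag_apply, Matrix.mul_apply]
  rw [Finset.sum_comm]
  refine Finset.sum_congr rfl fun I _ => Finset.sum_congr rfl fun J _ => ?_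
  exact Algebra.commutes _ _

theorem sc_mul_apply (A : Matrix (τ → Fin N) (τ → Fin N) S)
    (Y : Matrix (τ → Fin N) (τ → Fin N) E) (I J : τ → Fin N) :
    (sc N τ E A * Y) I J = ∑ K, A I K • Y K J := by
  rw [Matrix.mul_apply]
  exact Finset.sum_congr rfl fun K _ => (Algebra.smul_def _ _).symm

theorem mul_sc_apply (A : Matrix (τ → Fin N) (τ → Fin N) S)
    (Y : Matrix (τ → Fin N) (τ → Fin N) E) (I J : τ → Fin N) :
    (Y * sc N τ E A) I J = ∑ K, A K J • Y I K := by
  rw [Matrix.mul_apply]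
  refine Finset.sum_congr rfl fun K _ => ?_
  rw [Algebra.smul_def]
  exact (Algebra.commutes _ _).symm

/-- The relations between the entries of two neighbours in a fused product of L-operators. -/
def FusedPair (q q' : S) (A B : Matrix (Fin N) (Fin N) E) : Prop :=
  (∀ i a b, A i a * B i b = 0) ∧ (∀ a i j, A i a * B j a = 0) ∧
  (∀ i i' a b, i < i' → A i' a * B i b = -(q • (A i a * B i' b))) ∧
  ∀ i j a a', a < a' → A i a' * B j a = -(q' • (A i a * B j a'))

variable {n : ℕ} {q q' : S} (hq : q * q' = 1) {L : τ → Matrix (Fin N) (Fin N) E}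
  (g : Fin (n + 1) ↪ τ) (hL : ∀ k : Fin n, FusedPair q q' (L (g k.castSucc)) (L (g k.succ)))

theorem list_prod_pair {M : Type*} [Ring M] (f f' : τ → M) {l₁ l₃ : List τ} {b c : τ} (s : S)
    [Algebra S M] (h : f b * f c = s • (f' b * f' c)) (h1 : ∀ d ∈ l₁ ++ l₃, f d = f' d) :
    ((l₁ ++ b :: c :: l₃).map f).prod = s • ((l₁ ++ b :: c :: l₃).map f').prod := by
  have e1 : l₁.map f = l₁.map f' := List.map_congr_left fun d hd => h1 d (by simp [hd])
  have e3 : l₃.map f = l₃.map f' := List.map_congr_left fun d hd => h1 d (by simp [hd])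
  simp only [List.map_append, List.map_cons, List.prod_append, List.prod_cons, e1, e3]
  rw [← mul_assoc (f b), h, ← mul_assoc (f' b), smul_mul_assoc, mul_smul_comm]

include hq hL in
-- An entry of the ordered product is the ordered product of the entries, so neighbouring slots
-- contribute two adjacent factors, to which the pair relations apply. The rest of the word is not
-- touched.
theorem isAsym_prodL_row {l₁ l₃ : List τ} (hl : (l₁ ++ List.ofFn g ++ l₃).Nodup) (J : τ → Fin N) :
    IsAsym q q' g fun I => prodL L (l₁ ++ List.ofFn g ++ l₃) I J := by
  have hnd : ∀ k : Fin n, ∃ m₁ m₃, l₁ ++ List.ofFn g ++ l₃ =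
      m₁ ++ g k.castSucc :: g k.succ :: m₃ := by
    intro k
    obtain ⟨p₁, p₃, e⟩ := ofFn_split g k
    exact ⟨l₁ ++ p₁, p₃ ++ l₃, by rw [e]; simp⟩
  refine isAsym_of_adjacent hq g (fun k I hI => ?_) fun k I hI => ?_
  all_goals
    obtain ⟨m₁, m₃, e⟩ := hnd k
    rw [e] at hl
    rw [e, prodL, prod_leg_apply L _ hl]
  · split_ifs
    · rw [list_prod_pair (S := S) _ (fun b => L b (I b) (J b)) 0 _ fun _ _ => rfl, zero_smul]
      rw [zero_smul, hI]
      exact (hL k).1 _ _ _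
    · rfl
  · rw [prod_leg_apply L _ hl]
    have hmem : ∀ d, d ∉ m₁ ++ g k.castSucc :: g k.succ :: m₃ →
        Equiv.swap (g k.castSucc) (g k.succ) d = d := by
      intro d hd
      refine Equiv.swap_apply_of_ne_of_ne ?_ ?_ <;> rintro rfl <;> exact hd (by simp)
    have hc : (∀ d, d ∉ m₁ ++ g k.castSucc :: g k.succ :: m₃ →
        (I ∘ Equiv.swap (g k.castSucc) (g k.succ)) d = J d) ↔
        ∀ d, d ∉ m₁ ++ g k.castSucc :: g k.succ :: m₃ → I d = J d := by
      refine forall_congr' fun d => imp_congr_right fun hd => ?_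
      rw [Function.comp_apply, hmem d hd]
    simp only [hc]
    split_ifs
    · rw [list_prod_pair (S := S) _ (fun b => L b (I b) (J b)) (-q) _ fun d hd => ?_, neg_smul]
      · simp only [Function.comp_apply, Equiv.swap_apply_left, Equiv.swap_apply_right]
        rw [(hL k).2.2.1 _ _ _ _ hI, neg_smul]
      · have h1 : d ≠ g k.castSucc := by
          rintro rfl
          simp only [List.nodup_append, List.nodup_cons, List.mem_append, List.mem_cons] at hl hd
          grind
        have h2 : d ≠ g k.succ := by
          rintro rfl
          simp only [List.nodup_append, List.nodup_cons, List.mem_append, List.mem_cons] at hl hd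
          grind
        rw [Function.comp_apply, Equiv.swap_apply_of_ne_of_ne h1 h2]
    · simp

include hq hL in
theorem isAsym_prodL_col {l₁ l₃ : List τ} (hl : (l₁ ++ List.ofFn g ++ l₃).Nodup) (I : τ → Fin N) :
    IsAsym q' q g fun J => prodL L (l₁ ++ List.ofFn g ++ l₃) I J := by
  have hnd : ∀ k : Fin n, ∃ m₁ m₃, l₁ ++ List.ofFn g ++ l₃ =
      m₁ ++ g k.castSucc :: g k.succ :: m₃ := by
    intro k
    obtain ⟨p₁, p₃, e⟩ := ofFn_split g k
    exact ⟨l₁ ++ p₁, p₃ ++ l₃, by rw [e]; simp⟩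
  refine isAsym_of_adjacent (by rw [mul_comm, hq]) g (fun k J hJ => ?_) fun k J hJ => ?_
  all_goals
    obtain ⟨m₁, m₃, e⟩ := hnd k
    rw [e] at hl
    rw [e, prodL, prod_leg_apply L _ hl]
  · split_ifs
    · rw [list_prod_pair (S := S) _ (fun b => L b (I b) (J b)) 0 _ fun _ _ => rfl, zero_smul]
      rw [zero_smul, hJ]
      exact (hL k).2.1 _ _ _
    · rfl
  · rw [prod_leg_apply L _ hl]
    have hmem : ∀ d, d ∉ m₁ ++ g k.castSucc :: g k.succ :: m₃ →
        Equiv.swap (g k.castSucc) (g k.succ) d = d := by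
      intro d hd
      refine Equiv.swap_apply_of_ne_of_ne ?_ ?_ <;> rintro rfl <;> exact hd (by simp)
    have hc : (∀ d, d ∉ m₁ ++ g k.castSucc :: g k.succ :: m₃ →
        I d = (J ∘ Equiv.swap (g k.castSucc) (g k.succ)) d) ↔
        ∀ d, d ∉ m₁ ++ g k.castSucc :: g k.succ :: m₃ → I d = J d := by
      refine forall_congr' fun d => imp_congr_right fun hd => ?_
      rw [Function.comp_apply, hmem d hd]
    simp only [hc]
    split_ifs
    · rw [list_prod_pair (S := S) _ (fun b => L b (I b) (J b)) (-q') _ fun d hd => ?_, neg_smul]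
      · simp only [Function.comp_apply, Equiv.swap_apply_left, Equiv.swap_apply_right]
        rw [(hL k).2.2.2 _ _ _ _ hJ, neg_smul]
      · have h1 : d ≠ g k.castSucc := by
          rintro rfl
          simp only [List.nodup_append, List.nodup_cons, List.mem_append, List.mem_cons] at hl hd
          grind
        have h2 : d ≠ g k.succ := by
          rintro rfl
          simp only [List.nodup_append, List.nodup_cons, List.mem_append, List.mem_cons] at hl hd
          grind
        rw [Function.comp_apply, Equiv.swap_apply_of_ne_of_ne h1 h2]
    · simp

include hq hL in
theorem asym_mul_prodL {l₁ l₃ : List τ} (hl : (l₁ ++ List.ofFn g ++ l₃).Nodup) :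
    sc N τ E (asym N q q' g) * prodL L (l₁ ++ List.ofFn g ++ l₃) =
      ((n + 1).factorial : S) • prodL L (l₁ ++ List.ofFn g ++ l₃) := by
  ext I J
  rw [sc_mul_apply, Matrix.smul_apply]
  exact sum_asym_smul hq g (isAsym_prodL_row hq g hL hl J) I

include hq hL in
theorem prodL_mul_asym {l₁ l₃ : List τ} (hl : (l₁ ++ List.ofFn g ++ l₃).Nodup) :
    prodL L (l₁ ++ List.ofFn g ++ l₃) * sc N τ E (asym N q q' g) =
      ((n + 1).factorial : S) • prodL L (l₁ ++ List.ofFn g ++ l₃) := by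
  ext I J
  rw [mul_sc_apply, Matrix.smul_apply]
  have := sum_asym_smul (by rw [mul_comm, hq]) g (isAsym_prodL_col hq g hL hl I) J
  rw [← this]
  exact Finset.sum_congr rfl fun K _ => by rw [asym_symm]

/-- The trace of a doubly antisymmetric matrix is not changed by braiding. -/
theorem trace_braided {κ : S} (hκ : IsUnit κ) {A C C' Q Q' : Matrix (τ → Fin N) (τ → Fin N) S}
    {X : Matrix (τ → Fin N) (τ → Fin N) E} (hA : A * C = C' * A) (hAA : A * A = κ • A)
    (hAX : sc N τ E A * X = κ • X) (hXA : X * sc N τ E A = κ • X) (hQ : C * Q = 1)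
    (hQ' : Q' * C' = 1) :
    Matrix.trace (sc N τ E C' * X * sc N τ E Q) = Matrix.trace X := by
  have hQC : Q * C = 1 := mul_eq_one_comm.1 hQ
  have h1 : A * Q = Q' * A := by
    calc A * Q = Q' * C' * A * Q := by rw [hQ', one_mul]
      _ = Q' * (A * C) * Q := by rw [hA]; simp only [mul_assoc]
      _ = Q' * A := by rw [mul_assoc, mul_assoc, hQ, mul_one]
  have h2 : A * Q * A = κ • (A * Q) := by
    rw [h1, mul_assoc, hAA, mul_smul_comm]
  -- Since `A` passes the inverse R-matrix product as well, the antisymmetry of `X` in its columns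
  -- is inherited by `X Q`.
  have h3 : κ • (X * sc N τ E Q * sc N τ E A) = κ • (κ • (X * sc N τ E Q)) := by
    have : X * sc N τ E (A * Q * A) = κ • (X * sc N τ E (A * Q)) := by
      rw [h2, sc_smul, mul_smul_comm]
    rwa [map_mul, map_mul, ← mul_assoc, ← mul_assoc, hXA, smul_mul_assoc, smul_mul_assoc] at this
  have h3' := (hκ.smul_left_cancel).1 h3
  refine (hκ.smul_left_cancel).1 (?_ : κ • _ = κ • _)
  -- The scalar `κ` on `X` is traded for a factor `A`. It crosses `C'`, which becomes `C`, goes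
  -- around the trace and is absorbed by `X Q`. What remains is the trace of `X` conjugated by `C`.
  calc κ • Matrix.trace (sc N τ E C' * X * sc N τ E Q)
      = Matrix.trace (sc N τ E C' * (κ • X) * sc N τ E Q) := by
        rw [mul_smul_comm, smul_mul_assoc, Matrix.trace_smul]
    _ = Matrix.trace (sc N τ E A * (sc N τ E C * X * sc N τ E Q)) := by
        rw [← hAX]
        simp only [← mul_assoc, ← map_mul, hA]
    _ = Matrix.trace (sc N τ E C * (X * sc N τ E Q * sc N τ E A)) := by
        rw [trace_sc_mul_comm]
        simp only [mul_assoc]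
    _ = κ • Matrix.trace (sc N τ E C * X * sc N τ E Q) := by
        rw [h3', mul_smul_comm, Matrix.trace_smul, mul_assoc]
    _ = κ • Matrix.trace X := by
        rw [← trace_sc_mul_comm, ← mul_assoc, ← map_mul, hQC, map_one, one_mul]

/-- Because `X` absorbs `A` on both sides, `C'` acts on it from the left as `ψ`, and `Q` from the
right as the inverse of `ψ`, in the form `ψ • (A * Q) = A`. -/
theorem braided_eq_self {κ ψ : S} (hκ : IsUnit κ) {A C C' Q : Matrix (τ → Fin N) (τ → Fin N) S}
    {X : Matrix (τ → Fin N) (τ → Fin N) E} (hAC : A * C = ψ • A) (hCA : C' * A = ψ • A)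
    (hAX : sc N τ E A * X = κ • X) (hXA : X * sc N τ E A = κ • X) (hQ : C * Q = 1) :
    sc N τ E C' * X * sc N τ E Q = X := by
  have h1 : ψ • (A * Q) = A := by
    rw [← smul_mul_assoc, ← hAC, mul_assoc, hQ, mul_one]
  have h2 : sc N τ E C' * X = ψ • X := by
    refine (hκ.smul_left_cancel).1 (?_ : κ • _ = κ • _)
    rw [← mul_smul_comm, ← hAX, ← mul_assoc, ← map_mul, hCA, sc_smul, smul_mul_assoc, hAX,
      smul_comm]
  refine (hκ.smul_left_cancel).1 (?_ : κ • _ = κ • _)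
  rw [h2, smul_mul_assoc, smul_comm, ← smul_mul_assoc, ← hXA, mul_assoc, ← map_mul,
    ← mul_smul_comm, ← sc_smul, h1, hXA]

end Fused

/-! ### Evaluation of power series at nilpotent elements -/

section EvNil

variable {S A E : Type*} [CommRing S] [Semiring A] [Semiring E] [Algebra S E]

/-- The value of a power series in one variable at a nilpotent central element. -/
def evNil₁ (φ : A →+* E) {t : S} {B : ℕ} (ht : t ^ B • (1 : E) = 0) : PowerSeries A →+* E where
  toFun f := ∑ k ∈ Finset.range B, t ^ k • φ (PowerSeries.coeff k f)
  map_zero' := by simp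
  map_one' := by
    rcases B.eq_zero_or_pos with rfl | hB
    · simpa [eq_comm] using ht
    · rw [Finset.sum_eq_single 0]
      · simp
      · intro k _ hk
        simp [PowerSeries.coeff_one, hk]
      · simp [hB.ne']
  map_add' f g := by simp [smul_add, Finset.sum_add_distrib]
  map_mul' f g := by
    -- The Cauchy product gives a sum over a triangle, the product of the two truncated sums one
    -- over a square. They agree because terms of total degree at least `B` vanish.
    have hz : ∀ k x, B ≤ k → t ^ k • (x : E) = 0 := by
      intro k x hk
      rw [← Nat.add_sub_cancel' hk, pow_add, mul_comm, mul_smul, ← one_mul x, ← smul_mul_assoc, ht,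
        zero_mul, smul_zero]
    rw [Finset.sum_mul_sum, ← Finset.sum_product']
    calc ∑ k ∈ Finset.range B, t ^ k • φ (PowerSeries.coeff k (f * g))
        = ∑ k ∈ Finset.range B, ∑ p ∈ Finset.HasAntidiagonal.antidiagonal k,
            (t ^ p.1 • φ (PowerSeries.coeff p.1 f)) * (t ^ p.2 • φ (PowerSeries.coeff p.2 g)) := by
          refine Finset.sum_congr rfl fun k _ => ?_
          rw [PowerSeries.coeff_mul, map_sum, Finset.smul_sum]
          refine Finset.sum_congr rfl fun p hp => ?_
          rw [map_mul, smul_mul_smul_comm, ← pow_add, Finset.HasAntidiagonal.mem_antidiagonal.1 hp]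
      _ = ∑ p ∈ (Finset.range B ×ˢ Finset.range B).filter (fun p => p.1 + p.2 < B),
            (t ^ p.1 • φ (PowerSeries.coeff p.1 f)) * (t ^ p.2 • φ (PowerSeries.coeff p.2 g)) := by
          rw [Finset.sum_sigma']
          refine Finset.sum_bij' (fun x _ => x.2) (fun p _ => ⟨p.1 + p.2, p⟩) ?_ ?_ ?_ ?_ ?_
          · rintro ⟨k, p⟩ h
            simp only [Finset.mem_sigma, Finset.mem_range, Finset.HasAntidiagonal.mem_antidiagonal] at h
            simp only [Finset.mem_filter, Finset.mem_product, Finset.mem_range]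
            omega
          · rintro p h
            simp only [Finset.mem_filter, Finset.mem_product, Finset.mem_range] at h
            simp only [Finset.mem_sigma, Finset.mem_range, Finset.HasAntidiagonal.mem_antidiagonal]
            exact ⟨h.2, trivial⟩
          · rintro ⟨k, p⟩ h
            simp only [Finset.mem_sigma, Finset.mem_range, Finset.HasAntidiagonal.mem_antidiagonal] at h
            obtain ⟨_, rfl⟩ := h
            rfl
          · intro p _; rfl
          · intro p _; rfl
      _ = _ := by
          refine Finset.sum_subset (Finset.filter_subset _ _) fun p hp h => ?_
          rw [smul_mul_smul_comm, ← pow_add, hz]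
          by_contra h'
          exact h (Finset.mem_filter.2 ⟨hp, by omega⟩)

theorem evNil₁_apply (φ : A →+* E) {t : S} {B : ℕ} (ht : t ^ B • (1 : E) = 0) (f : PowerSeries A) :
    evNil₁ φ ht f = ∑ k ∈ Finset.range B, t ^ k • φ (PowerSeries.coeff k f) := rfl

variable {τ : Type*} [Fintype τ] [DecidableEq τ]

theorem monomial_smul_eq_zero {t : τ → S} {B : ℕ} (ht : ∀ i, t i ^ B = 0) {e : τ →₀ ℕ} {i : τ}
    (hi : B ≤ e i) : ∏ j, t j ^ e j = 0 := by
  refine Finset.prod_eq_zero (Finset.mem_univ i) ?_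
  rw [← Nat.add_sub_cancel' hi, pow_add, ht, zero_mul]

/-- The exponents which are smaller than `B`. -/
def expBox (τ : Type*) [Fintype τ] [DecidableEq τ] (B : ℕ) : Finset (τ →₀ ℕ) :=
  (Fintype.piFinset fun _ : τ => Finset.range B).map Finsupp.equivFunOnFinite.symm.toEmbedding

theorem mem_expBox {B : ℕ} {e : τ →₀ ℕ} : e ∈ expBox τ B ↔ ∀ i, e i < B := by
  simp only [expBox, Finset.mem_map, Fintype.mem_piFinset, Finset.mem_range]
  constructor
  · rintro ⟨f, hf, rfl⟩
    exact hf
  · intro h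
    exact ⟨e, h, by ext; rfl⟩

/-- The value of a power series at a family of nilpotent elements. -/
def evNil (φ : A →+* E) {t : τ → S} {B : ℕ} (ht : ∀ i, t i ^ B = 0) : MvPowerSeries τ A →+* E where
  toFun f := ∑ e ∈ expBox τ B, (∏ i, t i ^ e i) • φ (MvPowerSeries.coeff e f)
  map_zero' := by simp
  map_one' := by
    rw [Finset.sum_eq_single 0]
    · simp
    · intro e _ he
      simp [MvPowerSeries.coeff_one, he]
    · intro h
      rw [mem_expBox, not_forall] at h
      obtain ⟨i, hi⟩ := h
      rw [monomial_smul_eq_zero ht (not_lt.1 hi), zero_smul]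
  map_add' f g := by simp [smul_add, Finset.sum_add_distrib]
  map_mul' f g := by
    rw [Finset.sum_mul_sum, ← Finset.sum_product']
    calc ∑ e ∈ expBox τ B, (∏ i, t i ^ e i) • φ (MvPowerSeries.coeff e (f * g))
        = ∑ e ∈ expBox τ B, ∑ p ∈ Finset.HasAntidiagonal.antidiagonal e,
            ((∏ i, t i ^ p.1 i) • φ (MvPowerSeries.coeff p.1 f)) *
              ((∏ i, t i ^ p.2 i) • φ (MvPowerSeries.coeff p.2 g)) := by
          refine Finset.sum_congr rfl fun e _ => ?_
          rw [MvPowerSeries.coeff_mul, map_sum, Finset.smul_sum]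
          refine Finset.sum_congr rfl fun p hp => ?_
          rw [map_mul, smul_mul_smul_comm, ← Finset.prod_mul_distrib]
          simp only [← pow_add, ← Finsupp.add_apply, Finset.HasAntidiagonal.mem_antidiagonal.1 hp]
      _ = ∑ p ∈ (expBox τ B ×ˢ expBox τ B).filter (fun p => p.1 + p.2 ∈ expBox τ B),
            ((∏ i, t i ^ p.1 i) • φ (MvPowerSeries.coeff p.1 f)) *
              ((∏ i, t i ^ p.2 i) • φ (MvPowerSeries.coeff p.2 g)) := by
          rw [Finset.sum_sigma']
          refine Finset.sum_bij' (fun x _ => x.2) (fun p _ => ⟨p.1 + p.2, p⟩) ?_ ?_ ?_ ?_ ?_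
          · rintro ⟨e, p⟩ h
            simp only [Finset.mem_sigma, Finset.HasAntidiagonal.mem_antidiagonal] at h
            obtain ⟨h, rfl⟩ := h
            simp only [Finset.mem_filter, Finset.mem_product]
            refine ⟨⟨?_, ?_⟩, h⟩ <;> rw [mem_expBox] at h ⊢ <;> intro i <;>
              have := h i <;> simp only [Finsupp.add_apply] at this <;> omega
          · rintro p h
            simp only [Finset.mem_filter] at h
            simp only [Finset.mem_sigma, Finset.HasAntidiagonal.mem_antidiagonal]
            exact ⟨h.2, trivial⟩
          · rintro ⟨e, p⟩ h
            simp only [Finset.mem_sigma, Finset.HasAntidiagonal.mem_antidiagonal] at h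
            obtain ⟨_, rfl⟩ := h
            rfl
          · intro p _; rfl
          · intro p _; rfl
      _ = _ := by
          refine Finset.sum_subset (Finset.filter_subset _ _) fun p hp h => ?_
          have h' : p.1 + p.2 ∉ expBox τ B := fun h' => h (Finset.mem_filter.2 ⟨hp, h'⟩)
          rw [mem_expBox, not_forall] at h'
          obtain ⟨i, hi⟩ := h'
          rw [smul_mul_smul_comm, ← Finset.prod_mul_distrib]
          simp only [← pow_add, ← Finsupp.add_apply]
          rw [monomial_smul_eq_zero ht (not_lt.1 hi), zero_smul]

theorem evNil_apply (φ : A →+* E) {t : τ → S} {B : ℕ} (ht : ∀ i, t i ^ B = 0)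
    (f : MvPowerSeries τ A) :
    evNil φ ht f = ∑ e ∈ expBox τ B, (∏ i, t i ^ e i) • φ (MvPowerSeries.coeff e f) := rfl

theorem coeff_inVar (k : τ) (f : PowerSeries A) (e : τ →₀ ℕ) :
    MvPowerSeries.coeff e (inVar k f) =
      if e = Finsupp.single k (e k) then PowerSeries.coeff (e k) f else 0 := by
  classical
  rw [MvPowerSeries.coeff_apply, inVar]
  congr

theorem evNil_inVar (φ : A →+* E) {t : τ → S} {B : ℕ} (ht : ∀ i, t i ^ B = 0) (k : τ)
    (f : PowerSeries A) (htk : t k ^ B • (1 : E) = 0) :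
    evNil φ ht (inVar k f) = evNil₁ φ htk f := by
  rw [evNil_apply, evNil₁_apply]
  symm
  refine Finset.sum_bij_ne_zero (fun r _ _ => Finsupp.single k r) ?_ ?_ ?_ ?_
  · intro r hr _
    rw [mem_expBox]
    intro i
    rw [Finset.mem_range] at hr
    rw [Finsupp.single_apply]
    split_ifs <;> omega
  · intro r _ _ r' _ _ h
    exact Finsupp.single_injective k h
  · intro e he h
    rw [coeff_inVar] at h
    split_ifs at h with hk
    · refine ⟨e k, Finset.mem_range.2 (mem_expBox.1 he k), ?_, hk.symm⟩
      intro h0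
      apply h
      rw [Finset.prod_eq_single k]
      · exact h0
      · intro i _ hi
        rw [hk, Finsupp.single_apply, if_neg hi.symm, pow_zero]
      · simp
    · simp at h
  · intro r _ _
    rw [coeff_inVar, if_pos (by simp), Finset.prod_eq_single k]
    · simp
    · intro i _ hi
      rw [Finsupp.single_apply, if_neg hi.symm, pow_zero]
    · simp

theorem evNil_C (φ : A →+* E) {t : τ → S} {B : ℕ} (ht : ∀ i, t i ^ B = 0) (a : A) :
    evNil φ ht (MvPowerSeries.C a) = φ a := by
  rw [evNil_apply, Finset.sum_eq_single 0]
  · simp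
  · intro e _ he
    simp [MvPowerSeries.coeff_C, he]
  · intro h
    rw [mem_expBox, not_forall] at h
    obtain ⟨i, hi⟩ := h
    rw [monomial_smul_eq_zero ht (not_lt.1 hi), zero_smul]

theorem evNil_map {A' : Type*} [Semiring A'] (ψ : A' →+* A) (φ : A →+* E) {t : τ → S} {B : ℕ}
    (ht : ∀ i, t i ^ B = 0) (f : MvPowerSeries τ A') :
    evNil φ ht (MvPowerSeries.map ψ f) = evNil (φ.comp ψ) ht f := by
  simp [evNil_apply, MvPowerSeries.coeff_map]

theorem coeff_prod_inVar {l : List τ} (hl : l.Nodup) (F : τ → PowerSeries A) (e : τ →₀ ℕ) :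
    MvPowerSeries.coeff e (l.map fun b => inVar b (F b)).prod =
      if ∀ c, c ∉ l → e c = 0 then (l.map fun b => PowerSeries.coeff (e b) (F b)).prod else 0 := by
  induction l generalizing e with
  | nil =>
    rw [List.map_nil, List.prod_nil, MvPowerSeries.coeff_one]
    simp [Finsupp.ext_iff]
  | cons b l ih =>
    obtain ⟨hb, hl⟩ := List.nodup_cons.1 hl
    rw [List.map_cons, List.prod_cons, MvPowerSeries.coeff_mul,
      Finset.sum_eq_single (Finsupp.single b (e b), e.erase b)]
    · rw [coeff_inVar, if_pos (by simp), ih hl]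
      have h1 : (∀ c, c ∉ l → (e.erase b) c = 0) ↔ ∀ c, c ∉ b :: l → e c = 0 := by
        refine forall_congr' fun c => ?_
        by_cases hc : c = b
        · subst hc; simp
        · simp [hc, Finsupp.erase_ne hc]
      have h2 : (l.map fun c => PowerSeries.coeff ((e.erase b) c) (F c)) =
          l.map fun c => PowerSeries.coeff (e c) (F c) := by
        refine List.map_congr_left fun c hc => ?_
        rw [Finsupp.erase_ne]
        rintro rfl; exact hb hc
      simp only [h1, h2]
      split_ifs <;> simp
    · rintro ⟨e₁, e₂⟩ hp hne
      rw [Finset.HasAntidiagonal.mem_antidiagonal] at hp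
      dsimp only at hp ⊢
      rw [coeff_inVar, ih hl]
      split_ifs with h1 h2
      · exfalso
        apply hne
        have hb2 := h2 b hb
        have hb1 : e₁ b = e b := by rw [← hp, Finsupp.add_apply, hb2, add_zero]
        rw [hb1] at h1
        refine Prod.ext h1 ?_
        ext c
        dsimp only
        by_cases hc : c = b
        · subst hc; simp [hb2]
        · rw [Finsupp.erase_ne hc, ← hp, Finsupp.add_apply, h1,
            Finsupp.single_apply, if_neg (Ne.symm hc), zero_add]
      all_goals simp
    · intro h
      exact absurd (Finset.HasAntidiagonal.mem_antidiagonal.2 (Finsupp.single_add_erase b e)) h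

end EvNil

/-! ### Closed ideals and coefficients -/

section ClosedIdeal

variable {N : ℕ}

theorem freeTop_algebraMap_X : algebraMap (PowerSeries ℂ) (FreeTop N) PowerSeries.X =
    PowerSeries.X := PowerSeries.map_X _

/-- The ideal `K + h^p`. -/
def addPow (K : TwoSidedIdeal (FreeTop N)) (p : ℕ) : TwoSidedIdeal (FreeTop N) :=
  TwoSidedIdeal.mk' {f | ∃ g ∈ K, (PowerSeries.X : FreeTop N) ^ p ∣ f - g}
    ⟨0, K.zero_mem, by simp⟩
    (by
      rintro x y ⟨g, hg, h⟩ ⟨g', hg', h'⟩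
      exact ⟨g + g', K.add_mem hg hg', by
        rw [show x + y - (g + g') = (x - g) + (y - g') by abel]; exact dvd_add h h'⟩)
    (by
      rintro x ⟨g, hg, h⟩
      exact ⟨-g, K.neg_mem hg, by
        rw [show -x - -g = -(x - g) by abel]; exact (dvd_neg).2 h⟩)
    (by
      rintro x y ⟨g, hg, c, h⟩
      refine ⟨x * g, K.mul_mem_left _ _ hg, x * c, ?_⟩
      rw [← mul_sub, h, ← mul_assoc, ← mul_assoc, (PowerSeries.commute_X_pow x p).eq])
    (by
      rintro x y ⟨g, hg, c, h⟩
      exact ⟨g * y, K.mul_mem_right _ _ hg, c * y, by rw [← sub_mul, h, mul_assoc]⟩)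

theorem mem_addPow {K : TwoSidedIdeal (FreeTop N)} {p : ℕ} {f : FreeTop N} :
    f ∈ addPow K p ↔ ∃ g ∈ K, (PowerSeries.X : FreeTop N) ^ p ∣ f - g :=
  TwoSidedIdeal.mem_mk' _ _ _ _ _ _ _

/-- The algebra `FreeTop N / (K + h^p)`. -/
def QuotPow (K : TwoSidedIdeal (FreeTop N)) (p : ℕ) : Type := (addPow K p).ringCon.Quotient

instance QuotPow.instRing (K : TwoSidedIdeal (FreeTop N)) (p : ℕ) : Ring (QuotPow K p) :=
  inferInstanceAs (Ring (addPow K p).ringCon.Quotient)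

instance QuotPow.instAlgebra (K : TwoSidedIdeal (FreeTop N)) (p : ℕ) :
    Algebra (PowerSeries ℂ) (QuotPow K p) :=
  inferInstanceAs (Algebra (PowerSeries ℂ) (addPow K p).ringCon.Quotient)

/-- The projection to `FreeTop N / (K + h^p)`. -/
def toQuotPow (K : TwoSidedIdeal (FreeTop N)) (p : ℕ) : FreeTop N →+* QuotPow K p :=
  (addPow K p).ringCon.mk'

theorem toQuotPow_eq_zero {K : TwoSidedIdeal (FreeTop N)} {p : ℕ} {f : FreeTop N} :
    toQuotPow K p f = 0 ↔ f ∈ addPow K p := by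
  have h : f ∈ TwoSidedIdeal.ker (addPow K p).ringCon.mk' ↔ f ∈ addPow K p := by
    rw [TwoSidedIdeal.ker_ringCon_mk']
  rw [← h, TwoSidedIdeal.mem_ker]
  rfl

theorem toQuotPow_smul (K : TwoSidedIdeal (FreeTop N)) (p : ℕ) (c : PowerSeries ℂ)
    (f : FreeTop N) : toQuotPow K p (c • f) = c • toQuotPow K p f := rfl

theorem X_pow_smul_quotPow (K : TwoSidedIdeal (FreeTop N)) (p : ℕ) :
    (PowerSeries.X : PowerSeries ℂ) ^ p • (1 : QuotPow K p) = 0 := by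
  rw [← map_one (toQuotPow K p), ← toQuotPow_smul, toQuotPow_eq_zero, Algebra.smul_def, map_pow,
    freeTop_algebraMap_X, mem_addPow]
  exact ⟨0, K.zero_mem, by simp⟩

/-- The coefficient of `u^a v^b` as an element of the free topological algebra. -/
def iterCoeff (X : Iter (Words N)) (a b : ℤ) : FreeTop N :=
  PowerSeries.mk fun k => ((PowerSeries.coeff k X).coeff b).coeff a

theorem X_pow_smul_iter (K : TwoSidedIdeal (FreeTop N)) (p : ℕ) :
    (PowerSeries.X : PowerSeries ℂ) ^ p •
      (1 : LaurentSeries (LaurentSeries (QuotPow K p))) = 0 := by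
  ext b a
  rw [HahnSeries.coeff_smul, HahnSeries.coeff_smul, HahnSeries.coeff_one]
  split_ifs
  · rw [HahnSeries.coeff_one]
    split_ifs
    · simpa using X_pow_smul_quotPow K p
    · simp
  · simp

/-- The reduction of a series modulo `K + h^p`. -/
def iterRed (K : TwoSidedIdeal (FreeTop N)) (p : ℕ) :
    Iter (Words N) →+* LaurentSeries (LaurentSeries (QuotPow K p)) :=
  evNil₁ (laurentMap (laurentMap ((toQuotPow K p).comp PowerSeries.C))) (X_pow_smul_iter K p)

theorem sum_X_pow_mul_C (f : FreeTop N) (p : ℕ) :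
    (PowerSeries.X : FreeTop N) ^ p ∣
      f - ∑ k ∈ Finset.range p, (PowerSeries.X : PowerSeries ℂ) ^ k •
        PowerSeries.C (PowerSeries.coeff k f) := by
  rw [PowerSeries.X_pow_dvd_iff]
  intro m hm
  rw [map_sub, map_sum, sub_eq_zero, Finset.sum_eq_single m]
  · rw [Algebra.smul_def, map_pow, freeTop_algebraMap_X, PowerSeries.coeff_X_pow_mul']
    simp
  · intro k _ hk
    rw [Algebra.smul_def, map_pow, freeTop_algebraMap_X, PowerSeries.coeff_X_pow_mul']
    split_ifs
    · rw [PowerSeries.coeff_C, if_neg (by omega)]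
    · rfl
  · simp [hm]

theorem coeff_iterRed (K : TwoSidedIdeal (FreeTop N)) (p : ℕ) (X : Iter (Words N)) (a b : ℤ) :
    ((iterRed K p X).coeff b).coeff a = toQuotPow K p (iterCoeff X a b) := by
  have h : toQuotPow K p (iterCoeff X a b) = toQuotPow K p (∑ k ∈ Finset.range p,
      (PowerSeries.X : PowerSeries ℂ) ^ k •
        PowerSeries.C (PowerSeries.coeff k (iterCoeff X a b))) := by
    rw [← sub_eq_zero, ← map_sub, toQuotPow_eq_zero, mem_addPow]
    exact ⟨0, K.zero_mem, by rw [sub_zero]; exact sum_X_pow_mul_C _ _⟩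
  rw [h, iterRed, evNil₁_apply, HahnSeries.coeff_sum, HahnSeries.coeff_sum, map_sum]
  refine Finset.sum_congr rfl fun k _ => ?_
  rw [HahnSeries.coeff_smul, HahnSeries.coeff_smul, toQuotPow_smul, iterCoeff,
    PowerSeries.coeff_mk]
  rfl

theorem iterRed_eq_zero {K : TwoSidedIdeal (FreeTop N)} {p : ℕ} {X : Iter (Words N)} :
    iterRed K p X = 0 ↔ ∀ a b, iterCoeff X a b ∈ addPow K p := by
  simp only [← toQuotPow_eq_zero, ← coeff_iterRed]
  constructor
  · intro h a b
    rw [h]; rfl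
  · intro h
    ext b a
    exact h a b

/-- A coefficient of the product may involve infinitely many coefficients of `X`, but modulo `h ^ p`
all takes place in Laurent series over the quotient by `K + h ^ p`, where the image of `X` is zero.
Separatedness of the quotient by `K` then gives membership in `K`. -/
theorem iterCoeff_mul_mem {K : TwoSidedIdeal (FreeTop N)} (hK : IsTopFreeIdeal K)
    {X : Iter (Words N)} (hX : ∀ a b, iterCoeff X a b ∈ K) (Y Z : Iter (Words N)) (a b : ℤ) :
    iterCoeff (Y * X * Z) a b ∈ K := by
  refine hK.1 _ fun p => mem_addPow.1 ?_
  refine iterRed_eq_zero.1 ?_ a b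
  have : iterRed K p X = 0 :=
    iterRed_eq_zero.2 fun a b => mem_addPow.2 ⟨_, hX a b, by simp⟩
  rw [map_mul, map_mul, this, mul_zero, zero_mul]

end ClosedIdeal

/-! ### Clearing denominators in the defining relation -/

section Central

variable {A B : Type*} [Semiring A] [Semiring B]

theorem powerSeries_map_commute {f : A →+* B} (hf : ∀ s x, Commute (f s) x) (s : PowerSeries A)
    (x : PowerSeries B) : Commute (PowerSeries.map f s) x := by
  ext n
  rw [PowerSeries.coeff_mul, PowerSeries.coeff_mul, ← Finset.Nat.sum_antidiagonal_swap]
  refine Finset.sum_congr rfl fun p _ => ?_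
  rw [PowerSeries.coeff_map]
  exact hf _ _

theorem laurentMap_commute {f : A →+* B} (hf : ∀ s x, Commute (f s) x) (s : LaurentSeries A)
    (x : LaurentSeries B) : Commute (laurentMap f s) x := by
  ext n
  rw [HahnSeries.coeff_mul, HahnSeries.coeff_mul]
  refine Finset.sum_bij' (fun p _ => p.swap) (fun p _ => p.swap) ?_ ?_ ?_ ?_ ?_
  · intro p hp
    exact Finset.swap_mem_antidiagonal.2 hp
  · intro p hp
    exact Finset.swap_mem_antidiagonal.2 hp
  · intro p _; rfl
  · intro p _; rfl
  · intro p _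
    exact hf (s.coeff p.1) (x.coeff p.2)

theorem iterMap_commute (N : ℕ) (s : Iter ℂ) (x : Iter (Words N)) : Commute (iterMap N s) x :=
  powerSeries_map_commute (laurentMap_commute (laurentMap_commute Algebra.commutes)) s x

end Central

/-! ### Series without poles inside the iterated Laurent series -/

section Pow₃

/-- The ring `A[[u]][[v]][[h]]`. -/
abbrev Pow₃ (A : Type*) [Semiring A] : Type _ := PowerSeries (PowerSeries (PowerSeries A))

variable {A : Type*} [Semiring A]

/-- The inclusion of `A[[u]][[v]]` in `A((u))((v))`. -/
def toLaurent₂ (A : Type*) [Semiring A] :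
    PowerSeries (PowerSeries A) →+* LaurentSeries (LaurentSeries A) :=
  (HahnSeries.ofPowerSeries ℤ (LaurentSeries A)).comp
    (PowerSeries.map (HahnSeries.ofPowerSeries ℤ A))

/-- The inclusion of `A[[u]][[v]][[h]]` in `A((u))((v))[[h]]`. -/
def toIter (A : Type*) [Semiring A] : Pow₃ A →+* Iter A := PowerSeries.map (toLaurent₂ A)

/-- `f(u)` as an element of `A[[u]][[v]][[h]]`. -/
def powU (f : PowerSeries A) : Pow₃ A := PowerSeries.C (PowerSeries.C f)

/-- `f(v)` as an element of `A[[u]][[v]][[h]]`. -/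
def powV (f : PowerSeries A) : Pow₃ A :=
  PowerSeries.C (PowerSeries.map (PowerSeries.C (R := A)) f)

theorem toIter_powU (f : PowerSeries A) : toIter A (powU f) = inU f := by
  rw [toIter, powU, PowerSeries.map_C, toLaurent₂, RingHom.comp_apply, PowerSeries.map_C,
    HahnSeries.ofPowerSeries_C, inU]

theorem toIter_powV (f : PowerSeries A) : toIter A (powV f) = inV f := by
  rw [toIter, powV, PowerSeries.map_C, toLaurent₂, RingHom.comp_apply, inV]
  congr 2
  ext n : 1
  simp only [PowerSeries.coeff_map, HahnSeries.ofPowerSeries_C]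

/-- The map on `A[[u]][[v]][[h]]` induced by a ring homomorphism. -/
def pow₃Map {B : Type*} [Semiring B] (f : A →+* B) : Pow₃ A →+* Pow₃ B :=
  PowerSeries.map (PowerSeries.map (PowerSeries.map f))

theorem coeff_ofPowerSeries_natCast (f : PowerSeries A) (n : ℕ) :
    (HahnSeries.ofPowerSeries ℤ A f).coeff (n : ℤ) = PowerSeries.coeff n f :=
  HahnSeries.ofPowerSeries_apply_coeff f n

theorem coeff_ofPowerSeries_neg (f : PowerSeries A) {a : ℤ} (ha : a < 0) :
    (HahnSeries.ofPowerSeries ℤ A f).coeff a = 0 := by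
  rw [HahnSeries.ofPowerSeries_apply]
  refine HahnSeries.embDomain_of_notMem_range fun ⟨n, hn⟩ => ?_
  simp at hn
  omega

theorem coeff_toLaurent₂ (f : PowerSeries (PowerSeries A)) (a b : ℕ) :
    ((toLaurent₂ A f).coeff (b : ℤ)).coeff (a : ℤ) =
      PowerSeries.coeff a (PowerSeries.coeff b f) := by
  rw [toLaurent₂, RingHom.comp_apply, coeff_ofPowerSeries_natCast, PowerSeries.coeff_map,
    coeff_ofPowerSeries_natCast]

theorem coeff_toLaurent₂_neg (f : PowerSeries (PowerSeries A)) {a b : ℤ} (h : a < 0 ∨ b < 0) :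
    ((toLaurent₂ A f).coeff b).coeff a = 0 := by
  rw [toLaurent₂, RingHom.comp_apply]
  rcases lt_or_ge b 0 with hb | hb
  · rw [coeff_ofPowerSeries_neg _ hb]; rfl
  · lift b to ℕ using hb
    rw [coeff_ofPowerSeries_natCast, PowerSeries.coeff_map,
      coeff_ofPowerSeries_neg _ (h.resolve_right (by omega))]

theorem toIter_pow₃Map (N : ℕ) (f : Pow₃ ℂ) :
    toIter (Words N) (pow₃Map (algebraMap ℂ (Words N)) f) = iterMap N (toIter ℂ f) := by
  ext k b a
  rw [toIter, pow₃Map, iterMap, PowerSeries.coeff_map, PowerSeries.coeff_map,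
    PowerSeries.coeff_map, toIter, PowerSeries.coeff_map]
  show _ = algebraMap ℂ (Words N) (((toLaurent₂ ℂ (PowerSeries.coeff k f)).coeff b).coeff a)
  by_cases h : a < 0 ∨ b < 0
  · rw [coeff_toLaurent₂_neg _ h, coeff_toLaurent₂_neg _ h, map_zero]
  · rw [not_or, not_lt, not_lt] at h
    obtain ⟨ha, hb⟩ := h
    lift a to ℕ using ha
    lift b to ℕ using hb
    rw [coeff_toLaurent₂, coeff_toLaurent₂, PowerSeries.coeff_map, PowerSeries.coeff_map]

end Pow₃

/-! ### The relation without denominators and the ideal it generates -/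

section Cleared

/-- The spectral parameters `e^u`, `e^v`. -/
def pow₃Param : Fin 2 → Pow₃ ℂ := ![powU (expSeries 1 ℂ), powV (expSeries 1 ℂ)]

/-- The R-matrix between the tensor factors `b` and `c`, multiplied by the denominator of the
R-matrix in the opposite order. -/
def clearedR (N : ℕ) {τ S : Type*} [Fintype τ] [DecidableEq τ] [CommRing S] (q q' : S) (ζ : τ → S)
    (b c : τ) : Matrix (τ → Fin N) (τ → Fin N) S :=
  (ζ b - ζ c * q ^ 2) • rb N q q' ζ b c

/-- The defining relation of `V(R)` without denominators, over `ℂ⟨l⟩[[u]][[v]][[h]]`. -/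
def clearedRel (N : ℕ) : Matrix (Fin 2 → Fin N) (Fin 2 → Fin N) (Pow₃ (Words N)) :=
  (clearedR N (expSeries (1 / 2) _) (expSeries (-1 / 2) _) pow₃Param 1 0).map
      (pow₃Map (algebraMap ℂ (Words N))) *
    leg 0 (Matrix.of fun i j => powU (lWords i j)) *
    leg 1 (Matrix.of fun i j => powV (lWords i j)) -
  leg 1 (Matrix.of fun i j => powV (lWords i j)) *
    leg 0 (Matrix.of fun i j => powU (lWords i j)) *
    (clearedR N (expSeries (1 / 2) _) (expSeries (-1 / 2) _) pow₃Param 0 1).map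
      (pow₃Map (algebraMap ℂ (Words N)))

theorem toIter_expSeries (c : ℂ) :
    toIter ℂ (expSeries c (PowerSeries (PowerSeries ℂ))) = expSeries c _ := by
  rw [toIter]
  refine expSeries_map _ (fun c => ?_) c
  rw [toLaurent₂, RingHom.comp_apply, HahnSeries.algebraMap_apply']
  simp only [PowerSeries.algebraMap_apply, PowerSeries.map_C, HahnSeries.ofPowerSeries_C,
    HahnSeries.algebraMap_apply', Algebra.algebraMap_self, RingHom.id_apply]

/-- `e^{c u}` in `ℂ((u))((v))[[h]]`. -/
theorem inU_expSeries_mul (a b : ℂ) :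
    inU (expSeries a ℂ) * inU (expSeries b ℂ) = inU (expSeries (a + b) ℂ) := by
  rw [inU, inU, inU, ← map_mul, ← map_mul, ← map_mul, expSeries_add]

theorem inV_expSeries_mul (a b : ℂ) :
    inV (expSeries a ℂ) * inV (expSeries b ℂ) = inV (expSeries (a + b) ℂ) := by
  rw [inV, inV, inV, ← map_mul, ← map_mul, ← map_mul, expSeries_add]

theorem inU_one : inU (1 : PowerSeries ℂ) = 1 := by rw [inU, map_one, map_one, map_one]

theorem inV_one : inV (1 : PowerSeries ℂ) = 1 := by rw [inV, map_one, map_one, map_one]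

theorem constantCoeff_inU_ne_inV :
    PowerSeries.constantCoeff (inU (expSeries 1 ℂ)) ≠
      PowerSeries.constantCoeff (inV (expSeries 1 ℂ)) := by
  rw [inU, inV, PowerSeries.constantCoeff_C, PowerSeries.constantCoeff_C]
  intro h
  have h1 := congrArg (fun x => HahnSeries.coeff x ((1 : ℕ) : ℤ)) h
  simp only [coeff_ofPowerSeries_natCast, PowerSeries.coeff_map, coeff_expSeries] at h1
  rw [HahnSeries.C_apply, HahnSeries.coeff_single_of_ne (by simp)] at h1
  simp at h1

/-- A series in `h` is invertible as soon as its value at `h = 0` is nonzero in the field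
`ℂ((u))((v))`, and there `e ^ h` becomes `1`. -/
theorem isUnit_one_sub {x : Iter ℂ} (hx : PowerSeries.constantCoeff x ≠ 1) :
    IsUnit (1 - x * expSeries (1 / 2) _ ^ 2) := by
  rw [PowerSeries.isUnit_iff_constantCoeff]
  refine (isUnit_iff_ne_zero (G₀ := LaurentSeries (LaurentSeries ℂ))).2 ?_
  rw [map_sub, map_one, map_mul, map_pow]
  have : PowerSeries.constantCoeff (expSeries (1 / 2) (LaurentSeries (LaurentSeries ℂ))) = 1 := by
    rw [← PowerSeries.coeff_zero_eq_constantCoeff_apply, coeff_expSeries]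
    simp
  rw [this, one_pow, mul_one, sub_ne_zero]
  exact hx.symm

theorem isUnit_denomUV : IsUnit (1 - inU (expSeries 1 ℂ) * inV (expSeries (-1) ℂ) *
    expSeries (1 / 2) (LaurentSeries (LaurentSeries ℂ)) ^ 2) := by
  refine isUnit_one_sub fun h => constantCoeff_inU_ne_inV ?_
  have e : inV (expSeries (-1) ℂ) * inV (expSeries 1 ℂ) = 1 := by
    rw [inV_expSeries_mul, neg_add_cancel, expSeries_zero, inV_one]
  have e' := congrArg PowerSeries.constantCoeff e
  rw [map_mul] at e' h
  rw [map_one] at e'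
  rw [← mul_one (PowerSeries.constantCoeff (inU _)), ← e', ← mul_assoc, h, one_mul]

theorem isUnit_denomVU : IsUnit (1 - inU (expSeries (-1) ℂ) * inV (expSeries 1 ℂ) *
    expSeries (1 / 2) (LaurentSeries (LaurentSeries ℂ)) ^ 2) := by
  refine isUnit_one_sub fun h => constantCoeff_inU_ne_inV ?_
  have e : inU (expSeries 1 ℂ) * inU (expSeries (-1) ℂ) = 1 := by
    rw [inU_expSeries_mul, add_neg_cancel, expSeries_zero, inU_one]
  have e' := congrArg PowerSeries.constantCoeff e
  rw [map_mul] at e' h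
  rw [map_one] at e'
  rw [← one_mul (PowerSeries.constantCoeff (inV _)), ← e', mul_assoc, h, mul_one]

/-- The extra factor on the left is the denominator of the opposite R-matrix. It makes the scalar on
the right symmetric under the exchange of the two parameters, so one scalar clears both sides of the
defining relation. -/
theorem clearedR_eq_trigR {N : ℕ} {S : Type*} [CommRing S] {q q' a a' b b' : S} (hq : q * q' = 1)
    (ha : a * a' = 1) (hb : b * b' = 1) (h₁ : IsUnit (1 - a * b' * q ^ 2)) :
    (a - b * q ^ 2) • trigRBar N q q' a b =
      (-q' * a * b * (1 - a * b' * q ^ 2) * (1 - a' * b * q ^ 2)) • trigR N q q' (a * b') := by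
  have e : trigRBar N q q' a b = b • trigRBar N q q' (a * b') 1 := by
    rw [← trigRBar_smul]
    congr 1
    · linear_combination -a * hb
    · ring
  rw [e, trigR, smul_smul, smul_smul]
  congr 1
  have hi := Ring.mul_inverse_cancel _ h₁
  linear_combination (-(q' * q) * a * b * (1 - a' * b * q ^ 2)) * hi -
    a * b * (1 - a' * b * q ^ 2) * hq + b ^ 2 * q ^ 2 * ha

theorem isUnit_clearing {S : Type*} [CommRing S] {q q' a a' b b' x y : S} (hq : q * q' = 1)
    (ha : a * a' = 1) (hb : b * b' = 1) (hx : IsUnit x) (hy : IsUnit y) :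
    IsUnit (-q' * a * b * x * y) :=
  (((((IsUnit.of_mul_eq_one q (by rw [mul_comm]; exact hq)).neg.mul
    (IsUnit.of_mul_eq_one _ ha)).mul (IsUnit.of_mul_eq_one _ hb)).mul hx).mul hy)

theorem clearedR_eq_leg₂ {N : ℕ} {τ S : Type*} [Fintype τ] [DecidableEq τ] [CommRing S]
    {q q' : S} {ζ : τ → S} (hq : q * q' = 1) {b c : τ} {z w z' w' : S} (hζb : ζ b = z)
    (hζc : ζ c = w) (hb : z * z' = 1) (hc : w * w' = 1) (h : IsUnit (1 - z * w' * q ^ 2)) :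
    clearedR N q q' ζ b c =
      (-q' * z * w * (1 - z * w' * q ^ 2) * (1 - z' * w * q ^ 2)) •
        leg₂ b c (trigR N q q' (z * w')) := by
  rw [clearedR, rb, ← leg₂_smul, ← leg₂_smul, hζb, hζc, clearedR_eq_trigR hq hb hc h]

theorem clearedR_map {N : ℕ} {τ S S' : Type*} [Fintype τ] [DecidableEq τ] [CommRing S]
    [CommRing S'] (f : S →+* S') (q q' : S) (ζ : τ → S) (b c : τ) :
    (clearedR N q q' ζ b c).map f = clearedR N (f q) (f q') (fun x => f (ζ x)) b c := by
  rw [clearedR, clearedR, ← rb_map]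
  ext I J
  simp

theorem mul_mul_sub_apply {n S W : Type*} [Fintype n] [CommRing S] [Ring W]
    (f : S →+* W) (hf : ∀ s x, Commute (f s) x) (ω : S) (R₁ R₂ : Matrix n n S)
    (A B : Matrix n n W) (i j : n) :
    ((ω • R₁).map f * A * B - B * A * (ω • R₂).map f) i j =
      f ω * (R₁.map f * A * B - B * A * R₂.map f) i j := by
  have e : ∀ M : Matrix n n S, (ω • M).map f = f ω • M.map f := by
    intro M
    ext I J
    simp
  have e' : ∀ C D : Matrix n n W, C * (f ω • D) = f ω • (C * D) := by
    intro C D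
    ext i j
    rw [Matrix.mul_apply, Matrix.smul_apply, Matrix.mul_apply, smul_eq_mul, Finset.mul_sum]
    refine Finset.sum_congr rfl fun k _ => ?_
    rw [Matrix.smul_apply, smul_eq_mul, ← mul_assoc, ← mul_assoc, (hf ω _).eq]
  rw [e, e, e', smul_mul_assoc, smul_mul_assoc, ← smul_sub, Matrix.smul_apply, smul_eq_mul]

/-- The symmetric clearing factor is the same for `R_{21}` and `R_{12}`, and scalar series are
central, so it comes out of the whole difference. It is a unit because `e ^ u` and `e ^ v` differ at
`h = 0`. -/
theorem clearedRel_eq (N : ℕ) : ∃ ω : Iter ℂ, IsUnit ω ∧ ∀ i j,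
    toIter (Words N) (clearedRel N i j) = iterMap N ω * relMatrix N i j := by
  have hq : expSeries (1 / 2) (LaurentSeries (LaurentSeries ℂ)) * expSeries (-1 / 2) _ = 1 := by
    rw [expSeries_add, ← expSeries_zero]; congr 1; norm_num
  set q := expSeries (1 / 2) (LaurentSeries (LaurentSeries ℂ)) with hqdef
  set q' := expSeries (-1 / 2) (LaurentSeries (LaurentSeries ℂ)) with hqdef'
  set a := inU (expSeries 1 ℂ)
  set a' := inU (expSeries (-1) ℂ)
  set b := inV (expSeries 1 ℂ)
  set b' := inV (expSeries (-1) ℂ)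
  have ha : a * a' = 1 := by
    rw [inU_expSeries_mul, add_neg_cancel, expSeries_zero, inU_one]
  have hb : b * b' = 1 := by
    rw [inV_expSeries_mul, add_neg_cancel, expSeries_zero, inV_one]
  have h₁ : IsUnit (1 - a * b' * q ^ 2) := isUnit_denomUV
  have h₂ : IsUnit (1 - a' * b * q ^ 2) := isUnit_denomVU
  set ω := -q' * a * b * (1 - a * b' * q ^ 2) * (1 - a' * b * q ^ 2) with hω
  have hR : ∀ x y : Fin 2, (clearedR N (expSeries (1 / 2) _) (expSeries (-1 / 2) _)
      pow₃Param x y).map (toIter ℂ) = clearedR N q q' ![a, b] x y := by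
    intro x y
    have hz : ∀ x, toIter ℂ (pow₃Param x) = ![a, b] x := by
      intro x
      fin_cases x
      · exact toIter_powU _
      · exact toIter_powV _
    rw [clearedR_map, hqdef, hqdef', ← toIter_expSeries, ← toIter_expSeries]
    exact congrArg (fun ζ => clearedR N _ _ ζ x y) (funext hz)
  have h1 : clearedR N q q' ![a, b] 1 0 = ω • leg₂ 1 0 (rVU N) := by
    have e : ω = -q' * b * a * (1 - b * a' * q ^ 2) * (1 - b' * a * q ^ 2) := by
      rw [hω]; ring
    rw [e, clearedR_eq_leg₂ (N := N) (ζ := ![a, b]) hq (b := 1) (c := 0)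
      (z := b) (w := a) rfl rfl hb ha
      (by rwa [mul_comm b]), mul_comm b a', rVU]
  have h2 : clearedR N q q' ![a, b] 0 1 = ω • leg₂ 0 1 (rUV N) := by
    rw [clearedR_eq_leg₂ (N := N) (ζ := ![a, b]) hq (b := 0) (c := 1)
      (z := a) (w := b) rfl rfl ha hb h₁, rUV]
  have key : (clearedRel N).map (toIter (Words N)) =
      Matrix.of fun i j => iterMap N ω * relMatrix N i j := by
    have e0 : (leg 0 (Matrix.of fun i j => powU (lWords (N := N) i j)) :
        Matrix (Fin 2 → Fin N) (Fin 2 → Fin N) _).map (toIter (Words N)) =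
        leg 0 (Matrix.of fun i j => inU (lWords (N := N) i j)) := by
      rw [leg_map _ (map_zero _)]
      congr 1
      refine Matrix.ext fun i j => ?_
      exact toIter_powU _
    have e1 : (leg 1 (Matrix.of fun i j => powV (lWords (N := N) i j)) :
        Matrix (Fin 2 → Fin N) (Fin 2 → Fin N) _).map (toIter (Words N)) =
        leg 1 (Matrix.of fun i j => inV (lWords (N := N) i j)) := by
      rw [leg_map _ (map_zero _)]
      congr 1
      refine Matrix.ext fun i j => ?_
      exact toIter_powV _
    have e2 : ∀ x y : Fin 2, ((clearedR N (expSeries (1 / 2) _) (expSeries (-1 / 2) _)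
        pow₃Param x y).map (pow₃Map (algebraMap ℂ (Words N)))).map (toIter (Words N)) =
        (clearedR N q q' ![a, b] x y).map (iterMap N) := by
      intro x y
      rw [← hR]
      refine Matrix.ext fun I J => ?_
      exact toIter_pow₃Map _ _
    rw [clearedRel, Matrix.map_sub _ (map_sub _), Matrix.map_mul, Matrix.map_mul, Matrix.map_mul,
      Matrix.map_mul, e0, e1, e2, e2, h1, h2]
    have e5 := mul_mul_sub_apply (iterMap N) (iterMap_commute N) ω (leg₂ (1 : Fin 2) 0 (rVU N))
      (leg₂ (0 : Fin 2) 1 (rUV N)) (leg (0 : Fin 2) (Matrix.of fun i j => inU (lWords (N := N) i j)))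
      (leg (1 : Fin 2) (Matrix.of fun i j => inV (lWords (N := N) i j)))
    refine Matrix.ext fun i j => ?_
    rw [Matrix.of_apply]
    refine (e5 i j).trans ?_
    rfl
  have hu : IsUnit ω := by
    rw [hω]
    exact isUnit_clearing hq ha hb h₁ h₂
  refine ⟨ω, hu, fun i j => ?_⟩
  have := congrFun (congrFun key i) j
  rwa [Matrix.map_apply, Matrix.of_apply] at this

/-- The coefficient of `u^a v^b` of the relation without denominators. -/
def clearedCoeff (N : ℕ) (i j : Fin 2 → Fin N) (a b : ℕ) : FreeTop N :=
  PowerSeries.mk fun k =>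
    PowerSeries.coeff a (PowerSeries.coeff b (PowerSeries.coeff k (clearedRel N i j)))

theorem iterCoeff_toIter {N : ℕ} (X : Pow₃ (Words N)) (a b : ℕ) :
    iterCoeff (toIter (Words N) X) a b = PowerSeries.mk fun k =>
      PowerSeries.coeff a (PowerSeries.coeff b (PowerSeries.coeff k X)) := by
  ext k
  rw [iterCoeff, PowerSeries.coeff_mk, PowerSeries.coeff_mk, toIter, PowerSeries.coeff_map,
    coeff_toLaurent₂]

theorem iterCoeff_toIter_neg {N : ℕ} (X : Pow₃ (Words N)) {a b : ℤ} (h : a < 0 ∨ b < 0) :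
    iterCoeff (toIter (Words N) X) a b = 0 := by
  ext k
  rw [iterCoeff, PowerSeries.coeff_mk, toIter, PowerSeries.coeff_map,
    coeff_toLaurent₂_neg _ h, map_zero]

/-- The two relations differ by a unit of the series ring, and membership of all coefficients in `K`
is stable under multiplication by any series. -/
theorem relCoeff_mem_iff {N : ℕ} {K : TwoSidedIdeal (FreeTop N)} (hK : IsTopFreeIdeal K) :
    (∀ i j a b, relCoeff N i j a b ∈ K) ↔ ∀ i j a b, clearedCoeff N i j a b ∈ K := by
  obtain ⟨ω, hω, h⟩ := clearedRel_eq N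
  constructor
  · intro hr i j a b
    rw [clearedCoeff, ← iterCoeff_toIter, h, ← mul_one (iterMap N ω * _)]
    exact iterCoeff_mul_mem hK (hr i j) _ _ _ _
  · intro hc i j a b
    obtain ⟨ω', hω'⟩ := hω.exists_left_inv
    have e : relMatrix N i j = iterMap N ω' * toIter (Words N) (clearedRel N i j) * 1 := by
      rw [h, mul_one, ← mul_assoc, ← map_mul, hω', map_one, one_mul]
    have := iterCoeff_mul_mem hK (X := toIter (Words N) (clearedRel N i j)) (fun a b => ?_)
      (iterMap N ω') 1 a b
    · rw [← e] at this
      exact this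
    -- The cleared relation has no poles, so its coefficients at negative exponents are zero.
    · by_cases hab : a < 0 ∨ b < 0
      · rw [iterCoeff_toIter_neg _ hab]
        exact K.zero_mem
      · rw [not_or, not_lt, not_lt] at hab
        obtain ⟨ha, hb⟩ := hab
        lift a to ℕ using ha
        lift b to ℕ using hb
        rw [iterCoeff_toIter]
        exact hc i j a b

theorem isTopFreeIdeal_relIdeal (N : ℕ) : IsTopFreeIdeal (relIdeal N) := by
  constructor
  · intro f hf
    rw [relIdeal, TwoSidedIdeal.mem_sInf]
    intro I hI
    refine hI.1.1 f fun k => ?_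
    obtain ⟨g, hg, h⟩ := hf k
    exact ⟨g, (TwoSidedIdeal.mem_sInf _).1 hg I hI, h⟩
  · intro f hf
    rw [relIdeal, TwoSidedIdeal.mem_sInf] at hf ⊢
    intro I hI
    exact hI.1.2 f (hf I hI)

theorem clearedCoeff_mem_relIdeal (N : ℕ) (i j : Fin 2 → Fin N) (a b : ℕ) :
    clearedCoeff N i j a b ∈ relIdeal N := by
  refine (relCoeff_mem_iff (isTopFreeIdeal_relIdeal N)).1 (fun i j a b => ?_) i j a b
  rw [relIdeal, TwoSidedIdeal.mem_sInf]
  exact fun I hI => hI.2 i j a b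

end Cleared

/-! ### The defining relation at nilpotent parameters -/

section RelPair

variable {N : ℕ} {S E : Type*} [CommRing S] [Ring E] [Algebra S E]

/-- The relation of `V(R)` without denominators, for matrices `A = L(z)` and `B = L(w)`. -/
def RelPair (q q' z w : S) (A B : Matrix (Fin N) (Fin N) E) : Prop :=
  ∀ i i' j j',
    (w - z * q ^ 2) • (wD q q' w z i' i • (A i j * B i' j') +
      wO q q' w z i' i • (A i' j * B i j')) =
    (z - w * q ^ 2) • (wD q q' z w j j' • (B i' j' * A i j) +
      wO q q' z w j' j • (B i' j * A i j'))

variable {τ : Type*} [Fintype τ] [DecidableEq τ]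

theorem leg_mul_leg_apply {b c : τ} (hbc : b ≠ c) (A B : Matrix (Fin N) (Fin N) E)
    (I J : τ → Fin N) : (leg b A * leg c B) I J =
      if ∀ d, d ≠ b → d ≠ c → I d = J d then A (I b) (J b) * B (I c) (J c) else 0 := by
  have := prod_leg_apply (fun d => if d = b then A else B) [b, c] (by simpa using hbc) I J
  simpa [hbc.symm] using this

theorem rb_leg_leg_apply (q q' : S) (ζ : τ → S) {b c : τ} (hbc : b ≠ c)
    (A B : Matrix (Fin N) (Fin N) E) (I J : τ → Fin N) :
    (sc N τ E (rb N q q' ζ c b) * leg b A * leg c B) I J =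
      if ∀ d, d ≠ b → d ≠ c → I d = J d then
        wD q q' (ζ c) (ζ b) (I c) (I b) • (A (I b) (J b) * B (I c) (J c)) +
          wO q q' (ζ c) (ζ b) (I c) (I b) • (A (I c) (J b) * B (I b) (J c)) else 0 := by
  rw [mul_assoc, sc_apply, rb_mul_apply, leg_mul_leg_apply hbc, leg_mul_leg_apply hbc]
  have h : (∀ d, d ≠ b → d ≠ c → (I ∘ Equiv.swap c b) d = J d) ↔
      ∀ d, d ≠ b → d ≠ c → I d = J d := by
    refine forall_congr' fun d => forall_congr' fun h1 => forall_congr' fun h2 => ?_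
    rw [Function.comp_apply, Equiv.swap_apply_of_ne_of_ne h2 h1]
  simp only [h]
  split_ifs <;> simp

theorem leg_leg_rb_apply (q q' : S) (ζ : τ → S) {b c : τ} (hbc : b ≠ c)
    (A B : Matrix (Fin N) (Fin N) E) (I J : τ → Fin N) :
    (leg c B * leg b A * sc N τ E (rb N q q' ζ b c)) I J =
      if ∀ d, d ≠ b → d ≠ c → I d = J d then
        wD q q' (ζ b) (ζ c) (J b) (J c) • (B (I c) (J c) * A (I b) (J b)) +
          wO q q' (ζ b) (ζ c) (J c) (J b) • (B (I c) (J b) * A (I b) (J c)) else 0 := by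
  rw [sc_apply, mul_rb_apply, leg_mul_leg_apply hbc.symm, leg_mul_leg_apply hbc.symm]
  have h : (∀ d, d ≠ c → d ≠ b → I d = (J ∘ Equiv.swap b c) d) ↔
      ∀ d, d ≠ b → d ≠ c → I d = J d := by
    refine forall_congr' fun d => ⟨fun h h1 h2 => ?_, fun h h1 h2 => ?_⟩
    · rw [h h2 h1, Function.comp_apply, Equiv.swap_apply_of_ne_of_ne h1 h2]
    · rw [h h2 h1, Function.comp_apply, Equiv.swap_apply_of_ne_of_ne h2 h1]
  have h' : (∀ d, d ≠ c → d ≠ b → I d = J d) ↔ ∀ d, d ≠ b → d ≠ c → I d = J d :=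
    forall_congr' fun d => forall_comm
  simp only [h, h']
  split_ifs <;> simp

theorem RelPair.leg {q q' : S} {ζ : τ → S} {b c : τ} (hbc : b ≠ c)
    {A B : Matrix (Fin N) (Fin N) E} (h : RelPair q q' (ζ b) (ζ c) A B) :
    (ζ c - ζ b * q ^ 2) • (sc N τ E (rb N q q' ζ c b) * leg b A * leg c B) =
      (ζ b - ζ c * q ^ 2) • (leg c B * leg b A * sc N τ E (rb N q q' ζ b c)) := by
  ext I J
  rw [Matrix.smul_apply, Matrix.smul_apply, rb_leg_leg_apply _ _ _ hbc, leg_leg_rb_apply _ _ _ hbc]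
  split_ifs
  · exact h _ _ _ _
  · rw [smul_zero, smul_zero]

theorem relPair_of_leg {q q' z w : S} {A B : Matrix (Fin N) (Fin N) E}
    (h : (w - z * q ^ 2) • (sc N (Fin 2) E (rb N q q' ![z, w] 1 0) * TrigFRT.leg 0 A *
        TrigFRT.leg 1 B) =
      (z - w * q ^ 2) • (TrigFRT.leg 1 B * TrigFRT.leg 0 A *
        sc N (Fin 2) E (rb N q q' ![z, w] 0 1))) :
    RelPair q q' z w A B := by
  intro i i' j j'
  have := congrFun (congrFun h ![i, i']) ![j, j']
  rw [Matrix.smul_apply, Matrix.smul_apply, rb_leg_leg_apply _ _ _ (by simp),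
    leg_leg_rb_apply _ _ _ (by simp), if_pos (by intro d h0 h1; fin_cases d <;> simp_all),
    if_pos (by intro d h0 h1; fin_cases d <;> simp_all)] at this
  exact this

end RelPair

/-! ### Substitution of nilpotent elements for the variables -/

section Ev₃

variable {N : ℕ} {S E : Type*} [CommRing S] [Algebra (PowerSeries ℂ) S] [Ring E] [Algebra S E]

/-- The exponential of a nilpotent element, multiplied by a number. -/
def expNil {B : ℕ} (c : ℂ) {t : S} (ht : t ^ B = 0) : S :=
  evNil₁ (S := S) (E := S) ((algebraMap (PowerSeries ℂ) S).comp (PowerSeries.C (R := ℂ)))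
    (t := t) (B := B) (by rw [ht, zero_smul]) (expSeries c ℂ)

theorem pow_smul_eq_zero {t : S} {B : ℕ} (ht : t ^ B = 0) : t ^ B • (1 : E) = 0 := by
  rw [ht, zero_smul]

theorem algebraMap_eq_sum {B : ℕ} (hS : algebraMap (PowerSeries ℂ) S PowerSeries.X ^ B = 0)
    (f : PowerSeries ℂ) : algebraMap (PowerSeries ℂ) S f = ∑ k ∈ Finset.range B,
      algebraMap (PowerSeries ℂ) S PowerSeries.X ^ k *
        algebraMap (PowerSeries ℂ) S (PowerSeries.C (PowerSeries.coeff k f)) := by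
  have h : (PowerSeries.X : PowerSeries ℂ) ^ B ∣
      f - ∑ k ∈ Finset.range B, PowerSeries.X ^ k * PowerSeries.C (PowerSeries.coeff k f) := by
    rw [PowerSeries.X_pow_dvd_iff]
    intro m hm
    rw [map_sub, map_sum, sub_eq_zero, Finset.sum_eq_single m]
    · rw [PowerSeries.coeff_X_pow_mul']
      simp
    · intro k _ hk
      rw [PowerSeries.coeff_X_pow_mul']
      split_ifs
      · rw [PowerSeries.coeff_C, if_neg (by omega)]
      · rfl
    · simp [hm]
  obtain ⟨c, hc⟩ := h
  have := congrArg (algebraMap (PowerSeries ℂ) S) hc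
  rw [map_mul, map_pow, hS, zero_mul, map_sub, sub_eq_zero, map_sum] at this
  rw [this]
  exact Finset.sum_congr rfl fun k _ => by rw [map_mul, map_pow]

variable {B : ℕ} (hS : algebraMap (PowerSeries ℂ) S PowerSeries.X ^ B = 0) {t s : S}
  (ht : t ^ B = 0) (hs : s ^ B = 0)

/-- The value of a series in `u`, `v` and `h` at nilpotent elements. -/
def ev₃ {A : Type*} [Semiring A] (φ : A →+* E) : Pow₃ A →+* E :=
  evNil₁ (evNil₁ (evNil₁ φ (pow_smul_eq_zero ht)) (pow_smul_eq_zero hs)) (pow_smul_eq_zero hS)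

/-- The composite of an evaluation homomorphism with a homomorphism of coefficient rings. -/
theorem evNil₁_map {S A A' E : Type*} [CommRing S] [Semiring A] [Semiring A'] [Semiring E]
    [Algebra S E] (ψ : A' →+* A) (φ : A →+* E) {t : S} {B : ℕ} (ht : t ^ B • (1 : E) = 0)
    (f : PowerSeries A') : evNil₁ φ ht (PowerSeries.map ψ f) = evNil₁ (φ.comp ψ) ht f := by
  simp [evNil₁_apply]

theorem evNil₁_C {S A E : Type*} [CommRing S] [Semiring A] [Semiring E] [Algebra S E]
    (φ : A →+* E) {t : S} {B : ℕ} (ht : t ^ B • (1 : E) = 0) (a : A) :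
    evNil₁ φ ht (PowerSeries.C a) = φ a := by
  rcases B.eq_zero_or_pos with rfl | hB
  · have : Subsingleton E := by
      rw [pow_zero, one_smul] at ht
      exact subsingleton_of_zero_eq_one ht.symm
    exact Subsingleton.elim _ _
  · rw [evNil₁_apply, Finset.sum_eq_single 0]
    · simp
    · intro k _ hk
      simp [PowerSeries.coeff_C, hk]
    · simp [hB.ne']

theorem ev₃_powU {A : Type*} [Semiring A] (φ : A →+* E) (f : PowerSeries A) :
    ev₃ hS ht hs φ (powU f) = evNil₁ φ (pow_smul_eq_zero ht) f := by
  rw [ev₃, powU, evNil₁_C, evNil₁_C]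

theorem ev₃_powV {A : Type*} [Semiring A] (φ : A →+* E) (f : PowerSeries A) :
    ev₃ hS ht hs φ (powV f) = evNil₁ φ (pow_smul_eq_zero hs) f := by
  rw [ev₃, powV, evNil₁_C, evNil₁_map]
  simp only [evNil₁_apply, RingHom.comp_apply]
  refine Finset.sum_congr rfl fun k _ => ?_
  congr 1
  rw [← evNil₁_apply φ (pow_smul_eq_zero ht), evNil₁_C]

/-- The inclusion of the complex numbers in a `ℂ[[h]]`-algebra. -/
def numMap (S : Type*) [CommRing S] [Algebra (PowerSeries ℂ) S] : ℂ →+* S :=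
  (algebraMap (PowerSeries ℂ) S).comp (PowerSeries.C (R := ℂ))

theorem expNil_eq (c : ℂ) : expNil c ht = evNil₁ (numMap S) (pow_smul_eq_zero ht)
    (expSeries c ℂ) := rfl

theorem ev₃_pow₃Map {A : Type*} [Semiring A] {φ : A →+* E} {ψ : ℂ →+* A}
    (hφ : ∀ c, φ (ψ c) = algebraMap S E (numMap S c)) (f : Pow₃ ℂ) :
    ev₃ hS ht hs φ (pow₃Map ψ f) = algebraMap S E (ev₃ hS ht hs (numMap S) f) := by
  simp only [ev₃, pow₃Map, evNil₁_apply, PowerSeries.coeff_map, map_sum, hφ, Algebra.smul_def,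
    map_mul, Algebra.algebraMap_self, RingHom.id_apply]

theorem ev₃_expSeries (c : ℂ) :
    ev₃ hS ht hs (numMap S) (expSeries c (PowerSeries (PowerSeries ℂ))) = qExp S c := by
  rw [qExp, algebraMap_eq_sum hS, ev₃, evNil₁_apply]
  refine Finset.sum_congr rfl fun k _ => ?_
  rw [coeff_expSeries, coeff_expSeries, PowerSeries.algebraMap_apply, PowerSeries.algebraMap_apply,
    evNil₁_C, evNil₁_C, smul_eq_mul]
  rfl

theorem map_ev₃_clearedRel {φ : Words N →+* E}
    (hφ : ∀ c, φ (algebraMap ℂ _ c) = algebraMap S E (numMap S c)) :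
    (clearedRel N).map (ev₃ hS ht hs φ) =
      (expNil 1 hs - expNil 1 ht * qExp S (1 / 2) ^ 2) •
        (sc N (Fin 2) E (rb N (qExp S (1 / 2)) (qExp S (-1 / 2)) ![expNil 1 ht, expNil 1 hs] 1 0) *
          leg 0 (Matrix.of fun i j => evNil₁ φ (pow_smul_eq_zero ht) (lWords i j)) *
          leg 1 (Matrix.of fun i j => evNil₁ φ (pow_smul_eq_zero hs) (lWords i j))) -
      (expNil 1 ht - expNil 1 hs * qExp S (1 / 2) ^ 2) •
        (leg 1 (Matrix.of fun i j => evNil₁ φ (pow_smul_eq_zero hs) (lWords i j)) *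
          leg 0 (Matrix.of fun i j => evNil₁ φ (pow_smul_eq_zero ht) (lWords i j)) *
          sc N (Fin 2) E
            (rb N (qExp S (1 / 2)) (qExp S (-1 / 2)) ![expNil 1 ht, expNil 1 hs] 0 1)) := by
  have hz : ∀ x, ev₃ hS ht hs (numMap S) (pow₃Param x) = ![expNil 1 ht, expNil 1 hs] x := by
    intro x
    fin_cases x
    · exact ev₃_powU hS ht hs _ _
    · exact ev₃_powV hS ht hs _ _
  have e0 : (leg 0 (Matrix.of fun i j => powU (lWords (N := N) i j)) :
      Matrix (Fin 2 → Fin N) (Fin 2 → Fin N) _).map (ev₃ hS ht hs φ) =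
      leg 0 (Matrix.of fun i j => evNil₁ φ (pow_smul_eq_zero ht) (lWords i j)) := by
    rw [leg_map _ (map_zero _)]
    congr 1
    exact Matrix.ext fun i j => ev₃_powU hS ht hs _ _
  have e1 : (leg 1 (Matrix.of fun i j => powV (lWords (N := N) i j)) :
      Matrix (Fin 2 → Fin N) (Fin 2 → Fin N) _).map (ev₃ hS ht hs φ) =
      leg 1 (Matrix.of fun i j => evNil₁ φ (pow_smul_eq_zero hs) (lWords i j)) := by
    rw [leg_map _ (map_zero _)]
    congr 1
    exact Matrix.ext fun i j => ev₃_powV hS ht hs _ _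
  have e2 : ∀ x y : Fin 2, ((clearedR N (expSeries (1 / 2) _) (expSeries (-1 / 2) _)
      pow₃Param x y).map (pow₃Map (algebraMap ℂ (Words N)))).map (ev₃ hS ht hs φ) =
      sc N (Fin 2) E (clearedR N (qExp S (1 / 2)) (qExp S (-1 / 2))
        ![expNil 1 ht, expNil 1 hs] x y) := by
    intro x y
    rw [← ev₃_expSeries hS ht hs, ← ev₃_expSeries hS ht hs, ← funext hz, ← clearedR_map]
    exact Matrix.ext fun I J => ev₃_pow₃Map hS ht hs hφ _
  rw [clearedRel, Matrix.map_sub _ (map_sub _), Matrix.map_mul, Matrix.map_mul, Matrix.map_mul,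
    Matrix.map_mul, e0, e1, e2, e2, clearedR, clearedR, sc_smul, sc_smul, smul_mul_assoc,
    smul_mul_assoc, mul_smul_comm]
  rfl

theorem ev₃_clearedRel {φ : Words N →+* E}
    (hφ : ∀ c, φ (algebraMap ℂ _ c) = algebraMap S E (numMap S c))
    (h : ∀ i j, ev₃ hS ht hs φ (clearedRel N i j) = 0) :
    RelPair (qExp S (1 / 2)) (qExp S (-1 / 2)) (expNil 1 ht) (expNil 1 hs)
      (Matrix.of fun i j => evNil₁ φ (pow_smul_eq_zero ht) (lWords i j))
      (Matrix.of fun i j => evNil₁ φ (pow_smul_eq_zero hs) (lWords i j)) := by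
  apply relPair_of_leg
  have e3 : (clearedRel N).map (ev₃ hS ht hs φ) = 0 := Matrix.ext fun i j => h i j
  rwa [map_ev₃_clearedRel hS ht hs hφ, sub_eq_zero] at e3

variable [Algebra (PowerSeries ℂ) E] [IsScalarTower (PowerSeries ℂ) S E]

/-- No continuity of `φ` is assumed: the tail of a series is a multiple of `h ^ p`, which acts as
zero on the target. -/
theorem freeTop_map_eq_sum {p : ℕ} (hS : algebraMap (PowerSeries ℂ) S PowerSeries.X ^ p = 0)
    (φ : FreeTop N →ₐ[PowerSeries ℂ] E) (f : FreeTop N) :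
    φ f = ∑ k ∈ Finset.range p, algebraMap (PowerSeries ℂ) S PowerSeries.X ^ k •
      φ (PowerSeries.C (PowerSeries.coeff k f)) := by
  obtain ⟨c, hc⟩ := sum_X_pow_mul_C f p
  have := congrArg φ hc
  rw [map_mul, map_pow, ← freeTop_algebraMap_X, AlgHom.commutes,
    IsScalarTower.algebraMap_apply (PowerSeries ℂ) S E, ← map_pow, hS, map_zero, zero_mul, map_sub,
    sub_eq_zero, map_sum] at this
  rw [this]
  refine Finset.sum_congr rfl fun k _ => ?_
  rw [map_smul, ← algebraMap_smul S, map_pow]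

theorem ev₃_eq_sum (φ : FreeTop N →ₐ[PowerSeries ℂ] E) (X : Pow₃ (Words N)) :
    ev₃ hS ht hs ((φ : FreeTop N →+* E).comp PowerSeries.C) X =
      ∑ b ∈ Finset.range B, ∑ a ∈ Finset.range B, (s ^ b * t ^ a) •
        φ (PowerSeries.mk fun k =>
          PowerSeries.coeff a (PowerSeries.coeff b (PowerSeries.coeff k X))) := by
  have h : ∀ a b, φ (PowerSeries.mk fun k =>
      PowerSeries.coeff a (PowerSeries.coeff b (PowerSeries.coeff k X))) = _ :=
    fun a b => freeTop_map_eq_sum hS φ _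
  simp only [h, PowerSeries.coeff_mk, Finset.smul_sum]
  simp only [ev₃, evNil₁_apply, Finset.smul_sum, RingHom.comp_apply, RingHom.coe_coe, smul_smul]
  rw [Finset.sum_comm]
  refine Finset.sum_congr rfl fun b _ => ?_
  rw [Finset.sum_comm]
  refine Finset.sum_congr rfl fun a _ => Finset.sum_congr rfl fun k _ => ?_
  congr 1
  ring

include hS in
-- The value of the cleared relation at `t`, `s` is the sum of the images of its coefficients with
-- the factors `s ^ b * t ^ a`. These coefficients lie in the ideal of relations, which `φ` kills.
theorem relPair_of_freeTop (φ : FreeTop N →ₐ[PowerSeries ℂ] E)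
    (h : ∀ f ∈ relIdeal N, φ f = 0) :
    RelPair (qExp S (1 / 2)) (qExp S (-1 / 2)) (expNil 1 ht) (expNil 1 hs)
      (Matrix.of fun i j => evNil₁ ((φ : FreeTop N →+* E).comp PowerSeries.C)
        (pow_smul_eq_zero ht) (lWords i j))
      (Matrix.of fun i j => evNil₁ ((φ : FreeTop N →+* E).comp PowerSeries.C)
        (pow_smul_eq_zero hs) (lWords i j)) := by
  refine ev₃_clearedRel hS ht hs (fun c => ?_) fun i j => ?_
  · rw [RingHom.comp_apply, numMap, RingHom.comp_apply, ← IsScalarTower.algebraMap_apply,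
      RingHom.coe_coe, ← φ.commutes]
    congr 1
    exact (PowerSeries.map_C _ _).symm
  · rw [ev₃_eq_sum]
    refine Finset.sum_eq_zero fun b _ => Finset.sum_eq_zero fun a _ => ?_
    have := h _ (clearedCoeff_mem_relIdeal N i j a b)
    rw [clearedCoeff] at this
    rw [this, smul_zero]

end Ev₃

/-! ### Truncated polynomial rings and coefficient extraction -/

section Trunc

variable (τ 𝒪 : Type*) [CommRing 𝒪] [Algebra (PowerSeries ℂ) 𝒪] (p : ℕ)

/-- The polynomials whose coefficients at the exponents smaller than `p` are divisible by `h^p`. -/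
def truncIdeal : Ideal (MvPolynomial τ 𝒪) where
  carrier := {f | ∀ e : τ →₀ ℕ, (∀ i, e i < p) →
    algebraMap (PowerSeries ℂ) 𝒪 (PowerSeries.X ^ p) ∣ MvPolynomial.coeff e f}
  zero_mem' := by simp
  add_mem' hf hg e he := by
    rw [MvPolynomial.coeff_add]
    exact dvd_add (hf e he) (hg e he)
  smul_mem' g f hf e he := by
    classical
    rw [smul_eq_mul, MvPolynomial.coeff_mul]
    refine Finset.dvd_sum fun x hx => Dvd.dvd.mul_left (hf x.2 fun i => ?_) _
    rw [Finset.HasAntidiagonal.mem_antidiagonal] at hx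
    have := he i
    rw [← hx, Finsupp.add_apply] at this
    omega

/-- The polynomial ring over `𝒪`, truncated at `h^p` and at exponents below `p`. -/
abbrev Trunc : Type _ := MvPolynomial τ 𝒪 ⧸ truncIdeal τ 𝒪 p

variable {τ}

/-- The variables of the truncated polynomial ring. -/
def truncVar (b : τ) : Trunc τ 𝒪 p := Ideal.Quotient.mk _ (MvPolynomial.X b)

theorem truncVar_pow (b : τ) : truncVar 𝒪 p b ^ p = 0 := by
  classical
  rw [truncVar, ← map_pow, Ideal.Quotient.eq_zero_iff_mem]
  intro e he
  rw [MvPolynomial.coeff_X_pow, if_neg]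
  · exact dvd_zero _
  · rintro rfl
    have := he b
    simp at this

theorem trunc_algebraMap_X :
    algebraMap (PowerSeries ℂ) (Trunc τ 𝒪 p) PowerSeries.X ^ p = 0 := by
  rw [← map_pow, IsScalarTower.algebraMap_apply (PowerSeries ℂ) (MvPolynomial τ 𝒪) (Trunc τ 𝒪 p)]
  refine Ideal.Quotient.eq_zero_iff_mem.2 fun e _ => ?_
  classical
  rw [IsScalarTower.algebraMap_apply (PowerSeries ℂ) 𝒪 (MvPolynomial τ 𝒪),
    MvPolynomial.algebraMap_eq, MvPolynomial.coeff_C]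
  split_ifs
  · rfl
  · exact dvd_zero _

/-- The quotient of a module by `h^p`. -/
abbrev ModPow (W : Type*) [AddCommGroup W] [Module (PowerSeries ℂ) W] (p : ℕ) : Type _ :=
  W ⧸ ((Ideal.span {(PowerSeries.X : PowerSeries ℂ)}) ^ p • ⊤ : Submodule (PowerSeries ℂ) W)

theorem mem_span_X_pow_smul_top {W : Type*} [AddCommGroup W] [Module (PowerSeries ℂ) W] {p : ℕ}
    {x : W} : x ∈ ((Ideal.span {(PowerSeries.X : PowerSeries ℂ)}) ^ p • ⊤ :
      Submodule (PowerSeries ℂ) W) ↔ ∃ y, x = (PowerSeries.X : PowerSeries ℂ) ^ p • y := by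
  rw [Ideal.span_singleton_pow, Submodule.ideal_span_singleton_smul,
    Submodule.mem_smul_pointwise_iff_exists]
  simp [eq_comm]

theorem modPow_smul {W : Type*} [AddCommGroup W] [Module (PowerSeries ℂ) W] {p : ℕ}
    (y : ModPow W p) : (PowerSeries.X : PowerSeries ℂ) ^ p • y = 0 := by
  obtain ⟨x, rfl⟩ := Submodule.Quotient.mk_surjective _ y
  rw [← Submodule.Quotient.mk_smul, Submodule.Quotient.mk_eq_zero, mem_span_X_pow_smul_top]
  exact ⟨x, rfl⟩

variable {𝒪 p} {W W' : Type*} [AddCommGroup W] [Module (PowerSeries ℂ) W] [AddCommGroup W']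
  [Module (PowerSeries ℂ) W'] (m : 𝒪 →ₗ[PowerSeries ℂ] W →ₗ[PowerSeries ℂ] W') {e : τ →₀ ℕ}
  (he : ∀ i, e i < p)

/-- The coefficient at the exponent `e` of a polynomial, paired with an element of `W`. -/
def polyCoeff (m : 𝒪 →ₗ[PowerSeries ℂ] W →ₗ[PowerSeries ℂ] W') (e : τ →₀ ℕ) (p : ℕ) :
    MvPolynomial τ 𝒪 →ₗ[PowerSeries ℂ] W →ₗ[PowerSeries ℂ] ModPow W' p :=
  (LinearMap.compRight (PowerSeries ℂ) (Submodule.mkQ _)).comp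
    (m.comp ((MvPolynomial.lcoeff 𝒪 e).restrictScalars (PowerSeries ℂ)))

theorem polyCoeff_apply (f : MvPolynomial τ 𝒪) (x : W) :
    polyCoeff m e p f x = Submodule.Quotient.mk (m (MvPolynomial.coeff e f) x) := rfl

/-- The coefficient at the exponent `e` of an element of a truncated polynomial ring, paired with an
element of `W`. -/
def truncCoeff : Trunc τ 𝒪 p ⊗[PowerSeries ℂ] W →ₗ[PowerSeries ℂ] ModPow W' p :=
  TensorProduct.lift
    ((Submodule.liftQ ((truncIdeal τ 𝒪 p).restrictScalars (PowerSeries ℂ)) (polyCoeff m e p)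
      (by
        intro f hf
        ext x
        obtain ⟨c, hc⟩ := hf e he
        rw [polyCoeff_apply, hc, ← Algebra.smul_def, map_smul, LinearMap.smul_apply,
          Submodule.Quotient.mk_smul, modPow_smul]
        rfl)).comp
      (Submodule.Quotient.restrictScalarsEquiv (PowerSeries ℂ) (truncIdeal τ 𝒪 p)).symm.toLinearMap)

theorem truncCoeff_mk (f : MvPolynomial τ 𝒪) (x : W) :
    truncCoeff m he (Ideal.Quotient.mk (truncIdeal τ 𝒪 p) f ⊗ₜ x) =
      Submodule.Quotient.mk (m (MvPolynomial.coeff e f) x) := rfl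

variable [Fintype τ]

/-- The monomials with exponents below `p` are separated by these functionals modulo `h ^ p`; so
evaluation at the truncated variables loses no coefficient in this range. -/
theorem truncCoeff_monomial (e' : τ →₀ ℕ) (c : 𝒪) (x : W) :
    truncCoeff m he (((∏ i, truncVar 𝒪 p i ^ e' i) * algebraMap 𝒪 (Trunc τ 𝒪 p) c) ⊗ₜ x) =
      if e' = e then Submodule.Quotient.mk (m c x) else 0 := by
  classical
  have : (∏ i, truncVar 𝒪 p i ^ e' i) * algebraMap 𝒪 (Trunc τ 𝒪 p) c =
      Ideal.Quotient.mk (truncIdeal τ 𝒪 p) (MvPolynomial.monomial e' c) := by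
    rw [MvPolynomial.monomial_eq, Finsupp.prod_fintype _ _ (fun _ => pow_zero _), map_mul,
      map_prod, mul_comm]
    simp only [map_pow]
    rfl
  rw [this, truncCoeff_mk, MvPolynomial.coeff_monomial]
  split_ifs with h
  · rfl
  · rw [map_zero, LinearMap.zero_apply, Submodule.Quotient.mk_zero]

end Trunc

/-! ### R-matrices over the ring of power series -/

section InVar

variable {τ : Type*} [Fintype τ] [DecidableEq τ] {A : Type*} [Semiring A]

theorem inVar_one (k : τ) : inVar k (1 : PowerSeries A) = 1 := by
  ext e
  rw [coeff_inVar, MvPowerSeries.coeff_one, PowerSeries.coeff_one]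
  by_cases he : e = 0
  · subst he; simp
  · rw [if_neg he]
    split_ifs with h1 h2
    · rw [h2] at h1
      exact absurd (by simpa using h1) he
    all_goals rfl

theorem inVar_mul (k : τ) (f g : PowerSeries A) : inVar k (f * g) = inVar k f * inVar k g := by
  ext e
  rw [coeff_inVar, MvPowerSeries.coeff_mul]
  split_ifs with h
  · rw [PowerSeries.coeff_mul]
    refine Finset.sum_bij_ne_zero (fun p _ _ => (Finsupp.single k p.1, Finsupp.single k p.2))
      ?_ ?_ ?_ ?_
    · intro p hp _
      rw [Finset.HasAntidiagonal.mem_antidiagonal] at hp ⊢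
      rw [← Finsupp.single_add, hp]
      exact h.symm
    · rintro ⟨a, b⟩ _ _ ⟨c, d⟩ _ _ hh
      rw [Prod.ext_iff] at hh
      exact Prod.ext (Finsupp.single_injective k hh.1) (Finsupp.single_injective k hh.2)
    · rintro ⟨a, b⟩ hp hne
      rw [Finset.HasAntidiagonal.mem_antidiagonal] at hp
      dsimp only at hp hne
      rw [coeff_inVar, coeff_inVar] at hne
      have ha : a = Finsupp.single k (a k) := by
        by_contra h'
        rw [if_neg h', zero_mul] at hne
        exact hne rfl
      have hb : b = Finsupp.single k (b k) := by
        by_contra h'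
        rw [if_neg h', mul_zero] at hne
        exact hne rfl
      refine ⟨(a k, b k), ?_, ?_, ?_⟩
      · rw [Finset.HasAntidiagonal.mem_antidiagonal, ← hp]; rfl
      · rwa [if_pos ha, if_pos hb] at hne
      · exact Prod.ext ha.symm hb.symm
    · intro p _ _
      rw [coeff_inVar, coeff_inVar, if_pos (by simp), if_pos (by simp)]
      simp
  · symm
    refine Finset.sum_eq_zero fun p hp => ?_
    rw [Finset.HasAntidiagonal.mem_antidiagonal] at hp
    rw [coeff_inVar, coeff_inVar]
    split_ifs with h1 h2
    · exfalso
      apply h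
      conv_lhs => rw [← hp, h1, h2]
      rw [← hp, Finsupp.add_apply, Finsupp.single_add]
    all_goals simp

theorem constantCoeff_inVar (k : τ) (f : PowerSeries A) :
    MvPowerSeries.constantCoeff (inVar k f) = PowerSeries.constantCoeff f := by
  rw [← MvPowerSeries.coeff_zero_eq_constantCoeff_apply, coeff_inVar]
  simp

end InVar

section ZSeries

variable {n m : ℕ}

/-- The constant term of a series over `ℂ(z)[[h]]`. -/
def zConst (n m : ℕ) : ZSeries n m →+* RatFunc ℂ :=
  (PowerSeries.constantCoeff (R := RatFunc ℂ)).comp MvPowerSeries.constantCoeff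

theorem isUnit_of_zConst {f : ZSeries n m} (h : zConst n m f ≠ 0) : IsUnit f := by
  rw [MvPowerSeries.isUnit_iff_constantCoeff, PowerSeries.isUnit_iff_constantCoeff]
  exact isUnit_iff_ne_zero.2 h

theorem constantCoeff_expSeries {S : Type*} [Semiring S] [Algebra ℂ S] (c : ℂ) :
    PowerSeries.constantCoeff (expSeries c S) = 1 := by
  rw [← PowerSeries.coeff_zero_eq_constantCoeff_apply, coeff_expSeries]
  simp

/-- `e^{c h}` in the ring of series. -/
def zQ (n m : ℕ) (c : ℂ) : ZSeries n m := MvPowerSeries.C (expSeries c (RatFunc ℂ))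

/-- `e^{c x}` for a variable `x`. -/
def zExp (c : ℂ) (b : Fin n ⊕ Fin m) : ZSeries n m :=
  inVar b (expSeries c (PowerSeries (RatFunc ℂ)))

/-- The element `z`. -/
def zVar (n m : ℕ) : ZSeries n m :=
  MvPowerSeries.C (PowerSeries.C (RatFunc.X : RatFunc ℂ))

theorem zConst_zQ (c : ℂ) : zConst n m (zQ n m c) = 1 := by
  rw [zConst, RingHom.comp_apply, zQ, MvPowerSeries.constantCoeff_C, constantCoeff_expSeries]

theorem zConst_zExp (c : ℂ) (b : Fin n ⊕ Fin m) : zConst n m (zExp c b) = 1 := by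
  rw [zConst, RingHom.comp_apply, zExp, constantCoeff_inVar, constantCoeff_expSeries, map_one]

theorem zConst_zVar : zConst n m (zVar n m) = RatFunc.X := by
  rw [zConst, RingHom.comp_apply, zVar, MvPowerSeries.constantCoeff_C,
    PowerSeries.constantCoeff_C]

theorem ratFunc_X_ne_one : (RatFunc.X : RatFunc ℂ) ≠ 1 := by
  rw [← RatFunc.algebraMap_X, ← map_one (algebraMap (Polynomial ℂ) (RatFunc ℂ))]
  intro h
  have h' := IsFractionRing.injective (Polynomial ℂ) (RatFunc ℂ) h
  simpa [Polynomial.coeff_one] using congrArg (Polynomial.coeff · 1) h'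

theorem zExp_mul (a c : ℂ) (b : Fin n ⊕ Fin m) : zExp a b * zExp c b = zExp (a + c) b := by
  rw [zExp, zExp, ← inVar_mul, expSeries_add, zExp]

theorem zExp_zero (b : Fin n ⊕ Fin m) : zExp 0 b = 1 := by
  rw [zExp, expSeries_zero, inVar_one]

theorem zQ_mul (a c : ℂ) : zQ n m a * zQ n m c = zQ n m (a + c) := by
  rw [zQ, zQ, ← map_mul, expSeries_add, zQ]

theorem zQ_zero : zQ n m 0 = 1 := by
  rw [zQ, expSeries_zero, map_one]

/-- The spectral parameters `z e^{u_i}` and `e^{v_j}`. -/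
def zParam : Fin n ⊕ Fin m → ZSeries n m
  | Sum.inl i => zVar n m * zExp 1 (Sum.inl i)
  | Sum.inr j => zExp 1 (Sum.inr j)

/-- The argument `z e^{u_i - v_j}` of the R-matrices. -/
def zArg (b c : Fin n ⊕ Fin m) : ZSeries n m := zVar n m * (zExp 1 b * zExp (-1) c)

/-- The factor between `R(z e^{u_i - v_j})` and `R̄(z e^{u_i}, e^{v_j})`. -/
def zNorm (b c : Fin n ⊕ Fin m) : ZSeries n m :=
  -zQ n m (1 / 2) * Ring.inverse (1 - zArg b c * zQ n m (1 / 2) ^ 2) * zExp (-1) c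

/-- With `h` and all variables set to zero the denominator becomes `1 - z`, which is nonzero in
`ℂ(z)`. -/
theorem isUnit_zDenom (b c : Fin n ⊕ Fin m) : IsUnit (1 - zArg b c * zQ n m (1 / 2) ^ 2) := by
  apply isUnit_of_zConst
  rw [zArg, map_sub, map_one, map_mul, map_mul, map_mul, map_pow, zConst_zQ, zConst_zExp,
    zConst_zExp, zConst_zVar, mul_one, one_pow, mul_one, mul_one, sub_ne_zero]
  exact ratFunc_X_ne_one.symm

theorem isUnit_zNorm (b c : Fin n ⊕ Fin m) : IsUnit (zNorm b c) := by
  refine IsUnit.mul (IsUnit.mul (IsUnit.neg ?_) ?_) ?_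
  · apply isUnit_of_zConst
    rw [zConst_zQ]; exact one_ne_zero
  · exact IsUnit.of_mul_eq_one _ (Ring.inverse_mul_cancel _ (isUnit_zDenom b c))
  · apply isUnit_of_zConst
    rw [zConst_zExp]; exact one_ne_zero

variable (N : ℕ)

/-- `R̄` is homogeneous of degree one in its two parameters, so a matrix in the ratio `z e^{u_i -
v_j}` can be rewritten with one parameter per slot, as the Yang-Baxter equation requires. -/
theorem rFactor_eq (i : Fin n) (j : Fin m) : rFactor N i j =
    zNorm (Sum.inl i) (Sum.inr j) •
      rb N (zQ n m (1 / 2)) (zQ n m (-1 / 2)) zParam (Sum.inl i) (Sum.inr j) := by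
  have e : trigRBar N (zQ n m (1 / 2)) (zQ n m (-1 / 2)) (zArg (Sum.inl i) (Sum.inr j)) 1 =
      zExp (n := n) (-1) (Sum.inr j) • trigRBar N (zQ n m (1 / 2)) (zQ n m (-1 / 2))
        (zParam (Sum.inl i)) (zParam (Sum.inr j)) := by
    rw [← trigRBar_smul]
    congr 1
    · rw [zArg, zParam]; ring
    · rw [zParam, zExp_mul, neg_add_cancel, zExp_zero]
  have e2 : rFactor N i j = leg₂ (Sum.inl i) (Sum.inr j) (trigR N (zQ n m (1 / 2))
    (zQ n m (-1 / 2)) (zArg (Sum.inl i) (Sum.inr j))) := rfl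
  rw [e2, trigR, e, smul_smul, leg₂_smul]
  rfl

/-- The tensor factors of the first group. -/
def slotsL (n m : ℕ) : List (Fin n ⊕ Fin m) := (List.finRange n).map Sum.inl

/-- The tensor factors of the second group. -/
def slotsR (n m : ℕ) : List (Fin n ⊕ Fin m) := (List.finRange m).map Sum.inr

theorem rNM_eq : rNM N n m = crossR (zQ n m (1 / 2)) (zQ n m (-1 / 2)) zParam zNorm N
    (slotsL n m) (slotsR n m).reverse := by
  rw [rNM, crossR, crossProd, slotsL, slotsR, ← List.map_reverse]
  simp only [List.map_map, Function.comp_def, rFactor_eq]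

theorem rNMBar_eq : rNMBar N n m = crossR (zQ n m (1 / 2)) (zQ n m (-1 / 2)) zParam zNorm N
    (slotsL n m).reverse (slotsR n m) := by
  rw [rNMBar, crossR, crossProd, slotsL, slotsR, ← List.map_reverse]
  simp only [List.map_map, Function.comp_def, rFactor_eq]

/-- By unitarity the opposite R-matrix is an inverse up to a scalar, whose constant term is `(z - 1)
* (1 - z)`. -/
theorem isUnit_rFactor (i : Fin n) (j : Fin m) : IsUnit (rFactor N i j) := by
  have hq : zQ n m (1 / 2) * zQ n m (-1 / 2) = 1 := by
    rw [zQ_mul, ← zQ_zero]; congr 1; ring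
  have h := rb_unitarity (N := N) (zQ n m (1 / 2)) (zQ n m (-1 / 2)) zParam (Sum.inl i)
    (Sum.inr j) hq
  have hz : zConst n m (zParam (Sum.inl i)) = RatFunc.X := by
    rw [zParam, map_mul, zConst_zVar, zConst_zExp, mul_one]
  have hz' : zConst n m (zParam (Sum.inr j)) = 1 := by
    rw [zParam, zConst_zExp]
  have hu : IsUnit ((zParam (Sum.inl i) * zQ n m (-1 / 2) - zParam (Sum.inr j) * zQ n m (1 / 2)) *
      (zParam (Sum.inr j) * zQ n m (-1 / 2) - zParam (Sum.inl i) * zQ n m (1 / 2))) := by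
    apply isUnit_of_zConst
    rw [map_mul, map_sub, map_sub, map_mul, map_mul, map_mul, map_mul, zConst_zQ, zConst_zQ, hz,
      hz', mul_one, mul_one]
    exact mul_ne_zero (sub_ne_zero.2 ratFunc_X_ne_one) (sub_ne_zero.2 ratFunc_X_ne_one.symm)
  obtain ⟨g, hg⟩ := (isUnit_zNorm (Sum.inl i : Fin n ⊕ Fin m) (Sum.inr j)).exists_right_inv
  obtain ⟨u, hu⟩ := hu.exists_right_inv
  refine IsUnit.of_mul_eq_one ((g * u) • rb N (zQ n m (1 / 2)) (zQ n m (-1 / 2)) zParam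
    (Sum.inr j) (Sum.inl i)) ?_
  rw [rFactor_eq, smul_mul_smul_comm, h, smul_smul]
  refine Eq.trans (congrArg (· • _) (?_ : _ = (1 : ZSeries n m))) (one_smul _ _)
  linear_combination (g * zNorm (Sum.inl i) (Sum.inr j)) * hu + hg

theorem list_prod_isUnit {M : Type*} [Monoid M] {l : List M} (h : ∀ x ∈ l, IsUnit x) :
    IsUnit l.prod := by
  induction l with
  | nil => exact isUnit_one
  | cons a l ih =>
    rw [List.prod_cons]
    exact (h a (by simp)).mul (ih fun x hx => h x (by simp [hx]))

theorem isUnit_rNM : IsUnit (rNM N n m) := by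
  refine list_prod_isUnit fun x hx => ?_
  obtain ⟨i, _, rfl⟩ := List.mem_map.1 hx
  refine list_prod_isUnit fun x hx => ?_
  obtain ⟨j, _, rfl⟩ := List.mem_map.1 hx
  exact isUnit_rFactor N i j

theorem isUnit_rNMBar : IsUnit (rNMBar N n m) := by
  refine list_prod_isUnit fun x hx => ?_
  obtain ⟨i, _, rfl⟩ := List.mem_map.1 hx
  refine list_prod_isUnit fun x hx => ?_
  obtain ⟨j, _, rfl⟩ := List.mem_map.1 hx
  exact isUnit_rFactor N i j

end ZSeries

/-! ### Permutations of the tensor factors -/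

section Reindex

variable {N : ℕ} {τ : Type*} [Fintype τ] [DecidableEq τ]

/-- The permutation of the index set of matrices induced by a permutation of the tensor factors. -/
def slotReindex (N : ℕ) (ε : Equiv.Perm τ) : (τ → Fin N) ≃ (τ → Fin N) :=
  Equiv.arrowCongr ε.symm (Equiv.refl _)

theorem slotReindex_apply (ε : Equiv.Perm τ) (I : τ → Fin N) (b : τ) :
    slotReindex N ε I b = I (ε b) := by
  simp [slotReindex]

theorem leg_reindex {S : Type*} [Zero S] (ε : Equiv.Perm τ) (b : τ) (M : Matrix (Fin N) (Fin N) S) :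
    leg (ε b) M = (leg b M).submatrix (slotReindex N ε) (slotReindex N ε) := by
  ext I J
  rw [Matrix.submatrix_apply, leg, leg]
  simp only [slotReindex_apply]
  have h : (∀ c, c ≠ ε b → I c = J c) ↔ ∀ c, c ≠ b → I (ε c) = J (ε c) :=
    ⟨fun h c hc => h _ (ε.injective.ne hc), fun h c hc => by
      have := h (ε.symm c) (fun h' => hc (by rw [← h', Equiv.apply_symm_apply]))
      rwa [Equiv.apply_symm_apply] at this⟩
  simp only [h]

theorem leg₂_reindex {S : Type*} [Zero S] (ε : Equiv.Perm τ) (a b : τ)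
    (M : Matrix (Fin N × Fin N) (Fin N × Fin N) S) :
    leg₂ (ε a) (ε b) M = (leg₂ a b M).submatrix (slotReindex N ε) (slotReindex N ε) := by
  ext I J
  rw [Matrix.submatrix_apply, leg₂, leg₂]
  simp only [slotReindex_apply]
  have h : (∀ c, c ≠ ε a → c ≠ ε b → I c = J c) ↔ ∀ c, c ≠ a → c ≠ b → I (ε c) = J (ε c) :=
    ⟨fun h c hc hc' => h _ (ε.injective.ne hc) (ε.injective.ne hc'), fun h c hc hc' => by
      have := h (ε.symm c) (fun h' => hc (by rw [← h', Equiv.apply_symm_apply]))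
        (fun h' => hc' (by rw [← h', Equiv.apply_symm_apply]))
      rwa [Equiv.apply_symm_apply] at this⟩
  simp only [h]

theorem list_prod_submatrix {n S : Type*} [Fintype n] [DecidableEq n] [Semiring S] (f : n ≃ n)
    (l : List (Matrix n n S)) :
    l.prod.submatrix f f = (l.map fun X => X.submatrix f f).prod := by
  induction l with
  | nil => simp
  | cons X l ih => rw [List.map_cons, List.prod_cons, List.prod_cons, ← ih,
      Matrix.submatrix_mul_equiv]

theorem prodL_reindex {E : Type*} [Ring E] (ε : Equiv.Perm τ)
    (L : τ → Matrix (Fin N) (Fin N) E) (l : List τ) :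
    prodL L (l.map ε) =
      (prodL (fun b => L (ε b)) l).submatrix (slotReindex N ε) (slotReindex N ε) := by
  simp only [prodL, list_prod_submatrix, List.map_map, Function.comp_def, leg_reindex]

variable {S : Type*} [CommRing S] (q q' : S)

theorem crossR_reindex (ε : Equiv.Perm τ) (ζ : τ → S) (G : τ → τ → S) (l l' : List τ) :
    crossR q q' ζ G N (l.map ε) (l'.map ε) =
      (crossR q q' (fun b => ζ (ε b)) (fun b c => G (ε b) (ε c)) N l l').submatrix
        (slotReindex N ε) (slotReindex N ε) := by
  simp only [crossR, crossProd, list_prod_submatrix, List.map_map, Function.comp_def, rb,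
    leg₂_reindex, Matrix.submatrix_smul, Pi.smul_apply]

theorem crossR_map {S' : Type*} [CommRing S'] (f : S →+* S') (ζ : τ → S) (G : τ → τ → S)
    (l l' : List τ) : (crossR q q' ζ G N l l').map f =
      crossR (f q) (f q') (fun b => f (ζ b)) (fun b c => f (G b c)) N l l' := by
  have := crossProd_map f.mapMatrix (fun b c => G b c • rb N q q' ζ b c) l l'
  rw [RingHom.mapMatrix_apply] at this
  refine this.trans ?_
  rw [crossR]
  congr 1
  funext b c
  rw [← rb_map]
  exact Matrix.ext fun I J => map_mul f _ _

end Reindex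

/-! ### The braiding at nilpotent parameters -/

section Nil

variable {n m : ℕ} {S : Type*} [CommRing S] [Algebra (PowerSeries (RatFunc ℂ)) S]
  [Algebra (PowerSeries ℂ) S] [IsScalarTower (PowerSeries ℂ) (PowerSeries (RatFunc ℂ)) S]

theorem algebraMap_ratFunc (f : PowerSeries ℂ) :
    algebraMap (PowerSeries ℂ) (PowerSeries (RatFunc ℂ)) f =
      PowerSeries.map (algebraMap ℂ (RatFunc ℂ)) f := rfl

variable (S) in
/-- The element `z` of a `ℂ(z)[[h]]`-algebra. -/
def nilZ : S := algebraMap (PowerSeries (RatFunc ℂ)) S (PowerSeries.C RatFunc.X)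

variable {B : ℕ} {t : Fin n ⊕ Fin m → S} (ht : ∀ b, t b ^ B = 0)

/-- The spectral parameters `z e^{t_i}` and `e^{t_j}` at nilpotent elements. -/
def nilParam (b : Fin n ⊕ Fin m) : S := (bif b.isLeft then nilZ S else 1) * expNil 1 (ht b)

/-- The normalization factors of the R-matrices at nilpotent elements. -/
def nilNorm (b c : Fin n ⊕ Fin m) : S :=
  -qExp S (1 / 2) * Ring.inverse (1 - nilZ S * (expNil 1 (ht b) * expNil (-1) (ht c)) *
    qExp S (1 / 2) ^ 2) * expNil (-1) (ht c)

/-- The value of a series over `ℂ(z)[[h]]` at nilpotent elements. -/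
def evZ : ZSeries n m →+* S := evNil (algebraMap (PowerSeries (RatFunc ℂ)) S) ht

theorem evZ_zQ (c : ℂ) : evZ ht (zQ n m c) = qExp S c := by
  rw [evZ, zQ, evNil_C, qExp, IsScalarTower.algebraMap_apply (PowerSeries ℂ)
    (PowerSeries (RatFunc ℂ)) S, algebraMap_ratFunc, expSeries_map _ fun _ => rfl]

theorem evZ_zVar : evZ ht (zVar n m) = nilZ S := by
  rw [evZ, zVar, evNil_C, nilZ]

theorem evZ_zExp (c : ℂ) (b : Fin n ⊕ Fin m) : evZ ht (zExp c b) = expNil c (ht b) := by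
  rw [evZ, zExp, evNil_inVar _ _ _ _ (pow_smul_eq_zero (ht b)), expNil_eq, evNil₁_apply,
    evNil₁_apply]
  refine Finset.sum_congr rfl fun k _ => ?_
  rw [coeff_expSeries, coeff_expSeries, numMap, RingHom.comp_apply,
    IsScalarTower.algebraMap_apply (PowerSeries ℂ) (PowerSeries (RatFunc ℂ)) S, algebraMap_ratFunc,
    PowerSeries.map_C, PowerSeries.algebraMap_apply]
  rfl

theorem evZ_zParam (b : Fin n ⊕ Fin m) : evZ ht (zParam b) = nilParam ht b := by
  rcases b with i | j
  · rw [zParam, map_mul, evZ_zVar, evZ_zExp]; rfl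
  · rw [zParam, evZ_zExp]; exact (one_mul _).symm

theorem map_ringInverse {R R' : Type*} [CommRing R] [CommRing R'] (f : R →+* R') {x : R}
    (hx : IsUnit x) : f (Ring.inverse x) = Ring.inverse (f x) := by
  obtain ⟨u, rfl⟩ := hx
  rw [Ring.inverse_unit, ← MonoidHom.coe_coe, ← Units.coe_map, map_inv, ← Ring.inverse_unit]
  rfl

theorem evZ_zNorm (b c : Fin n ⊕ Fin m) : evZ ht (zNorm b c) = nilNorm ht b c := by
  rw [zNorm, map_mul, map_mul, map_neg, map_ringInverse _ (isUnit_zDenom b c), map_sub, map_one,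
    map_mul, map_pow, zArg, map_mul, map_mul, evZ_zExp, evZ_zExp, evZ_zVar, evZ_zQ]
  rfl

/-- The product of the R-matrices between two lists of tensor factors, at nilpotent elements. -/
def nilR (N : ℕ) (l l' : List (Fin n ⊕ Fin m)) :
    Matrix (Fin n ⊕ Fin m → Fin N) (Fin n ⊕ Fin m → Fin N) S :=
  crossR (qExp S (1 / 2)) (qExp S (-1 / 2)) (nilParam ht) (nilNorm ht) N l l'

theorem map_evZ_crossR (N : ℕ) (l l' : List (Fin n ⊕ Fin m)) :
    (crossR (zQ n m (1 / 2)) (zQ n m (-1 / 2)) zParam zNorm N l l').map (evZ ht) =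
      nilR ht N l l' := by
  rw [crossR_map, nilR, evZ_zQ, evZ_zQ, funext (evZ_zParam ht)]
  congr 1
  funext b c
  exact evZ_zNorm ht b c

variable {N : ℕ}

variable (N S) in
/-- The map from `V(R) ⊗ V(R) ⊗ ℂ(z)[[h]]` to `V(R) ⊗ V(R)` with scalars in `S`. -/
def vvzMap : VVz N →ₐ[PowerSeries ℂ] S ⊗[PowerSeries ℂ] VV N :=
  Algebra.TensorProduct.lift Algebra.TensorProduct.includeRight
    ((Algebra.TensorProduct.includeLeft : S →ₐ[PowerSeries ℂ] S ⊗[PowerSeries ℂ] VV N).comp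
      (IsScalarTower.toAlgHom (PowerSeries ℂ) (PowerSeries (RatFunc ℂ)) S))
    fun _ _ => by
      rw [commute_iff_eq]
      simp [Algebra.TensorProduct.tmul_mul_tmul]

theorem vvzMap_tmul (x : VV N) (c : PowerSeries (RatFunc ℂ)) :
    vvzMap S N (x ⊗ₜ c) = algebraMap (PowerSeries (RatFunc ℂ)) S c ⊗ₜ x := by
  simp [vvzMap]

/-- The value of a series with coefficients in `V(R) ⊗ V(R) ⊗ ℂ(z)[[h]]` at nilpotent elements. -/
def evV (N : ℕ) : MvPowerSeries (Fin n ⊕ Fin m) (VVz N) →+* S ⊗[PowerSeries ℂ] VV N :=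
  evNil (vvzMap S N).toRingHom ht

theorem evV_scalarMap (f : ZSeries n m) :
    evV ht N (scalarMap N n m f) = algebraMap S (S ⊗[PowerSeries ℂ] VV N) (evZ ht f) := by
  rw [evV, scalarMap, evNil_map, evZ, evNil_apply, evNil_apply, map_sum]
  refine Finset.sum_congr rfl fun e _ => ?_
  rw [smul_eq_mul, map_mul, Algebra.smul_def]
  congr 1
  exact vvzMap_tmul _ _

/-- The map `x ↦ 1 ⊗ x` as a ring homomorphism. -/
def toBase (S W : Type*) [CommRing S] [Algebra (PowerSeries ℂ) S] [Ring W]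
    [Algebra (PowerSeries ℂ) W] : W →+* S ⊗[PowerSeries ℂ] W :=
  (Algebra.TensorProduct.includeRight : W →ₐ[PowerSeries ℂ] S ⊗[PowerSeries ℂ] W).toRingHom

theorem evV_vectorMap (f : MvPowerSeries (Fin n ⊕ Fin m) (VV N)) :
    evV ht N (vectorMap N n m f) = evNil (toBase S (VV N)) ht f := by
  rw [evV, vectorMap, evNil_map, evNil_apply, evNil_apply]
  refine Finset.sum_congr rfl fun e _ => ?_
  congr 1
  refine (vvzMap_tmul _ _).trans ?_
  rw [map_one]
  rfl

variable {W : Type*} [Ring W] [Algebra (PowerSeries ℂ) W]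

/-- The generators which belong to a tensor factor. -/
def slotGen (γ γ' : ℕ → Fin N → Fin N → W) (b : Fin n ⊕ Fin m) : ℕ → Fin N → Fin N → W :=
  bif b.isLeft then γ else γ'

/-- The matrix `L_{[n]}(u) L_{[m]}(v)` for two families of generators. -/
def lGen (γ γ' : ℕ → Fin N → Fin N → W) (n m : ℕ) :
    Matrix (Fin n ⊕ Fin m → Fin N) (Fin n ⊕ Fin m → Fin N)
      (MvPowerSeries (Fin n ⊕ Fin m) W) :=
  prodL (fun b => Matrix.of fun a c => inVar b (PowerSeries.mk fun r => slotGen γ γ' b r a c))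
    (slotsL n m) *
  prodL (fun b => Matrix.of fun a c => inVar b (PowerSeries.mk fun r => slotGen γ γ' b r a c))
    (slotsR n m)

theorem lNM_eq : lNM N n m = lGen (fun r a c => gen r a c ⊗ₜ[PowerSeries ℂ] (1 : VR N))
    (fun r a c => (1 : VR N) ⊗ₜ[PowerSeries ℂ] gen r a c) n m := by
  rw [lGen, prodL, prodL, slotsL, slotsR, List.map_map, List.map_map]
  rfl

/-- The L-operators at nilpotent elements. -/
def nilL (γ γ' : ℕ → Fin N → Fin N → W) (b : Fin n ⊕ Fin m) :
    Matrix (Fin N) (Fin N) (S ⊗[PowerSeries ℂ] W) :=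
  Matrix.of fun a c => evNil₁ (toBase S W) (pow_smul_eq_zero (ht b))
    (PowerSeries.mk fun r => slotGen γ γ' b r a c)

theorem map_prodL {A E τ : Type*} [Fintype τ] [DecidableEq τ] [Ring A] [Ring E] (f : A →+* E)
    (L : τ → Matrix (Fin N) (Fin N) A) (l : List τ) :
    (prodL L l).map f = prodL (fun b => (L b).map f) l := by
  have := map_list_prod f.mapMatrix (l.map fun b => leg b (L b))
  rw [RingHom.mapMatrix_apply, List.map_map] at this
  refine this.trans ?_
  rw [prodL]
  congr 1
  refine List.map_congr_left fun b _ => ?_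
  exact leg_map f (map_zero f) b (L b)

theorem map_lGen (γ γ' : ℕ → Fin N → Fin N → W) :
    (lGen γ γ' n m).map (evNil (toBase S W) ht) =
      prodL (nilL ht γ γ') (slotsL n m) * prodL (nilL ht γ γ') (slotsR n m) := by
  have h : ∀ b : Fin n ⊕ Fin m, (Matrix.of fun a c => inVar b (PowerSeries.mk fun r =>
      slotGen γ γ' b r a c)).map (evNil (toBase S W) ht) = nilL ht γ γ' b := fun b =>
    Matrix.ext fun a c => evNil_inVar _ ht _ _ (pow_smul_eq_zero (ht b))
  rw [lGen, Matrix.map_mul, map_prodL, map_prodL, funext h]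

variable (N) in
/-- The L-operators of `V(R) ⊗ V(R)` at nilpotent elements. -/
def nilLV : Fin n ⊕ Fin m → Matrix (Fin N) (Fin N) (S ⊗[PowerSeries ℂ] VV N) :=
  nilL ht (fun r a c => gen r a c ⊗ₜ[PowerSeries ℂ] (1 : VR N))
    (fun r a c => (1 : VR N) ⊗ₜ[PowerSeries ℂ] gen r a c)

/-- Evaluation is a ring homomorphism, so the inverse over the power series ring specializes to an
inverse at the nilpotent elements. -/
theorem exists_nilR_inverse : ∃ Q, nilR ht N (slotsL n m) (slotsR n m).reverse * Q = 1 ∧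
    Q * nilR ht N (slotsL n m) (slotsR n m).reverse = 1 ∧
    (braidedLNM N n m).map (evV ht N) =
      sc N _ _ (nilR ht N (slotsL n m).reverse (slotsR n m)) *
        (prodL (nilLV ht N) (slotsL n m) * prodL (nilLV ht N) (slotsR n m)) * sc N _ _ Q := by
  have hu := (Matrix.isUnit_iff_isUnit_det _).1 (isUnit_rNM (n := n) (m := m) N)
  refine ⟨(rNM N n m)⁻¹.map (evZ ht), ?_, ?_, ?_⟩
  · rw [← map_evZ_crossR, ← rNM_eq, ← Matrix.map_mul, Matrix.mul_nonsing_inv _ hu,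
      Matrix.map_one _ (map_zero _) (map_one _)]
  · rw [← map_evZ_crossR, ← rNM_eq, ← Matrix.map_mul, Matrix.nonsing_inv_mul _ hu,
      Matrix.map_one _ (map_zero _) (map_one _)]
  · have hs : ∀ X : Matrix (Fin n ⊕ Fin m → Fin N) (Fin n ⊕ Fin m → Fin N) (ZSeries n m),
        (X.map (scalarMap N n m)).map (evV ht N) =
          sc N _ (S ⊗[PowerSeries ℂ] VV N) (X.map (evZ ht)) := fun X =>
      Matrix.ext fun I J => evV_scalarMap ht _
    have hv : ((lNM N n m).map (vectorMap N n m)).map (evV ht N) =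
        (lNM N n m).map (evNil (toBase S (VV N)) ht) :=
      Matrix.ext fun I J => evV_vectorMap ht _
    rw [braidedLNM, Matrix.map_mul, Matrix.map_mul, hs, hs, hv, lNM_eq, map_lGen, rNMBar_eq,
      map_evZ_crossR]
    rfl

/-- An `𝒪`-linear map which sends the coefficients of `L_{[n]}(u) L_{[m]}(v)` to those of the
braided product does the same for the values at nilpotent elements. -/
theorem liftBaseChange_prodL {γ γ' : ℕ → Fin N → Fin N → W}
    (G : W →ₗ[PowerSeries ℂ] S ⊗[PowerSeries ℂ] VV N)
    (hG : ∀ I J e, G (MvPowerSeries.coeff e (lGen γ γ' n m I J)) =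
      vvzMap S N (MvPowerSeries.coeff e (braidedLNM N n m I J))) (I J : Fin n ⊕ Fin m → Fin N) :
    G.liftBaseChange S ((prodL (nilL ht γ γ') (slotsL n m) *
      prodL (nilL ht γ γ') (slotsR n m)) I J) = (braidedLNM N n m).map (evV ht N) I J := by
  rw [← map_lGen, Matrix.map_apply, Matrix.map_apply, evV, evNil_apply, evNil_apply, map_sum]
  refine Finset.sum_congr rfl fun e _ => ?_
  rw [map_smul]
  congr 1
  refine (LinearMap.liftBaseChange_tmul _ _ _ _).trans ?_
  rw [one_smul, hG]
  rfl

theorem nilR_perm {ε : Equiv.Perm (Fin n ⊕ Fin m)} (hε : ∀ b, (ε b).isLeft = b.isLeft)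
    (l l' : List (Fin n ⊕ Fin m)) : nilR ht N (l.map ε) (l'.map ε) =
      (nilR (fun b => ht (ε b)) N l l').submatrix (slotReindex N ε) (slotReindex N ε) := by
  rw [nilR, crossR_reindex, nilR]
  congr 2
  funext b
  rw [nilParam, nilParam, hε]

theorem prodL_nilL_perm (γ γ' : ℕ → Fin N → Fin N → W) {ε : Equiv.Perm (Fin n ⊕ Fin m)}
    (hε : ∀ b, (ε b).isLeft = b.isLeft) (l : List (Fin n ⊕ Fin m)) :
    prodL (nilL ht γ γ') (l.map ε) = (prodL (nilL (fun b => ht (ε b)) γ γ') l).submatrix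
      (slotReindex N ε) (slotReindex N ε) := by
  rw [prodL_reindex]
  congr 2
  funext b
  rw [nilL, nilL, slotGen, slotGen, hε]

/-- The same for a permutation of the factors in the two groups. -/
theorem liftBaseChange_prodL_perm {γ γ' : ℕ → Fin N → Fin N → W}
    (G : W →ₗ[PowerSeries ℂ] S ⊗[PowerSeries ℂ] VV N)
    (hG : ∀ I J e, G (MvPowerSeries.coeff e (lGen γ γ' n m I J)) =
      vvzMap S N (MvPowerSeries.coeff e (braidedLNM N n m I J)))
    (ε : Equiv.Perm (Fin n ⊕ Fin m)) (hε : ∀ b, (ε b).isLeft = b.isLeft) :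
    ∃ Q, nilR ht N ((slotsL n m).map ε) ((slotsR n m).map ε).reverse * Q = 1 ∧
      Q * nilR ht N ((slotsL n m).map ε) ((slotsR n m).map ε).reverse = 1 ∧
      (prodL (nilL ht γ γ') ((slotsL n m).map ε) *
        prodL (nilL ht γ γ') ((slotsR n m).map ε)).map (G.liftBaseChange S) =
      sc N _ _ (nilR ht N ((slotsL n m).map ε).reverse ((slotsR n m).map ε)) *
        (prodL (nilLV ht N) ((slotsL n m).map ε) * prodL (nilLV ht N) ((slotsR n m).map ε)) *
        sc N _ _ Q := by
  obtain ⟨Q, h1, h2, h3⟩ := exists_nilR_inverse (N := N) (fun b => ht (ε b))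
  have h4 := liftBaseChange_prodL (fun b => ht (ε b)) G hG
  have hsc : ∀ X : Matrix (Fin n ⊕ Fin m → Fin N) (Fin n ⊕ Fin m → Fin N) S,
      sc N _ (S ⊗[PowerSeries ℂ] VV N) (X.submatrix (slotReindex N ε) (slotReindex N ε)) =
        (sc N _ _ X).submatrix (slotReindex N ε) (slotReindex N ε) := fun _ => rfl
  refine ⟨Q.submatrix (slotReindex N ε) (slotReindex N ε), ?_, ?_, ?_⟩
  · rw [← List.map_reverse, nilR_perm ht hε, Matrix.submatrix_mul_equiv, h1, Matrix.submatrix_one_equiv]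
  · rw [← List.map_reverse, nilR_perm ht hε, Matrix.submatrix_mul_equiv, h2, Matrix.submatrix_one_equiv]
  · rw [← List.map_reverse, nilR_perm ht hε, nilLV, prodL_nilL_perm ht _ _ hε, prodL_nilL_perm ht _ _ hε,
      prodL_nilL_perm ht _ _ hε, prodL_nilL_perm ht _ _ hε, hsc, hsc, Matrix.submatrix_mul_equiv,
      Matrix.submatrix_mul_equiv, Matrix.submatrix_mul_equiv, Matrix.submatrix_mul_equiv]
    refine Matrix.ext fun I J => ?_
    refine (h4 (slotReindex N ε I) (slotReindex N ε J)).trans ?_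
    rw [h3]
    rfl

end Nil

/-! ### Linear maps on the free topological algebra -/

section FreeTopLift

variable {N : ℕ}

/-- The words in the generators. -/
abbrev WordList (N : ℕ) : Type := FreeMonoid (ℕ × Fin N × Fin N)

/-- The basis of words of the free algebra. -/
def wordsBasis (N : ℕ) : Module.Basis (WordList N) ℂ (Words N) :=
  FreeAlgebra.basisFreeMonoid ℂ _

theorem wordsBasis_apply (w : WordList N) :
    wordsBasis N w = (w.toList.map (FreeAlgebra.ι ℂ)).prod := by
  refine Eq.trans (?_ : _ = FreeAlgebra.equivMonoidAlgebraFreeMonoid.symm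
    (MonoidAlgebra.of ℂ (WordList N) w)) ?_
  · rfl
  · refine (MonoidAlgebra.lift_of (R := ℂ) (FreeMonoid.lift (FreeAlgebra.ι ℂ)) w).trans ?_
    rw [FreeMonoid.lift_apply]

/-- The element of the free topological algebra which corresponds to a word. -/
def wordTop (w : WordList N) : FreeTop N := PowerSeries.C (wordsBasis N w)

variable {Y : Type*} [AddCommGroup Y] [Module (PowerSeries ℂ) Y]

/-- The additive extension of a map on words to the free algebra. -/
def wordsLift (b : WordList N → Y) : Words N →+ Y :=
  (Finsupp.liftAddHom fun w => ((smulAddHom (PowerSeries ℂ) Y).flip (b w)).comp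
    (PowerSeries.C (R := ℂ)).toAddMonoidHom).comp (wordsBasis N).repr.toLinearMap.toAddMonoidHom

theorem wordsLift_apply (b : WordList N → Y) (x : Words N) :
    wordsLift b x = ((wordsBasis N).repr x).sum fun w c => PowerSeries.C c • b w := rfl

theorem wordsLift_basis (b : WordList N → Y) (w : WordList N) :
    wordsLift b (wordsBasis N w) = b w := by
  rw [wordsLift_apply, Module.Basis.repr_self, Finsupp.sum_single_index]
  · rw [map_one, one_smul]
  · rw [map_zero, zero_smul]

theorem wordsLift_smul (b : WordList N → Y) (c : ℂ) (x : Words N) :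
    wordsLift b (c • x) = PowerSeries.C c • wordsLift b x := by
  rw [wordsLift_apply, wordsLift_apply, map_smul, Finsupp.sum_smul_index, Finsupp.smul_sum]
  · simp only [map_mul, mul_smul]
  · intro w; rw [map_zero, zero_smul]

variable {p : ℕ} (hY : ∀ y : Y, (PowerSeries.X : PowerSeries ℂ) ^ p • y = 0)

/-- The extension of a map on words to the free topological algebra, as an additive map. -/
def freeTopLiftAux (p : ℕ) (b : WordList N → Y) : FreeTop N →+ Y where
  toFun f := ∑ k ∈ Finset.range p, (PowerSeries.X : PowerSeries ℂ) ^ k •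
    wordsLift b (PowerSeries.coeff k f)
  map_zero' := by simp
  map_add' f g := by simp [smul_add, Finset.sum_add_distrib]

theorem freeTopLiftAux_apply (b : WordList N → Y) (f : FreeTop N) :
    freeTopLiftAux p b f = ∑ k ∈ Finset.range p, (PowerSeries.X : PowerSeries ℂ) ^ k •
      wordsLift b (PowerSeries.coeff k f) := rfl

theorem freeTopLiftAux_C_smul (b : WordList N → Y) (c : ℂ) (f : FreeTop N) :
    freeTopLiftAux p b ((PowerSeries.C c : PowerSeries ℂ) • f) =
      (PowerSeries.C c : PowerSeries ℂ) • freeTopLiftAux p b f := by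
  rw [freeTopLiftAux_apply, freeTopLiftAux_apply, Finset.smul_sum]
  refine Finset.sum_congr rfl fun k _ => ?_
  rw [smul_comm, ← wordsLift_smul, Algebra.smul_def, Algebra.smul_def]
  congr 2
  have : algebraMap (PowerSeries ℂ) (FreeTop N) (PowerSeries.C c) =
    PowerSeries.C (algebraMap ℂ (Words N) c) := PowerSeries.map_C _ _
  rw [this, PowerSeries.coeff_C_mul]

include hY in
theorem freeTopLiftAux_X_smul (b : WordList N → Y) (f : FreeTop N) :
    freeTopLiftAux p b ((PowerSeries.X : PowerSeries ℂ) • f) =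
      (PowerSeries.X : PowerSeries ℂ) • freeTopLiftAux p b f := by
  rw [freeTopLiftAux_apply, freeTopLiftAux_apply, Finset.smul_sum, Algebra.smul_def,
    freeTop_algebraMap_X]
  rcases p with _ | p
  · simp
  rw [Finset.sum_range_succ', Finset.sum_range_succ _ p]
  simp only [smul_smul, ← pow_succ', hY, add_zero, PowerSeries.coeff_zero_X_mul, map_zero, smul_zero,
    PowerSeries.coeff_succ_X_mul]

include hY in
theorem freeTopLiftAux_smul (b : WordList N → Y) (a : PowerSeries ℂ) (f : FreeTop N) :
    freeTopLiftAux p b (a • f) = a • freeTopLiftAux p b f := by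
  have hX : ∀ k (f : FreeTop N), freeTopLiftAux p b ((PowerSeries.X : PowerSeries ℂ) ^ k • f) =
      (PowerSeries.X : PowerSeries ℂ) ^ k • freeTopLiftAux p b f := by
    intro k
    induction k with
    | zero => simp
    | succ k ih =>
      intro f
      rw [pow_succ', mul_smul, freeTopLiftAux_X_smul hY, ih, ← mul_smul]
  -- Linearity over the constants and over `h` is known. Multiplied by `h ^ p` both sides vanish;
  -- writing a scalar as its constant term plus a multiple of `h` removes one power of `h` at each
  -- step, down to none.
  have key : ∀ j ≤ p, ∀ a : PowerSeries ℂ,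
      (PowerSeries.X : PowerSeries ℂ) ^ (p - j) • freeTopLiftAux p b (a • f) =
        (PowerSeries.X : PowerSeries ℂ) ^ (p - j) • a • freeTopLiftAux p b f := by
    intro j
    induction j with
    | zero => intro _ a; rw [Nat.sub_zero, hY, hY]
    | succ j ih =>
      intro hj a
      have h := PowerSeries.X_dvd_iff (φ := a - PowerSeries.C (PowerSeries.constantCoeff a)).2
        (by rw [map_sub, PowerSeries.constantCoeff_C, sub_self])
      obtain ⟨a', ha⟩ := h
      have e := ih (by omega) a'
      rw [show p - j = p - (j + 1) + 1 by omega, pow_succ, mul_smul, mul_smul,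
        ← freeTopLiftAux_X_smul hY] at e
      rw [sub_eq_iff_eq_add.1 ha, add_smul, map_add, add_smul, smul_add, smul_add, mul_smul, e,
        mul_smul, freeTopLiftAux_C_smul]
  simpa using key p le_rfl a

/-- The extension of a map on words to the free topological algebra, for modules in which `h` is
nilpotent. -/
def freeTopLift (b : WordList N → Y) : FreeTop N →ₗ[PowerSeries ℂ] Y :=
  { freeTopLiftAux p b with map_smul' := freeTopLiftAux_smul hY b }

theorem freeTopLift_wordTop (b : WordList N → Y) (w : WordList N) :
    freeTopLift hY b (wordTop w) = b w := by
  have h : freeTopLift hY b (wordTop w) = ∑ k ∈ Finset.range p,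
    (PowerSeries.X : PowerSeries ℂ) ^ k • wordsLift b (PowerSeries.coeff k (wordTop w)) := rfl
  rw [h]
  rcases p with _ | p
  · have := hY (b w)
    rw [pow_zero, one_smul] at this
    simp [this]
  · rw [Finset.sum_eq_single 0]
    · rw [pow_zero, one_smul, wordTop, PowerSeries.coeff_zero_C, wordsLift_basis]
    · intro k _ hk
      rw [wordTop, PowerSeries.coeff_C, if_neg hk, map_zero, smul_zero]
    · simp

include hY in
/-- Linear maps to a module in which `h` is nilpotent are determined by their values on words. -/
theorem freeTop_hom_ext {f g : FreeTop N →ₗ[PowerSeries ℂ] Y}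
    (h : ∀ w, f (wordTop w) = g (wordTop w)) : f = g := by
  suffices H : ∀ d : FreeTop N →ₗ[PowerSeries ℂ] Y, (∀ w, d (wordTop w) = 0) → d = 0 by
    rw [← sub_eq_zero]
    exact H _ fun w => by rw [LinearMap.sub_apply, h, sub_self]
  intro d hd
  have hC : ∀ x : Words N, d (PowerSeries.C x) = 0 := by
    intro x
    induction (wordsBasis N).mem_span x using Submodule.span_induction with
    | mem x hx => obtain ⟨w, rfl⟩ := hx; exact hd w
    | zero => rw [map_zero, map_zero]
    | add x y _ _ hx hy => rw [map_add, map_add, hx, hy, add_zero]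
    | smul c x _ hx =>
      have : (PowerSeries.C (c • x) : FreeTop N) =
          (PowerSeries.C c : PowerSeries ℂ) • (PowerSeries.C x : FreeTop N) := by
        rw [Algebra.smul_def, Algebra.smul_def, map_mul]
        congr 1
        exact (PowerSeries.map_C _ _).symm
      rw [this, map_smul, hx, smul_zero]
  ext f
  obtain ⟨c, hc⟩ := sum_X_pow_mul_C f p
  have := congrArg d hc
  rw [map_sub, map_sum] at this
  simp only [map_smul, hC, smul_zero, Finset.sum_const_zero, sub_zero] at this
  rw [this, ← freeTop_algebraMap_X, ← map_pow, ← Algebra.smul_def, map_smul, hY]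
  rfl

end FreeTopLift

/-! ### Torsion -/

section Torsion

/-- In the discrete valuation ring `ℂ[[h]]` a nonzero element is a unit times a power of `h`. -/
theorem isTorsionFree_of_X {M : Type*} [AddCommGroup M] [Module (PowerSeries ℂ) M]
    (h : ∀ y : M, (PowerSeries.X : PowerSeries ℂ) • y = 0 → y = 0) :
    Module.IsTorsionFree (PowerSeries ℂ) M := by
  have hp : ∀ k, ∀ y : M, (PowerSeries.X : PowerSeries ℂ) ^ k • y = 0 → y = 0 := by
    intro k
    induction k with
    | zero => intro y hy; rwa [pow_zero, one_smul] at hy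
    | succ k ih => intro y hy; rw [pow_succ, mul_smul] at hy; exact h y (ih _ hy)
  refine ⟨fun r hr x y hxy => ?_⟩
  dsimp only at hxy
  rw [← sub_eq_zero, ← smul_sub] at hxy
  rw [← sub_eq_zero]
  obtain ⟨k, u, hu⟩ := IsDiscreteValuationRing.associated_pow_irreducible hr.ne_zero
    (PowerSeries.X_irreducible (R := ℂ))
  refine hp k _ ?_
  rw [← hu, mul_comm, mul_smul, hxy, smul_zero]

theorem toVR_eq_zero {N : ℕ} {f : FreeTop N} : toVR N f = 0 ↔ f ∈ relIdeal N := by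
  have h : f ∈ TwoSidedIdeal.ker (relIdeal N).ringCon.mk' ↔ f ∈ relIdeal N := by
    rw [TwoSidedIdeal.ker_ringCon_mk']
  rw [← h, TwoSidedIdeal.mem_ker]
  rfl

theorem toVR_surjective (N : ℕ) : Function.Surjective (toVR N) :=
  (relIdeal N).ringCon.mk'_surjective

theorem toVR_smul {N : ℕ} (c : PowerSeries ℂ) (f : FreeTop N) :
    toVR N (c • f) = c • toVR N f := rfl

instance (N : ℕ) : Module.IsTorsionFree (PowerSeries ℂ) (VR N) := by
  refine isTorsionFree_of_X fun y hy => ?_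
  obtain ⟨f, rfl⟩ := toVR_surjective N y
  rw [← toVR_smul, toVR_eq_zero, Algebra.smul_def, freeTop_algebraMap_X] at hy
  rw [toVR_eq_zero]
  exact (isTopFreeIdeal_relIdeal N).2 f hy

instance : Module.IsTorsionFree (PowerSeries ℂ) (PowerSeries (RatFunc ℂ)) := by
  refine isTorsionFree_of_X fun y hy => ?_
  rw [Algebra.smul_def, algebraMap_ratFunc, PowerSeries.map_X] at hy
  exact (mul_eq_zero.1 hy).resolve_left PowerSeries.X_ne_zero

theorem smul_X_eq_zero {M : Type*} [AddCommGroup M] [Module (PowerSeries ℂ) M]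
    [Module.IsTorsionFree (PowerSeries ℂ) M] {y : M}
    (h : (PowerSeries.X : PowerSeries ℂ) • y = 0) : y = 0 :=
  (smul_eq_zero.1 h).resolve_left PowerSeries.X_ne_zero

end Torsion

/-! ### The braiding on words -/

section Words

variable {N : ℕ}

theorem nodup_slots (n m : ℕ) : (slotsL n m ++ slotsR n m).Nodup := by
  rw [slotsL, slotsR, List.nodup_append]
  refine ⟨(List.nodup_finRange n).map Sum.inl_injective,
    (List.nodup_finRange m).map Sum.inr_injective, ?_⟩
  intro a ha b hb
  obtain ⟨i, _, rfl⟩ := List.mem_map.1 ha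
  obtain ⟨j, _, rfl⟩ := List.mem_map.1 hb
  simp

theorem mem_slots {n m : ℕ} (b : Fin n ⊕ Fin m) : b ∈ slotsL n m ++ slotsR n m := by
  rcases b with i | j <;> simp [slotsL, slotsR]

theorem prodL_append {τ E : Type*} [Fintype τ] [DecidableEq τ] [Ring E]
    (L : τ → Matrix (Fin N) (Fin N) E) (l l' : List τ) :
    prodL L (l ++ l') = prodL L l * prodL L l' := by
  rw [prodL, List.map_append, List.prod_append, prodL, prodL]

theorem coeff_lGen {W : Type*} [Ring W] [Algebra (PowerSeries ℂ) W]
    (γ γ' : ℕ → Fin N → Fin N → W) {n m : ℕ} (I J : Fin n ⊕ Fin m → Fin N)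
    (e : Fin n ⊕ Fin m →₀ ℕ) :
    MvPowerSeries.coeff e (lGen γ γ' n m I J) =
      ((slotsL n m).map fun b => γ (e b) (I b) (J b)).prod *
        ((slotsR n m).map fun b => γ' (e b) (I b) (J b)).prod := by
  have hL : (slotsL n m).map (fun b => slotGen γ γ' b (e b) (I b) (J b)) =
      (slotsL n m).map fun b => γ (e b) (I b) (J b) := by
    simp [slotsL, slotGen]
  have hR : (slotsR n m).map (fun b => slotGen γ γ' b (e b) (I b) (J b)) =
      (slotsR n m).map fun b => γ' (e b) (I b) (J b) := by
    simp [slotsR, slotGen]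
  rw [lGen, ← prodL_append, prodL, prod_leg_apply _ _ (nodup_slots n m),
    if_pos fun c hc => absurd (mem_slots c) hc]
  refine (coeff_prod_inVar (nodup_slots n m) (fun b => PowerSeries.mk fun r =>
    slotGen γ γ' b r (I b) (J b)) e).trans ?_
  rw [if_pos fun c hc => absurd (mem_slots c) hc, ← hL, ← hR, ← List.prod_append,
    ← List.map_append]
  simp only [PowerSeries.coeff_mk]

/-- The coefficient of the braided product which belongs to two families of generators. -/
def braidFn {n m : ℕ} (x : Fin n → ℕ × Fin N × Fin N) (y : Fin m → ℕ × Fin N × Fin N) : VVz N :=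
  MvPowerSeries.coeff (Finsupp.equivFunOnFinite.symm fun b => (Sum.elim x y b).1)
    (braidedLNM N n m (fun b => (Sum.elim x y b).2.1) fun b => (Sum.elim x y b).2.2)

/-- The coefficient of the braided product which belongs to two words. -/
def braidCoeff (w w' : WordList N) : VVz N :=
  braidFn (List.equivSigmaTuple w.toList).2 (List.equivSigmaTuple w'.toList).2

theorem braidCoeff_ofFn {n m : ℕ} (x : Fin n → ℕ × Fin N × Fin N)
    (y : Fin m → ℕ × Fin N × Fin N) :
    braidCoeff (FreeMonoid.ofList (List.ofFn x)) (FreeMonoid.ofList (List.ofFn y)) =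
      braidFn x y := by
  have hx : List.equivSigmaTuple (List.ofFn x) = ⟨n, x⟩ :=
    List.equivSigmaTuple.apply_symm_apply ⟨n, x⟩
  have hy : List.equivSigmaTuple (List.ofFn y) = ⟨m, y⟩ :=
    List.equivSigmaTuple.apply_symm_apply ⟨m, y⟩
  rw [braidCoeff, FreeMonoid.toList_ofList, FreeMonoid.toList_ofList, hx, hy]

/-- The word in the tensor factors of a list, for given exponents and indices. -/
def readWord {τ : Type*} (l : List τ) (e : τ → ℕ) (I J : τ → Fin N) : WordList N :=
  FreeMonoid.ofList (l.map fun b => (e b, I b, J b))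

/-- The data of an exponent and two indices are the same as a pair of words of lengths `n` and `m`.
The defining property thus prescribes exactly one value per pair of words, and over the free algebra
no consistency condition arises. -/
theorem braidCoeff_readWord {n m : ℕ} (I J : Fin n ⊕ Fin m → Fin N) (e : Fin n ⊕ Fin m →₀ ℕ) :
    braidCoeff (readWord (slotsL n m) e I J) (readWord (slotsR n m) e I J) =
      MvPowerSeries.coeff e (braidedLNM N n m I J) := by
  have h := braidCoeff_ofFn (fun i => (e (Sum.inl i), I (Sum.inl i), J (Sum.inl i)))
    (fun j => (e (Sum.inr j), I (Sum.inr j), J (Sum.inr j)))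
  rw [List.ofFn_eq_map, List.ofFn_eq_map] at h
  rw [readWord, readWord, slotsL, slotsR, List.map_map, List.map_map]
  refine h.trans ?_
  have hs : (Sum.elim (fun i => (e (Sum.inl i), I (Sum.inl i), J (Sum.inl i)))
      (fun j => (e (Sum.inr j), I (Sum.inr j), J (Sum.inr j)))) =
      fun b : Fin n ⊕ Fin m => (e b, I b, J b) := by
    funext b; rcases b with i | j <;> rfl
  rw [braidFn, hs]
  congr 2
  ext b
  rfl

/-- The tensor square of the free topological algebra. -/
abbrev FreeTop₂ (N : ℕ) : Type := FreeTop N ⊗[PowerSeries ℂ] FreeTop N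

/-- The generators of the two factors of the tensor square. -/
def freeGenL (r : ℕ) (i j : Fin N) : FreeTop₂ N := PowerSeries.C (word r i j) ⊗ₜ 1

/-- The generators of the second factor of the tensor square. -/
def freeGenR (r : ℕ) (i j : Fin N) : FreeTop₂ N := 1 ⊗ₜ PowerSeries.C (word r i j)

theorem wordTop_readWord {τ : Type*} (l : List τ) (e : τ → ℕ) (I J : τ → Fin N) :
    wordTop (readWord l e I J) =
      (l.map fun b => (PowerSeries.C (word (e b) (I b) (J b)) : FreeTop N)).prod := by
  rw [wordTop, wordsBasis_apply, map_list_prod, readWord, FreeMonoid.toList_ofList, List.map_map,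
    List.map_map]
  rfl

theorem prod_freeGenL {τ : Type*} (l : List τ) (e : τ → ℕ) (I J : τ → Fin N) :
    (l.map fun b => freeGenL (e b) (I b) (J b)).prod = wordTop (readWord l e I J) ⊗ₜ 1 := by
  rw [wordTop_readWord]
  have := map_list_prod (Algebra.TensorProduct.includeLeft :
    FreeTop N →ₐ[PowerSeries ℂ] FreeTop₂ N)
    (l.map fun b => (PowerSeries.C (word (e b) (I b) (J b)) : FreeTop N))
  rw [List.map_map] at this
  exact this.symm

theorem prod_freeGenR {τ : Type*} (l : List τ) (e : τ → ℕ) (I J : τ → Fin N) :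
    (l.map fun b => freeGenR (e b) (I b) (J b)).prod = 1 ⊗ₜ wordTop (readWord l e I J) := by
  rw [wordTop_readWord]
  have := map_list_prod (Algebra.TensorProduct.includeRight :
    FreeTop N →ₐ[PowerSeries ℂ] FreeTop₂ N)
    (l.map fun b => (PowerSeries.C (word (e b) (I b) (J b)) : FreeTop N))
  rw [List.map_map] at this
  exact this.symm

theorem coeff_lGen_free {n m : ℕ} (I J : Fin n ⊕ Fin m → Fin N) (e : Fin n ⊕ Fin m →₀ ℕ) :
    MvPowerSeries.coeff e (lGen freeGenL freeGenR n m I J) =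
      wordTop (readWord (slotsL n m) e I J) ⊗ₜ wordTop (readWord (slotsR n m) e I J) := by
  rw [coeff_lGen, prod_freeGenL, prod_freeGenR, Algebra.TensorProduct.tmul_mul_tmul, one_mul,
    mul_one]

theorem linearMap_X_pow_smul {M Y : Type*} [AddCommGroup M] [Module (PowerSeries ℂ) M]
    [AddCommGroup Y] [Module (PowerSeries ℂ) Y] {p : ℕ}
    (hY : ∀ y : Y, (PowerSeries.X : PowerSeries ℂ) ^ p • y = 0) (f : M →ₗ[PowerSeries ℂ] Y) :
    (PowerSeries.X : PowerSeries ℂ) ^ p • f = 0 := by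
  ext x
  rw [LinearMap.smul_apply, hY]
  rfl

/-- The braiding on the free topological algebra, modulo `h^p`. -/
def braidFree (N p : ℕ) :
    FreeTop N →ₗ[PowerSeries ℂ] FreeTop N →ₗ[PowerSeries ℂ] ModPow (VVz N) p :=
  freeTopLift (linearMap_X_pow_smul modPow_smul) fun w =>
    freeTopLift modPow_smul fun w' => Submodule.Quotient.mk (braidCoeff w w')

theorem braidFree_wordTop (p : ℕ) (w w' : WordList N) :
    braidFree N p (wordTop w) (wordTop w') = Submodule.Quotient.mk (braidCoeff w w') := by
  rw [braidFree, freeTopLift_wordTop, freeTopLift_wordTop]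

/-- The reduction modulo a smaller power of `h`. -/
def modPowRed (W : Type*) [AddCommGroup W] [Module (PowerSeries ℂ) W] {p p' : ℕ} (h : p ≤ p') :
    ModPow W p' →ₗ[PowerSeries ℂ] ModPow W p :=
  AdicCompletion.transitionMap (Ideal.span {(PowerSeries.X : PowerSeries ℂ)}) W h

theorem modPowRed_mk {W : Type*} [AddCommGroup W] [Module (PowerSeries ℂ) W] {p p' : ℕ}
    (h : p ≤ p') (x : W) : modPowRed W h (Submodule.Quotient.mk x) = Submodule.Quotient.mk x :=
  rfl

theorem modPowRed_braidFree {p p' : ℕ} (h : p ≤ p') (f g : FreeTop N) :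
    modPowRed (VVz N) h (braidFree N p' f g) = braidFree N p f g := by
  have e : (braidFree N p').compr₂ (modPowRed (VVz N) h) = braidFree N p := by
    refine freeTop_hom_ext (linearMap_X_pow_smul modPow_smul) fun w => ?_
    refine freeTop_hom_ext modPow_smul fun w' => ?_
    rw [LinearMap.compr₂_apply, braidFree_wordTop, braidFree_wordTop, modPowRed_mk]
  rw [← e, LinearMap.compr₂_apply]

end Words

/-! ### Kernels of compatible families -/

section KerIdeal

variable {N : ℕ} {Z : Type*} [AddCommGroup Z] [Module (PowerSeries ℂ) Z]
  [Module.IsTorsionFree (PowerSeries ℂ) Z] {M : Type*} [AddCommGroup M] [Module (PowerSeries ℂ) M]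
  (T : ∀ p, FreeTop N →ₗ[PowerSeries ℂ] M →ₗ[PowerSeries ℂ] ModPow Z p)

theorem map_mul_X_pow_mul {p : ℕ} {Y : Type*} [AddCommGroup Y] [Module (PowerSeries ℂ) Y]
    (T : FreeTop N →ₗ[PowerSeries ℂ] Y) (a f c : FreeTop N) :
    T (a * (PowerSeries.X ^ p * f) * c) = (PowerSeries.X : PowerSeries ℂ) ^ p • T (a * f * c) := by
  rw [← map_smul, ← freeTop_algebraMap_X, ← map_pow, ← Algebra.smul_def, mul_smul_comm,
    smul_mul_assoc]

/-- The largest two-sided ideal on which the family `T` vanishes. -/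
def kerIdeal : TwoSidedIdeal (FreeTop N) :=
  TwoSidedIdeal.mk' {f | ∀ p a c g, T p (a * f * c) g = 0}
    (by intro p a c g; simp)
    (by
      intro x y hx hy p a c g
      rw [mul_add, add_mul, map_add, LinearMap.add_apply, hx, hy, add_zero])
    (by
      intro x hx p a c g
      rw [mul_neg, neg_mul, map_neg, LinearMap.neg_apply, hx, neg_zero])
    (by
      intro x y hy p a c g
      rw [← mul_assoc]; exact hy p _ c g)
    (by
      intro x y hx p a c g
      rw [mul_assoc a, mul_assoc x, ← mul_assoc]; exact hx p a _ g)

theorem mem_kerIdeal {f : FreeTop N} : f ∈ kerIdeal T ↔ ∀ p a c g, T p (a * f * c) g = 0 :=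
  TwoSidedIdeal.mem_mk' _ _ _ _ _ _ _

variable (hT : ∀ p f g, modPowRed Z p.le_succ (T (p + 1) f g) = T p f g)

include hT in
-- Separatedness: the map with index `p` kills multiples of `h ^ p`. Absence of torsion: if `h f` is
-- killed at level `p + 1`, then `h` times a lift of the value of `f` is divisible by `h ^ (p + 1)`,
-- so the lift is divisible by `h ^ p` in the torsion-free module `Z`, and `f` is killed at level
-- `p`.
theorem isTopFreeIdeal_kerIdeal : IsTopFreeIdeal (kerIdeal T) := by
  constructor
  · intro f hf
    rw [mem_kerIdeal]
    intro p a c g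
    obtain ⟨x, hx, y, hy⟩ := hf p
    rw [mem_kerIdeal] at hx
    rw [sub_eq_iff_eq_add.1 hy, mul_add, add_mul, map_add, LinearMap.add_apply, hx, add_zero,
      map_mul_X_pow_mul, LinearMap.smul_apply, modPow_smul]
  · intro f hf
    rw [mem_kerIdeal] at hf ⊢
    intro p a c g
    have h := hf (p + 1) a c g
    rw [← hT]
    have e := map_mul_X_pow_mul (p := 1) (T (p + 1)) a f c
    rw [pow_one, pow_one] at e
    rw [e, LinearMap.smul_apply] at h
    obtain ⟨y, hy⟩ := Submodule.Quotient.mk_surjective _ (T (p + 1) (a * f * c) g)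
    rw [← hy, ← Submodule.Quotient.mk_smul, Submodule.Quotient.mk_eq_zero,
      mem_span_X_pow_smul_top] at h
    obtain ⟨z, hz⟩ := h
    rw [pow_succ', mul_smul, ← sub_eq_zero, ← smul_sub] at hz
    rw [← hy, modPowRed_mk, Submodule.Quotient.mk_eq_zero, mem_span_X_pow_smul_top]
    exact ⟨z, sub_eq_zero.1 (smul_X_eq_zero hz)⟩

end KerIdeal

/-! ### The defining relation between two neighbouring factors -/

section Bracket

variable {N : ℕ} {S E : Type*} [CommRing S] [Ring E] [Algebra S E]
  {τ : Type*} [Fintype τ] [DecidableEq τ]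

/-- The difference of the two sides of the relation without denominators. -/
def relBracket (q q' : S) (ζ : τ → S) (b c : τ) (A B : Matrix (Fin N) (Fin N) E) :
    Matrix (τ → Fin N) (τ → Fin N) E :=
  (ζ c - ζ b * q ^ 2) • (sc N τ E (rb N q q' ζ c b) * leg b A * leg c B) -
    (ζ b - ζ c * q ^ 2) • (leg c B * leg b A * sc N τ E (rb N q q' ζ b c))

variable {q q' : S} {ζ : τ → S} {b c : τ} (hbc : b ≠ c) (A B : Matrix (Fin N) (Fin N) E)

include hbc in
theorem relBracket_apply (I J : τ → Fin N) : relBracket q q' ζ b c A B I J =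
    if ∀ d, d ≠ b → d ≠ c → I d = J d then
      (ζ c - ζ b * q ^ 2) • (wD q q' (ζ c) (ζ b) (I c) (I b) • (A (I b) (J b) * B (I c) (J c)) +
        wO q q' (ζ c) (ζ b) (I c) (I b) • (A (I c) (J b) * B (I b) (J c))) -
      (ζ b - ζ c * q ^ 2) • (wD q q' (ζ b) (ζ c) (J b) (J c) • (B (I c) (J c) * A (I b) (J b)) +
        wO q q' (ζ b) (ζ c) (J c) (J b) • (B (I c) (J b) * A (I b) (J c))) else 0 := by
  rw [relBracket, Matrix.sub_apply, Matrix.smul_apply, Matrix.smul_apply, rb_leg_leg_apply _ _ _ hbc,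
    leg_leg_rb_apply _ _ _ hbc]
  split_ifs
  · rfl
  · rw [smul_zero, smul_zero, sub_zero]

include hbc in
theorem relBracket_apply_fin_two (I J : τ → Fin N) : relBracket q q' ζ b c A B I J =
    if ∀ d, d ≠ b → d ≠ c → I d = J d then
      relBracket q q' ![ζ b, ζ c] 0 1 A B ![I b, I c] ![J b, J c] else 0 := by
  rw [relBracket_apply hbc, relBracket_apply (by simp : (0 : Fin 2) ≠ 1),
    if_pos (by intro d h0 h1; fin_cases d <;> simp_all : ∀ d : Fin 2, d ≠ 0 → d ≠ 1 → _ = _)]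
  rfl

include hbc in
-- The cleared relation is homogeneous of degree two in the spectral parameters. This removes the
-- common factor `z` which the braiding attaches to the first group.
theorem relBracket_smul {ζ' : τ → S} {ω : S} (hb : ζ' b = ω * ζ b) (hc : ζ' c = ω * ζ c) :
    relBracket q q' ζ' b c A B = ω ^ 2 • relBracket q q' ζ b c A B := by
  have hD : ∀ (z w : S) (i j : Fin N), wD q q' (ω * z) (ω * w) i j = ω * wD q q' z w i j := by
    intro z w i j
    rw [wD, wD]; split_ifs <;> ring
  have hO : ∀ (z w : S) (i j : Fin N), wO q q' (ω * z) (ω * w) i j = ω * wO q q' z w i j := by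
    intro z w i j
    simp only [wO]; split_ifs <;> ring
  ext I J
  rw [Matrix.smul_apply, relBracket_apply hbc, relBracket_apply hbc, hb, hc]
  split_ifs
  · simp only [hD, hO]
    module
  · rw [smul_zero]

theorem prodL_apply_eq_zero {l : List τ}
    {L : τ → Matrix (Fin N) (Fin N) E} (hl : l.Nodup) (I J : τ → Fin N)
    (h : ∃ d, d ∉ l ∧ I d ≠ J d) : prodL L l I J = 0 := by
  obtain ⟨d, hd, hne⟩ := h
  rw [prodL, prod_leg_apply _ _ hl, if_neg fun h => hne (h d hd)]

/-- The entries of a product of two matrices which act in disjoint sets of tensor factors. -/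
theorem mul_apply_of_disjoint {X Y : Matrix (τ → Fin N) (τ → Fin N) E} {s : Set τ}
    [DecidablePred (· ∈ s)] (hX : ∀ I J, (∃ d, d ∉ s ∧ I d ≠ J d) → X I J = 0)
    (hY : ∀ I J, (∃ d, d ∈ s ∧ I d ≠ J d) → Y I J = 0) (I J : τ → Fin N) :
    (X * Y) I J = X I (s.piecewise J I) * Y (s.piecewise J I) J := by
  rw [Matrix.mul_apply, Finset.sum_eq_single (s.piecewise J I)]
  · intro K _ hK
    by_cases h : ∃ d, d ∉ s ∧ I d ≠ K d
    · rw [hX _ _ h, zero_mul]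
    · rw [hY, mul_zero]
      by_contra h'
      push Not at h h'
      refine hK (funext fun d => ?_)
      by_cases hd : d ∈ s
      · rw [Set.piecewise_eq_of_mem _ _ _ hd, h' d hd]
      · rw [Set.piecewise_eq_of_notMem _ _ _ hd, h d hd]
  · simp

include hbc in
/-- The entries of the difference of two ordered products with two exchanged neighbours. -/
theorem prodL_relBracket_apply {L : τ → Matrix (Fin N) (Fin N) E} {l₁ l₃ : List τ}
    (hl : (l₁ ++ b :: c :: l₃).Nodup) (hmem : ∀ d, d ∈ l₁ ++ b :: c :: l₃) (I J : τ → Fin N) :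
    (prodL L l₁ * (relBracket q q' ζ b c A B * prodL L l₃)) I J =
      (l₁.map fun d => L d (I d) (J d)).prod *
        (relBracket q q' ![ζ b, ζ c] 0 1 A B ![I b, I c] ![J b, J c] *
          (l₃.map fun d => L d (I d) (J d)).prod) := by
  classical
  have hmem' : ∀ d, d ∈ l₁ ∨ d = b ∨ d = c ∨ d ∈ l₃ := by simpa using hmem
  simp only [List.nodup_append, List.nodup_cons, List.mem_cons, not_or] at hl
  obtain ⟨h1, ⟨⟨_, hb3⟩, hc3, h3⟩, h13⟩ := hl
  have hb1 : b ∉ l₁ := fun h => h13 b h b (by simp) rfl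
  have hc1 : c ∉ l₁ := fun h => h13 c h c (by simp) rfl
  have h31 : ∀ d, d ∈ l₃ → d ∉ l₁ := fun d hd h => h13 d h d (by simp [hd]) rfl
  have hX : ∀ I J, (∃ d, d ∉ ({b, c} : Set τ) ∧ I d ≠ J d) →
      relBracket q q' ζ b c A B I J = 0 := by
    rintro I J ⟨d, hd, hne⟩
    simp only [Set.mem_insert_iff, Set.mem_singleton_iff, not_or] at hd
    rw [relBracket_apply hbc, if_neg fun h => hne (h d hd.1 hd.2)]
  have hY : ∀ I J, (∃ d, d ∈ ({b, c} : Set τ) ∧ I d ≠ J d) → prodL L l₃ I J = 0 := by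
    rintro I J ⟨d, hd, hne⟩
    refine prodL_apply_eq_zero h3 I J ⟨d, ?_, hne⟩
    rcases hd with rfl | rfl
    · exact hb3
    · exact hc3
  have hXY : ∀ I J, (∃ d, d ∈ {d | d ∈ l₁} ∧ I d ≠ J d) →
      (relBracket q q' ζ b c A B * prodL L l₃) I J = 0 := by
    rintro I J ⟨d, hd, hne⟩
    rw [mul_apply_of_disjoint hX hY]
    have hd' : d ∉ ({b, c} : Set τ) := by
      rintro (rfl | rfl)
      · exact hb1 hd
      · exact hc1 hd
    rw [prodL_apply_eq_zero h3 _ _ ⟨d, fun h => h31 d h hd, ?_⟩, mul_zero]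
    rwa [Set.piecewise_eq_of_notMem _ _ _ hd']
  rw [mul_apply_of_disjoint (s := {d | d ∈ l₁}) (fun I J h => prodL_apply_eq_zero h1 I J h)
    hXY, mul_apply_of_disjoint hX hY]
  have p1 : ∀ d ∈ l₁, ({d | d ∈ l₁} : Set τ).piecewise J I d = J d := fun d hd =>
    Set.piecewise_eq_of_mem _ _ _ hd
  have p2 : ∀ d, d ∉ l₁ → ({d | d ∈ l₁} : Set τ).piecewise J I d = I d := fun d hd =>
    Set.piecewise_eq_of_notMem _ _ _ hd
  generalize ({d | d ∈ l₁} : Set τ).piecewise J I = K at p1 p2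
  have q1 : ∀ d, d = b ∨ d = c → ({b, c} : Set τ).piecewise J K d = J d := fun d hd =>
    Set.piecewise_eq_of_mem _ _ _ hd
  have q2 : ∀ d, d ≠ b → d ≠ c → ({b, c} : Set τ).piecewise J K d = K d := fun d hd hd' =>
    Set.piecewise_eq_of_notMem _ _ _ (by simp [hd, hd'])
  generalize ({b, c} : Set τ).piecewise J K = K' at q1 q2
  rw [relBracket_apply_fin_two hbc, if_pos (fun d hd hd' => (q2 d hd hd').symm), prodL,
    prod_leg_apply _ _ h1, if_pos (fun d hd => (p2 d hd).symm), prodL, prod_leg_apply _ _ h3, if_pos,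
    p2 b hb1, p2 c hc1, q1 b (Or.inl rfl), q1 c (Or.inr rfl)]
  · have e1 : (l₁.map fun d => L d (I d) (K d)) = l₁.map fun d => L d (I d) (J d) :=
      List.map_congr_left fun d hd => by rw [p1 d hd]
    have e3 : (l₃.map fun d => L d (K' d) (J d)) = l₃.map fun d => L d (I d) (J d) :=
      List.map_congr_left fun d hd => by
        rw [q2 d (by rintro rfl; exact hb3 hd) (by rintro rfl; exact hc3 hd), p2 d (h31 d hd)]
    rw [e1, e3]
  · intro d hd
    rcases hmem' d with h | h | h | h
    · rw [q2 d (by rintro rfl; exact hb1 h) (by rintro rfl; exact hc1 h), p1 d h]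
    · exact q1 d (Or.inl h)
    · exact q1 d (Or.inr h)
    · exact absurd h hd

/-- The difference of two ordered products with two exchanged neighbours. -/
theorem smul_rb_mul_prodL_sub {L : τ → Matrix (Fin N) (Fin N) E} {l₁ l₃ : List τ}
    (hl : (l₁ ++ b :: c :: l₃).Nodup) :
    (ζ c - ζ b * q ^ 2) • (sc N τ E (rb N q q' ζ c b) * prodL L (l₁ ++ b :: c :: l₃)) -
      (ζ b - ζ c * q ^ 2) • (prodL L (l₁ ++ c :: b :: l₃) * sc N τ E (rb N q q' ζ b c)) =
    prodL L l₁ * (relBracket q q' ζ b c (L b) (L c) * prodL L l₃) := by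
  simp only [List.nodup_append, List.nodup_cons, List.mem_cons, not_or] at hl
  obtain ⟨h1, ⟨⟨_, hb3⟩, hc3, h3⟩, h13⟩ := hl
  have e1 : Commute (sc N τ E (rb N q q' ζ c b)) (prodL L l₁) :=
    sc_commute_prodL L (actsOn_rb q q' ζ c b) fun d hd => by
      rintro (rfl | rfl)
      · exact h13 _ hd d (by simp) rfl
      · exact h13 _ hd d (by simp) rfl
  have e3 : Commute (sc N τ E (rb N q q' ζ b c)) (prodL L l₃) :=
    sc_commute_prodL L (actsOn_rb q q' ζ b c) fun d hd => by
      rintro (rfl | rfl)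
      · exact hb3 hd
      · exact hc3 hd
  have s1 : prodL L (l₁ ++ b :: c :: l₃) = prodL L l₁ * (leg b (L b) * (leg c (L c) * prodL L l₃)) := by
    simp only [prodL, List.map_append, List.map_cons, List.prod_append, List.prod_cons]
  have s2 : prodL L (l₁ ++ c :: b :: l₃) = prodL L l₁ * (leg c (L c) * (leg b (L b) * prodL L l₃)) := by
    simp only [prodL, List.map_append, List.map_cons, List.prod_append, List.prod_cons]
  rw [s1, s2, relBracket, sub_mul, mul_sub, ← mul_assoc (sc N τ E _), e1.eq, smul_mul_assoc,
    smul_mul_assoc, mul_smul_comm, mul_smul_comm]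
  have e3' : ∀ Y : Matrix (τ → Fin N) (τ → Fin N) E,
      Y * sc N τ E (rb N q q' ζ b c) * prodL L l₃ = Y * prodL L l₃ * sc N τ E (rb N q q' ζ b c) := by
    intro Y; rw [mul_assoc, e3.eq, mul_assoc]
  rw [e3']
  simp only [mul_assoc]

end Bracket

/-! ### Products of series in disjoint sets of variables -/

section Disjoint

variable {τ : Type*} [Fintype τ] [DecidableEq τ] {A : Type*} [Semiring A]

theorem coeff_mul_of_disjoint {s : Finset τ} {F G : MvPowerSeries τ A}
    (hF : ∀ e, (∃ d, d ∉ s ∧ e d ≠ 0) → MvPowerSeries.coeff e F = 0)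
    (hG : ∀ e, (∃ d, d ∈ s ∧ e d ≠ 0) → MvPowerSeries.coeff e G = 0) (e : τ →₀ ℕ) :
    MvPowerSeries.coeff e (F * G) = MvPowerSeries.coeff (e.filter (· ∈ s)) F *
      MvPowerSeries.coeff (e.filter (· ∉ s)) G := by
  rw [MvPowerSeries.coeff_mul, Finset.sum_eq_single (e.filter (· ∈ s), e.filter (· ∉ s))]
  · rintro ⟨e₁, e₂⟩ hp hne
    rw [Finset.HasAntidiagonal.mem_antidiagonal] at hp
    dsimp only at hp ⊢
    by_cases h1 : ∃ d, d ∉ s ∧ e₁ d ≠ 0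
    · rw [hF _ h1, zero_mul]
    by_cases h2 : ∃ d, d ∈ s ∧ e₂ d ≠ 0
    · rw [hG _ h2, mul_zero]
    exfalso
    push Not at h1 h2
    apply hne
    rw [← hp]
    refine Prod.ext (Finsupp.ext fun d => ?_) (Finsupp.ext fun d => ?_) <;>
      by_cases hd : d ∈ s <;> simp [hd, h1, h2]
  · intro h
    exact absurd (Finset.HasAntidiagonal.mem_antidiagonal.2 (Finsupp.filter_add_filter_not e _)) h

/-- A series in two variables of a family. -/
def pairSeries (b c : τ) (F : ℕ → ℕ → A) : MvPowerSeries τ A :=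
  fun e => if ∀ d, d ≠ b → d ≠ c → e d = 0 then F (e b) (e c) else 0

theorem coeff_pairSeries (b c : τ) (F : ℕ → ℕ → A) (e : τ →₀ ℕ) :
    MvPowerSeries.coeff e (pairSeries b c F) =
      if ∀ d, d ≠ b → d ≠ c → e d = 0 then F (e b) (e c) else 0 := rfl

theorem evNil_pairSeries {S E : Type*} [CommRing S] [Semiring E] [Algebra S E] (φ : A →+* E)
    {t : τ → S} {B : ℕ} (ht : ∀ i, t i ^ B = 0) {b c : τ} (hbc : b ≠ c) (F : ℕ → ℕ → A) :
    evNil φ ht (pairSeries b c F) =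
      ∑ j ∈ Finset.range B, ∑ i ∈ Finset.range B, (t c ^ j * t b ^ i) • φ (F i j) := by
  have hs : ∀ i j : ℕ, (Finsupp.single b i + Finsupp.single c j : τ →₀ ℕ) b = i ∧
      (Finsupp.single b i + Finsupp.single c j : τ →₀ ℕ) c = j ∧
      ∀ d, d ≠ b → d ≠ c → (Finsupp.single b i + Finsupp.single c j : τ →₀ ℕ) d = 0 := by
    intro i j
    refine ⟨?_, ?_, fun d h1 h2 => ?_⟩ <;> rw [Finsupp.add_apply, Finsupp.single_apply,
      Finsupp.single_apply]
    · simp [hbc.symm]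
    · simp [hbc]
    · simp [h1.symm, h2.symm]
  rw [evNil_apply, ← Finset.sum_product' (Finset.range B) (Finset.range B)
    (fun j i => (t c ^ j * t b ^ i) • φ (F i j))]
  symm
  refine Finset.sum_bij_ne_zero (fun x _ _ => Finsupp.single b x.2 + Finsupp.single c x.1)
    ?_ ?_ ?_ ?_
  · rintro ⟨j, i⟩ hx _
    rw [Finset.mem_product, Finset.mem_range, Finset.mem_range] at hx
    rw [mem_expBox]
    intro d
    obtain ⟨h1, h2, h3⟩ := hs i j
    by_cases hb : d = b
    · subst hb; rw [h1]; exact hx.2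
    · by_cases hc : d = c
      · subst hc; rw [h2]; exact hx.1
      · rw [h3 d hb hc]; exact lt_of_le_of_lt (Nat.zero_le _) hx.1
  · rintro ⟨j, i⟩ _ _ ⟨j', i'⟩ _ _ h
    obtain ⟨h1, h2, _⟩ := hs i j
    obtain ⟨h1', h2', _⟩ := hs i' j'
    dsimp only at h
    rw [h] at h1 h2
    exact Prod.ext (h2.symm.trans h2') (h1.symm.trans h1')
  · intro e he hne
    rw [coeff_pairSeries] at hne
    split_ifs at hne with h
    · have e' : e = Finsupp.single b (e b) + Finsupp.single c (e c) := by
        ext d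
        obtain ⟨h1, h2, h3⟩ := hs (e b) (e c)
        by_cases hb : d = b
        · subst hb; exact h1.symm
        · by_cases hc : d = c
          · subst hc; exact h2.symm
          · rw [h3 d hb hc, h d hb hc]
      refine ⟨(e c, e b), ?_, ?_, e'.symm⟩
      · rw [Finset.mem_product, Finset.mem_range, Finset.mem_range]
        exact ⟨mem_expBox.1 he c, mem_expBox.1 he b⟩
      · dsimp only
        have hp : ∏ i, t i ^ e i = t c ^ e c * t b ^ e b := by
          rw [← Finset.prod_subset (Finset.subset_univ {c, b}), Finset.prod_pair hbc.symm]
          intro d _ hd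
          simp only [Finset.mem_insert, Finset.mem_singleton, not_or] at hd
          rw [h d hd.2 hd.1, pow_zero]
        rwa [← hp]
    · simp at hne
  · rintro ⟨j, i⟩ _ _
    obtain ⟨h1, h2, h3⟩ := hs i j
    rw [coeff_pairSeries, if_pos h3, h1, h2]
    congr 1
    rw [← Finset.prod_subset (Finset.subset_univ {c, b}), Finset.prod_pair hbc.symm, h1, h2]
    intro d _ hd
    simp only [Finset.mem_insert, Finset.mem_singleton, not_or] at hd
    rw [h3 d hd.2 hd.1, pow_zero]

/-- The coefficients of a product of series in single variables with one series in two variables. -/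
theorem coeff_prod_mul_pairSeries {b c : τ} {l₁ l₃ : List τ} (hl : (l₁ ++ b :: c :: l₃).Nodup)
    (hmem : ∀ d, d ∈ l₁ ++ b :: c :: l₃) (f : τ → PowerSeries A) (F : ℕ → ℕ → A) (e : τ →₀ ℕ) :
    MvPowerSeries.coeff e ((l₁.map fun d => inVar d (f d)).prod *
      (pairSeries b c F * (l₃.map fun d => inVar d (f d)).prod)) =
    (l₁.map fun d => PowerSeries.coeff (e d) (f d)).prod *
      (F (e b) (e c) * (l₃.map fun d => PowerSeries.coeff (e d) (f d)).prod) := by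
  have hmem' : ∀ d, d ∈ l₁ ∨ d = b ∨ d = c ∨ d ∈ l₃ := by simpa using hmem
  simp only [List.nodup_append, List.nodup_cons, List.mem_cons, not_or] at hl
  obtain ⟨h1, ⟨⟨hbc, hb3⟩, hc3, h3⟩, h13⟩ := hl
  have hb1 : b ∉ l₁ := fun h => h13 b h b (by simp) rfl
  have hc1 : c ∉ l₁ := fun h => h13 c h c (by simp) rfl
  have h31 : ∀ d, d ∈ l₃ → d ∉ l₁ := fun d hd h => h13 d h d (by simp [hd]) rfl
  have hP : ∀ {l : List τ}, l.Nodup → ∀ e : τ →₀ ℕ, (∃ d, d ∉ l ∧ e d ≠ 0) →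
      MvPowerSeries.coeff e (l.map fun d => inVar d (f d)).prod = 0 := by
    rintro l hl e ⟨d, hd, hne⟩
    rw [coeff_prod_inVar hl, if_neg fun h => hne (h d hd)]
  have hX : ∀ e : τ →₀ ℕ, (∃ d, d ∉ ({b, c} : Finset τ) ∧ e d ≠ 0) →
      MvPowerSeries.coeff e (pairSeries b c F) = 0 := by
    rintro e ⟨d, hd, hne⟩
    simp only [Finset.mem_insert, Finset.mem_singleton, not_or] at hd
    rw [coeff_pairSeries, if_neg fun h => hne (h d hd.1 hd.2)]
  have hY : ∀ e : τ →₀ ℕ, (∃ d, d ∈ ({b, c} : Finset τ) ∧ e d ≠ 0) →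
      MvPowerSeries.coeff e (l₃.map fun d => inVar d (f d)).prod = 0 := by
    rintro e ⟨d, hd, hne⟩
    refine hP h3 e ⟨d, ?_, hne⟩
    simp only [Finset.mem_insert, Finset.mem_singleton] at hd
    rcases hd with rfl | rfl
    · exact hb3
    · exact hc3
  have hXY : ∀ e : τ →₀ ℕ, (∃ d, d ∈ l₁.toFinset ∧ e d ≠ 0) → MvPowerSeries.coeff e
      (pairSeries b c F * (l₃.map fun d => inVar d (f d)).prod) = 0 := by
    rintro e ⟨d, hd, hne⟩
    rw [List.mem_toFinset] at hd
    rw [coeff_mul_of_disjoint hX hY, hP h3 _ ⟨d, fun h => h31 d h hd, ?_⟩, mul_zero]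
    rw [Finsupp.filter_apply, if_pos]
    · exact hne
    · simp only [Finset.mem_insert, Finset.mem_singleton, not_or]
      exact ⟨fun h => hb1 (h ▸ hd), fun h => hc1 (h ▸ hd)⟩
  rw [coeff_mul_of_disjoint (s := l₁.toFinset) (fun e h => hP h1 e (by simpa using h)) hXY,
    coeff_mul_of_disjoint hX hY, coeff_prod_inVar h1, coeff_prod_inVar h3, coeff_pairSeries,
    if_pos (fun d hd => by simp [hd]),
    if_pos (fun d hd hd' => by simp [hd, hd']), if_pos]
  · have e1 : (l₁.map fun d => PowerSeries.coeff ((e.filter (· ∈ l₁.toFinset)) d) (f d)) =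
        l₁.map fun d => PowerSeries.coeff (e d) (f d) :=
      List.map_congr_left fun d hd => by simp [hd]
    have e3 : (l₃.map fun d => PowerSeries.coeff
        (((e.filter (· ∉ l₁.toFinset)).filter (· ∉ ({b, c} : Finset τ))) d) (f d)) =
        l₃.map fun d => PowerSeries.coeff (e d) (f d) :=
      List.map_congr_left fun d hd => by
        have h1 : d ≠ b := by rintro rfl; exact hb3 hd
        have h2 : d ≠ c := by rintro rfl; exact hc3 hd
        simp [h1, h2, h31 d hd]
    rw [e1, e3]
    simp [hb1, hc1]
  · intro d hd
    rcases hmem' d with h | h | h | h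
    · simp [Finsupp.filter_apply, h]
    · simp [h]
    · simp [h]
    · exact absurd h hd

end Disjoint

/-! ### Extraction of coefficients -/

section Extract

variable (N : ℕ)

/-- The reduction modulo `h^p` of the map from `V(R) ⊗ V(R) ⊗ ℂ(z)[[h]]` to `V(R) ⊗ V(R)` with scalars
in an algebra in which `h^p = 0`. -/
def vvzMod (S : Type*) [CommRing S] [Algebra (PowerSeries (RatFunc ℂ)) S]
    [Algebra (PowerSeries ℂ) S] [IsScalarTower (PowerSeries ℂ) (PowerSeries (RatFunc ℂ)) S] {p : ℕ}
    (hS : algebraMap (PowerSeries ℂ) S PowerSeries.X ^ p = 0) :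
    ModPow (VVz N) p →ₗ[PowerSeries ℂ] S ⊗[PowerSeries ℂ] VV N :=
  Submodule.liftQ _ (vvzMap S N).toLinearMap (by
    intro x hx
    obtain ⟨y, rfl⟩ := mem_span_X_pow_smul_top.1 hx
    rw [LinearMap.mem_ker, map_smul, ← algebraMap_smul S, map_pow, hS, zero_smul])

variable {N} {n m p : ℕ}

theorem truncCoeff_smul_vvzMap {e : Fin n ⊕ Fin m →₀ ℕ} (he : ∀ i, e i < p)
    (e' : Fin n ⊕ Fin m →₀ ℕ) (z : VVz N) :
    truncCoeff (TensorProduct.mk (PowerSeries ℂ) (VV N) (PowerSeries (RatFunc ℂ))).flip he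
      ((∏ i, truncVar (PowerSeries (RatFunc ℂ)) p i ^ e' i) • vvzMap (Trunc _ _ p) N z) =
      if e' = e then Submodule.Quotient.mk z else 0 := by
  induction z using TensorProduct.induction_on with
  | zero => simp
  | tmul x c =>
    rw [vvzMap_tmul, TensorProduct.smul_tmul', smul_eq_mul, truncCoeff_monomial]
    split_ifs <;> rfl
  | add x y hx hy =>
    rw [map_add, smul_add, map_add, hx, hy]
    split_ifs
    · rfl
    · rw [add_zero]

/-- A family of elements modulo `h^p` can be recovered from the sum over the monomials. -/
theorem eq_zero_of_sum_eq_zero (y : (Fin n ⊕ Fin m →₀ ℕ) → ModPow (VVz N) p)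
    (h : ∑ e ∈ expBox (Fin n ⊕ Fin m) p, (∏ i, truncVar (PowerSeries (RatFunc ℂ)) p i ^ e i) •
      vvzMod N (Trunc (Fin n ⊕ Fin m) (PowerSeries (RatFunc ℂ)) p) (trunc_algebraMap_X _ p) (y e) = 0)
    {e : Fin n ⊕ Fin m →₀ ℕ} (he : ∀ i, e i < p) : y e = 0 := by
  have hz : ∀ e', truncCoeff
      (TensorProduct.mk (PowerSeries ℂ) (VV N) (PowerSeries (RatFunc ℂ))).flip he
      ((∏ i, truncVar (PowerSeries (RatFunc ℂ)) p i ^ e' i) •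
        vvzMod N (Trunc _ _ p) (trunc_algebraMap_X _ p) (y e')) = if e' = e then y e' else 0 := by
    intro e'
    obtain ⟨z, hz⟩ := Submodule.Quotient.mk_surjective _ (y e')
    rw [← hz]
    exact truncCoeff_smul_vvzMap he e' z
  have := congrArg (truncCoeff
    (TensorProduct.mk (PowerSeries ℂ) (VV N) (PowerSeries (RatFunc ℂ))).flip he) h
  rw [map_sum, map_zero, Finset.sum_congr rfl fun e' _ => hz e', Finset.sum_ite_eq',
    if_pos (mem_expBox.2 he)] at this
  exact this

end Extract

/-! ### The braiding is compatible with the relation -/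

section Compat

variable {N : ℕ} {S : Type*} [CommRing S] [Algebra (PowerSeries ℂ) S]

section Maps

variable {τ : Type*} [Fintype τ] [DecidableEq τ] {S E E' : Type*} [CommRing S] [Ring E]
  [Algebra S E] [Ring E'] [Algebra S E'] (f : E →ₗ[S] E')

theorem map_sc_mul (X : Matrix (τ → Fin N) (τ → Fin N) S) (Y : Matrix (τ → Fin N) (τ → Fin N) E) :
    (sc N τ E X * Y).map f = sc N τ E' X * Y.map f := by
  refine Matrix.ext fun I J => ?_
  rw [Matrix.map_apply, sc_mul_apply, sc_mul_apply, map_sum]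
  exact Finset.sum_congr rfl fun K _ => map_smul f _ _

theorem map_mul_sc (X : Matrix (τ → Fin N) (τ → Fin N) S) (Y : Matrix (τ → Fin N) (τ → Fin N) E) :
    (Y * sc N τ E X).map f = Y.map f * sc N τ E' X := by
  refine Matrix.ext fun I J => ?_
  rw [Matrix.map_apply, mul_sc_apply, mul_sc_apply, map_sum]
  exact Finset.sum_congr rfl fun K _ => map_smul f _ _

theorem map_sub_eq_zero {X₁ X₂ : Matrix (τ → Fin N) (τ → Fin N) E}
    {Y₁ Y₂ : Matrix (τ → Fin N) (τ → Fin N) E'} {k k' : S}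
    {r r' : Matrix (τ → Fin N) (τ → Fin N) S} (h₁ : X₁.map f = Y₁) (h₂ : X₂.map f = Y₂)
    (h : k • (sc N τ E' r * Y₁) = k' • (Y₂ * sc N τ E' r')) :
    (k • (sc N τ E r * X₁) - k' • (X₂ * sc N τ E r')).map f = 0 := by
  rw [← h₁, ← h₂, ← map_sc_mul, ← map_mul_sc] at h
  refine Matrix.ext fun I J => ?_
  have := congrFun (congrFun h I) J
  rw [Matrix.smul_apply, Matrix.smul_apply, Matrix.map_apply, Matrix.map_apply, ← map_smul,
    ← map_smul, ← sub_eq_zero, ← map_sub] at this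
  exact this

end Maps

variable (N) in
/-- The projection onto `V(R)` as a homomorphism of algebras. -/
def toVRAlg : FreeTop N →ₐ[PowerSeries ℂ] VR N :=
  { toVR N with commutes' := fun _ => rfl }

variable {W : Type*} [Ring W] [Algebra (PowerSeries ℂ) W] {n m : ℕ} {B : ℕ} {t : Fin n ⊕ Fin m → S}
  (ht : ∀ b, t b ^ B = 0)

/-- The composite of a homomorphism from the free topological algebra with an extension of
scalars. -/
def baseHom (S : Type*) [CommRing S] [Algebra (PowerSeries ℂ) S]
    (φ : FreeTop N →ₐ[PowerSeries ℂ] W) : FreeTop N →ₐ[PowerSeries ℂ] S ⊗[PowerSeries ℂ] W :=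
  (Algebra.TensorProduct.includeRight : W →ₐ[PowerSeries ℂ] S ⊗[PowerSeries ℂ] W).comp φ

theorem nilL_eq (φ : FreeTop N →ₐ[PowerSeries ℂ] W) {γ γ' : ℕ → Fin N → Fin N → W}
    {b : Fin n ⊕ Fin m} (hb : ∀ r i j, slotGen γ γ' b r i j = φ (PowerSeries.C (word r i j))) :
    nilL ht γ γ' b = Matrix.of fun i j => evNil₁ (((baseHom S φ : FreeTop N →ₐ[PowerSeries ℂ] _) :
      FreeTop N →+* S ⊗[PowerSeries ℂ] W).comp PowerSeries.C) (pow_smul_eq_zero (ht b))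
        (lWords i j) := by
  refine Matrix.ext fun i j => ?_
  rw [nilL, Matrix.of_apply, Matrix.of_apply, evNil₁_apply, evNil₁_apply]
  refine Finset.sum_congr rfl fun k _ => ?_
  rw [PowerSeries.coeff_mk, hb, lWords, PowerSeries.coeff_mk]
  rfl

theorem baseHom_C_algebraMap (φ : FreeTop N →ₐ[PowerSeries ℂ] W) (c : ℂ) :
    (((baseHom S φ : FreeTop N →ₐ[PowerSeries ℂ] _) : FreeTop N →+* S ⊗[PowerSeries ℂ] W).comp
      PowerSeries.C) (algebraMap ℂ _ c) = algebraMap S (S ⊗[PowerSeries ℂ] W) (numMap S c) := by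
  rw [RingHom.comp_apply, numMap, RingHom.comp_apply, ← IsScalarTower.algebraMap_apply,
    RingHom.coe_coe, ← (baseHom S φ).commutes]
  congr 1
  exact (PowerSeries.map_C _ _).symm

variable (hS : algebraMap (PowerSeries ℂ) S PowerSeries.X ^ B = 0)

include hS in
/-- The difference of the two sides of the relation in an extension of scalars. -/
theorem relBracket_nilL (φ : FreeTop N →ₐ[PowerSeries ℂ] W) {γ γ' : ℕ → Fin N → Fin N → W}
    {b c : Fin n ⊕ Fin m} (hbc : b ≠ c)
    (hb : ∀ r i j, slotGen γ γ' b r i j = φ (PowerSeries.C (word r i j)))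
    (hc : ∀ r i j, slotGen γ γ' c r i j = φ (PowerSeries.C (word r i j))) (i j : Fin 2 → Fin N) :
    relBracket (qExp S (1 / 2)) (qExp S (-1 / 2)) ![expNil 1 (ht b), expNil 1 (ht c)] 0 1
      (nilL ht γ γ' b) (nilL ht γ γ' c) i j =
    evNil (toBase S W) ht (pairSeries b c fun x y => φ (clearedCoeff N i j x y)) := by
  rw [nilL_eq ht φ hb, nilL_eq ht φ hc]
  have h := congrFun (congrFun (map_ev₃_clearedRel (N := N) hS (ht b) (ht c)
    (baseHom_C_algebraMap (S := S) φ)) i) j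
  refine Eq.trans h.symm ?_
  rw [Matrix.map_apply, ev₃_eq_sum, evNil_pairSeries _ _ hbc]
  rfl

end Compat

/-! ### Exchange of neighbouring factors under the braiding -/

section Compat

variable {N : ℕ} {S : Type*} [CommRing S] [Algebra (PowerSeries (RatFunc ℂ)) S]
  [Algebra (PowerSeries ℂ) S] [IsScalarTower (PowerSeries ℂ) (PowerSeries (RatFunc ℂ)) S]
  {n m : ℕ} {B : ℕ} {t : Fin n ⊕ Fin m → S} (ht : ∀ b, t b ^ B = 0)
  (hS : algebraMap (PowerSeries ℂ) S PowerSeries.X ^ B = 0)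

/-- The scale of the spectral parameters of a group of tensor factors. -/
def slotScale (S : Type*) [CommRing S] [Algebra (PowerSeries (RatFunc ℂ)) S] (b : Fin n ⊕ Fin m) : S :=
  bif b.isLeft then nilZ S else 1

theorem isUnit_slotScale (b : Fin n ⊕ Fin m) : IsUnit (slotScale S b) := by
  rw [slotScale]
  rcases b with i | j
  · refine IsUnit.map (algebraMap (PowerSeries (RatFunc ℂ)) S) (IsUnit.map PowerSeries.C ?_)
    exact isUnit_iff_ne_zero.2 RatFunc.X_ne_zero
  · exact isUnit_one

theorem nilParam_eq {b c : Fin n ⊕ Fin m} (h : c.isLeft = b.isLeft) :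
    nilParam ht c = slotScale S b * expNil 1 (ht c) := by
  rw [nilParam, slotScale, h]

theorem relBracket_nilParam {E : Type*} [Ring E] [Algebra S E] {b c : Fin n ⊕ Fin m} (hbc : b ≠ c)
    (h : c.isLeft = b.isLeft) (A A' : Matrix (Fin N) (Fin N) E) :
    relBracket (qExp S (1 / 2)) (qExp S (-1 / 2)) (nilParam ht) b c A A' =
      slotScale S b ^ 2 • relBracket (qExp S (1 / 2)) (qExp S (-1 / 2))
        (fun d => expNil 1 (ht d)) b c A A' :=
  relBracket_smul hbc _ _ (nilParam_eq ht rfl) (nilParam_eq ht h)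

include hS in
-- Two slots of one group belong to the same copy of `V(R)`, so the defining relation holds between
-- their L-operators. It involves the parameters without `z`; homogeneity allows the common
-- rescaling.
theorem relBracket_nilLV {b c : Fin n ⊕ Fin m} (hbc : b ≠ c) (h : c.isLeft = b.isLeft) :
    (nilParam ht c - nilParam ht b * qExp S (1 / 2) ^ 2) •
      (sc N _ _ (rb N (qExp S (1 / 2)) (qExp S (-1 / 2)) (nilParam ht) c b) *
        leg b (nilLV ht N b) * leg c (nilLV ht N c)) =
    (nilParam ht b - nilParam ht c * qExp S (1 / 2) ^ 2) •
      (leg c (nilLV ht N c) * leg b (nilLV ht N b) *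
        sc N _ _ (rb N (qExp S (1 / 2)) (qExp S (-1 / 2)) (nilParam ht) b c)) := by
  rw [← sub_eq_zero]
  refine (relBracket_nilParam ht hbc h _ _).trans ?_
  refine Eq.trans (congrArg _ ?_) (smul_zero _)
  have key : ∀ φ : FreeTop N →ₐ[PowerSeries ℂ] VV N, (∀ f ∈ relIdeal N, φ f = 0) →
      (∀ d : Fin n ⊕ Fin m, d.isLeft = b.isLeft → ∀ r i j,
        slotGen (fun r a c => gen r a c ⊗ₜ[PowerSeries ℂ] (1 : VR N))
          (fun r a c => (1 : VR N) ⊗ₜ[PowerSeries ℂ] gen r a c) d r i j =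
            φ (PowerSeries.C (word r i j))) →
      relBracket (qExp S (1 / 2)) (qExp S (-1 / 2)) (fun d => expNil 1 (ht d)) b c
        (nilLV ht N b) (nilLV ht N c) = 0 := by
    intro φ h0 hφ
    rw [nilLV, nilL_eq ht φ (hφ b rfl), nilL_eq ht φ (hφ c h), relBracket, sub_eq_zero]
    refine RelPair.leg (ζ := fun d => expNil 1 (ht d)) hbc (relPair_of_freeTop hS (ht b) (ht c)
      (baseHom S φ) fun f hf => ?_)
    rw [baseHom, AlgHom.comp_apply, h0 f hf, map_zero]
  rcases hb : b.isLeft with _ | _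
  · refine key (Algebra.TensorProduct.includeRight.comp (toVRAlg N)) (fun f hf => ?_) ?_
    · rw [AlgHom.comp_apply, show toVRAlg N f = 0 from toVR_eq_zero.2 hf, map_zero]
    · intro d hd r i j
      rw [slotGen, hd, hb]
      rfl
  · refine key (Algebra.TensorProduct.includeLeft.comp (toVRAlg N)) (fun f hf => ?_) ?_
    · rw [AlgHom.comp_apply, show toVRAlg N f = 0 from toVR_eq_zero.2 hf, map_zero]
    · intro d hd r i j
      rw [slotGen, hd, hb]
      rfl

/-- The difference of the two sides of the exchange relation for a group of ordered products. -/
def exchangeDiff {W : Type*} [Ring W] [Algebra (PowerSeries ℂ) W] (γ γ' : ℕ → Fin N → Fin N → W)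
    (b c : Fin n ⊕ Fin m) (l₁ l₃ : List (Fin n ⊕ Fin m)) :
    Matrix (Fin n ⊕ Fin m → Fin N) (Fin n ⊕ Fin m → Fin N) (S ⊗[PowerSeries ℂ] W) :=
  (nilParam ht c - nilParam ht b * qExp S (1 / 2) ^ 2) •
      (sc N _ _ (rb N (qExp S (1 / 2)) (qExp S (-1 / 2)) (nilParam ht) c b) *
        prodL (nilL ht γ γ') (l₁ ++ b :: c :: l₃)) -
    (nilParam ht b - nilParam ht c * qExp S (1 / 2) ^ 2) •
      (prodL (nilL ht γ γ') (l₁ ++ c :: b :: l₃) *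
        sc N _ _ (rb N (qExp S (1 / 2)) (qExp S (-1 / 2)) (nilParam ht) b c))

variable {W : Type*} [Ring W] [Algebra (PowerSeries ℂ) W] {γ γ' : ℕ → Fin N → Fin N → W}

include hS in
-- The L-operators outside the two slots are common to both ordered products, so an entry of the
-- difference is the value of a series whose coefficients are words with one coefficient of the
-- cleared relation inserted.
theorem exchangeDiff_apply (φ : FreeTop N →ₐ[PowerSeries ℂ] W)
    {b c : Fin n ⊕ Fin m} (h : c.isLeft = b.isLeft) {l₁ l₃ : List (Fin n ⊕ Fin m)}
    (hl : slotsL n m ++ slotsR n m = l₁ ++ b :: c :: l₃)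
    (hb : ∀ r i j, slotGen γ γ' b r i j = φ (PowerSeries.C (word r i j)))
    (hc : ∀ r i j, slotGen γ γ' c r i j = φ (PowerSeries.C (word r i j)))
    (I J : Fin n ⊕ Fin m → Fin N) :
    exchangeDiff ht γ γ' b c l₁ l₃ I J = slotScale S b ^ 2 • evNil (toBase S W) ht
      ((l₁.map fun d => inVar d (PowerSeries.mk fun r => slotGen γ γ' d r (I d) (J d))).prod *
        (pairSeries b c (fun x y => φ (clearedCoeff N ![I b, I c] ![J b, J c] x y)) *
          (l₃.map fun d => inVar d (PowerSeries.mk fun r => slotGen γ γ' d r (I d) (J d))).prod)) := by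
  have hnd := nodup_slots n m
  have hmem : ∀ d : Fin n ⊕ Fin m, d ∈ slotsL n m ++ slotsR n m := mem_slots
  rw [hl] at hnd hmem
  have hbc : b ≠ c := by
    rintro rfl
    simp [List.nodup_append] at hnd
  have hp : ∀ l : List (Fin n ⊕ Fin m), (l.map fun d => nilL ht γ γ' d (I d) (J d)).prod =
      evNil (toBase S W) ht
        (l.map fun d => inVar d (PowerSeries.mk fun r => slotGen γ γ' d r (I d) (J d))).prod := by
    intro l
    rw [map_list_prod, List.map_map]
    congr 1
    refine List.map_congr_left fun d _ => ?_
    exact (evNil_inVar _ ht _ _ (pow_smul_eq_zero (ht d))).symm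
  rw [exchangeDiff, smul_rb_mul_prodL_sub hnd, relBracket_nilParam ht hbc h, smul_mul_assoc,
    mul_smul_comm, Matrix.smul_apply, prodL_relBracket_apply hbc _ _ hnd hmem,
    relBracket_nilL ht hS φ hbc hb hc, hp, hp, map_mul, map_mul]

variable (G : W →ₗ[PowerSeries ℂ] S ⊗[PowerSeries ℂ] VV N)
  (hG : ∀ I J e, G (MvPowerSeries.coeff e (lGen γ γ' n m I J)) =
    vvzMap S N (MvPowerSeries.coeff e (braidedLNM N n m I J)))

theorem map_swap_eq {τ : Type*} [DecidableEq τ] {b c : τ} {l₁ l₃ : List τ}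
    (h : (l₁ ++ b :: c :: l₃).Nodup) :
    (l₁ ++ b :: c :: l₃).map (Equiv.swap b c) = l₁ ++ c :: b :: l₃ := by
  simp only [List.nodup_append, List.nodup_cons, List.mem_cons, not_or] at h
  obtain ⟨h1, ⟨⟨_, hb3⟩, hc3, h3⟩, h13⟩ := h
  have e : ∀ l : List τ, b ∉ l → c ∉ l → l.map (Equiv.swap b c) = l := by
    intro l hb hc
    conv_rhs => rw [← List.map_id l]
    exact List.map_congr_left fun d hd => Equiv.swap_apply_of_ne_of_ne
      (by rintro rfl; exact hb hd) (by rintro rfl; exact hc hd)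
  rw [List.map_append, List.map_cons, List.map_cons, e l₁ (fun h => h13 b h b (by simp) rfl)
    (fun h => h13 c h c (by simp) rfl), e l₃ hb3 hc3, Equiv.swap_apply_left, Equiv.swap_apply_right]

theorem map_swap_eq_self {τ : Type*} [DecidableEq τ] {b c : τ} {l : List τ} (hb : b ∉ l)
    (hc : c ∉ l) : l.map (Equiv.swap b c) = l := by
  conv_rhs => rw [← List.map_id l]
  exact List.map_congr_left fun d hd => Equiv.swap_apply_of_ne_of_ne
    (by rintro rfl; exact hb hd) (by rintro rfl; exact hc hd)

theorem isLeft_swap {b c : Fin n ⊕ Fin m} (h : c.isLeft = b.isLeft) (d : Fin n ⊕ Fin m) :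
    (Equiv.swap b c d).isLeft = d.isLeft := by
  rcases eq_or_ne d b with rfl | hb
  · rw [Equiv.swap_apply_left, h]
  · rcases eq_or_ne d c with rfl | hc
    · rw [Equiv.swap_apply_right, h]
    · rw [Equiv.swap_apply_of_ne_of_ne hb hc]

include hS hG in
-- The map sends an ordered product to the braided one, for the given order of slots and for the
-- order with `b` and `c` interchanged. The two braided products satisfy the exchange relation, so
-- the difference goes to zero.
theorem map_exchangeDiff_left {b c : Fin n ⊕ Fin m} {l₁ l₃ : List (Fin n ⊕ Fin m)}
    (hl : slotsL n m = l₁ ++ b :: c :: l₃) (h : c.isLeft = b.isLeft) :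
    (exchangeDiff ht γ γ' b c l₁ (l₃ ++ slotsR n m)).map (G.liftBaseChange S) = 0 := by
  have hnd := nodup_slots n m
  rw [hl] at hnd
  have hnd1 := (List.nodup_append.1 hnd).1
  have hd := (List.nodup_append.1 hnd).2.2
  have hbc : b ≠ c := by
    rintro rfl
    simp [List.nodup_append] at hnd
  obtain ⟨Q, h1, h2, h3⟩ := liftBaseChange_prodL_perm ht G hG (Equiv.refl _) fun _ => rfl
  -- The product with `b` and `c` interchanged is the standard product with two nilpotent parameters
  -- swapped, seen after renaming the slots; the prescribed values hold for all parameters.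
  obtain ⟨Q', h1', h2', h3'⟩ := liftBaseChange_prodL_perm ht G hG (Equiv.swap b c) (isLeft_swap h)
  simp only [Equiv.coe_refl, List.map_id] at h1 h2 h3
  rw [map_swap_eq_self (l := slotsR n m) (fun h => hd b (by simp) b h rfl)
    (fun h => hd c (by simp) c h rfl), hl, map_swap_eq hnd1] at h1' h2' h3'
  rw [hl] at h1 h2 h3
  have key := braided_exchange_left (nilParam ht) (nilNorm ht) (nilLV ht N) qExp_half_mul hnd
    (relBracket_nilLV ht hS hbc h) h1 h2'
  have a1 : ∀ x y, prodL (nilL ht γ γ') (l₁ ++ x :: y :: (l₃ ++ slotsR n m)) =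
      prodL (nilL ht γ γ') (l₁ ++ x :: y :: l₃) * prodL (nilL ht γ γ') (slotsR n m) := by
    intro x y
    rw [← prodL_append, List.append_assoc, List.cons_append, List.cons_append]
  rw [exchangeDiff, a1, a1]
  exact map_sub_eq_zero _ h3 h3' key

include hS hG in
theorem map_exchangeDiff_right {b c : Fin n ⊕ Fin m} {l₁ l₃ : List (Fin n ⊕ Fin m)}
    (hl : slotsR n m = l₁ ++ b :: c :: l₃) (h : c.isLeft = b.isLeft) :
    (exchangeDiff ht γ γ' b c (slotsL n m ++ l₁) l₃).map (G.liftBaseChange S) = 0 := by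
  have hnd := nodup_slots n m
  rw [hl] at hnd
  have hnd1 := (List.nodup_append.1 hnd).2.1
  have hd := (List.nodup_append.1 hnd).2.2
  have hbc : b ≠ c := by
    rintro rfl
    simp [List.nodup_append] at hnd1
  obtain ⟨Q, h1, h2, h3⟩ := liftBaseChange_prodL_perm ht G hG (Equiv.refl _) fun _ => rfl
  obtain ⟨Q', h1', h2', h3'⟩ := liftBaseChange_prodL_perm ht G hG (Equiv.swap b c) (isLeft_swap h)
  simp only [Equiv.coe_refl, List.map_id] at h1 h2 h3
  rw [map_swap_eq_self (l := slotsL n m) (fun h => hd b h b (by simp) rfl)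
    (fun h => hd c h c (by simp) rfl), hl, map_swap_eq hnd1] at h1' h2' h3'
  rw [hl] at h1 h2 h3
  have key := braided_exchange_right (nilParam ht) (nilNorm ht) (nilLV ht N) qExp_half_mul hnd
    (relBracket_nilLV ht hS hbc h) h1 h2'
  have a1 : ∀ x y, prodL (nilL ht γ γ') (slotsL n m ++ l₁ ++ x :: y :: l₃) =
      prodL (nilL ht γ γ') (slotsL n m) * prodL (nilL ht γ γ') (l₁ ++ x :: y :: l₃) := by
    intro x y
    rw [← prodL_append, List.append_assoc]
  rw [exchangeDiff, a1, a1]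
  exact map_sub_eq_zero _ h3 h3' key

end Compat

/-! ### The braiding vanishes on the relations -/

section Vanish

variable {N : ℕ}

variable (N) in
/-- The braiding on the tensor square of the free topological algebra, modulo `h^p`. -/
def braidFree₂ (p : ℕ) : FreeTop₂ N →ₗ[PowerSeries ℂ] ModPow (VVz N) p :=
  TensorProduct.lift (braidFree N p)

theorem braidFree₂_tmul (p : ℕ) (f g : FreeTop N) :
    braidFree₂ N p (f ⊗ₜ g) = braidFree N p f g := rfl

variable {n m p : ℕ}

/-- The truncated polynomial ring over `ℂ(z)[[h]]` in the variables of two groups. -/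
abbrev TruncZ (n m p : ℕ) : Type := Trunc (Fin n ⊕ Fin m) (PowerSeries (RatFunc ℂ)) p

variable (N n m p) in
/-- The braiding with values in an extension of scalars. -/
def braidTrunc : FreeTop₂ N →ₗ[PowerSeries ℂ] TruncZ n m p ⊗[PowerSeries ℂ] VV N :=
  (vvzMod N (TruncZ n m p) (trunc_algebraMap_X _ p)).comp (braidFree₂ N p)

theorem braidTrunc_coeff (I J : Fin n ⊕ Fin m → Fin N) (e : Fin n ⊕ Fin m →₀ ℕ) :
    braidTrunc N n m p (MvPowerSeries.coeff e (lGen freeGenL freeGenR n m I J)) =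
      vvzMap (TruncZ n m p) N (MvPowerSeries.coeff e (braidedLNM N n m I J)) := by
  rw [coeff_lGen_free, braidTrunc, LinearMap.comp_apply, braidFree₂_tmul, braidFree_wordTop,
    braidCoeff_readWord]
  rfl

/-- The vanishing of the mapped difference at the truncated variables is an identity of truncated
polynomials once the unit `slotScale` is removed. Its coefficient at `e` is the vanishing of the
braiding on one word with a relation inserted. -/
theorem braidFree₂_eq_zero (φ : FreeTop N →ₐ[PowerSeries ℂ] FreeTop₂ N)
    {b c : Fin n ⊕ Fin m} (h : c.isLeft = b.isLeft) {l₁ l₃ : List (Fin n ⊕ Fin m)}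
    (hl : slotsL n m ++ slotsR n m = l₁ ++ b :: c :: l₃)
    (hb : ∀ r i j, slotGen freeGenL freeGenR b r i j = φ (PowerSeries.C (word r i j)))
    (hc : ∀ r i j, slotGen freeGenL freeGenR c r i j = φ (PowerSeries.C (word r i j)))
    (h0 : (exchangeDiff (truncVar_pow (PowerSeries (RatFunc ℂ)) p) freeGenL freeGenR b c l₁ l₃).map
      ((braidTrunc N n m p).liftBaseChange (TruncZ n m p)) = 0)
    (I J : Fin n ⊕ Fin m → Fin N) {e : Fin n ⊕ Fin m →₀ ℕ} (he : ∀ i, e i < p) :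
    braidFree₂ N p ((l₁.map fun d => slotGen freeGenL freeGenR d (e d) (I d) (J d)).prod *
      (φ (clearedCoeff N ![I b, I c] ![J b, J c] (e b) (e c)) *
        (l₃.map fun d => slotGen freeGenL freeGenR d (e d) (I d) (J d)).prod)) = 0 := by
  have hnd := nodup_slots n m
  have hmem : ∀ d : Fin n ⊕ Fin m, d ∈ slotsL n m ++ slotsR n m := mem_slots
  rw [hl] at hnd hmem
  have h1 := congrFun (congrFun h0 I) J
  rw [Matrix.map_apply, exchangeDiff_apply _ (trunc_algebraMap_X _ p) φ h hl hb hc, map_smul] at h1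
  have h2 := ((isUnit_slotScale (S := TruncZ n m p) b).pow 2).smul_eq_zero.1 h1
  rw [evNil_apply, map_sum] at h2
  have h3 := eq_zero_of_sum_eq_zero (fun e => braidFree₂ N p (MvPowerSeries.coeff e
    ((l₁.map fun d => inVar d (PowerSeries.mk fun r =>
        slotGen freeGenL freeGenR d r (I d) (J d))).prod *
      (pairSeries b c (fun x y => φ (clearedCoeff N ![I b, I c] ![J b, J c] x y)) *
        (l₃.map fun d => inVar d (PowerSeries.mk fun r =>
          slotGen freeGenL freeGenR d r (I d) (J d))).prod))))
    (Eq.trans (Finset.sum_congr rfl fun e _ => ?_) h2) he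
  · rw [coeff_prod_mul_pairSeries hnd hmem] at h3
    simpa only [PowerSeries.coeff_mk] using h3
  · rw [map_smul]
    congr 1
    refine Eq.symm ((LinearMap.liftBaseChange_tmul _ _ _ _).trans ?_)
    rw [one_smul]
    rfl

theorem map_slotGen_left (l : List (Fin n)) (e : Fin n ⊕ Fin m → ℕ)
    (I J : Fin n ⊕ Fin m → Fin N) :
    ((l.map Sum.inl).map fun d => slotGen freeGenL freeGenR d (e d) (I d) (J d)).prod =
      wordTop (readWord (l.map Sum.inl) e I J) ⊗ₜ 1 := by
  rw [← prod_freeGenL, List.map_map, List.map_map]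
  rfl

theorem map_slotGen_right (l : List (Fin m)) (e : Fin n ⊕ Fin m → ℕ)
    (I J : Fin n ⊕ Fin m → Fin N) :
    ((l.map Sum.inr).map fun d => slotGen freeGenL freeGenR d (e d) (I d) (J d)).prod =
      1 ⊗ₜ wordTop (readWord (l.map Sum.inr) e I J) := by
  rw [← prod_freeGenR, List.map_map, List.map_map]
  rfl

theorem exists_finRange_split {α : Type*} {f A B : List α} {x y : α} (hf : f = A ++ x :: y :: B) :
    ∃ (p₁ p₃ : List (Fin f.length)) (b c : Fin f.length),
      List.finRange f.length = p₁ ++ b :: c :: p₃ ∧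
      p₁.map f.get = A ∧ p₃.map f.get = B ∧ f.get b = x ∧ f.get c = y := by
  obtain ⟨p₁, r, h, h1, h2⟩ := List.map_eq_append_iff.1 ((List.map_get_finRange f).trans hf)
  obtain ⟨b, r, rfl, hb, h2⟩ := List.map_eq_cons_iff.1 h2
  obtain ⟨c, p₃, rfl, hc, h3⟩ := List.map_eq_cons_iff.1 h2
  exact ⟨p₁, p₃, b, c, h, h1, h3, hb, hc⟩

theorem exists_bound {τ : Type*} [Fintype τ] (e : τ → ℕ) (p : ℕ) : ∃ p', p ≤ p' ∧ ∀ i, e i < p' := by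
  refine ⟨max p (Finset.univ.sup e + 1), le_max_left _ _, fun i => ?_⟩
  exact lt_of_lt_of_le (Nat.lt_succ_of_le (Finset.le_sup (Finset.mem_univ i))) (le_max_right _ _)

theorem braidFree_clearedCoeff_left (p : ℕ) (A B w : WordList N) (i j : Fin 2 → Fin N) (x y : ℕ) :
    braidFree N p (wordTop A * clearedCoeff N i j x y * wordTop B) (wordTop w) = 0 := by
  obtain ⟨f, hf⟩ : ∃ f, f = A.toList ++ (x, i 0, j 0) :: (y, i 1, j 1) :: B.toList := ⟨_, rfl⟩
  obtain ⟨p₁, p₃, b, c, h, h1, h3, hb, hc⟩ := exists_finRange_split hf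
  set v : Fin f.length ⊕ Fin w.toList.length → ℕ × Fin N × Fin N :=
    Sum.elim f.get w.toList.get
  -- A coefficient is visible only if all its exponents lie below the truncation level. The claim is
  -- therefore proved modulo a higher power of `h` and reduced afterwards.
  obtain ⟨p', hp, he⟩ := exists_bound (fun d => (v d).1) p
  rw [← modPowRed_braidFree hp]
  refine Eq.trans (congrArg _ ?_) (map_zero _)
  have hl : slotsL f.length w.toList.length =
      p₁.map Sum.inl ++ Sum.inl b :: Sum.inl c :: p₃.map Sum.inl := by
    rw [slotsL, h]; simp
  have key := braidFree₂_eq_zero (p := p') Algebra.TensorProduct.includeLeft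
    (b := Sum.inl b) (c := Sum.inl c) rfl
    (l₁ := p₁.map Sum.inl) (l₃ := p₃.map Sum.inl ++ slotsR f.length w.toList.length)
    (by rw [hl, List.append_assoc]; rfl) (fun _ _ _ => rfl) (fun _ _ _ => rfl)
    (map_exchangeDiff_left _ (trunc_algebraMap_X _ p') _ braidTrunc_coeff hl rfl)
    (fun d => (v d).2.1) (fun d => (v d).2.2) (e := Finsupp.equivFunOnFinite.symm fun d => (v d).1) he
  have r1 : readWord (p₁.map Sum.inl) (fun d => (v d).1) (fun d => (v d).2.1) (fun d => (v d).2.2) =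
      A := by
    rw [readWord, List.map_map]
    exact h1
  have r3 : readWord (p₃.map Sum.inl) (fun d => (v d).1) (fun d => (v d).2.1) (fun d => (v d).2.2) =
      B := by
    rw [readWord, List.map_map]
    exact h3
  have r2 : readWord ((List.finRange w.toList.length).map Sum.inr) (fun d => (v d).1)
      (fun d => (v d).2.1) (fun d => (v d).2.2) = w := by
    rw [readWord, List.map_map]
    exact List.map_get_finRange _
  have hvb : v (Sum.inl b) = (x, i 0, j 0) := hb
  have hvc : v (Sum.inl c) = (y, i 1, j 1) := hc
  have ei : ![(v (Sum.inl b)).2.1, (v (Sum.inl c)).2.1] = i := by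
    rw [hvb, hvc]; funext k; fin_cases k <;> rfl
  have ej : ![(v (Sum.inl b)).2.2, (v (Sum.inl c)).2.2] = j := by
    rw [hvb, hvc]; funext k; fin_cases k <;> rfl
  have ex : (v (Sum.inl b)).1 = x := by rw [hvb]
  have ey : (v (Sum.inl c)).1 = y := by rw [hvc]
  simp only [Finsupp.equivFunOnFinite_symm_apply_apply, List.map_append, List.prod_append] at key
  rw [ei, ej, ex, ey, slotsR, map_slotGen_left p₁ (fun d => (v d).1) (fun d => (v d).2.1)
    (fun d => (v d).2.2), map_slotGen_left p₃ (fun d => (v d).1) (fun d => (v d).2.1)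
    (fun d => (v d).2.2), map_slotGen_right _ (fun d => (v d).1) (fun d => (v d).2.1)
    (fun d => (v d).2.2), r1, r2, r3, Algebra.TensorProduct.includeLeft_apply,
    Algebra.TensorProduct.tmul_mul_tmul, Algebra.TensorProduct.tmul_mul_tmul,
    Algebra.TensorProduct.tmul_mul_tmul, braidFree₂_tmul] at key
  simpa only [mul_one, one_mul, mul_assoc] using key

theorem braidFree_clearedCoeff_right (p : ℕ) (A B w : WordList N) (i j : Fin 2 → Fin N) (x y : ℕ) :
    braidFree N p (wordTop w) (wordTop A * clearedCoeff N i j x y * wordTop B) = 0 := by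
  obtain ⟨f, hf⟩ : ∃ f, f = A.toList ++ (x, i 0, j 0) :: (y, i 1, j 1) :: B.toList := ⟨_, rfl⟩
  obtain ⟨p₁, p₃, b, c, h, h1, h3, hb, hc⟩ := exists_finRange_split hf
  set v : Fin w.toList.length ⊕ Fin f.length → ℕ × Fin N × Fin N :=
    Sum.elim w.toList.get f.get
  obtain ⟨p', hp, he⟩ := exists_bound (fun d => (v d).1) p
  rw [← modPowRed_braidFree hp]
  refine Eq.trans (congrArg _ ?_) (map_zero _)
  have hl : slotsR w.toList.length f.length =
      p₁.map Sum.inr ++ Sum.inr b :: Sum.inr c :: p₃.map Sum.inr := by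
    rw [slotsR, h]; simp
  have key := braidFree₂_eq_zero (p := p') Algebra.TensorProduct.includeRight
    (b := Sum.inr b) (c := Sum.inr c) rfl
    (l₁ := slotsL w.toList.length f.length ++ p₁.map Sum.inr) (l₃ := p₃.map Sum.inr)
    (by rw [hl, List.append_assoc]) (fun _ _ _ => rfl) (fun _ _ _ => rfl)
    (map_exchangeDiff_right _ (trunc_algebraMap_X _ p') _ braidTrunc_coeff hl rfl)
    (fun d => (v d).2.1) (fun d => (v d).2.2) (e := Finsupp.equivFunOnFinite.symm fun d => (v d).1) he
  have r1 : readWord (p₁.map Sum.inr) (fun d => (v d).1) (fun d => (v d).2.1) (fun d => (v d).2.2) =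
      A := by
    rw [readWord, List.map_map]
    exact h1
  have r3 : readWord (p₃.map Sum.inr) (fun d => (v d).1) (fun d => (v d).2.1) (fun d => (v d).2.2) =
      B := by
    rw [readWord, List.map_map]
    exact h3
  have r2 : readWord ((List.finRange w.toList.length).map Sum.inl) (fun d => (v d).1)
      (fun d => (v d).2.1) (fun d => (v d).2.2) = w := by
    rw [readWord, List.map_map]
    exact List.map_get_finRange _
  have hvb : v (Sum.inr b) = (x, i 0, j 0) := hb
  have hvc : v (Sum.inr c) = (y, i 1, j 1) := hc
  have ei : ![(v (Sum.inr b)).2.1, (v (Sum.inr c)).2.1] = i := by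
    rw [hvb, hvc]; funext k; fin_cases k <;> rfl
  have ej : ![(v (Sum.inr b)).2.2, (v (Sum.inr c)).2.2] = j := by
    rw [hvb, hvc]; funext k; fin_cases k <;> rfl
  have ex : (v (Sum.inr b)).1 = x := by rw [hvb]
  have ey : (v (Sum.inr c)).1 = y := by rw [hvc]
  simp only [Finsupp.equivFunOnFinite_symm_apply_apply, List.map_append, List.prod_append] at key
  rw [ei, ej, ex, ey, slotsL, map_slotGen_right p₁ (fun d => (v d).1) (fun d => (v d).2.1)
    (fun d => (v d).2.2), map_slotGen_right p₃ (fun d => (v d).1) (fun d => (v d).2.1)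
    (fun d => (v d).2.2), map_slotGen_left _ (fun d => (v d).1) (fun d => (v d).2.1)
    (fun d => (v d).2.2), r1, r2, r3, Algebra.TensorProduct.includeRight_apply,
    Algebra.TensorProduct.tmul_mul_tmul, Algebra.TensorProduct.tmul_mul_tmul,
    Algebra.TensorProduct.tmul_mul_tmul, braidFree₂_tmul] at key
  simpa only [mul_one, one_mul, mul_assoc] using key

theorem eq_zero_of_words {Y : Type*} [AddCommGroup Y] [Module (PowerSeries ℂ) Y] {p : ℕ}
    (hY : ∀ y : Y, (PowerSeries.X : PowerSeries ℂ) ^ p • y = 0)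
    (T : FreeTop N →ₗ[PowerSeries ℂ] FreeTop N →ₗ[PowerSeries ℂ] Y) {f : FreeTop N}
    (h : ∀ A B w, T (wordTop A * f * wordTop B) (wordTop w) = 0) (a c g : FreeTop N) :
    T (a * f * c) g = 0 := by
  have h1 : ∀ A B g, T (wordTop A * f * wordTop B) g = 0 := fun A B g =>
    LinearMap.congr_fun (freeTop_hom_ext (g := 0) hY (h A B)) g
  have h2 : ∀ A c g, T (wordTop A * f * c) g = 0 := fun A c g =>
    LinearMap.congr_fun (freeTop_hom_ext (f := (T.flip g).comp (LinearMap.mulLeft _ (wordTop A * f)))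
      (g := 0) hY fun B => h1 A B g) c
  have := LinearMap.congr_fun (freeTop_hom_ext
    (f := (T.flip g).comp (LinearMap.mulRight _ (f * c))) (g := 0) hY fun A => by
      rw [LinearMap.comp_apply, LinearMap.mulRight_apply, ← mul_assoc]
      exact h2 A c g) a
  rw [LinearMap.comp_apply, LinearMap.mulRight_apply, ← mul_assoc] at this
  exact this

theorem relIdeal_le {K : TwoSidedIdeal (FreeTop N)} (hK : IsTopFreeIdeal K)
    (h : ∀ i j x y, clearedCoeff N i j x y ∈ K) : ∀ f ∈ relIdeal N, f ∈ K := by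
  intro f hf
  rw [relIdeal, TwoSidedIdeal.mem_sInf] at hf
  exact hf K ⟨hK, (relCoeff_mem_iff hK).2 h⟩

/-- The kernel ideal of the family over all `p` satisfies the conditions in the definition of
`relIdeal` and contains the cleared relations, hence contains `relIdeal` by minimality. -/
theorem braidFree_eq_zero_left {f : FreeTop N} (hf : f ∈ relIdeal N) (p : ℕ) (g : FreeTop N) :
    braidFree N p f g = 0 := by
  have h := relIdeal_le (isTopFreeIdeal_kerIdeal (fun p => braidFree N p)
    fun p f g => modPowRed_braidFree p.le_succ f g) (fun i j x y => by
      rw [mem_kerIdeal]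
      exact fun p => eq_zero_of_words modPow_smul _ fun A B w =>
        braidFree_clearedCoeff_left p A B w i j x y) f hf
  rw [mem_kerIdeal] at h
  simpa using h p 1 1 g

theorem braidFree_eq_zero_right {g : FreeTop N} (hg : g ∈ relIdeal N) (p : ℕ) (f : FreeTop N) :
    braidFree N p f g = 0 := by
  have h := relIdeal_le (isTopFreeIdeal_kerIdeal (fun p => (braidFree N p).flip)
    fun p f g => modPowRed_braidFree p.le_succ g f) (fun i j x y => by
      rw [mem_kerIdeal]
      exact fun p => eq_zero_of_words modPow_smul _ fun A B w =>
        braidFree_clearedCoeff_right p A B w i j x y) g hg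
  rw [mem_kerIdeal] at h
  simpa using h p 1 1 f

end Vanish

/-! ### The braiding map -/

section Braiding

variable {N : ℕ}

/-- The linear map on `V(R)` induced by a linear map which vanishes on the relations. -/
def vrLift {Y : Type*} [AddCommGroup Y] [Module (PowerSeries ℂ) Y]
    (T : FreeTop N →ₗ[PowerSeries ℂ] Y) (h : ∀ f ∈ relIdeal N, T f = 0) :
    VR N →ₗ[PowerSeries ℂ] Y :=
  (Submodule.liftQ (LinearMap.ker (toVRAlg N).toLinearMap) T
    fun f hf => h f (toVR_eq_zero.1 hf)).comp
    ((toVRAlg N).toLinearMap.quotKerEquivOfSurjective (toVR_surjective N)).symm.toLinearMap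

theorem vrLift_toVR {Y : Type*} [AddCommGroup Y] [Module (PowerSeries ℂ) Y]
    (T : FreeTop N →ₗ[PowerSeries ℂ] Y) (h : ∀ f ∈ relIdeal N, T f = 0) (f : FreeTop N) :
    vrLift T h (toVR N f) = T f := by
  have e : ((toVRAlg N).toLinearMap.quotKerEquivOfSurjective (toVR_surjective N)).symm (toVR N f) =
      Submodule.Quotient.mk f := by
    rw [LinearEquiv.symm_apply_eq]
    rfl
  rw [vrLift, LinearMap.comp_apply, LinearEquiv.coe_coe, e]
  rfl

variable (N) in
/-- The braiding on `V(R) × V(R)`, modulo `h^p`, as a bilinear map. -/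
def braidBilin (p : ℕ) : VR N →ₗ[PowerSeries ℂ] VR N →ₗ[PowerSeries ℂ] ModPow (VVz N) p :=
  (vrLift (vrLift (braidFree N p) fun _ hf => LinearMap.ext fun g =>
    braidFree_eq_zero_left hf p g).flip fun g hg => LinearMap.ext fun x => by
      obtain ⟨f, rfl⟩ := toVR_surjective N x
      rw [LinearMap.flip_apply, vrLift_toVR, braidFree_eq_zero_right hg]
      rfl).flip

theorem braidBilin_toVR (p : ℕ) (f g : FreeTop N) :
    braidBilin N p (toVR N f) (toVR N g) = braidFree N p f g := by
  rw [braidBilin, LinearMap.flip_apply, vrLift_toVR, LinearMap.flip_apply, vrLift_toVR]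

variable (N) in
/-- The braiding on `V(R) ⊗ V(R)`, modulo `h^p`. -/
def braidVV (p : ℕ) : VV N →ₗ[PowerSeries ℂ] ModPow (VVz N) p := TensorProduct.lift (braidBilin N p)

theorem braidVV_toVR (p : ℕ) (f g : FreeTop N) :
    braidVV N p (toVR N f ⊗ₜ toVR N g) = braidFree N p f g := by
  rw [braidVV, TensorProduct.lift.tmul, braidBilin_toVR]

theorem modPowRed_braidVV {p p' : ℕ} (h : p ≤ p') (x : VV N) :
    modPowRed (VVz N) h (braidVV N p' x) = braidVV N p x := by
  induction x using TensorProduct.induction_on with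
  | zero => simp only [map_zero]
  | tmul x y =>
    obtain ⟨f, rfl⟩ := toVR_surjective N x
    obtain ⟨g, rfl⟩ := toVR_surjective N y
    rw [braidVV_toVR, braidVV_toVR, modPowRed_braidFree]
  | add x y hx hy => rw [map_add, map_add, map_add, hx, hy]

variable (N) in
/-- The reduction of the braiding modulo `h^p`. -/
def braidMod (p : ℕ) : ModPow (VV N) p →ₗ[PowerSeries ℂ] ModPow (VVz N) p :=
  Submodule.liftQ _ (braidVV N p) (by
    intro x hx
    obtain ⟨y, rfl⟩ := mem_span_X_pow_smul_top.1 hx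
    rw [LinearMap.mem_ker, map_smul, modPow_smul])

theorem modPowRed_braidMod {p p' : ℕ} (h : p ≤ p') (x : ModPow (VV N) p') :
    modPowRed (VVz N) h (braidMod N p' x) = braidMod N p (modPowRed (VV N) h x) := by
  obtain ⟨y, rfl⟩ := Submodule.Quotient.mk_surjective _ x
  exact modPowRed_braidVV h y

variable (N) in
/-- The braiding map. -/
def braiding : HComp (VV N) →ₗ[PowerSeries ℂ] HComp (VVz N) :=
  AdicCompletion.lift _ (fun p => (braidMod N p).comp (AdicCompletion.eval _ _ p)) (by
    intro m n hle
    refine LinearMap.ext fun x => ?_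
    refine (modPowRed_braidMod hle _).trans ?_
    rw [LinearMap.comp_apply]
    congr 1
    exact AdicCompletion.transitionMap_comp_eval_apply _ _ hle x)

theorem braiding_toHComp {x : VV N} {y : VVz N}
    (h : ∀ p, braidVV N p x = Submodule.Quotient.mk y) :
    braiding N (toHComp (VV N) x) = toHComp (VVz N) y := by
  refine AdicCompletion.ext fun p => ?_
  exact h p

theorem coeff_lNM {n m : ℕ} (I J : Fin n ⊕ Fin m → Fin N) (e : Fin n ⊕ Fin m →₀ ℕ) :
    MvPowerSeries.coeff e (lNM N n m I J) = toVR N (wordTop (readWord (slotsL n m) e I J)) ⊗ₜ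
      toVR N (wordTop (readWord (slotsR n m) e I J)) := by
  have hL := map_list_prod ((Algebra.TensorProduct.includeLeft : VR N →ₐ[PowerSeries ℂ] VV N).comp
    (toVRAlg N)) ((slotsL n m).map fun b => (PowerSeries.C (word (e b) (I b) (J b)) : FreeTop N))
  have hR := map_list_prod ((Algebra.TensorProduct.includeRight : VR N →ₐ[PowerSeries ℂ] VV N).comp
    (toVRAlg N)) ((slotsR n m).map fun b => (PowerSeries.C (word (e b) (I b) (J b)) : FreeTop N))
  rw [← wordTop_readWord, List.map_map] at hL hR
  rw [lNM_eq, coeff_lGen]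
  refine (congrArg₂ (· * ·) hL.symm hR.symm).trans ?_
  refine (Algebra.TensorProduct.tmul_mul_tmul _ _ _ _).trans ?_
  rw [one_mul, mul_one]
  rfl

theorem isBraiding_braiding : IsBraiding N (braiding N) := by
  intro n m I J e
  refine braiding_toHComp fun p => ?_
  rw [coeff_lNM, braidVV_toVR, braidFree_wordTop, braidCoeff_readWord]

end Braiding

/-! ### Uniqueness of the braiding map -/

section Unique

variable {N : ℕ}

theorem exists_eq_readWord (w w' : WordList N) :
    ∃ (I J : Fin w.toList.length ⊕ Fin w'.toList.length → Fin N)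
      (e : Fin w.toList.length ⊕ Fin w'.toList.length →₀ ℕ),
      readWord (slotsL _ _) e I J = w ∧ readWord (slotsR _ _) e I J = w' := by
  refine ⟨fun d => (Sum.elim w.toList.get w'.toList.get d).2.1,
    fun d => (Sum.elim w.toList.get w'.toList.get d).2.2,
    Finsupp.equivFunOnFinite.symm fun d => (Sum.elim w.toList.get w'.toList.get d).1, ?_, ?_⟩
  · rw [readWord, slotsL, List.map_map]
    exact List.map_get_finRange _
  · rw [readWord, slotsR, List.map_map]
    exact List.map_get_finRange _

/-- Linear maps from `V(R) ⊗ V(R)` to a module in which `h` is nilpotent are determined by their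
values on words. -/
theorem vv_hom_ext {Y : Type*} [AddCommGroup Y] [Module (PowerSeries ℂ) Y] {p : ℕ}
    (hY : ∀ y : Y, (PowerSeries.X : PowerSeries ℂ) ^ p • y = 0) {f g : VV N →ₗ[PowerSeries ℂ] Y}
    (h : ∀ w w', f (toVR N (wordTop w) ⊗ₜ toVR N (wordTop w')) =
      g (toVR N (wordTop w) ⊗ₜ toVR N (wordTop w'))) : f = g := by
  refine TensorProduct.ext' fun x y => ?_
  obtain ⟨a, rfl⟩ := toVR_surjective N x
  obtain ⟨b, rfl⟩ := toVR_surjective N y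
  have h1 : ∀ w, f (toVR N (wordTop w) ⊗ₜ toVR N b) = g (toVR N (wordTop w) ⊗ₜ toVR N b) := fun w =>
    LinearMap.congr_fun (freeTop_hom_ext
      (f := (f.comp (TensorProduct.mk (PowerSeries ℂ) _ _ (toVR N (wordTop w)))).comp
        (toVRAlg N).toLinearMap)
      (g := (g.comp (TensorProduct.mk (PowerSeries ℂ) _ _ (toVR N (wordTop w)))).comp
        (toVRAlg N).toLinearMap) hY (h w)) b
  exact LinearMap.congr_fun (freeTop_hom_ext
      (f := (f.comp ((TensorProduct.mk (PowerSeries ℂ) _ _).flip (toVR N b))).comp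
        (toVRAlg N).toLinearMap)
      (g := (g.comp ((TensorProduct.mk (PowerSeries ℂ) _ _).flip (toVR N b))).comp
        (toVRAlg N).toLinearMap) hY h1) a

/-- The braiding map is determined by its defining property. -/
theorem IsBraiding.eq {σ σ' : HComp (VV N) →ₗ[PowerSeries ℂ] HComp (VVz N)} (h : IsBraiding N σ)
    (h' : IsBraiding N σ') : σ = σ' := by
  refine LinearMap.ext fun x => AdicCompletion.ext fun p => ?_
  have hVV : ∀ y : VV N, AdicCompletion.eval _ _ p (σ (toHComp (VV N) y)) =
      AdicCompletion.eval _ _ p (σ' (toHComp (VV N) y)) := LinearMap.congr_fun (vv_hom_ext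
    (f := ((AdicCompletion.eval _ _ p).comp σ).comp (toHComp (VV N)))
    (g := ((AdicCompletion.eval _ _ p).comp σ').comp (toHComp (VV N))) modPow_smul fun w w' => by
      obtain ⟨I, J, e, h1, h2⟩ := exists_eq_readWord w w'
      have := (h _ _ I J e).trans (h' _ _ I J e).symm
      rw [coeff_lNM, h1, h2] at this
      exact congrArg (AdicCompletion.eval _ _ p) this)
  obtain ⟨y, hy⟩ := Submodule.Quotient.mk_surjective _ (AdicCompletion.eval _ _ p x)
  have hx : x - toHComp (VV N) y ∈ LinearMap.ker
      (AdicCompletion.eval (Ideal.span {(PowerSeries.X : PowerSeries ℂ)}) (VV N) p) := by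
    rw [LinearMap.mem_ker, map_sub, sub_eq_zero, ← hy]
    rfl
  -- The kernel of reduction modulo `h ^ p` is `h ^ p` times the completion, since the ideal is
  -- finitely generated. A linear map is therefore determined modulo `h ^ p` by its values on
  -- uncompleted tensors.
  rw [← AdicCompletion.pow_smul_top_eq_ker_eval ⟨{PowerSeries.X}, by simp⟩,
    mem_span_X_pow_smul_top] at hx
  obtain ⟨z, hz⟩ := hx
  have hk : ∀ ρ : HComp (VV N) →ₗ[PowerSeries ℂ] HComp (VVz N),
      AdicCompletion.eval _ _ p (ρ x) = AdicCompletion.eval _ _ p (ρ (toHComp (VV N) y)) := by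
    intro ρ
    rw [← sub_eq_zero, ← map_sub, ← map_sub, hz, map_smul, map_smul]
    exact modPow_smul _
  exact (hk σ).trans ((hVV y).trans (hk σ').symm)

end Unique

/-! ### Shifted series at nilpotent parameters -/

section Shift

variable {S : Type*} [CommRing S] [Algebra (PowerSeries ℂ) S]

theorem expNil_eq_exp [Algebra ℚ S] {B : ℕ} {t : S} (ht : t ^ B = 0) :
    expNil 1 ht = IsNilpotent.exp t := by
  rw [IsNilpotent.exp_eq_sum ht, expNil_eq, evNil₁_apply]
  refine Finset.sum_congr rfl fun k _ => ?_
  have h : ∀ r : ℚ, numMap S (algebraMap ℚ ℂ r) = algebraMap ℚ S r := fun r =>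
    RingHom.congr_fun (Subsingleton.elim ((numMap S).comp (algebraMap ℚ ℂ)) (algebraMap ℚ S)) r
  rw [Algebra.smul_def (k.factorial : ℚ)⁻¹, ← h, smul_eq_mul, mul_comm, coeff_expSeries, one_pow]
  congr 2
  simp

/-- As `h` is nilpotent in `S`, the image of the series `e^{c h}` is the exponential of the
nilpotent element `c h`, and exponentials of commuting nilpotent elements multiply. -/
theorem expNil_add_mul_X {B B' : ℕ} {u : S} (hu : u ^ B = 0)
    (hS : algebraMap (PowerSeries ℂ) S PowerSeries.X ^ B = 0) (c : ℂ)
    (ht : (u + numMap S c * algebraMap (PowerSeries ℂ) S PowerSeries.X) ^ B' = 0) :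
    expNil 1 ht = expNil 1 hu * qExp S c := by
  let _ : Algebra ℚ S := ((numMap S).comp (algebraMap ℚ ℂ)).toAlgebra
  have hc : (numMap S c * algebraMap (PowerSeries ℂ) S PowerSeries.X) ^ B = 0 := by
    rw [mul_pow, hS, mul_zero]
  have hq : qExp S c = expNil 1 hc := by
    rw [qExp, algebraMap_eq_sum hS, expNil_eq, evNil₁_apply]
    refine Finset.sum_congr rfl fun k _ => ?_
    rw [coeff_expSeries, coeff_expSeries, mul_pow, ← map_pow (numMap S), smul_eq_mul, mul_assoc,
      mul_left_comm, one_pow]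
    change _ * numMap S _ = _ * (_ * numMap S _)
    rw [← map_mul]
    congr 2
    simp [div_eq_mul_inv]
  rw [hq, expNil_eq_exp, expNil_eq_exp, expNil_eq_exp, IsNilpotent.exp_add_of_commute
    (Commute.all _ _) ⟨B, hu⟩ ⟨B, hc⟩]

theorem add_pow_two_mul_eq_zero {p : ℕ} {x y : S} (hx : x ^ p = 0) (hy : y ^ p = 0) :
    (x + y) ^ (2 * p) = 0 := by
  rw [(Commute.all x y).add_pow']
  refine Finset.sum_eq_zero fun m hm => ?_
  rw [Finset.HasAntidiagonal.mem_antidiagonal] at hm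
  rcases le_total p m.1 with h | h
  · rw [pow_eq_zero_of_le h hx, zero_mul, smul_zero]
  · rw [pow_eq_zero_of_le (by omega : p ≤ m.2) hy, mul_zero, smul_zero]

variable {N : ℕ} {W : Type*} [Ring W] [Algebra (PowerSeries ℂ) W] {p : ℕ}

/-- The value of a series with coefficients in `V(R)` at a nilpotent element. -/
def evVR (ψ : VR N →ₐ[PowerSeries ℂ] W) {u : S} (hu : u ^ p = 0) :
    PowerSeries (VR N) →+* S ⊗[PowerSeries ℂ] W :=
  evNil₁ ((toBase S W).comp (ψ : VR N →+* W)) (pow_smul_eq_zero hu)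

/-- The binomial theorem for $(u-kh)^r$ produces the coefficients built into `lShift`. The order `2
* p` appears because `u` and `h` are both nilpotent of order `p`; the products missing from the
square of exponents below `p` are zero. -/
theorem evNil₁_lWords_shift (ψ : VR N →ₐ[PowerSeries ℂ] W) {u : S} (hu : u ^ p = 0)
    (hS : algebraMap (PowerSeries ℂ) S PowerSeries.X ^ p = 0) {k : ℕ}
    (ht : (u + numMap S (-(k : ℂ)) * algebraMap (PowerSeries ℂ) S PowerSeries.X) ^ (2 * p) = 0)
    (i j : Fin N) :
    evNil₁ (((baseHom S (ψ.comp (toVRAlg N)) : FreeTop N →ₐ[PowerSeries ℂ] _) :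
      FreeTop N →+* S ⊗[PowerSeries ℂ] W).comp PowerSeries.C) (pow_smul_eq_zero ht) (lWords i j) =
      evVR ψ hu (lShift k i j) := by
  set Φ := baseHom S (ψ.comp (toVRAlg N)) with hΦ
  set x : S := algebraMap (PowerSeries ℂ) S PowerSeries.X
  have hC : ∀ (c : ℂ) (w : Words N), Φ (PowerSeries.C (c • w)) = numMap S c • Φ (PowerSeries.C w) := by
    intro c w
    have h := baseHom_C_algebraMap (S := S) (ψ.comp (toVRAlg N)) c
    rw [← hΦ] at h
    rw [Algebra.smul_def, Algebra.smul_def, map_mul, map_mul, ← h]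
    rfl
  have hR : evVR ψ hu (lShift k i j) = ∑ m ∈ Finset.range p ×ˢ Finset.range p,
      ((m.1 + m.2).choose m.1 • (u ^ m.1 * (numMap S (-(k : ℂ)) * x) ^ m.2)) •
        Φ (PowerSeries.C (word (m.1 + m.2) i j)) := by
    rw [evVR, evNil₁_apply, Finset.sum_product]
    refine Finset.sum_congr rfl fun s _ => ?_
    rw [lShift, PowerSeries.coeff_mk]
    refine (congrArg (u ^ s • ·) (freeTop_map_eq_sum hS Φ _)).trans ?_
    dsimp only
    rw [Finset.smul_sum]
    refine Finset.sum_congr rfl fun d _ => ?_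
    rw [PowerSeries.coeff_mk, hC, map_mul, map_natCast, map_pow, smul_smul, smul_smul]
    congr 1
    rw [nsmul_eq_mul]
    ring
  rw [hR, evNil₁_apply, ← Finset.sum_fiberwise_of_maps_to (g := fun m : ℕ × ℕ => m.1 + m.2)
    (t := Finset.range (2 * p))]
  · refine Finset.sum_congr rfl fun r _ => ?_
    rw [(Commute.all _ _).add_pow', Finset.sum_smul]
    symm
    refine Finset.sum_subset_zero_on_sdiff (fun m hm => ?_) (fun m hm => ?_) fun m hm => ?_
    · exact Finset.HasAntidiagonal.mem_antidiagonal.2 (Finset.mem_filter.1 hm).2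
    · rw [Finset.mem_sdiff, Finset.HasAntidiagonal.mem_antidiagonal, Finset.mem_filter, Finset.mem_product,
        Finset.mem_range, Finset.mem_range] at hm
      have h0 : u ^ m.1 * (numMap S (-(k : ℂ)) * x) ^ m.2 = 0 := by
        rcases le_or_gt p m.1 with h | h
        · rw [pow_eq_zero_of_le h hu, zero_mul]
        · rw [mul_pow, pow_eq_zero_of_le (by omega) hS, mul_zero, mul_zero]
      rw [h0, smul_zero, zero_smul]
    · rw [Finset.mem_filter] at hm
      rw [hm.2, lWords, PowerSeries.coeff_mk]
      rfl
  · intro m hm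
    rw [Finset.mem_product, Finset.mem_range, Finset.mem_range] at hm
    rw [Finset.mem_range]
    omega

end Shift

/-! ### The relations between neighbouring shifted series -/

section Fused

variable {N : ℕ} {S E : Type*} [CommRing S] [Ring E] [Algebra S E]

/-- At these parameters `z - w * q ^ 2 = 0`, so one side of the defining relation disappears. The
relation for `A`, `B` leaves identities between rows, the one for `B`, `A` identities between
columns. The surviving coefficients are brought to the common factor `z ^ 2 * (q' ^ 2 - q ^ 2) ^ 2`.
-/
theorem fused_of_relPair {q q' z w : S} (hq : q * q' = 1) (hw : w = z * q' ^ 2) (hz : IsUnit z)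
    {A B : Matrix (Fin N) (Fin N) E} (h : RelPair q q' z w A B) (h' : RelPair q q' w z B A) :
    (∀ i a b, (q' ^ 2 - q ^ 2) ^ 2 • (A i a * B i b) = 0) ∧
    (∀ a i j, (q' ^ 2 - q ^ 2) ^ 2 • (A i a * B j a) = 0) ∧
    (∀ i i' a b, i < i' → (q' ^ 2 - q ^ 2) ^ 2 • (A i' a * B i b + q • (A i a * B i' b)) = 0) ∧
    ∀ i j a a', a < a' → (q' ^ 2 - q ^ 2) ^ 2 • (A i a' * B j a + q' • (A i a * B j a')) = 0 := by
  have e0 : z - w * q ^ 2 = 0 := by grind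
  refine ⟨fun i a b => ?_, fun a i j => ?_, fun i i' a b hi => ?_, fun i j a a' ha => ?_⟩
  · have := h i i a b
    rw [e0, zero_smul, wD, if_pos rfl, wO, if_neg (lt_irrefl i), if_neg (lt_irrefl i), zero_smul,
      add_zero, smul_smul] at this
    refine ((hz.pow 2).smul_eq_zero).1 ?_
    rw [smul_smul]
    have e : z ^ 2 * (q' ^ 2 - q ^ 2) ^ 2 = q * ((w - z * q ^ 2) * (w * q' - z * q)) := by grind
    rw [e, mul_smul, this, smul_zero]
  · have := h' j i a a
    rw [e0, zero_smul, wD, if_pos rfl, wO, if_neg (lt_irrefl a), if_neg (lt_irrefl a), zero_smul,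
      add_zero, smul_smul] at this
    refine ((hz.pow 2).smul_eq_zero).1 ?_
    rw [smul_smul]
    have e : z ^ 2 * (q' ^ 2 - q ^ 2) ^ 2 = q * ((w - z * q ^ 2) * (w * q' - z * q)) := by grind
    rw [e, mul_smul, ← this, smul_zero]
  · have := h i i' a b
    rw [e0, zero_smul, wD, if_neg hi.ne', wO, if_pos hi] at this
    refine ((hz.pow 2).smul_eq_zero).1 ?_
    have e1 : z ^ 2 * (q' ^ 2 - q ^ 2) ^ 2 =
      q ^ 2 * (q + q') * ((w - z * q ^ 2) * ((q' - q) * w)) := by grind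
    have e2 : z ^ 2 * (q' ^ 2 - q ^ 2) ^ 2 * q =
      q ^ 2 * (q + q') * ((w - z * q ^ 2) * (w - z)) := by grind
    refine Eq.trans ?_ ((congrArg (fun y => (q ^ 2 * (q + q')) • y) this).trans (smul_zero _))
    rw [smul_smul, smul_add, smul_smul, e1, ← e1, e2, e1]
    module
  · have := h' j i a a'
    rw [e0, zero_smul, wD, if_neg ha.ne, wO, if_pos ha] at this
    refine ((hz.pow 2).smul_eq_zero).1 ?_
    have e1 : z ^ 2 * (q' ^ 2 - q ^ 2) ^ 2 =
      q * (q + q') * ((w - z * q ^ 2) * (w - z)) := by grind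
    have e2 : z ^ 2 * (q' ^ 2 - q ^ 2) ^ 2 * q' =
      q * (q + q') * ((w - z * q ^ 2) * ((q' - q) * w)) := by grind
    refine Eq.trans ?_ ((congrArg (fun y => (q * (q + q')) • y) this.symm).trans (smul_zero _))
    rw [smul_smul, smul_add, smul_smul, e2, e1]
    module

end Fused

/-! ### Fusion in the algebra `V(R)` -/

section FusedVR

variable {N : ℕ}

theorem vr_separated {x : VR N} (h : ∀ p : ℕ, ∃ y, x = (PowerSeries.X : PowerSeries ℂ) ^ p • y) :
    x = 0 := by
  obtain ⟨f, rfl⟩ := toVR_surjective N x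
  refine toVR_eq_zero.2 ((isTopFreeIdeal_relIdeal N).1 f fun p => ?_)
  obtain ⟨y, hy⟩ := h p
  obtain ⟨g, rfl⟩ := toVR_surjective N y
  refine ⟨f - (PowerSeries.X : PowerSeries ℂ) ^ p • g, ?_, ?_⟩
  · rw [← toVR_eq_zero, map_sub, hy, toVR_smul, sub_self]
  · rw [sub_sub_cancel, Algebra.smul_def, map_pow, freeTop_algebraMap_X]
    exact dvd_mul_right _ _

/-- A series over `V(R)` which is annihilated by a nonzero scalar at every truncated variable
vanishes. -/
theorem eq_zero_of_evVR {κ : PowerSeries ℂ} (hκ : κ ≠ 0) {F : PowerSeries (VR N)}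
    (h : ∀ p, algebraMap (PowerSeries ℂ) (Trunc Unit (PowerSeries ℂ) p) κ •
      evVR (AlgHom.id (PowerSeries ℂ) (VR N)) (truncVar_pow (PowerSeries ℂ) p ()) F = 0) : F = 0 := by
  ext r
  refine (smul_eq_zero.1 (?_ : κ • PowerSeries.coeff r F = 0)).resolve_left hκ
  have key : ∀ p, r < p → ∃ y, κ • PowerSeries.coeff r F = (PowerSeries.X : PowerSeries ℂ) ^ p • y := by
    intro p hp
    have he : ∀ i : Unit, Finsupp.single () r i < p := by simpa using hp
    have hm : ∀ k, truncCoeff (LinearMap.lsmul (PowerSeries ℂ) (VR N)) he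
        ((truncVar (PowerSeries ℂ) p ()) ^ k • ((toBase _ _).comp
          (AlgHom.id (PowerSeries ℂ) (VR N) : VR N →+* VR N)) (PowerSeries.coeff k F)) =
        if k = r then Submodule.Quotient.mk (PowerSeries.coeff r F) else 0 := by
      intro k
      have := truncCoeff_monomial (LinearMap.lsmul (PowerSeries ℂ) (VR N)) he (Finsupp.single () k)
        1 (PowerSeries.coeff k F)
      rw [Fintype.prod_unique, map_one (algebraMap _ _), mul_one] at this
      refine Eq.trans (congrArg _ ?_) (this.trans ?_)
      · refine (TensorProduct.smul_tmul' _ _ _).trans ?_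
        rw [smul_eq_mul, mul_one]
        simp
      · by_cases hk : k = r
        · subst hk
          rw [if_pos rfl, if_pos rfl, LinearMap.lsmul_apply, one_smul]
        · rw [if_neg hk, if_neg fun h => hk (Finsupp.single_injective () h)]
    have h1 := congrArg (truncCoeff (LinearMap.lsmul (PowerSeries ℂ) (VR N)) he) (h p)
    rw [algebraMap_smul, map_smul, map_zero, evVR, evNil₁_apply, map_sum,
      Finset.sum_congr rfl fun k _ => hm k, Finset.sum_ite_eq' , if_pos (Finset.mem_range.2 hp),
      ← Submodule.Quotient.mk_smul, Submodule.Quotient.mk_eq_zero, mem_span_X_pow_smul_top] at h1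
    exact h1
  refine vr_separated fun p => ?_
  -- The coefficient of index `r` is visible only at truncation levels above `r`, so the level is
  -- raised and the surplus power of `h` is put into the witness.
  obtain ⟨y, hy⟩ := key (p + r + 1) (by omega)
  exact ⟨(PowerSeries.X : PowerSeries ℂ) ^ (r + 1) • y, by rw [hy, smul_smul, ← pow_add, add_assoc]⟩

theorem evVR_smul {S W : Type*} [CommRing S] [Algebra (PowerSeries ℂ) S] [Ring W]
    [Algebra (PowerSeries ℂ) W] {p : ℕ} (ψ : VR N →ₐ[PowerSeries ℂ] W) {u : S} (hu : u ^ p = 0)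
    (c : PowerSeries ℂ) (F : PowerSeries (VR N)) :
    evVR ψ hu (c • F) = algebraMap (PowerSeries ℂ) S c • evVR ψ hu F := by
  rw [evVR, evNil₁_apply, evNil₁_apply, Finset.smul_sum]
  refine Finset.sum_congr rfl fun k _ => ?_
  rw [smul_comm, algebraMap_smul]
  congr 1
  rw [PowerSeries.coeff_smul, RingHom.comp_apply, RingHom.coe_coe, map_smul]
  exact map_smul (Algebra.TensorProduct.includeRight : W →ₐ[PowerSeries ℂ] S ⊗[PowerSeries ℂ] W) _ _

theorem isUnit_expNil {S : Type*} [CommRing S] [Algebra (PowerSeries ℂ) S] {B : ℕ} {t : S}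
    (ht : t ^ B = 0) : IsUnit (expNil 1 ht) := by
  let _ : Algebra ℚ S := ((numMap S).comp (algebraMap ℚ ℂ)).toAlgebra
  rw [expNil_eq_exp]
  exact IsNilpotent.isUnit_exp ⟨_, ht⟩

variable (N) in
theorem relPair_evVR {S : Type*} [CommRing S] [Algebra (PowerSeries ℂ) S] {p : ℕ} {u : S}
    (hu : u ^ p = 0) (hS : algebraMap (PowerSeries ℂ) S PowerSeries.X ^ p = 0) {k k' : ℕ}
    (ht : (u + numMap S (-(k : ℂ)) * algebraMap (PowerSeries ℂ) S PowerSeries.X) ^ (2 * p) = 0)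
    (ht' : (u + numMap S (-(k' : ℂ)) * algebraMap (PowerSeries ℂ) S PowerSeries.X) ^ (2 * p) = 0) :
    RelPair (qExp S (1 / 2)) (qExp S (-1 / 2)) (expNil 1 ht) (expNil 1 ht')
      (Matrix.of fun i j => evVR (AlgHom.id (PowerSeries ℂ) (VR N)) hu (lShift k i j))
      (Matrix.of fun i j => evVR (AlgHom.id (PowerSeries ℂ) (VR N)) hu (lShift k' i j)) := by
  have := relPair_of_freeTop (pow_eq_zero_of_le (by omega) hS) ht ht'
    (baseHom S ((AlgHom.id (PowerSeries ℂ) (VR N)).comp (toVRAlg N))) fun f hf => by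
      rw [baseHom, AlgHom.comp_apply, AlgHom.comp_apply, show toVRAlg N f = 0 from toVR_eq_zero.2 hf,
        map_zero, map_zero]
  have e : ∀ {k : ℕ} (ht : (u + numMap S (-(k : ℂ)) *
      algebraMap (PowerSeries ℂ) S PowerSeries.X) ^ (2 * p) = 0),
      (Matrix.of fun i j : Fin N => evVR (AlgHom.id (PowerSeries ℂ) (VR N)) hu (lShift k i j)) =
      Matrix.of fun i j : Fin N => evNil₁ (((baseHom S ((AlgHom.id (PowerSeries ℂ) (VR N)).comp
        (toVRAlg N)) : FreeTop N →ₐ[PowerSeries ℂ] _) : FreeTop N →+* _).comp PowerSeries.C)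
          (pow_smul_eq_zero ht) (lWords i j) := fun ht =>
    Matrix.ext fun i j => (evNil₁_lWords_shift _ hu hS ht i j).symm
  rw [e ht, e ht']
  exact this

/-- The parameter `u - kh` at a nilpotent element is nilpotent. -/
theorem shift_pow_eq_zero {S : Type*} [CommRing S] [Algebra (PowerSeries ℂ) S] {p : ℕ} {u : S}
    (hu : u ^ p = 0) (hS : algebraMap (PowerSeries ℂ) S PowerSeries.X ^ p = 0) (c : ℂ) :
    (u + numMap S c * algebraMap (PowerSeries ℂ) S PowerSeries.X) ^ (2 * p) = 0 :=
  add_pow_two_mul_eq_zero hu (by rw [mul_pow, hS, mul_zero])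

/-- The relations between the entries of `L(u - kh)` and `L(u - (k+1)h)`. -/
theorem fusedPair_lShift (k : ℕ) : FusedPair (qExp (PowerSeries ℂ) (1 / 2))
    (qExp (PowerSeries ℂ) (-1 / 2)) (Matrix.of fun i j : Fin N => lShift (N := N) k i j)
    (Matrix.of fun i j : Fin N => lShift (N := N) (k + 1) i j) := by
  -- This is $(e^{-h}-e^{h})^2$, which is divisible by $h^2$ and cannot be cancelled where `h` is
  -- nilpotent. Over all truncations together it can, because `V(R)` is torsion free and separated.
  obtain ⟨κ, hκ⟩ : ∃ κ, κ = (qExp (PowerSeries ℂ) (-1 / 2) ^ 2 -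
    qExp (PowerSeries ℂ) (1 / 2) ^ 2) ^ 2 := ⟨_, rfl⟩
  have hκ0 : κ ≠ 0 := by
    rw [hκ]
    refine pow_ne_zero _ (sub_ne_zero.2 fun h => ?_)
    rw [qExp_pow, qExp_pow] at h
    have := expSeries_injective h
    norm_num at this
  have hu := fun p => truncVar_pow (τ := Unit) (PowerSeries ℂ) p ()
  have hS := fun p => trunc_algebraMap_X (τ := Unit) (PowerSeries ℂ) p
  have hw : ∀ p, expNil 1 (shift_pow_eq_zero (hu p) (hS p) (-((k + 1 : ℕ) : ℂ))) =
      expNil 1 (shift_pow_eq_zero (hu p) (hS p) (-(k : ℂ))) * qExp _ (-1 / 2) ^ 2 := fun p => by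
    rw [expNil_add_mul_X (hu p) (hS p), expNil_add_mul_X (hu p) (hS p), mul_assoc, qExp_pow, qExp_mul]
    congr 2
    push_cast
    ring
  have r1 := fun p => relPair_evVR N (hu p) (hS p) (shift_pow_eq_zero (hu p) (hS p) (-(k : ℂ)))
    (shift_pow_eq_zero (hu p) (hS p) (-((k + 1 : ℕ) : ℂ)))
  have r2 := fun p => relPair_evVR N (hu p) (hS p)
    (shift_pow_eq_zero (hu p) (hS p) (-((k + 1 : ℕ) : ℂ)))
    (shift_pow_eq_zero (hu p) (hS p) (-(k : ℂ)))
  have key := fun p => fused_of_relPair qExp_half_mul (hw p) (isUnit_expNil _) (r1 p) (r2 p)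
  have hκS : ∀ p, (qExp (Trunc Unit (PowerSeries ℂ) p) (-1 / 2) ^ 2 -
      qExp (Trunc Unit (PowerSeries ℂ) p) (1 / 2) ^ 2) ^ 2 = algebraMap _ _ κ := fun p => by
    rw [hκ, map_pow, map_sub, map_pow, map_pow]
    rfl
  have hsm : ∀ p c F, qExp (Trunc Unit (PowerSeries ℂ) p) c •
      evVR (AlgHom.id (PowerSeries ℂ) (VR N)) (hu p) F =
        evVR (AlgHom.id (PowerSeries ℂ) (VR N)) (hu p)
          (qExp (PowerSeries ℂ) c • F) := fun p c F => (evVR_smul _ _ _ _).symm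
  simp only [Matrix.of_apply, hκS, ← map_mul, hsm, ← map_add] at key
  refine ⟨fun i a b => ?_, fun a i j => ?_, fun i i' a b hi => ?_, fun i j a a' ha => ?_⟩
  · exact eq_zero_of_evVR hκ0 fun p => (key p).1 i a b
  · exact eq_zero_of_evVR hκ0 fun p => (key p).2.1 a i j
  · exact eq_neg_of_add_eq_zero_left (eq_zero_of_evVR hκ0 fun p => (key p).2.2.1 i i' a b hi)
  · exact eq_neg_of_add_eq_zero_left (eq_zero_of_evVR hκ0 fun p => (key p).2.2.2 i j a a' ha)

/-- The image of a pair of neighbours under a homomorphism. -/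
theorem FusedPair.map {S S' E E' : Type*} [CommRing S] [Ring E] [Algebra S E] [CommRing S'] [Ring E']
    [Algebra S' E'] {q q' : S} {A B : Matrix (Fin N) (Fin N) E} (h : FusedPair q q' A B)
    (f : E →+* E') (g : S →+* S') (hf : ∀ c x, f (c • x) = g c • f x) :
    FusedPair (g q) (g q') (A.map f) (B.map f) := by
  obtain ⟨h1, h2, h3, h4⟩ := h
  refine ⟨fun i a b => ?_, fun a i j => ?_, fun i i' a b hi => ?_, fun i j a a' ha => ?_⟩
  · rw [Matrix.map_apply, Matrix.map_apply, ← map_mul, h1, map_zero]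
  · rw [Matrix.map_apply, Matrix.map_apply, ← map_mul, h2, map_zero]
  · simp only [Matrix.map_apply, ← map_mul, h3 i i' a b hi, map_neg, hf]
  · simp only [Matrix.map_apply, ← map_mul, h4 i j a a' ha, map_neg, hf]

end FusedVR

/-! ### The braiding on fused products at nilpotent parameters -/

section FusedBraiding

theorem list_prod_smul {S M σ : Type*} [CommRing S] [Ring M] [Algebra S M] (g : σ → S) (f : σ → M)
    (l : List σ) : (l.map fun i => g i • f i).prod = (l.map g).prod • (l.map f).prod := by
  induction l with
  | nil => simp
  | cons a l ih => simp only [List.map_cons, List.prod_cons, ih, smul_mul_smul_comm]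

theorem crossProd_smul {S M : Type*} [CommRing S] [Ring M] [Algebra S M] {ι κ : Type*}
    (G : ι → κ → S) (ρ : ι → κ → M) (l : List ι) (l' : List κ) :
    crossProd (fun i j => G i j • ρ i j) l l' =
      (l.map fun i => (l'.map fun j => G i j).prod).prod • crossProd ρ l l' := by
  rw [crossProd, crossProd, ← list_prod_smul]
  congr 1
  exact List.map_congr_left fun i _ => list_prod_smul _ _ _

section Scale

variable {N : ℕ} {τ : Type*} [Fintype τ] [DecidableEq τ] {S E : Type*} [CommRing S] [Ring E]
  [Algebra S E] {κ κ' : S} {A A' : Matrix (τ → Fin N) (τ → Fin N) S}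
  {X : Matrix (τ → Fin N) (τ → Fin N) E}

theorem sc_mul_mul_eq_smul (h : sc N τ E A * X = κ • X) (h' : sc N τ E A' * X = κ' • X) :
    sc N τ E (A' * A) * X = (κ' * κ) • X := by
  rw [map_mul, mul_assoc, h, mul_smul_comm, h', smul_smul, mul_comm]

theorem mul_sc_mul_eq_smul (h : X * sc N τ E A = κ • X) (h' : X * sc N τ E A' = κ' • X) :
    X * sc N τ E (A' * A) = (κ' * κ) • X := by
  rw [map_mul, ← mul_assoc, h', smul_mul_assoc, h, smul_smul]

end Scale

variable {n m N p : ℕ} {S : Type*} [CommRing S] [Algebra (PowerSeries (RatFunc ℂ)) S]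
  [Algebra (PowerSeries ℂ) S] [IsScalarTower (PowerSeries ℂ) (PowerSeries (RatFunc ℂ)) S]
  {B : ℕ} {t : Fin n ⊕ Fin m → S} (ht : ∀ b, t b ^ B = 0)

/-- The product of the R-matrices without their normalization factors. -/
def nilRb (N : ℕ) (l l' : List (Fin n ⊕ Fin m)) :
    Matrix (Fin n ⊕ Fin m → Fin N) (Fin n ⊕ Fin m → Fin N) S :=
  crossProd (rb N (qExp S (1 / 2)) (qExp S (-1 / 2)) (nilParam ht)) l l'

variable (N) in
-- The normalization factors are scalars, so their product does not depend on the order of the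
-- R-matrices and is the same `γ` on both sides of the braiding.
theorem nilR_eq_smul (l l' : List (Fin n ⊕ Fin m)) :
    ∃ γ : S, nilR ht N l.reverse l' = γ • nilRb ht N l.reverse l' ∧
      nilR ht N l l'.reverse = γ • nilRb ht N l l'.reverse := by
  refine ⟨_, crossProd_smul _ _ _ _, ?_⟩
  rw [nilR, crossR, crossProd_smul, nilRb]
  congr 1
  rw [((l.reverse_perm).map _).prod_eq]
  congr 1
  refine List.map_congr_left fun i _ => ?_
  exact ((l'.reverse_perm).map _).prod_eq

theorem ofFn_inl : List.ofFn (Function.Embedding.inl : Fin n ↪ Fin n ⊕ Fin m) = slotsL n m :=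
  List.ofFn_eq_map

theorem ofFn_inr : List.ofFn (Function.Embedding.inr : Fin m ↪ Fin n ⊕ Fin m) = slotsR n m :=
  List.ofFn_eq_map

theorem nodup_slotsL (n m : ℕ) : (slotsL n m).Nodup := (List.nodup_append.1 (nodup_slots n m)).1

theorem nodup_slotsR (n m : ℕ) : (slotsR n m).Nodup := (List.nodup_append.1 (nodup_slots n m)).2.1

theorem notMem_range_inr {b : Fin n ⊕ Fin m} (hb : b ∈ slotsL n m) :
    b ∉ Set.range (Function.Embedding.inr : Fin m ↪ Fin n ⊕ Fin m) := by
  obtain ⟨i, _, rfl⟩ := List.mem_map.1 hb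
  rintro ⟨j, hj⟩
  cases hj

theorem notMem_range_inl {b : Fin n ⊕ Fin m} (hb : b ∈ slotsR n m) :
    b ∉ Set.range (Function.Embedding.inl : Fin n ↪ Fin n ⊕ Fin m) := by
  obtain ⟨i, _, rfl⟩ := List.mem_map.1 hb
  rintro ⟨j, hj⟩
  cases hj

variable (hS : algebraMap (PowerSeries ℂ) S PowerSeries.X ^ p = 0)

variable (N) in
/-- The braiding with values in an extension of scalars. -/
def braidExt : VV N →ₗ[PowerSeries ℂ] S ⊗[PowerSeries ℂ] VV N := (vvzMod N S hS).comp (braidVV N p)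

theorem braidExt_coeff (I J : Fin n ⊕ Fin m → Fin N) (e : Fin n ⊕ Fin m →₀ ℕ) :
    braidExt N hS (MvPowerSeries.coeff e (lGen (fun r a c => gen r a c ⊗ₜ[PowerSeries ℂ] (1 : VR N))
      (fun r a c => (1 : VR N) ⊗ₜ[PowerSeries ℂ] gen r a c) n m I J)) =
      vvzMap S N (MvPowerSeries.coeff e (braidedLNM N n m I J)) := by
  rw [← lNM_eq, coeff_lNM, braidExt, LinearMap.comp_apply, braidVV_toVR, braidFree_wordTop,
    braidCoeff_readWord]
  rfl

variable (N) in
/-- The product of the L-operators of `V(R) ⊗ V(R)` at nilpotent elements. -/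
def nilX : Matrix (Fin n ⊕ Fin m → Fin N) (Fin n ⊕ Fin m → Fin N) (S ⊗[PowerSeries ℂ] VV N) :=
  prodL (nilLV ht N) (slotsL n m) * prodL (nilLV ht N) (slotsR n m)

variable (N) in
theorem nilX_eq : nilX N ht = prodL (nilLV ht N) (slotsL n m ++ slotsR n m) :=
  (prodL_append _ _ _).symm

variable (N) in
theorem map_braidExt_nilX : ∃ Q, nilR ht N (slotsL n m) (slotsR n m).reverse * Q = 1 ∧
    (nilX N ht).map ((braidExt N hS).liftBaseChange S) =
      sc N _ _ (nilR ht N (slotsL n m).reverse (slotsR n m)) * nilX N ht * sc N _ _ Q := by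
  obtain ⟨Q, h1, _, h3⟩ := liftBaseChange_prodL_perm ht (braidExt N hS) (braidExt_coeff hS)
    (Equiv.refl _) fun _ => rfl
  simp only [Equiv.coe_refl, List.map_id] at h1 h3
  exact ⟨Q, h1, h3⟩

variable (N) in
theorem exists_nilR_reverse_inverse :
    ∃ Q, Q * nilR ht N (slotsL n m).reverse (slotsR n m) = 1 := by
  obtain ⟨Q, hQ⟩ := (isUnit_rNMBar (n := n) (m := m) N).exists_left_inv
  refine ⟨Q.map (evZ ht), ?_⟩
  rw [← map_evZ_crossR, ← rNMBar_eq, ← Matrix.map_mul, hQ,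
    Matrix.map_one _ (map_zero _) (map_one _)]

theorem isUnit_natCast {k : ℕ} (hk : k ≠ 0) : IsUnit (k : S) := by
  have : (k : S) = numMap S k := (map_natCast _ _).symm
  rw [this]
  exact IsUnit.map _ (isUnit_iff_ne_zero.2 (Nat.cast_ne_zero.2 hk))

end FusedBraiding

/-! ### Invariance of fused products and of their traces -/

section Fix

variable {n m N p : ℕ} {S : Type*} [CommRing S] [Algebra (PowerSeries (RatFunc ℂ)) S]
  [Algebra (PowerSeries ℂ) S] [IsScalarTower (PowerSeries ℂ) (PowerSeries (RatFunc ℂ)) S]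
  {B : ℕ} (hS : algebraMap (PowerSeries ℂ) S PowerSeries.X ^ p = 0)

/-- The antisymmetrizer of the second group has as many slots as letters, so both R-matrix products
act on it by one scalar. The slots of the first group may carry any parameters and indices. -/
theorem braidExt_nilX_apply {t : Fin n ⊕ Fin (m + 1) → S} (ht : ∀ b, t b ^ B = 0) (hN : N = m + 1)
    (hL : ∀ k : Fin m, FusedPair (qExp S (1 / 2)) (qExp S (-1 / 2))
      (nilLV ht N (Sum.inr k.castSucc)) (nilLV ht N (Sum.inr k.succ)))
    (hζ : ∀ k : Fin (m + 1),
      nilParam ht (Sum.inr k) = nilParam ht (Sum.inr 0) * qExp S (-(k : ℕ)))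
    (I J : Fin n ⊕ Fin (m + 1) → Fin N) :
    (braidExt N hS).liftBaseChange S (nilX N ht I J) = nilX N ht I J := by
  obtain ⟨Q, hQ, hX⟩ := map_braidExt_nilX N ht hS
  obtain ⟨γ, hγ, hγ'⟩ := nilR_eq_smul N ht (slotsL n (m + 1)) (slotsR n (m + 1))
  obtain ⟨ψ, h1, h2⟩ := asym_top Function.Embedding.inr hζ hN (nodup_slotsL n (m + 1))
    fun _ => notMem_range_inr
  rw [ofFn_inr] at h1 h2
  refine (congrFun (congrFun hX I) J).trans (congrFun (congrFun ?_ I) J)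
  refine braided_eq_self (κ := ((m + 1).factorial : S)) (ψ := γ * ψ)
    (isUnit_natCast (Nat.factorial_ne_zero _))
    (A := asym N (qExp S (1 / 2)) (qExp S (-1 / 2)) Function.Embedding.inr) ?_ ?_ ?_ ?_ hQ
  · rw [hγ', mul_smul_comm, mul_smul, ← h1]
    rfl
  · rw [hγ, smul_mul_assoc, mul_smul, ← h2]
    rfl
  · have := asym_mul_prodL qExp_half_mul Function.Embedding.inr (l₁ := slotsL n (m + 1)) (l₃ := [])
      hL (by rw [ofFn_inr, List.append_nil]; exact nodup_slots _ _)
    rw [ofFn_inr, List.append_nil, ← nilX_eq] at this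
    exact this
  · have := prodL_mul_asym qExp_half_mul Function.Embedding.inr (l₁ := slotsL n (m + 1)) (l₃ := [])
      hL (by rw [ofFn_inr, List.append_nil]; exact nodup_slots _ _)
    rw [ofFn_inr, List.append_nil, ← nilX_eq] at this
    exact this

/-- The antisymmetrizer of the first group reverses the order of the rows of the R-matrix product,
the one of the second group that of the columns. Together they turn the order in the inverted factor
into the order on the left. As they commute, their product satisfies the hypotheses of
`trace_braided`. -/
theorem braidExt_trace_nilX {t : Fin (n + 1) ⊕ Fin (m + 1) → S} (ht : ∀ b, t b ^ B = 0)
    (hL : ∀ k : Fin m, FusedPair (qExp S (1 / 2)) (qExp S (-1 / 2))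
      (nilLV ht N (Sum.inr k.castSucc)) (nilLV ht N (Sum.inr k.succ)))
    (hζ : ∀ k : Fin (m + 1),
      nilParam ht (Sum.inr k) = nilParam ht (Sum.inr 0) * qExp S (-(k : ℕ)))
    (hL' : ∀ k : Fin n, FusedPair (qExp S (1 / 2)) (qExp S (-1 / 2))
      (nilLV ht N (Sum.inl k.castSucc)) (nilLV ht N (Sum.inl k.succ)))
    (hζ' : ∀ k : Fin (n + 1),
      nilParam ht (Sum.inl k) = nilParam ht (Sum.inl 0) * qExp S (-(k : ℕ))) :
    (braidExt N hS).liftBaseChange S (Matrix.trace (nilX N ht)) = Matrix.trace (nilX N ht) := by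
  obtain ⟨Q, hQ, hX⟩ := map_braidExt_nilX N ht hS
  obtain ⟨Q', hQ'⟩ := exists_nilR_reverse_inverse N ht
  obtain ⟨γ, hγ, hγ'⟩ := nilR_eq_smul N ht (slotsL (n + 1) (m + 1)) (slotsR (n + 1) (m + 1))
  set A := asym N (qExp S (1 / 2)) (qExp S (-1 / 2))
    (Function.Embedding.inl : Fin (n + 1) ↪ Fin (n + 1) ⊕ Fin (m + 1)) with hA
  set A' := asym N (qExp S (1 / 2)) (qExp S (-1 / 2))
    (Function.Embedding.inr : Fin (m + 1) ↪ Fin (n + 1) ⊕ Fin (m + 1)) with hA'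
  have hcomm : A * A' = A' * A := ActsOn.commute (actsOn_asym _ _ _) (actsOn_asym _ _ _)
    (Set.disjoint_left.2 (by rintro _ ⟨i, rfl⟩ ⟨j, hj⟩; cases hj))
    fun _ _ _ _ => Commute.all _ _
  have h1 := asym_exchange_left (N := N) Function.Embedding.inl hζ'
    (List.nodup_reverse.2 (nodup_slotsR (n + 1) (m + 1)))
    fun _ h => notMem_range_inl (List.mem_reverse.1 h)
  have h2 := asym_exchange_right (N := N) Function.Embedding.inr hζ
    (List.nodup_reverse.2 (nodup_slotsL (n + 1) (m + 1)))
    fun _ h => notMem_range_inr (List.mem_reverse.1 h)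
  rw [ofFn_inl, ← hA] at h1
  rw [ofFn_inr, ← hA'] at h2
  have hl : ([] ++ List.ofFn (Function.Embedding.inl : Fin (n + 1) ↪ Fin (n + 1) ⊕ Fin (m + 1)) ++
      slotsR (n + 1) (m + 1)).Nodup := by
    rw [ofFn_inl, List.nil_append]; exact nodup_slots _ _
  have hr : (slotsL (n + 1) (m + 1) ++
      List.ofFn (Function.Embedding.inr : Fin (m + 1) ↪ Fin (n + 1) ⊕ Fin (m + 1)) ++ []).Nodup := by
    rw [ofFn_inr, List.append_nil]; exact nodup_slots _ _
  have a1 := asym_mul_prodL qExp_half_mul Function.Embedding.inl hL' hl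
  have a2 := prodL_mul_asym qExp_half_mul Function.Embedding.inl hL' hl
  have a3 := asym_mul_prodL qExp_half_mul Function.Embedding.inr hL hr
  have a4 := prodL_mul_asym qExp_half_mul Function.Embedding.inr hL hr
  rw [ofFn_inl, List.nil_append, ← nilX_eq, ← hA] at a1 a2
  rw [ofFn_inr, List.append_nil, ← nilX_eq, ← hA'] at a3 a4
  have ht : (braidExt N hS).liftBaseChange S (Matrix.trace (nilX N ht)) =
      Matrix.trace ((nilX N ht).map ((braidExt N hS).liftBaseChange S)) := by
    simp only [Matrix.trace, Matrix.diag_apply, Matrix.map_apply, map_sum]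
  rw [ht, hX]
  refine trace_braided (κ := ((m + 1).factorial : S) * ((n + 1).factorial : S)) (A := A' * A)
    ((isUnit_natCast (Nat.factorial_ne_zero _)).mul (isUnit_natCast (Nat.factorial_ne_zero _)))
    ?_ ?_ ?_ ?_ hQ hQ'
  · rw [hγ, hγ', mul_smul_comm, smul_mul_assoc]
    congr 1
    rw [nilRb, nilRb, mul_assoc, h1, ← mul_assoc, h2, mul_assoc]
  · calc A' * A * (A' * A) = A' * (A * A') * A := by simp only [mul_assoc]
      _ = (A' * A') * (A * A) := by rw [hcomm]; simp only [mul_assoc]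
      _ = _ := by
        rw [asym_mul_asym qExp_half_mul, asym_mul_asym qExp_half_mul, smul_mul_smul_comm]
  · exact sc_mul_mul_eq_smul a1 a3
  · exact mul_sc_mul_eq_smul a2 a4

end Fix

/-! ### The L-operators at shifted parameters -/

section NilShift

variable {n m N p : ℕ} {S : Type*} [CommRing S] [Algebra (PowerSeries (RatFunc ℂ)) S]
  [Algebra (PowerSeries ℂ) S] [IsScalarTower (PowerSeries ℂ) (PowerSeries (RatFunc ℂ)) S]
  {u : S} (hu : u ^ p = 0) (hS : algebraMap (PowerSeries ℂ) S PowerSeries.X ^ p = 0)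
  {t : Fin n ⊕ Fin m → S} (ht : ∀ b, t b ^ (2 * p) = 0)

variable (N) in
/-- The inclusion of `V(R)` in the group of factors of `V(R) ⊗ V(R)` which belongs to a slot. -/
def slotIncl (b : Fin n ⊕ Fin m) : VR N →ₐ[PowerSeries ℂ] VV N :=
  bif b.isLeft then Algebra.TensorProduct.includeLeft else Algebra.TensorProduct.includeRight

include hS in
theorem nilLV_eq_evVR {b : Fin n ⊕ Fin m} {k : ℕ}
    (hb : t b = u + numMap S (-(k : ℂ)) * algebraMap (PowerSeries ℂ) S PowerSeries.X) :
    nilLV ht N b = Matrix.of fun i j => evVR (slotIncl N b) hu (lShift k i j) := by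
  have key : ∀ (s : S) (hs : s ^ (2 * p) = 0),
      s = u + numMap S (-(k : ℂ)) * algebraMap (PowerSeries ℂ) S PowerSeries.X → ∀ i j : Fin N,
      evNil₁ (((baseHom S ((slotIncl N b).comp (toVRAlg N)) : FreeTop N →ₐ[PowerSeries ℂ] _) :
        FreeTop N →+* S ⊗[PowerSeries ℂ] VV N).comp PowerSeries.C) (pow_smul_eq_zero hs)
          (lWords i j) = evVR (slotIncl N b) hu (lShift k i j) := by
    rintro s hs rfl i j
    exact evNil₁_lWords_shift _ hu hS hs i j
  rw [nilLV, nilL_eq ht ((slotIncl N b).comp (toVRAlg N))]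
  · exact Matrix.ext fun i j => key _ (ht b) hb i j
  · intro r i j
    rw [slotGen, slotIncl]
    cases b.isLeft <;> rfl

include hS hu in
theorem nilParam_shift {b b' : Fin n ⊕ Fin m} (hbb : b.isLeft = b'.isLeft) {k : ℕ}
    (hb : t b = u + numMap S (-(k : ℂ)) * algebraMap (PowerSeries ℂ) S PowerSeries.X)
    (hb' : t b' = u + numMap S (-((0 : ℕ) : ℂ)) * algebraMap (PowerSeries ℂ) S PowerSeries.X) :
    nilParam ht b = nilParam ht b' * qExp S (-(k : ℂ)) := by
  have key : ∀ (c : ℂ) (s : S) (hs : s ^ (2 * p) = 0),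
      s = u + numMap S c * algebraMap (PowerSeries ℂ) S PowerSeries.X →
      expNil 1 hs = expNil 1 hu * qExp S c := by
    rintro c s hs rfl
    exact expNil_add_mul_X hu hS c hs
  rw [nilParam, nilParam, hbb, key _ _ (ht b) hb, key _ _ (ht b') hb', Nat.cast_zero, neg_zero,
    qExp_zero, mul_one, mul_assoc]

theorem fusedPair_evVR (ψ : VR N →ₐ[PowerSeries ℂ] VV N) (k : ℕ) :
    FusedPair (qExp S (1 / 2)) (qExp S (-1 / 2))
      (Matrix.of fun i j => evVR ψ hu (lShift k i j))
      (Matrix.of fun i j => evVR ψ hu (lShift (k + 1) i j)) :=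
  (fusedPair_lShift k).map (evVR ψ hu) (algebraMap (PowerSeries ℂ) S) (evVR_smul ψ hu)

variable (N) in
theorem nilX_apply (I J : Fin n ⊕ Fin m → Fin N) : nilX N ht I J =
    ((List.finRange n).map fun k => nilLV ht N (Sum.inl k) (I (Sum.inl k)) (J (Sum.inl k))).prod *
    ((List.finRange m).map fun k =>
      nilLV ht N (Sum.inr k) (I (Sum.inr k)) (J (Sum.inr k))).prod := by
  rw [nilX_eq, prodL, prod_leg_apply _ _ (nodup_slots n m), if_pos fun c hc => absurd (mem_slots c) hc,
    List.map_append, List.prod_append, slotsL, slotsR, List.map_map, List.map_map]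
  rfl

theorem lTrace_eq (N n : ℕ) : lTrace N n = ∑ K : Fin n → Fin N,
    ((List.finRange n).map fun k : Fin n => lShift (k : ℕ) (K k) (K k)).prod := by
  rw [lTrace, Matrix.trace]
  refine Finset.sum_congr rfl fun K _ => ?_
  rw [Matrix.diag_apply, prod_leg_apply _ _ (List.nodup_finRange n),
    if_pos fun c hc => absurd (List.mem_finRange c) hc]
  rfl

theorem evVR_lTrace (ψ : VR N →ₐ[PowerSeries ℂ] VV N) (m : ℕ) :
    evVR ψ hu (lTrace N m) = ∑ K : Fin m → Fin N,
      ((List.finRange m).map fun k : Fin m => evVR ψ hu (lShift (k : ℕ) (K k) (K k))).prod := by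
  rw [lTrace_eq, map_sum]
  refine Finset.sum_congr rfl fun K _ => ?_
  rw [map_list_prod, List.map_map]
  rfl

end NilShift

/-! ### Elements fixed by the braiding -/

section Fixed

variable {N n p : ℕ}

/-- Both the braided series and the series itself are finite sums over monomials in the truncated
variables; comparing coefficients turns invariance of the value into invariance of each coefficient
modulo `h ^ p`. -/
theorem braidVV_eq_of_evNil {m : ℕ} {Y : MvPowerSeries (Fin n ⊕ Fin m) (VV N)}
    (h : (braidExt N (trunc_algebraMap_X (PowerSeries (RatFunc ℂ)) p)).liftBaseChange (TruncZ n m p)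
      (evNil (toBase (TruncZ n m p) (VV N))
        (truncVar_pow (τ := Fin n ⊕ Fin m) (PowerSeries (RatFunc ℂ)) p) Y) =
      evNil (toBase (TruncZ n m p) (VV N))
        (truncVar_pow (τ := Fin n ⊕ Fin m) (PowerSeries (RatFunc ℂ)) p) Y)
    {e : Fin n ⊕ Fin m →₀ ℕ} (he : ∀ i, e i < p) :
    braidVV N p (MvPowerSeries.coeff e Y) =
      Submodule.Quotient.mk (MvPowerSeries.coeff e Y ⊗ₜ (1 : PowerSeries (RatFunc ℂ))) := by
  refine sub_eq_zero.1 (eq_zero_of_sum_eq_zero (fun e => braidVV N p (MvPowerSeries.coeff e Y) -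
    Submodule.Quotient.mk (MvPowerSeries.coeff e Y ⊗ₜ (1 : PowerSeries (RatFunc ℂ)))) ?_ he)
  rw [← sub_eq_zero, evNil_apply, map_sum, ← Finset.sum_sub_distrib] at h
  refine Eq.trans (Finset.sum_congr rfl fun e _ => ?_) h
  rw [map_sub, smul_sub, map_smul]
  congr 1
  · congr 1
    refine Eq.symm ((LinearMap.liftBaseChange_tmul _ _ _ _).trans ?_)
    rw [one_smul]
    rfl
  · congr 1
    refine (vvzMap_tmul _ _).trans ?_
    rw [map_one]
    rfl

theorem braidVV_eq_of_le {p p' : ℕ} (h : p ≤ p') {x : VV N} {y : VVz N}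
    (hx : braidVV N p' x = Submodule.Quotient.mk y) : braidVV N p x = Submodule.Quotient.mk y := by
  rw [← modPowRed_braidVV h, hx]
  rfl

/-- The series `f k` and `g` are placed in separate variables, with a single variable for the whole
second tensor factor. The tensor in question is one coefficient of their product, and invariance is
used at a truncation level above all its exponents. -/
theorem braidVV_tmul_of_evVR {f : Fin n → PowerSeries (VR N)} {g : PowerSeries (VR N)}
    (h : ∀ p, ∃ z, z = ((List.finRange n).map fun k =>
        evVR (slotIncl N (Sum.inl k : Fin n ⊕ Fin 1))
          (truncVar_pow (PowerSeries (RatFunc ℂ)) p (Sum.inl k : Fin n ⊕ Fin 1)) (f k)).prod *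
        evVR (slotIncl N (Sum.inr 0 : Fin n ⊕ Fin 1))
          (truncVar_pow (PowerSeries (RatFunc ℂ)) p (Sum.inr 0 : Fin n ⊕ Fin 1)) g ∧
      (braidExt N (trunc_algebraMap_X (PowerSeries (RatFunc ℂ)) p)).liftBaseChange (TruncZ n 1 p) z =
        z) (p : ℕ) (e : Fin n → ℕ) (s : ℕ) :
    braidVV N p (((List.finRange n).map fun k => PowerSeries.coeff (e k) (f k)).prod ⊗ₜ
      PowerSeries.coeff s g) =
    Submodule.Quotient.mk ((((List.finRange n).map fun k => PowerSeries.coeff (e k) (f k)).prod ⊗ₜ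
      PowerSeries.coeff s g) ⊗ₜ (1 : PowerSeries (RatFunc ℂ))) := by
  obtain ⟨p', hp, he⟩ := exists_bound (Sum.elim e fun _ : Fin 1 => s) p
  refine braidVV_eq_of_le hp ?_
  obtain ⟨z, hz, hfix⟩ := h p'
  have e1 : List.finRange 1 = [0] := rfl
  set F : Fin n ⊕ Fin 1 → PowerSeries (VV N) := fun b =>
    PowerSeries.map (slotIncl N b : VR N →+* VV N) (Sum.elim f (fun _ => g) b) with hF
  set Y : MvPowerSeries (Fin n ⊕ Fin 1) (VV N) :=
    ((slotsL n 1 ++ slotsR n 1).map fun b => inVar b (F b)).prod with hY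
  have hv : ∀ b : Fin n ⊕ Fin 1, evNil (toBase (TruncZ n 1 p') (VV N))
      (truncVar_pow (PowerSeries (RatFunc ℂ)) p') (inVar b (F b)) = evVR (slotIncl N b)
        (truncVar_pow (PowerSeries (RatFunc ℂ)) p' b) (Sum.elim f (fun _ => g) b) := fun b => by
    rw [evNil_inVar _ _ _ _ (pow_smul_eq_zero (truncVar_pow (PowerSeries (RatFunc ℂ)) p' b)), hF,
      evNil₁_map, evVR]
  have hzY : z = evNil (toBase _ _) (truncVar_pow (PowerSeries (RatFunc ℂ)) p') Y := by
    rw [hz, hY, List.map_append, List.prod_append, map_mul, map_list_prod, map_list_prod, slotsL,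
      slotsR, List.map_map, List.map_map, List.map_map, List.map_map]
    simp only [Function.comp_def, hv]
    rw [e1, List.map_singleton, List.prod_singleton]
    rfl
  rw [hzY] at hfix
  have hc : MvPowerSeries.coeff (Finsupp.equivFunOnFinite.symm (Sum.elim e fun _ : Fin 1 => s)) Y =
      ((List.finRange n).map fun k => PowerSeries.coeff (e k) (f k)).prod ⊗ₜ
        PowerSeries.coeff s g := by
    rw [hY, coeff_prod_inVar (nodup_slots n 1), if_pos fun c hc => absurd (mem_slots c) hc,
      List.map_append, List.prod_append, slotsL, slotsR, List.map_map, List.map_map]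
    have h1 := map_list_prod (slotIncl N (Sum.inl 0 : Fin 1 ⊕ Fin 1))
      ((List.finRange n).map fun k => PowerSeries.coeff (e k) (f k))
    rw [List.map_map] at h1
    refine (congrArg₂ (· * ·) h1.symm (?_ : _ =
      slotIncl N (Sum.inr 0 : Fin 1 ⊕ Fin 1) (PowerSeries.coeff s g))).trans ?_
    · rw [e1, List.map_singleton, List.prod_singleton]
      rfl
    · refine (Algebra.TensorProduct.tmul_mul_tmul _ _ _ _).trans ?_
      rw [one_mul, mul_one]
  have := braidVV_eq_of_evNil hfix (e := Finsupp.equivFunOnFinite.symm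
    (Sum.elim e fun _ : Fin 1 => s)) he
  rwa [hc] at this

end Fixed

/-! ### The fixed elements -/

section FixedTraces

variable {n m N p : ℕ} {S : Type*} [CommRing S] [Algebra (PowerSeries (RatFunc ℂ)) S]
  [Algebra (PowerSeries ℂ) S] [IsScalarTower (PowerSeries ℂ) (PowerSeries (RatFunc ℂ)) S]

/-- The parameters `u_i - k_i h` and `v - jh`. -/
def shiftParam (u : Fin n → S) (k : Fin n → ℕ) (v : S) : Fin n ⊕ Fin m → S :=
  Sum.elim (fun i => u i + numMap S (-(k i : ℂ)) * algebraMap (PowerSeries ℂ) S PowerSeries.X)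
    fun j => v + numMap S (-((j : ℕ) : ℂ)) * algebraMap (PowerSeries ℂ) S PowerSeries.X

variable {u : Fin n → S} {k : Fin n → ℕ} {v : S} (hu : ∀ i, u i ^ p = 0) (hv : v ^ p = 0)
  (hS : algebraMap (PowerSeries ℂ) S PowerSeries.X ^ p = 0)

include hu hv hS in
theorem shiftParam_pow (b : Fin n ⊕ Fin m) : shiftParam u k v b ^ (2 * p) = 0 := by
  rcases b with i | j
  · exact shift_pow_eq_zero (hu i) hS _
  · exact shift_pow_eq_zero hv hS _

include hS in
-- At the parameters `v - jh` the sum over the diagonal indices of the second group is the fused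
-- trace evaluated at the one nilpotent element `v`; the first group remains a product of single
-- entries.
theorem sum_nilX (ht : ∀ b : Fin n ⊕ Fin m, shiftParam u k v b ^ (2 * p) = 0) (I J : Fin n → Fin N) :
    ∑ K : Fin m → Fin N, nilX N ht (Sum.elim I K) (Sum.elim J K) =
      ((List.finRange n).map fun i =>
        evVR (slotIncl N (Sum.inl i : Fin n ⊕ Fin 1)) (hu i) (lShift (k i) (I i) (J i))).prod *
      evVR (slotIncl N (Sum.inr 0 : Fin n ⊕ Fin 1)) hv (lTrace N m) := by
  rw [evVR_lTrace, Finset.mul_sum]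
  refine Finset.sum_congr rfl fun K _ => ?_
  rw [nilX_apply]
  congr 2
  · refine List.map_congr_left fun i _ => ?_
    rw [nilLV_eq_evVR (hu i) hS ht rfl]
    rfl
  · refine List.map_congr_left fun j _ => ?_
    rw [nilLV_eq_evVR hv hS ht rfl]
    rfl

include hv hS in
theorem fusedPair_shiftParam_inr (ht : ∀ b : Fin n ⊕ Fin (m + 1), shiftParam u k v b ^ (2 * p) = 0)
    (j : Fin m) : FusedPair (qExp S (1 / 2)) (qExp S (-1 / 2))
      (nilLV ht N (Sum.inr j.castSucc)) (nilLV ht N (Sum.inr j.succ)) := by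
  rw [nilLV_eq_evVR hv hS ht (k := (j : ℕ)) rfl, nilLV_eq_evVR hv hS ht (k := (j : ℕ) + 1) rfl]
  exact fusedPair_evVR hv _ _

include hv hS in
theorem nilParam_shiftParam_inr (ht : ∀ b : Fin n ⊕ Fin (m + 1), shiftParam u k v b ^ (2 * p) = 0)
    (j : Fin (m + 1)) :
    nilParam ht (Sum.inr j) = nilParam ht (Sum.inr 0) * qExp S (-((j : ℕ) : ℂ)) :=
  nilParam_shift hv hS ht (b := Sum.inr j) (b' := Sum.inr 0) rfl (k := (j : ℕ)) rfl rfl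

/-- The product of an arbitrary left factor and the top fused trace is not changed by braiding. -/
theorem braidExt_prod_mul_lTrace (I J : Fin n → Fin (m + 1)) {z : S ⊗[PowerSeries ℂ] VV (m + 1)}
    (hz : z = ((List.finRange n).map fun i => evVR (slotIncl (m + 1) (Sum.inl i : Fin n ⊕ Fin 1))
        (hu i) (lShift (k i) (I i) (J i))).prod *
      evVR (slotIncl (m + 1) (Sum.inr 0 : Fin n ⊕ Fin 1)) hv (lTrace (m + 1) (m + 1))) :
    (braidExt (m + 1) hS).liftBaseChange S z = z := by
  have ht := shiftParam_pow (m := m + 1) (k := k) hu hv hS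
  rw [hz, ← sum_nilX hu hv hS ht I J, map_sum]
  exact Finset.sum_congr rfl fun K _ => braidExt_nilX_apply hS ht rfl
    (fusedPair_shiftParam_inr hv hS ht) (nilParam_shiftParam_inr hv hS ht) _ _

/-- The product of two fused traces is not changed by braiding. -/
theorem braidExt_lTrace_mul_lTrace {u : S} (hu : u ^ p = 0) {z : S ⊗[PowerSeries ℂ] VV N}
    (hz : z = evVR (slotIncl N (Sum.inl 0 : Fin 1 ⊕ Fin 1)) hu (lTrace N (n + 1)) *
      evVR (slotIncl N (Sum.inr 0 : Fin 1 ⊕ Fin 1)) hv (lTrace N (m + 1))) :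
    (braidExt N hS).liftBaseChange S z = z := by
  have ht := shiftParam_pow (m := m + 1) (k := fun i : Fin (n + 1) => (i : ℕ)) (fun _ => hu) hv hS
  have e : z = Matrix.trace (nilX N ht) := by
    rw [hz, evVR_lTrace hu, Finset.sum_mul, Matrix.trace]
    refine Eq.trans (Finset.sum_congr rfl fun I _ => ?_) (((Fintype.sum_prod_type
      (fun x : (Fin (n + 1) → Fin N) × (Fin (m + 1) → Fin N) =>
        nilX N ht (Sum.elim x.1 x.2) (Sum.elim x.1 x.2))).symm).trans
      (Fintype.sum_equiv (Equiv.sumArrowEquivProdArrow _ _ _).symm _ _ fun _ => rfl))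
    exact (sum_nilX (fun _ => hu) hv hS ht I I).symm
  rw [e]
  refine braidExt_trace_nilX hS ht (fusedPair_shiftParam_inr hv hS ht)
    (nilParam_shiftParam_inr hv hS ht) (fun i => ?_)
    fun i => nilParam_shift hu hS ht (b := Sum.inl i) (b' := Sum.inl 0) rfl (k := (i : ℕ)) rfl rfl
  rw [nilLV_eq_evVR hu hS ht (k := (i : ℕ)) rfl, nilLV_eq_evVR hu hS ht (k := (i : ℕ) + 1) rfl]
  exact fusedPair_evVR hu _ _

theorem coeff_lShift_zero (r : ℕ) (i j : Fin N) :
    PowerSeries.coeff r (lShift (N := N) 0 i j) = gen r i j := by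
  rw [lShift, PowerSeries.coeff_mk, gen]
  congr 1
  ext d
  rw [PowerSeries.coeff_mk, PowerSeries.coeff_C]
  split_ifs with hd
  · subst hd
    simp
  · simp [hd]

/-- With shift zero the series `lShift` has the generators as coefficients, so an arbitrary word is
a coefficient of a product covered by `braidExt_prod_mul_lTrace`. -/
theorem toVR_wordTop (w : WordList N) : toVR N (wordTop w) =
    ((List.finRange w.toList.length).map fun i =>
      PowerSeries.coeff (w.toList.get i).1
        (lShift (N := N) 0 (w.toList.get i).2.1 (w.toList.get i).2.2)).prod := by
  have h : readWord (List.finRange w.toList.length) (fun i => (w.toList.get i).1)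
      (fun i => (w.toList.get i).2.1) (fun i => (w.toList.get i).2.2) = w :=
    List.map_get_finRange _
  conv_lhs => rw [← h, wordTop_readWord, map_list_prod, List.map_map]
  congr 1
  exact List.map_congr_left fun i _ => (coeff_lShift_zero _ _ _).symm

theorem braidVV_wordTop_lTrace (w : WordList (m + 1)) (s p : ℕ) :
    braidVV (m + 1) p (toVR (m + 1) (wordTop w) ⊗ₜ PowerSeries.coeff s (lTrace (m + 1) (m + 1))) =
      Submodule.Quotient.mk ((toVR (m + 1) (wordTop w) ⊗ₜ
        PowerSeries.coeff s (lTrace (m + 1) (m + 1))) ⊗ₜ (1 : PowerSeries (RatFunc ℂ))) := by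
  rw [toVR_wordTop]
  exact braidVV_tmul_of_evVR (fun p => ⟨_, rfl, braidExt_prod_mul_lTrace (k := fun _ => 0)
    (fun i => truncVar_pow (PowerSeries (RatFunc ℂ)) p (Sum.inl i))
    (truncVar_pow (PowerSeries (RatFunc ℂ)) p (Sum.inr 0)) (trunc_algebraMap_X _ p)
    (fun i => (w.toList.get i).2.1) (fun i => (w.toList.get i).2.2) rfl⟩) p
    (fun i => (w.toList.get i).1) s

/-- Both sides are linear in `x` with values in a module killed by `h ^ p`, so the case of words is
enough. -/
theorem braidVV_tmul_lTrace_top (x : VR (m + 1)) (s p : ℕ) :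
    braidVV (m + 1) p (x ⊗ₜ PowerSeries.coeff s (lTrace (m + 1) (m + 1))) = Submodule.Quotient.mk
      ((x ⊗ₜ PowerSeries.coeff s (lTrace (m + 1) (m + 1))) ⊗ₜ (1 : PowerSeries (RatFunc ℂ))) := by
  obtain ⟨f, rfl⟩ := toVR_surjective (m + 1) x
  exact LinearMap.congr_fun (freeTop_hom_ext
    (f := ((braidVV (m + 1) p).comp ((TensorProduct.mk (PowerSeries ℂ) _ _).flip
      (PowerSeries.coeff s (lTrace (m + 1) (m + 1))))).comp (toVRAlg (m + 1)).toLinearMap)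
    (g := (((Submodule.mkQ _).comp ((TensorProduct.mk (PowerSeries ℂ) (VV (m + 1)) _).flip
      (1 : PowerSeries (RatFunc ℂ)))).comp ((TensorProduct.mk (PowerSeries ℂ) _ _).flip
        (PowerSeries.coeff s (lTrace (m + 1) (m + 1))))).comp (toVRAlg (m + 1)).toLinearMap) modPow_smul
      fun w => braidVV_wordTop_lTrace w s p) f

theorem braidVV_lTrace_tmul_lTrace (n m r s p : ℕ) :
    braidVV N p (PowerSeries.coeff r (lTrace N (n + 1)) ⊗ₜ
      PowerSeries.coeff s (lTrace N (m + 1))) = Submodule.Quotient.mk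
        ((PowerSeries.coeff r (lTrace N (n + 1)) ⊗ₜ PowerSeries.coeff s (lTrace N (m + 1))) ⊗ₜ
          (1 : PowerSeries (RatFunc ℂ))) := by
  have hw : ∀ f : Fin 1 → VR N, ((List.finRange 1).map f).prod = f 0 := fun f => by
    rw [show List.finRange 1 = [0] from rfl, List.map_singleton, List.prod_singleton]
  have key := braidVV_tmul_of_evVR (N := N) (f := fun _ : Fin 1 => lTrace N (n + 1))
    (g := lTrace N (m + 1)) (fun p => ⟨_, rfl, braidExt_lTrace_mul_lTrace
      (truncVar_pow (PowerSeries (RatFunc ℂ)) p (Sum.inr 0)) (trunc_algebraMap_X _ p)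
      (truncVar_pow (PowerSeries (RatFunc ℂ)) p (Sum.inl 0))
      (by rw [show List.finRange 1 = [0] from rfl, List.map_singleton, List.prod_singleton])⟩) p
    (fun _ => r) s
  rwa [hw] at key

end FixedTraces

end TrigFRT

end

theorem mainTheorem8 (N : ℕ) (hN : 2 ≤ N) :
    ∃ σ : TrigFRT.HComp (TrigFRT.VV N) →ₗ[PowerSeries ℂ] TrigFRT.HComp (TrigFRT.VVz N),
      TrigFRT.IsBraiding N σ ∧
      (∀ σ' : TrigFRT.HComp (TrigFRT.VV N) →ₗ[PowerSeries ℂ] TrigFRT.HComp (TrigFRT.VVz N),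
        TrigFRT.IsBraiding N σ' → σ' = σ) ∧
      (∀ m n : ℕ, 1 ≤ m → m ≤ N → 1 ≤ n → n ≤ N → ∀ r s : ℕ,
        TrigFRT.FixesTensor σ (PowerSeries.coeff r (TrigFRT.lTrace N m))
          (PowerSeries.coeff s (TrigFRT.lTrace N n))) ∧
      (∀ (a : TrigFRT.VR N) (s : ℕ),
        TrigFRT.FixesTensor σ a (PowerSeries.coeff s (TrigFRT.lTrace N N))) := by
  refine ⟨TrigFRT.braiding N, TrigFRT.isBraiding_braiding,
    fun σ' h => h.eq TrigFRT.isBraiding_braiding, fun m n hm _ hn _ r s => ?_, fun a s => ?_⟩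
  · obtain ⟨m, rfl⟩ := Nat.exists_eq_add_of_le' hm
    obtain ⟨n, rfl⟩ := Nat.exists_eq_add_of_le' hn
    exact TrigFRT.braiding_toHComp fun p => TrigFRT.braidVV_lTrace_tmul_lTrace m n r s p
  · obtain ⟨m, rfl⟩ := Nat.exists_eq_add_of_le' (le_trans one_le_two hN)
    exact TrigFRT.braiding_toHComp fun p => TrigFRT.braidVV_tmul_lTrace_top a s p
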